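/- **Correlation clustering.** Let $G=(V,E)$ be a graph on $V=\{0,\dots,n-1\}$, $n\ge 2$. The edges of $G$ are the $+$edges (every self-loop $uu$ is counted as a $+$edge), all other pairs are $-$edges. For a clustering $\mathcal C$ of $V$ let $\mathrm{cost}_{\mathcal C}(u)$ be the number of vertices $v\ne u$ such that $uv$ is a $+$edge and $u,v$ lie in different clusters, or $uv$ is a $-$edge and $u,v$ lie in the same cluster. Let $0<\epsilon\le 1/20$ and let $(x_{uv})_{u,v\in V}$ be LP values, i.e. $x_{uv}=x_{vu}\in[0,1]$, with the approximate triangle inequality $x_{uv}+x_{uw}+\epsilon\ge x_{vw}$ for all $u,v,w\in V$. Put $$y_u=\sum_{v\ne u,\ uv\in E}x_{uv}+\sum_{v\neq u,\ uv\notin E}(1-x_{uv}),\qquad K=E\cup\Bigl\{uv\in\tbinom V2\setminus E \,:\, x_{uv}<1\Bigr\},$$ where $E$ includes the $n$ self-loops. **MPC model.** Fix $0<\delta<1$. All machines run the same finite program in synchronous rounds: in a round, a machine reads the messages it received, computes locally (with private random draws, uniform on $\{0,\dots,k\}$ for a $k$ computed by the program, all independent), and sends messages, which arrive at the start of the next round.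 A word is an integer of $O(\log n)$ bits or a real number; operations on words (arithmetic, comparison, memory access, random draw, sending a message of $O(1)$ words) cost one unit each, and reals cannot be rounded to integers. The work is the number of operations of all machines. There are $\lceil |K|\lceil\log_2 n\rceil/\lceil n^\delta\rceil\rceil$ machines; each knows $n$, $\epsilon$, the number of machines and its own index. The input consists of one record $(u,v,\text{sign of }uv,x_{uv})$ for each $uv\in K$; the records are distributed over the machines arbitrarily, subject to at most $a\lceil n^\delta\rceil$ records on each machine, where $a$ is a constant. The algorithm terminates when all machines have halted; then each machine must hold in its memory the cluster IDs of both endpoints of each pair in its input. **Theorem.** For all constants $0<\delta<1$ and $a\in\mathbb N$ there is a randomized MPC algorithm such that for all $n$, $\epsilon$, $G$, $x$ and input distributions as above: 1. Whenever the algorithm terminates (for every outcome of the random draws), its output is a clustering $\mathcal C$ with $\mathrm{cost}_{\mathcal C}(u)\le(5+55\epsilon)\,y_u$ for every $u\in V$. 2. Always, each machine uses $O(n^\delta)$ words of memory, including the messages that it receives and sends in a round, and the total memory is $O(|K|\log n)$ words. 3. With high probability it terminates within $O(\log^3 n/\epsilon)$ rounds and with total work $O(|K|\log^3 n/\epsilon)$;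 that is, for each $\gamma\in\mathbb{N}$ this holds with probability at least $1-n^{-\gamma}$, with hidden constants that depend on $\gamma$. The hidden constants depend only on $\delta$, $a$ and (in part 3) $\gamma$. -/

import Mathlib

/-!
Part 1: correlation clustering.  The vertex set is `Fin n`; the `+`edges are the edges of a simple
graph `G` together with all self-loops, every other pair is a `-`edge.

Part 2: the MPC model.  All machines run the same finite program once per round.  A local
computation is a program of a register machine with unit-cost word operations (integer words
of `O(log n)` bits, real words with exact arithmetic and comparison, no rounding of reals to
integers), and every operation is counted.

Part 3: the input distribution and the output convention.
-/

namespace CorrClust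

/-! ### Part 1: correlation clustering -/

/-- LP values: symmetric, in `[0,1]`, with the `ε`-approximate triangle inequality. -/
structure IsApproxLP {n : ℕ} (ε : ℝ) (x : Fin n → Fin n → ℝ) : Prop where
  symm : ∀ u v, x u v = x v u
  nonneg : ∀ u v, 0 ≤ x u v
  le_one : ∀ u v, x u v ≤ 1
  triangle : ∀ u v w, x v w ≤ x u v + x u w + ε

open scoped Classical in
/-- The LP disagreement `y_u`. -/
noncomputable def lpCost {n : ℕ} (G : SimpleGraph (Fin n)) (x : Fin n → Fin n → ℝ)
    (u : Fin n) : ℝ :=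
  ∑ v ∈ Finset.univ.erase u, if G.Adj u v then x u v else 1 - x u v

open scoped Classical in
/-- The number of edges at `u` in disagreement with the clustering whose clusters are the
nonempty fibres of `f`. -/
noncomputable def clusterCost {n : ℕ} (G : SimpleGraph (Fin n)) (f : Fin n → ℕ)
    (u : Fin n) : ℕ :=
  ((Finset.univ.erase u).filter fun v =>
    (G.Adj u v ∧ f u ≠ f v) ∨ (¬ G.Adj u v ∧ f u = f v)).card

open scoped Classical in
/-- The set `K` of `+`edges (self-loops included) and of `-`edges with LP value less than `1`;
the unordered pair `uv` is represented by `(u, v)` with `u ≤ v`. -/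
noncomputable def relevantPairs {n : ℕ} (G : SimpleGraph (Fin n)) (x : Fin n → Fin n → ℝ) :
    Finset (Fin n × Fin n) :=
  Finset.univ.filter fun p =>
    p.1 ≤ p.2 ∧ (p.1 = p.2 ∨ G.Adj p.1 p.2 ∨ x p.1 p.2 < 1)

/-! ### Part 2: the MPC model -/

/-- A message consists of a destination, four integer words and one real word. -/
structure Msg where
  dst : ℕ
  num : Fin 4 → ℕ
  val : ℝ

/-- Integer expressions of a program with `c` integer registers and `c` integer arrays. -/
inductive NExpr (c : ℕ) : Type
  | const (k : ℕ)
  | numVertices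
  | numMachines
  | myId
  | capacity
  | reg (i : Fin c)
  | load (a : Fin c) (i : NExpr c)
  | inboxLen
  | inboxNum (i : NExpr c) (j : Fin 4)
  | add (e f : NExpr c)
  | sub (e f : NExpr c)
  | mul (e f : NExpr c)
  | div (e f : NExpr c)
  | mod (e f : NExpr c)

/-- Real expressions of a program with `c` real registers and `c` real arrays. -/
inductive RExpr (c : ℕ) : Type
  | eps
  | ofNat (e : NExpr c)
  | reg (i : Fin c)
  | load (a : Fin c) (i : NExpr c)
  | inboxVal (i : NExpr c)
  | add (e f : RExpr c)
  | sub (e f : RExpr c)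
  | mul (e f : RExpr c)
  | div (e f : RExpr c)

/-- Tests. -/
inductive BExpr (c : ℕ) : Type
  | natEq (e f : NExpr c)
  | natLt (e f : NExpr c)
  | realLt (e f : RExpr c)
  | realLe (e f : RExpr c)
  | not (b : BExpr c)
  | and (b d : BExpr c)

/-- Programs.  `rand i e` puts a uniformly random element of `{0, …, e}` into register `i`;
`loop i e s` runs `s` for the values `0, …, e - 1` of register `i`, where `e` is evaluated once,
at the start. -/
inductive Prog (c : ℕ) : Type
  | skip
  | assign (i : Fin c) (e : NExpr c)
  | rassign (i : Fin c) (e : RExpr c)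
  | store (a : Fin c) (i : NExpr c) (e : NExpr c)
  | rstore (a : Fin c) (i : NExpr c) (e : RExpr c)
  | rand (i : Fin c) (e : NExpr c)
  | send (dst : NExpr c) (num : Fin 4 → NExpr c) (val : RExpr c)
  | halt
  | seq (s t : Prog c)
  | ite (b : BExpr c) (s t : Prog c)
  | loop (i : Fin c) (e : NExpr c) (s : Prog c)

/-- What a machine knows during one round and cannot change; `rnd j k` is the outcome of its
`j`-th random draw of the round, if that draw is from `{0, …, k}`. -/
structure Env where
  numVertices : ℕ
  numMachines : ℕ
  myId : ℕ
  capacity : ℕ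
  wordBound : ℕ
  eps : ℝ
  rnd : ℕ → (k : ℕ) → Fin (k + 1)

/-- The state of one machine; `draws` is the number of random draws of the current round and
`work` the number of operations executed so far. -/
structure MState (c : ℕ) where
  nreg : Fin c → ℕ
  rreg : Fin c → ℝ
  narr : Fin c → ℕ → ℕ
  rarr : Fin c → ℕ → ℝ
  inbox : List Msg
  outbox : List Msg
  halted : Bool
  draws : ℕ
  work : ℕ

namespace NExpr

/-- The number of operations needed to evaluate an integer expression. -/
def cost {c : ℕ} : NExpr c → ℕ
  | load _ i => i.cost + 1
  | inboxNum i _ => i.cost + 1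
  | add e f => e.cost + f.cost + 1
  | sub e f => e.cost + f.cost + 1
  | mul e f => e.cost + f.cost + 1
  | div e f => e.cost + f.cost + 1
  | mod e f => e.cost + f.cost + 1
  | _ => 1

/-- The value of an integer expression. -/
noncomputable def eval {c : ℕ} (Γ : Env) (σ : MState c) : NExpr c → ℕ
  | const k => k
  | numVertices => Γ.numVertices
  | numMachines => Γ.numMachines
  | myId => Γ.myId
  | capacity => Γ.capacity
  | reg i => σ.nreg i
  | load a i => σ.narr a (i.eval Γ σ)
  | inboxLen => σ.inbox.length
  | inboxNum i j => ((σ.inbox[i.eval Γ σ]?).map fun m => m.num j).getD 0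
  | add e f => e.eval Γ σ + f.eval Γ σ
  | sub e f => e.eval Γ σ - f.eval Γ σ
  | mul e f => e.eval Γ σ * f.eval Γ σ
  | div e f => e.eval Γ σ / f.eval Γ σ
  | mod e f => e.eval Γ σ % f.eval Γ σ

end NExpr

namespace RExpr

/-- The number of operations needed to evaluate a real expression. -/
def cost {c : ℕ} : RExpr c → ℕ
  | eps => 1
  | ofNat e => e.cost + 1
  | reg _ => 1
  | load _ i => i.cost + 1
  | inboxVal i => i.cost + 1
  | add e f => e.cost + f.cost + 1
  | sub e f => e.cost + f.cost + 1
  | mul e f => e.cost + f.cost + 1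
  | div e f => e.cost + f.cost + 1

/-- The value of a real expression. -/
noncomputable def eval {c : ℕ} (Γ : Env) (σ : MState c) : RExpr c → ℝ
  | eps => Γ.eps
  | ofNat e => (e.eval Γ σ : ℝ)
  | reg i => σ.rreg i
  | load a i => σ.rarr a (i.eval Γ σ)
  | inboxVal i => ((σ.inbox[i.eval Γ σ]?).map fun m => m.val).getD 0
  | add e f => e.eval Γ σ + f.eval Γ σ
  | sub e f => e.eval Γ σ - f.eval Γ σ
  | mul e f => e.eval Γ σ * f.eval Γ σ
  | div e f => e.eval Γ σ / f.eval Γ σ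

end RExpr

namespace BExpr

/-- The number of operations needed to evaluate a test. -/
def cost {c : ℕ} : BExpr c → ℕ
  | natEq e f => e.cost + f.cost + 1
  | natLt e f => e.cost + f.cost + 1
  | realLt e f => e.cost + f.cost + 1
  | realLe e f => e.cost + f.cost + 1
  | not b => b.cost + 1
  | and b d => b.cost + d.cost + 1

/-- The truth of a test. -/
def Holds {c : ℕ} (Γ : Env) (σ : MState c) : BExpr c → Prop
  | natEq e f => e.eval Γ σ = f.eval Γ σ
  | natLt e f => e.eval Γ σ < f.eval Γ σ
  | realLt e f => e.eval Γ σ < f.eval Γ σ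
  | realLe e f => e.eval Γ σ ≤ f.eval Γ σ
  | not b => ¬ b.Holds Γ σ
  | and b d => b.Holds Γ σ ∧ d.Holds Γ σ

end BExpr

/-- Count `k` further operations. -/
def MState.tick {c : ℕ} (σ : MState c) (k : ℕ) : MState c :=
  { σ with work := σ.work + k }

open scoped Classical in
/-- The effect of a program on the state of a machine.  Integer words are taken modulo the word
bound.  An array has the cells `0, …, capacity - 1`; writing outside of them has no effect. -/
noncomputable def Prog.exec {c : ℕ} (Γ : Env) : Prog c → MState c → MState c
  | .skip, σ => σ.tick 1
  | .assign i e, σ =>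
      { σ with nreg := Function.update σ.nreg i (e.eval Γ σ % Γ.wordBound) }.tick (e.cost + 1)
  | .rassign i e, σ =>
      { σ with rreg := Function.update σ.rreg i (e.eval Γ σ) }.tick (e.cost + 1)
  | .store a i e, σ =>
      (if i.eval Γ σ < Γ.capacity then
        { σ with
          narr := Function.update σ.narr a
            (Function.update (σ.narr a) (i.eval Γ σ) (e.eval Γ σ % Γ.wordBound)) }
      else σ).tick (i.cost + e.cost + 1)
  | .rstore a i e, σ =>
      (if i.eval Γ σ < Γ.capacity then
        { σ with
          rarr := Function.update σ.rarr a
            (Function.update (σ.rarr a) (i.eval Γ σ) (e.eval Γ σ)) }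
      else σ).tick (i.cost + e.cost + 1)
  | .rand i e, σ =>
      { σ with
        nreg := Function.update σ.nreg i
          ((Γ.rnd σ.draws (e.eval Γ σ) : ℕ) % Γ.wordBound),
        draws := σ.draws + 1 }.tick (e.cost + 1)
  | .send d num val, σ =>
      { σ with
        outbox := σ.outbox ++
          [{ dst := d.eval Γ σ,
             num := fun j => (num j).eval Γ σ % Γ.wordBound,
             val := val.eval Γ σ : Msg }] }.tick
        (d.cost + (∑ j, (num j).cost) + val.cost + 1)
  | .halt, σ => { σ with halted := true }.tick 1
  | .seq s t, σ => t.exec Γ (s.exec Γ σ)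
  | .ite b s t, σ =>
      if b.Holds Γ σ then s.exec Γ (σ.tick (b.cost + 1)) else t.exec Γ (σ.tick (b.cost + 1))
  | .loop i e s, σ =>
      (List.range (e.eval Γ σ)).foldl
        (fun τ k => s.exec Γ
          ({ τ with nreg := Function.update τ.nreg i (k % Γ.wordBound) }.tick 1))
        (σ.tick (e.cost + 1))

/-- Words in use on a machine: registers, arrays, and the messages received and sent. -/
def MState.memory {c : ℕ} (capacity : ℕ) (σ : MState c) : ℕ :=
  2 * c + 2 * c * capacity + 6 * σ.inbox.length + 6 * σ.outbox.length

/-- Random outcomes: the coordinate `(i, t, j, k)` is the `j`-th draw of machine `i` in round `t`,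
if that draw is from `{0, …, k}`. -/
abbrev Tape : Type := (q : ℕ × ℕ × ℕ × ℕ) → Fin (q.2.2.2 + 1)

/-- The law of the random outcomes: all draws are independent and uniform. -/
noncomputable def tapeLaw : MeasureTheory.Measure Tape :=
  MeasureTheory.Measure.infinitePi fun q : ℕ × ℕ × ℕ × ℕ =>
    (PMF.uniformOfFintype (Fin (q.2.2.2 + 1))).toMeasure

/-- The data of a run that do not change: `M` machines, array capacity, bound on integer words. -/
structure Setup where
  numVertices : ℕ
  numMachines : ℕ
  capacity : ℕ
  wordBound : ℕ
  eps : ℝ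

/-- What machine `i` knows in round `t`. -/
def Setup.env (S : Setup) (ω : Tape) (t : ℕ) (i : Fin S.numMachines) : Env where
  numVertices := S.numVertices
  numMachines := S.numMachines
  myId := i
  capacity := S.capacity
  wordBound := S.wordBound
  eps := S.eps
  rnd := fun j k => ω (i, t, j, k)

/-- The local computation of one machine in one round; a halted machine does nothing. -/
noncomputable def localRound {c : ℕ} (P : Prog c) (Γ : Env) (σ : MState c) : MState c :=
  if σ.halted then { σ with outbox := [] }
  else P.exec Γ { σ with outbox := [], draws := 0 }

/-- One round: local computation on every machine, then delivery of the messages, ordered by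
sender and, for one sender, by the time of sending. -/
noncomputable def mpcRound {c : ℕ} (P : Prog c) (S : Setup) (ω : Tape) (t : ℕ)
    (σ : Fin S.numMachines → MState c) : Fin S.numMachines → MState c :=
  fun i =>
    { localRound P (S.env ω t i) (σ i) with
      inbox := (List.finRange S.numMachines).flatMap fun j =>
        (localRound P (S.env ω t j) (σ j)).outbox.filter fun m => m.dst = (i : ℕ) }

/-- The machine states before the first round: the input is in the inboxes, everything else is
empty. -/
def initState (c : ℕ) (input : List Msg) : MState c where
  nreg := fun _ => 0
  rreg := fun _ => 0
  narr := fun _ _ => 0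
  rarr := fun _ _ => 0
  inbox := input
  outbox := []
  halted := false
  draws := 0
  work := 0

/-- The machine states after `t` rounds. -/
noncomputable def mpcRun {c : ℕ} (P : Prog c) (S : Setup) (input : Fin S.numMachines → List Msg)
    (ω : Tape) : ℕ → Fin S.numMachines → MState c
  | 0 => fun i => initState c (input i)
  | t + 1 => mpcRound P S ω t (mpcRun P S input ω t)

/-! ### Part 3: input and output -/

/-- The local memory scale `⌈n ^ δ⌉`. -/
noncomputable def memScale (δ : ℝ) (n : ℕ) : ℕ := ⌈(n : ℝ) ^ δ⌉₊

/-- The setup for `n` vertices and `k` relevant pairs, with constant `c`: arrays of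
`c ⌈n ^ δ⌉` cells, integer words below `n ^ c`, and `⌈k ⌈log₂ n⌉ / ⌈n ^ δ⌉⌉` machines. -/
noncomputable def mpcSetup (c : ℕ) (δ ε : ℝ) (n k : ℕ) : Setup where
  numVertices := n
  numMachines := (k * Nat.clog 2 n) ⌈/⌉ memScale δ n
  capacity := c * memScale δ n
  wordBound := n ^ c
  eps := ε

/-- The pairs in `K` are distributed over the machines, each to one machine, in any way that
gives each machine at most `b` pairs. -/
structure IsDistribution {n M : ℕ} (K : Finset (Fin n × Fin n)) (b : ℕ)
    (D : Fin M → List (Fin n × Fin n)) : Prop where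
  partition : ∑ i, (D i : Multiset (Fin n × Fin n)) = K.val
  load : ∀ i, (D i).length ≤ b

open scoped Classical in
/-- The input record of the pair `uv`: both endpoints, `1` for a `+`edge and `0` for a `-`edge,
and the LP value. -/
noncomputable def inputRecord {n : ℕ} (G : SimpleGraph (Fin n)) (x : Fin n → Fin n → ℝ)
    (i : ℕ) (p : Fin n × Fin n) : Msg where
  dst := i
  num := ![p.1, p.2, if p.1 = p.2 ∨ G.Adj p.1 p.2 then 1 else 0, 0]
  val := x p.1 p.2

/-- The run of a program on given LP values that are distributed according to `D`. -/
noncomputable def roundingRun {c : ℕ} (P : Prog c) {n : ℕ} (S : Setup)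
    (G : SimpleGraph (Fin n)) (x : Fin n → Fin n → ℝ)
    (D : Fin S.numMachines → List (Fin n × Fin n)) (ω : Tape) (t : ℕ) :
    Fin S.numMachines → MState c :=
  mpcRun P S (fun i => (D i).map (inputRecord G x i)) ω t

/-- All machines have halted. -/
def AllHalted {c M : ℕ} (σ : Fin M → MState c) : Prop := ∀ i, (σ i).halted = true

/-- Each machine stores the cluster IDs of both endpoints of each pair that was assigned to it:
those of its `j`-th pair are in the `j`-th cells of the arrays `outL` and `outR`. -/
def Outputs {c n M : ℕ} (outL outR : Fin c) (D : Fin M → List (Fin n × Fin n))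
    (σ : Fin M → MState c) (f : Fin n → ℕ) : Prop :=
  ∀ i, ∀ j : Fin (D i).length,
    (σ i).narr outL j = f ((D i).get j).1 ∧ (σ i).narr outR j = f ((D i).get j).2

end CorrClust

set_option linter.unusedSimpArgs false
set_option linter.unusedVariables false

namespace CorrClust

/-! ### The program -/

/-! Pivots and hulls. Put r = (1-6ε)/5 (`coreR`), h = (2-2ε)/5 (`hullR`) and s = (4+ε)/5 (`nearR`);
these numbers solve s = 2h+ε, h = 2r+2ε, r = 1-s-ε. The weight of u is L(u) = Σ_v max(0, r - x_uv),
where x_uu is read as 0. Suppose that the pivots are pairwise farther apart than s and that every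
other vertex u has a pivot w with x_uw ≤ s and L(u) ≤ (1+ε)L(w). Then the hulls of the pivots
(radius h) are disjoint; they become the clusters, and all remaining vertices are singletons. Let
the profit of a pair be its LP disagreement minus 1/(5+55ε) times its actual disagreement. Only
+edges that are cut at very small distance have negative profit. If u has such an edge, then it lies
neither at a pivot nor deep inside a hull; in that case each v in the core of w earns at least r -
x_wv, in total L(w), and the losses at u are at most L(w). So the total profit at u is nonnegative
(`cost_le_of_pivots`).

Finding the pivots. A threshold θ starts at n·r and is divided by 1+ε until it is at most r.
Undecided vertices always have weight at most (1+ε)θ, so an undecided vertex of weight at least θ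
(an active one) may serve as the pivot of all its undecided neighbours. Among the active vertices
pivots are chosen by Luby's method: random priorities, and strict local maxima win. A step reduces
the expected number of adjacent ordered pairs by the factor 3/4 (`sum_pairCount_residual`), and a
potential that also pays for the changes of the threshold falls by the factor 7/8
(`sum_potential_step`). There are O(log n/ε) thresholds, and Markov's inequality bounds the number
of steps by O(log² n/ε) with high probability (`card_unfinished_le`, `tapeLaw_unfinished_le`).

The machines. Everything the algorithm needs is a sum over the records at a vertex or over all
records. A cycle computes all such sums at once: both endpoints of each record (its home cells) post
a summand with a label at a slot; the slots are sorted by label, so equal labels are contiguous;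
local prefix and suffix sums and a doubling scan over the machines give each slot the sum over the
preceding slots with its label and the total of its label; these travel back as answers
(`Posted.cycle`). The sorted slots are produced by the same means: if all labels are equal, the
prefix sums perform a stable partition by one bit, hence a radix sort by vertices (`RadixInv.next`).
A cycle takes O(log n) rounds and work linear in the memory, up to a factor that depends on δ.

Correctness. `algRun` is the algorithm with global variables. The machines follow it for every
outcome of the draws (`algRun_simulates`, `algRun_halts`), and its pivots have the required
properties (`AlgInv.next`). Randomness affects only the running time. -/

/-- The names of the integer registers. -/
inductive Reg
  | mode | kind | bit | total | len | first | last | carryL | carryR | shift | sum | idx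
  | tmp₀ | tmp₁ | draw

/-- The names of the real registers. -/
inductive RReg
  | thr | carryL | carryR | tmp₀ | tmp₁

/-- The names of the integer arrays: the outputs, the data of the endpoints of the input records
(`vtx`, `pos`, `status`, `prio`), and the data of the slots. -/
inductive Arr
  | outL | outR | vtx | pos | status | prio | addr | lab | val | pre | suf

/-- The names of the real arrays. -/
inductive RArr
  | dist | weight | val | pre | suf

/-- The number of registers and arrays of the program. -/
def dim (a : ℕ) : ℕ := 2 * a + 64

section Names

variable {a : ℕ}

/-- The number of a named integer register. -/
def Reg.ix (r : Reg) : Fin (dim a) := ⟨r.ctorIdx, by cases r <;> simp [dim, Reg.ctorIdx]⟩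

/-- The number of a named real register. -/
def RReg.ix (r : RReg) : Fin (dim a) := ⟨r.ctorIdx, by cases r <;> simp [dim, RReg.ctorIdx]⟩

/-- The number of a named integer array. -/
def Arr.ix (r : Arr) : Fin (dim a) := ⟨r.ctorIdx, by cases r <;> simp [dim, Arr.ctorIdx]⟩

/-- The number of a named real array. -/
def RArr.ix (r : RArr) : Fin (dim a) := ⟨r.ctorIdx, by cases r <;> simp [dim, RArr.ctorIdx]⟩

@[simp] theorem Reg.ix_inj {r s : Reg} : (r.ix : Fin (dim a)) = s.ix ↔ r = s := by
  cases r <;> cases s <;> simp [Reg.ix, Reg.ctorIdx]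

@[simp] theorem RReg.ix_inj {r s : RReg} : (r.ix : Fin (dim a)) = s.ix ↔ r = s := by
  cases r <;> cases s <;> simp [RReg.ix, RReg.ctorIdx]

@[simp] theorem Arr.ix_inj {r s : Arr} : (r.ix : Fin (dim a)) = s.ix ↔ r = s := by
  cases r <;> cases s <;> simp [Arr.ix, Arr.ctorIdx]

@[simp] theorem RArr.ix_inj {r s : RArr} : (r.ix : Fin (dim a)) = s.ix ↔ r = s := by
  cases r <;> cases s <;> simp [RArr.ix, RArr.ctorIdx]

end Names

section Program

variable (a : ℕ)

/-- The value of a named integer register. -/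
abbrev rg (r : Reg) : NExpr (dim a) := .reg r.ix

/-- The value of a named real register. -/
abbrev rr (r : RReg) : RExpr (dim a) := .reg r.ix

/-- The entry of a named integer array. -/
abbrev ld (x : Arr) (i : NExpr (dim a)) : NExpr (dim a) := .load x.ix i

/-- The entry of a named real array. -/
abbrev rld (x : RArr) (i : NExpr (dim a)) : RExpr (dim a) := .load x.ix i

/-- Assignment to a named integer register. -/
abbrev set (r : Reg) (e : NExpr (dim a)) : Prog (dim a) := .assign r.ix e

/-- Assignment to a named real register. -/
abbrev rset (r : RReg) (e : RExpr (dim a)) : Prog (dim a) := .rassign r.ix e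

/-- Assignment to a cell of a named integer array. -/
abbrev put (x : Arr) (i e : NExpr (dim a)) : Prog (dim a) := .store x.ix i e

/-- Assignment to a cell of a named real array. -/
abbrev rput (x : RArr) (i : NExpr (dim a)) (e : RExpr (dim a)) : Prog (dim a) := .rstore x.ix i e

/-- A loop with the loop variable `idx`. -/
abbrev loopIdx (e : NExpr (dim a)) (s : Prog (dim a)) : Prog (dim a) := .loop Reg.idx.ix e s

/-- The test `e ≤ f`. -/
abbrev natLe (e f : NExpr (dim a)) : BExpr (dim a) := .not (.natLt f e)

/-- The number of slots of a machine. -/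
abbrev slotsE : NExpr (dim a) := .mul (.const (2 * a)) (.div .capacity (.const (dim a)))

/-- The bound on the number of input records of a machine. -/
abbrev recordsE : NExpr (dim a) := .mul (.const a) (.div .capacity (.const (dim a)))

/-- The radius of the core of a cluster. -/
abbrev coreE : RExpr (dim a) :=
  .div (.sub (.ofNat (.const 1)) (.mul (.ofNat (.const 6)) .eps)) (.ofNat (.const 5))

/-- The radius of a cluster. -/
abbrev hullE : RExpr (dim a) :=
  .div (.sub (.ofNat (.const 2)) (.mul (.ofNat (.const 2)) .eps)) (.ofNat (.const 5))

/-- The radius within which two vertices cannot both be pivots. -/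
abbrev nearE : RExpr (dim a) :=
  .div (.add (.ofNat (.const 4)) .eps) (.ofNat (.const 5))

/-- Empty all slots. -/
def clearSlots : Prog (dim a) :=
  loopIdx a (slotsE a) <|
    -- Address 0 marks an empty slot; a request stores the number of its home cell plus one. Empty
    -- slots have label 0 and value 0, so they never change a sum.
    .seq (put a .addr (rg a .idx) (.const 0)) <|
    .seq (put a .lab (rg a .idx) (.const 0)) <|
    .seq (put a .val (rg a .idx) (.const 0))
      (rput a .val (rg a .idx) (.ofNat (.const 0)))

/-- Put the received requests into their slots. -/
def fillSlots : Prog (dim a) :=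
  loopIdx a .inboxLen <|
    .seq (put a .addr (.inboxNum (rg a .idx) 0) (.inboxNum (rg a .idx) 1)) <|
    .seq (put a .lab (.inboxNum (rg a .idx) 0) (.inboxNum (rg a .idx) 2)) <|
    .seq (put a .val (.inboxNum (rg a .idx) 0) (.inboxNum (rg a .idx) 3))
      (rput a .val (.inboxNum (rg a .idx) 0) (.inboxVal (rg a .idx)))

/-- The sums over the preceding slots with the same label. -/
def prefixSlots : Prog (dim a) :=
  loopIdx a (slotsE a) <|
    .ite (.and (.natLt (.const 0) (rg a .idx))
        (.natEq (ld a .lab (.sub (rg a .idx) (.const 1))) (ld a .lab (rg a .idx))))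
      (.seq (put a .pre (rg a .idx) (.add (ld a .pre (.sub (rg a .idx) (.const 1)))
          (ld a .val (.sub (rg a .idx) (.const 1)))))
        (rput a .pre (rg a .idx) (.add (rld a .pre (.sub (rg a .idx) (.const 1)))
          (rld a .val (.sub (rg a .idx) (.const 1))))))
      (.seq (put a .pre (rg a .idx) (.const 0))
        (rput a .pre (rg a .idx) (.ofNat (.const 0))))

/-- The sums over the following slots with the same label. -/
def suffixSlots : Prog (dim a) :=
  loopIdx a (slotsE a) <|
    .seq (set a .tmp₀ (.sub (.sub (slotsE a) (.const 1)) (rg a .idx))) <|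
    .ite (.and (.natLt (.const 0) (rg a .idx))
        (.natEq (ld a .lab (.add (rg a .tmp₀) (.const 1))) (ld a .lab (rg a .tmp₀))))
      (.seq (put a .suf (rg a .tmp₀) (.add (ld a .suf (.add (rg a .tmp₀) (.const 1)))
          (ld a .val (.add (rg a .tmp₀) (.const 1)))))
        (rput a .suf (rg a .tmp₀) (.add (rld a .suf (.add (rg a .tmp₀) (.const 1)))
          (rld a .val (.add (rg a .tmp₀) (.const 1))))))
      (.seq (put a .suf (rg a .tmp₀) (.const 0))
        (rput a .suf (rg a .tmp₀) (.ofNat (.const 0))))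

/-- Initialize the scan over the machines. -/
def initScan : Prog (dim a) :=
  .seq (set a .first (ld a .lab (.const 0))) <|
  .seq (set a .last (ld a .lab (.sub (slotsE a) (.const 1)))) <|
  .seq (set a .carryL (.const 0)) <|
  .seq (set a .carryR (.const 0)) <|
  .seq (rset a .carryL (.ofNat (.const 0))) <|
  .seq (rset a .carryR (.ofNat (.const 0))) <|
  .seq (set a .shift (.const 1)) <|
  -- The right neighbour gets the sum for the label of the last slot, the left neighbour the sum for
  -- the label of the first slot. A message to a machine number that does not exist is delivered to
  -- nobody.
  .seq (.send (.add .myId (.const 1))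
      ![.const 0, rg a .last,
        .add (ld a .pre (.sub (slotsE a) (.const 1))) (ld a .val (.sub (slotsE a) (.const 1))),
        .const 0]
      (.add (rld a .pre (.sub (slotsE a) (.const 1))) (rld a .val (.sub (slotsE a) (.const 1))))) <|
  .seq (.ite (.natLt (.const 0) .myId)
      (.send (.sub .myId (.const 1))
        ![.const 1, rg a .first,
          .add (ld a .suf (.const 0)) (ld a .val (.const 0)), .const 0]
        (.add (rld a .suf (.const 0)) (rld a .val (.const 0))))
      .skip)
    (set a .mode (.const 2))

/-- The round in which the requests arrive at the slots. -/
def slotRound : Prog (dim a) :=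
  .seq (clearSlots a) <| .seq (fillSlots a) <| .seq (prefixSlots a) <|
    .seq (suffixSlots a) (initScan a)

/-- Receive the messages of the scan. -/
def scanReceive : Prog (dim a) :=
  loopIdx a .inboxLen <|
    -- Tag 0 marks messages from the left. Only a run of equal labels that crosses the border
    -- matters, so one label comparison, with the first or the last slot, is enough.
    .ite (.natEq (.inboxNum (rg a .idx) 0) (.const 0))
      (.ite (.natEq (.inboxNum (rg a .idx) 1) (rg a .first))
        (.seq (set a .carryL (.add (rg a .carryL) (.inboxNum (rg a .idx) 2)))
          (rset a .carryL (.add (rr a .carryL) (.inboxVal (rg a .idx)))))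
        .skip)
      (.ite (.natEq (.inboxNum (rg a .idx) 1) (rg a .last))
        (.seq (set a .carryR (.add (rg a .carryR) (.inboxNum (rg a .idx) 2)))
          (rset a .carryR (.add (rr a .carryR) (.inboxVal (rg a .idx)))))
        .skip)

/-- Send the messages of the scan. -/
def scanSend : Prog (dim a) :=
  .seq (.send (.add .myId (rg a .shift))
      ![.const 0, rg a .first, rg a .carryL, .const 0] (rr a .carryL)) <|
  .seq (.ite (natLe a (rg a .shift) .myId)
      (.send (.sub .myId (rg a .shift))
        ![.const 1, rg a .last, rg a .carryR, .const 0] (rr a .carryR))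
      .skip)
    (set a .shift (.mul (.const 2) (rg a .shift)))

/-- The answer to one request. -/
def reply : Prog (dim a) :=
  .seq (set a .tmp₀ (ld a .pre (rg a .idx))) <|
  .seq (set a .tmp₁ (ld a .suf (rg a .idx))) <|
  .seq (rset a .tmp₀ (.add (.add (rld a .pre (rg a .idx)) (rld a .val (rg a .idx)))
      (rld a .suf (rg a .idx)))) <|
  .seq (.ite (.natEq (ld a .lab (rg a .idx)) (rg a .first))
      (.seq (set a .tmp₀ (.add (rg a .tmp₀) (rg a .carryL)))
        (rset a .tmp₀ (.add (rr a .tmp₀) (rr a .carryL)))) .skip) <|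
  .seq (.ite (.natEq (ld a .lab (rg a .idx)) (rg a .last))
      (.seq (set a .tmp₁ (.add (rg a .tmp₁) (rg a .carryR)))
        (rset a .tmp₀ (.add (rr a .tmp₀) (rr a .carryR)))) .skip)
    -- Home cell `h` is the entry `h % m` of machine `h / m`, where `m` is the number of slots per
    -- machine.
    (.send (.div (.sub (ld a .addr (rg a .idx)) (.const 1)) (slotsE a))
      ![.mod (.sub (ld a .addr (rg a .idx)) (.const 1)) (slotsE a), rg a .tmp₀,
        .add (.add (rg a .tmp₀) (ld a .val (rg a .idx))) (rg a .tmp₁), ld a .val (rg a .idx)]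
      (rr a .tmp₀))

/-- Answer all requests. -/
def replies : Prog (dim a) :=
  -- This is the total for the label of the first slot of the machine. It is the global sum when all
  -- labels are 0, and it is used only in such cycles (kinds 0 and 3).
  .seq (set a .sum (.add (.add (rg a .carryL)
      (.add (ld a .suf (.const 0)) (ld a .val (.const 0)))) (rg a .carryR))) <|
  .seq (loopIdx a (slotsE a)
      (.ite (.natLt (.const 0) (ld a .addr (rg a .idx))) (reply a) .skip))
    (set a .mode (.const 3))

/-- A round of the scan over the machines. -/
def scanRound : Prog (dim a) :=
  .seq (scanReceive a) (.ite (.natLt (rg a .shift) .numMachines) (scanSend a) (replies a))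

/-- Store the input. -/
def loadInput : Prog (dim a) :=
  .seq (set a .len .inboxLen) <|
    loopIdx a .inboxLen <|
      .seq (set a .tmp₀ (.mul (.const 2) (rg a .idx))) <|
      .seq (put a .vtx (rg a .tmp₀) (.inboxNum (rg a .idx) 0)) <|
      .seq (put a .vtx (.add (rg a .tmp₀) (.const 1)) (.inboxNum (rg a .idx) 1)) <|
      .seq (put a .pos (rg a .tmp₀) (.add (.mul .myId (slotsE a)) (rg a .tmp₀))) <|
      .seq (put a .pos (.add (rg a .tmp₀) (.const 1))
          (.add (.mul .myId (slotsE a)) (.add (rg a .tmp₀) (.const 1))))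
        (rput a .dist (rg a .idx) (.inboxVal (rg a .idx)))

/-- Branching on the kind of the current cycle. -/
def byKind (s : Fin 6 → Prog (dim a)) : Prog (dim a) :=
  .ite (.natEq (rg a .kind) (.const 0)) (s 0) <|
  .ite (.natEq (rg a .kind) (.const 1)) (s 1) <|
  .ite (.natEq (rg a .kind) (.const 2)) (s 2) <|
  .ite (.natEq (rg a .kind) (.const 3)) (s 3) <|
  .ite (.natEq (rg a .kind) (.const 4)) (s 4) (s 5)

/-- Use the answer to one request; `tmp₀` is the number of the endpoint. -/
def updateOne : Fin 6 → Prog (dim a) := ![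
  -- Kind 0, a stable partition: `total - sum` is the number of zeros, so a one goes behind all
  -- zeros and behind the ones that precede it, and a zero moves forward by the number of ones
  -- before it. In the first cycle all values are 1, and the new position is the rank.
  .ite (.natEq (.inboxNum (rg a .idx) 3) (.const 1))
    (put a .pos (rg a .tmp₀)
      (.add (.sub (rg a .total) (rg a .sum)) (.inboxNum (rg a .idx) 1)))
    (put a .pos (rg a .tmp₀) (.sub (ld a .pos (rg a .tmp₀)) (.inboxNum (rg a .idx) 1))),
  rput a .weight (rg a .tmp₀) (.inboxVal (rg a .idx)),
  -- Status 0 means undecided, 1 pivot, 2 dominated. The integer total is the priority of the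
  -- vertex, the real total counts the pivots near it.
  .seq (put a .prio (rg a .tmp₀) (.inboxNum (rg a .idx) 2))
    (.ite (.and (.realLt (.ofNat (.const 0)) (.inboxVal (rg a .idx)))
        (.natEq (ld a .status (rg a .tmp₀)) (.const 0)))
      (put a .status (rg a .tmp₀) (.const 2)) .skip),
  .skip,
  -- The total counts the near active vertices whose priority is not smaller; it is 0 exactly if an
  -- active vertex is a strict local maximum.
  .ite (.and (.natEq (ld a .status (rg a .tmp₀)) (.const 0))
      (.and (.realLe (rr a .thr) (rld a .weight (rg a .tmp₀)))
        (.natEq (.inboxNum (rg a .idx) 2) (.const 0))))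
    (put a .status (rg a .tmp₀) (.const 1)) .skip,
  -- The hulls are disjoint, so the total is the number of the pivot plus one, or 0 if there is
  -- none; in the latter case the vertex is a singleton and its own number is the cluster ID.
  .seq (.ite (.natEq (.inboxNum (rg a .idx) 2) (.const 0))
      (set a .tmp₁ (ld a .vtx (rg a .tmp₀)))
      (set a .tmp₁ (.sub (.inboxNum (rg a .idx) 2) (.const 1))))
    (.ite (.natEq (.mod (rg a .tmp₀) (.const 2)) (.const 0))
      (put a .outL (.div (rg a .tmp₀) (.const 2)) (rg a .tmp₁))
      (put a .outR (.div (rg a .tmp₀) (.const 2)) (rg a .tmp₁)))]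

/-- Use the answers. -/
def update : Prog (dim a) :=
  loopIdx a .inboxLen (.seq (set a .tmp₀ (.inboxNum (rg a .idx) 0)) (byKind a (updateOne a)))

/-- Remember the number of requests of the first cycle. -/
def setTotal : Prog (dim a) :=
  .ite (.and (.natEq (rg a .kind) (.const 0)) (.natEq (rg a .bit) (.const 0)))
    (set a .total (rg a .sum)) .skip

/-- Choose the next kind of cycle. -/
def nextKind : Prog (dim a) := byKind a ![
  -- Place value 0 stands for the first cycle, which only closes the gaps between the positions;
  -- then follow 1, 2, 4, … below `n`.
  .seq (.ite (.natEq (rg a .bit) (.const 0)) (set a .bit (.const 1))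
      (set a .bit (.mul (.const 2) (rg a .bit))))
    (.ite (natLe a .numVertices (rg a .bit)) (set a .kind (.const 1)) .skip),
  .seq (rset a .thr (.mul (.ofNat .numVertices) (coreE a))) (set a .kind (.const 2)),
  set a .kind (.const 3),
  -- No active vertex is left, so the threshold is lowered. Every weight is at least the core
  -- radius; once the threshold has reached it, all vertices are decided and the last kind of cycle
  -- follows.
  .ite (.natEq (rg a .sum) (.const 0))
    (.seq (.ite (.realLe (rr a .thr) (coreE a)) (set a .kind (.const 5)) (set a .kind (.const 4)))
      (rset a .thr (.div (rr a .thr) (.add (.ofNat (.const 1)) .eps))))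
    (set a .kind (.const 4)),
  set a .kind (.const 2),
  .skip]

/-- The first endpoint of the current record. -/
abbrev endE₀ : NExpr (dim a) := .mul (.const 2) (rg a .idx)

/-- The second endpoint of the current record. -/
abbrev endE₁ : NExpr (dim a) := .add (.mul (.const 2) (rg a .idx)) (.const 1)

/-- The test for a self-loop. -/
abbrev selfB : BExpr (dim a) := .natEq (ld a .vtx (endE₀ a)) (ld a .vtx (endE₁ a))

/-- Compute the summands that the two endpoints of the current record contribute. -/
def contribution : Fin 6 → Prog (dim a) := ![
  .ite (.natEq (rg a .bit) (.const 0))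
    (.seq (set a .tmp₀ (.const 1)) (set a .tmp₁ (.const 1)))
    (.seq (set a .tmp₀ (.mod (.div (ld a .vtx (endE₀ a)) (rg a .bit)) (.const 2)))
      (set a .tmp₁ (.mod (.div (ld a .vtx (endE₁ a)) (rg a .bit)) (.const 2)))),
  .ite (selfB a) (rset a .tmp₀ (coreE a))
    (.ite (.realLt (rld a .dist (rg a .idx)) (coreE a))
      (.seq (rset a .tmp₀ (.sub (coreE a) (rld a .dist (rg a .idx))))
        (rset a .tmp₁ (.sub (coreE a) (rld a .dist (rg a .idx))))) .skip),
  -- A draw is made for every record although only self-loops use it; thus the number of the draw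
  -- equals the number of the record.
  .seq (.rand Reg.draw.ix (.mul (.const 2) .numVertices))
    (.ite (selfB a) (set a .tmp₀ (rg a .draw))
      (.ite (.realLe (rld a .dist (rg a .idx)) (nearE a))
        (.seq (.ite (.natEq (ld a .status (endE₁ a)) (.const 1))
            (rset a .tmp₀ (.ofNat (.const 1))) .skip)
          (.ite (.natEq (ld a .status (endE₀ a)) (.const 1))
            (rset a .tmp₁ (.ofNat (.const 1))) .skip)) .skip)),
  .ite (.and (selfB a) (.and (.natEq (ld a .status (endE₀ a)) (.const 0))
      (.realLe (rr a .thr) (rld a .weight (endE₀ a)))))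
    (set a .tmp₀ (.const 1)) .skip,
  .ite (.and (.not (selfB a)) (.and (.realLe (rld a .dist (rg a .idx)) (nearE a))
      (.and (.and (.natEq (ld a .status (endE₀ a)) (.const 0))
          (.natEq (ld a .status (endE₁ a)) (.const 0)))
        (.and (.realLe (rr a .thr) (rld a .weight (endE₀ a)))
          (.realLe (rr a .thr) (rld a .weight (endE₁ a)))))))
    -- With equal priorities both endpoints are blocked.
    (.seq (.ite (natLe a (ld a .prio (endE₀ a)) (ld a .prio (endE₁ a)))
        (set a .tmp₀ (.const 1)) .skip)
      (.ite (natLe a (ld a .prio (endE₁ a)) (ld a .prio (endE₀ a)))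
        (set a .tmp₁ (.const 1)) .skip)) .skip,
  .ite (selfB a)
    (.ite (.natEq (ld a .status (endE₀ a)) (.const 1))
      (set a .tmp₀ (.add (ld a .vtx (endE₀ a)) (.const 1))) .skip)
    (.ite (.realLe (rld a .dist (rg a .idx)) (hullE a))
      (.seq (.ite (.natEq (ld a .status (endE₁ a)) (.const 1))
          (set a .tmp₀ (.add (ld a .vtx (endE₁ a)) (.const 1))) .skip)
        (.ite (.natEq (ld a .status (endE₀ a)) (.const 1))
          (set a .tmp₁ (.add (ld a .vtx (endE₀ a)) (.const 1))) .skip)) .skip)]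

/-- Send the request of an endpoint with a given label expression. -/
abbrev requestE (e lab : NExpr (dim a)) (v : Reg) (w : RReg) : Prog (dim a) :=
  .send (.div (ld a .pos e) (slotsE a))
    ![.mod (ld a .pos e) (slotsE a), .add (.add (.mul .myId (slotsE a)) e) (.const 1), lab, rg a v]
    (rr a w)

/-- Send the requests of both endpoints of the current record. -/
def requests : Prog (dim a) :=
  .ite (.and (.not (.natEq (rg a .kind) (.const 0))) (.not (.natEq (rg a .kind) (.const 3))))
    -- The label `n - u` is positive and decreases along the slots once they are sorted by vertices;
    -- the empty slots, with label 0, come last.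
    (.seq (requestE a (endE₀ a) (.sub .numVertices (ld a .vtx (endE₀ a))) .tmp₀ .tmp₀)
      (requestE a (endE₁ a) (.sub .numVertices (ld a .vtx (endE₁ a))) .tmp₁ .tmp₁))
    (.seq (requestE a (endE₀ a) (.const 0) .tmp₀ .tmp₀)
      (requestE a (endE₁ a) (.const 0) .tmp₁ .tmp₁))

/-- The start of a cycle. -/
def startCycle : Prog (dim a) :=
  -- The loop runs to a bound that does not depend on the registers, and a test skips the
  -- superfluous passes; this makes the number of passes evident in every state.
  .seq (loopIdx a (recordsE a)
      (.ite (.natLt (rg a .idx) (rg a .len))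
        (.seq (set a .tmp₀ (.const 0)) <| .seq (set a .tmp₁ (.const 0)) <|
          .seq (rset a .tmp₀ (.ofNat (.const 0))) <| .seq (rset a .tmp₁ (.ofNat (.const 0))) <|
          .seq (byKind a (contribution a)) (requests a))
        .skip))
    (set a .mode (.const 1))

/-- The round in which the answers arrive. -/
def homeRound : Prog (dim a) :=
  .seq (setTotal a) <| .seq (update a) <|
    .ite (.natEq (rg a .kind) (.const 5)) .halt (.seq (nextKind a) (startCycle a))

/-- The program. -/
def clusterProg : Prog (dim a) :=
  .ite (.natEq (rg a .mode) (.const 0)) (.seq (loadInput a) (startCycle a)) <|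
  .ite (.natEq (rg a .mode) (.const 1)) (slotRound a) <|
  .ite (.natEq (rg a .mode) (.const 2)) (scanRound a) (homeRound a)

end Program

/-! ### General facts about the execution of programs -/

section Exec

variable {c : ℕ} {Γ : Env}

/-- The components of a machine state that a program can change. -/
inductive Loc (c : ℕ)
  | nreg (i : Fin c)
  | rreg (i : Fin c)
  | narr (x : Fin c)
  | rarr (x : Fin c)
  | outbox
  | halted
  | draws

/-- Two states agree in a component. -/
def Loc.Same {c : ℕ} (σ τ : MState c) : Loc c → Prop
  | nreg i => τ.nreg i = σ.nreg i
  | rreg i => τ.rreg i = σ.rreg i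
  | narr x => τ.narr x = σ.narr x
  | rarr x => τ.rarr x = σ.rarr x
  | outbox => τ.outbox = σ.outbox
  | halted => τ.halted = σ.halted
  | draws => τ.draws = σ.draws

theorem Loc.Same.trans' {c : ℕ} {σ τ υ : MState c} {ℓ : Loc c} (h : ℓ.Same σ τ)
    (h' : ℓ.Same τ υ) : ℓ.Same σ υ := by
  cases ℓ <;> exact h'.trans h

/-- The components that occur in a program as the target of an operation. -/
def Prog.Writes {c : ℕ} : Prog c → Loc c → Prop
  | .skip, _ => False
  | .assign i _, ℓ => ℓ = .nreg i
  | .rassign i _, ℓ => ℓ = .rreg i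
  | .store x _ _, ℓ => ℓ = .narr x
  | .rstore x _ _, ℓ => ℓ = .rarr x
  | .rand i _, ℓ => ℓ = .nreg i ∨ ℓ = .draws
  | .send _ _ _, ℓ => ℓ = .outbox
  | .halt, ℓ => ℓ = .halted
  | .seq s t, ℓ => s.Writes ℓ ∨ t.Writes ℓ
  | .ite _ s t, ℓ => s.Writes ℓ ∨ t.Writes ℓ
  | .loop i _ s, ℓ => ℓ = .nreg i ∨ s.Writes ℓ

theorem foldl_range_induction {α : Type*} (f : α → ℕ → α) (I : ℕ → α → Prop) (N : ℕ) (x : α)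
    (h0 : I 0 x) (hs : ∀ k < N, ∀ y, I k y → I (k + 1) (f y k)) :
    I N ((List.range N).foldl f x) := by
  induction N with
  | zero => simpa
  | succ N ih =>
    rw [List.range_succ, List.foldl_append]
    exact hs N (Nat.lt_succ_self N) _ (ih fun k hk => hs k (hk.trans (Nat.lt_succ_self N)))

/-- The state at the start of a pass of a loop. -/
def loopEnter (Γ : Env) (i : Fin c) (k : ℕ) (τ : MState c) : MState c :=
  { τ with nreg := Function.update τ.nreg i (k % Γ.wordBound) }.tick 1

/-- The rule of loop invariants. The invariant is assumed before the loop variable is set and one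
operation is counted, which is what `loopEnter` does. -/
theorem exec_loop_induction (i : Fin c) (e : NExpr c) (s : Prog c) (σ : MState c)
    (I : ℕ → MState c → Prop) (h0 : I 0 (σ.tick (e.cost + 1)))
    (hs : ∀ k < e.eval Γ σ, ∀ τ, I k τ → I (k + 1) (s.exec Γ (loopEnter Γ i k τ))) :
    I (e.eval Γ σ) ((Prog.loop i e s).exec Γ σ) := by
  rw [Prog.exec]
  exact foldl_range_induction _ I _ _ h0 hs

theorem exec_inbox (P : Prog c) (σ : MState c) : (P.exec Γ σ).inbox = σ.inbox := by
  induction P generalizing σ with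
  | store a i e => simp only [Prog.exec, MState.tick]; split_ifs <;> rfl
  | rstore a i e => simp only [Prog.exec, MState.tick]; split_ifs <;> rfl
  | seq s t hs ht => simp [Prog.exec, hs, ht]
  | ite b s t hs ht => simp only [Prog.exec]; split_ifs <;> simp [hs, ht, MState.tick]
  | loop i e s hs =>
    refine exec_loop_induction (Γ := Γ) i e s σ (fun _ τ => τ.inbox = σ.inbox) rfl ?_
    intro k _ τ h
    rw [hs]; exact h
  | _ => rfl

/-- The frame rule. `Prog.Writes` is purely syntactic, so that for a concrete program the hypothesis
is settled by simplification. -/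
theorem exec_same {ℓ : Loc c} (P : Prog c) (σ : MState c) (h : ¬ P.Writes ℓ) :
    ℓ.Same σ (P.exec Γ σ) := by
  induction P generalizing σ with
  | skip => cases ℓ <;> rfl
  | assign i e =>
    cases ℓ <;> simp_all [Prog.Writes, Prog.exec, Loc.Same, MState.tick]
  | rassign i e =>
    cases ℓ <;> simp_all [Prog.Writes, Prog.exec, Loc.Same, MState.tick]
  | store a i e =>
    cases ℓ <;> simp only [Prog.exec, Loc.Same, MState.tick] <;> split_ifs <;>
      simp_all [Prog.Writes]
  | rstore a i e =>
    cases ℓ <;> simp only [Prog.exec, Loc.Same, MState.tick] <;> split_ifs <;>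
      simp_all [Prog.Writes]
  | rand i e =>
    cases ℓ <;> simp_all [Prog.Writes, Prog.exec, Loc.Same, MState.tick]
  | send d num val =>
    cases ℓ <;> simp_all [Prog.Writes, Prog.exec, Loc.Same, MState.tick]
  | halt => cases ℓ <;> simp_all [Prog.Writes, Prog.exec, Loc.Same, MState.tick]
  | seq s t hs ht =>
    rw [Prog.Writes, not_or] at h
    exact (hs σ h.1).trans' (ht _ h.2)
  | ite b s t hs ht =>
    rw [Prog.Writes, not_or] at h
    have h0 : ℓ.Same σ (σ.tick (b.cost + 1)) := by cases ℓ <;> rfl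
    rw [Prog.exec]
    split_ifs
    · exact h0.trans' (hs _ h.1)
    · exact h0.trans' (ht _ h.2)
  | loop i e s hs =>
    rw [Prog.Writes, not_or] at h
    refine exec_loop_induction (Γ := Γ) i e s σ (fun _ τ => ℓ.Same σ τ) (by cases ℓ <;> rfl) ?_
    intro k _ τ hτ
    have h1 : ℓ.Same τ (loopEnter Γ i k τ) := by
      cases ℓ <;> simp_all [Loc.Same, loopEnter, MState.tick]
    exact hτ.trans' (h1.trans' (hs _ h.2))

theorem exec_nreg {P : Prog c} {σ : MState c} {i : Fin c} (h : ¬ P.Writes (.nreg i)) :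
    (P.exec Γ σ).nreg i = σ.nreg i := exec_same P σ h

theorem exec_rreg {P : Prog c} {σ : MState c} {i : Fin c} (h : ¬ P.Writes (.rreg i)) :
    (P.exec Γ σ).rreg i = σ.rreg i := exec_same P σ h

theorem exec_narr {P : Prog c} {σ : MState c} {i : Fin c} (h : ¬ P.Writes (.narr i)) :
    (P.exec Γ σ).narr i = σ.narr i := exec_same P σ h

theorem exec_rarr {P : Prog c} {σ : MState c} {i : Fin c} (h : ¬ P.Writes (.rarr i)) :
    (P.exec Γ σ).rarr i = σ.rarr i := exec_same P σ h

theorem exec_outbox {P : Prog c} {σ : MState c} (h : ¬ P.Writes .outbox) :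
    (P.exec Γ σ).outbox = σ.outbox := exec_same P σ h

theorem exec_halted {P : Prog c} {σ : MState c} (h : ¬ P.Writes .halted) :
    (P.exec Γ σ).halted = σ.halted := exec_same P σ h

theorem exec_draws {P : Prog c} {σ : MState c} (h : ¬ P.Writes .draws) :
    (P.exec Γ σ).draws = σ.draws := exec_same P σ h

/-- All loops of a program have at most `B` passes on states with a given inbox. -/
def Prog.LoopsLe (Γ : Env) (ib : List Msg) (B : ℕ) : Prog c → Prop
  | .seq s t => s.LoopsLe Γ ib B ∧ t.LoopsLe Γ ib B
  | .ite _ s t => s.LoopsLe Γ ib B ∧ t.LoopsLe Γ ib B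
  | .loop _ e s => (∀ σ : MState c, σ.inbox = ib → e.eval Γ σ ≤ B) ∧ s.LoopsLe Γ ib B
  | _ => True

/-- A bound on the cost of a program whose loops have at most `B` passes. -/
def Prog.cost (B : ℕ) : Prog c → ℕ
  | .skip => 1
  | .assign _ e => e.cost + 1
  | .rassign _ e => e.cost + 1
  | .store _ i e => i.cost + e.cost + 1
  | .rstore _ i e => i.cost + e.cost + 1
  | .rand _ e => e.cost + 1
  | .send d num val => d.cost + (∑ j, (num j).cost) + val.cost + 1
  | .halt => 1
  | .seq s t => s.cost B + t.cost B
  | .ite b s t => b.cost + 1 + s.cost B + t.cost B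
  | .loop _ e s => e.cost + 1 + B * (1 + s.cost B)

/-- The work is bounded by the syntax alone, as long as each loop bound is controlled by the
environment and the inbox, which no program changes. Both branches of a test are counted. -/
theorem exec_work_le {B : ℕ} (P : Prog c) (σ : MState c) (h : P.LoopsLe Γ σ.inbox B) :
    (P.exec Γ σ).work ≤ σ.work + P.cost B := by
  induction P generalizing σ with
  | store a i e => simp only [Prog.exec, MState.tick, Prog.cost]; split_ifs <;> simp
  | rstore a i e => simp only [Prog.exec, MState.tick, Prog.cost]; split_ifs <;> simp
  | seq s t hs ht =>
    rw [Prog.LoopsLe] at h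
    have h1 := hs σ h.1
    have h2 := ht (s.exec Γ σ) (by rw [exec_inbox]; exact h.2)
    simp only [Prog.exec, Prog.cost]; omega
  | ite b s t hs ht =>
    rw [Prog.LoopsLe] at h
    have h1 := hs (σ.tick (b.cost + 1)) h.1
    have h2 := ht (σ.tick (b.cost + 1)) h.2
    simp only [Prog.exec, Prog.cost]
    simp only [MState.tick] at h1 h2 ⊢
    split_ifs <;> omega
  | loop i e s hs =>
    rw [Prog.LoopsLe] at h
    have := exec_loop_induction (Γ := Γ) i e s σ (fun k τ => τ.inbox = σ.inbox ∧
      τ.work ≤ σ.work + (e.cost + 1) + k * (1 + s.cost B)) ⟨rfl, by simp [MState.tick]⟩ ?_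
    · refine this.2.trans ?_
      have := Nat.mul_le_mul_right (1 + s.cost B) (h.1 σ rfl)
      simp only [Prog.cost]; omega
    · rintro k _ τ ⟨h1, h2⟩
      refine ⟨by rw [exec_inbox]; exact h1, ?_⟩
      have h3 := hs (loopEnter Γ i k τ) (by
        have : (loopEnter Γ i k τ).inbox = σ.inbox := h1
        rw [this]; exact h.2)
      have h4 : (loopEnter Γ i k τ).work = τ.work + 1 := rfl
      rw [add_mul]; omega
  | _ => simp [Prog.exec, MState.tick, Prog.cost]

end Exec

end CorrClust

namespace CorrClust

/-! ### The slots -/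

section Blocks

variable {a : ℕ} {Γ : Env}

/-- The number of slots of a machine. -/
def Env.slots (a : ℕ) (Γ : Env) : ℕ := 2 * a * (Γ.capacity / dim a)

theorem Env.slots_le (a : ℕ) (Γ : Env) : Γ.slots a ≤ Γ.capacity := by
  have h1 : Γ.capacity / dim a * dim a ≤ Γ.capacity := Nat.div_mul_le_self _ _
  have h2 : 2 * a * (Γ.capacity / dim a) ≤ dim a * (Γ.capacity / dim a) :=
    Nat.mul_le_mul_right _ (by simp [dim])
  rw [Env.slots]; linarith

/-- The content of a slot. -/
structure SlotIs (τ : MState (dim a)) (s A L V : ℕ) (R : ℝ) : Prop where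
  addr : τ.narr Arr.addr.ix s = A
  lab : τ.narr Arr.lab.ix s = L
  val : τ.narr Arr.val.ix s = V
  rval : τ.rarr RArr.val.ix s = R

theorem SlotIs.of_eq {σ τ : MState (dim a)} {s A L V : ℕ} {R : ℝ} (h : SlotIs σ s A L V R)
    (h1 : τ.narr Arr.addr.ix = σ.narr Arr.addr.ix) (h2 : τ.narr Arr.lab.ix = σ.narr Arr.lab.ix)
    (h3 : τ.narr Arr.val.ix = σ.narr Arr.val.ix) (h4 : τ.rarr RArr.val.ix = σ.rarr RArr.val.ix) :
    SlotIs τ s A L V R :=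
  ⟨h1 ▸ h.1, h2 ▸ h.2, h3 ▸ h.3, h4 ▸ h.4⟩

theorem clearSlots_spec (hW : Γ.capacity < Γ.wordBound) (σ : MState (dim a)) (s : ℕ)
    (hs : s < Γ.slots a) : SlotIs ((clearSlots a).exec Γ σ) s 0 0 0 0 := by
  have hm := Γ.slots_le a
  refine exec_loop_induction (Γ := Γ) _ (slotsE a) _ σ (fun k τ => ∀ s < k,
    SlotIs τ s 0 0 0 0) (by simp) ?_ s hs
  intro k hk τ ih s hs
  have hk' : k < Γ.capacity := lt_of_lt_of_le hk hm
  have hkW : k % Γ.wordBound = k := Nat.mod_eq_of_lt (by omega)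
  rcases Nat.lt_succ_iff_lt_or_eq.1 hs with h | h
  · obtain ⟨h1, h2, h3, h4⟩ := ih s h
    constructor <;>
    simp [Prog.exec, loopEnter, MState.tick, NExpr.eval, RExpr.eval, hkW, hk',
      Function.update_apply, h1, h2, h3, h4]
  · subst h
    constructor <;>
    simp [Prog.exec, loopEnter, MState.tick, NExpr.eval, RExpr.eval, hkW, hk',
      Function.update_apply]

theorem fillSlots_spec (hW : Γ.capacity < Γ.wordBound) (σ : MState (dim a))
    (hlen : σ.inbox.length ≤ Γ.wordBound)
    (A L V : ℕ → ℕ) (R : ℕ → ℝ)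
    (hlt : ∀ q ∈ σ.inbox, q.num 0 < Γ.slots a ∧ ∀ j, q.num j < Γ.wordBound)
    (hin : ∀ q ∈ σ.inbox, A (q.num 0) = q.num 1 ∧ L (q.num 0) = q.num 2 ∧
      V (q.num 0) = q.num 3 ∧ R (q.num 0) = q.val)
    (hout : ∀ s < Γ.slots a, (∀ q ∈ σ.inbox, q.num 0 ≠ s) → A s = 0 ∧ L s = 0 ∧ V s = 0 ∧ R s = 0)
    (h0 : ∀ s < Γ.slots a, SlotIs σ s 0 0 0 0) (s : ℕ) (hs : s < Γ.slots a) :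
    SlotIs ((fillSlots a).exec Γ σ) s (A s) (L s) (V s) (R s) := by
  have hm := Γ.slots_le a
  have key : ∀ s < Γ.slots a, SlotIs ((fillSlots a).exec Γ σ) s (A s) (L s) (V s) (R s) ∨
      (SlotIs ((fillSlots a).exec Γ σ) s 0 0 0 0 ∧ ∀ i (hi : i < σ.inbox.length),
        i < σ.inbox.length → (σ.inbox[i]).num 0 ≠ s) := by
    -- Invariant: a slot has its final content, or it is still empty and none of the messages read
    -- so far was addressed to it.
    refine (exec_loop_induction (Γ := Γ) Reg.idx.ix (NExpr.inboxLen : NExpr (dim a)) _ σ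
      (fun k τ => τ.inbox = σ.inbox ∧ ∀ s < Γ.slots a, SlotIs τ s (A s) (L s) (V s) (R s) ∨
        (SlotIs τ s 0 0 0 0 ∧ ∀ i (hi : i < σ.inbox.length), i < k → (σ.inbox[i]).num 0 ≠ s))
      ⟨rfl, fun s hs => Or.inr ⟨(h0 s hs).of_eq rfl rfl rfl rfl, by simp⟩⟩ ?_).2
    rintro k hk τ ⟨hib, ih⟩
    replace hk : k < σ.inbox.length := hk
    have hkW : k % Γ.wordBound = k := Nat.mod_eq_of_lt (by omega)
    refine ⟨by rw [exec_inbox]; exact hib, fun s hs => ?_⟩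
    have hq := hlt _ (List.getElem_mem hk)
    have hq' := hin _ (List.getElem_mem hk)
    have hqc : (σ.inbox[k]).num 0 < Γ.capacity := lt_of_lt_of_le hq.1 hm
    have m1 := Nat.mod_eq_of_lt (hq.2 1)
    have m2 := Nat.mod_eq_of_lt (hq.2 2)
    have m3 := Nat.mod_eq_of_lt (hq.2 3)
    have hget : σ.inbox[k]? = some σ.inbox[k] := List.getElem?_eq_getElem hk
    by_cases hsk : (σ.inbox[k]).num 0 = s
    · left
      subst hsk
      constructor <;>
      simp [Prog.exec, loopEnter, MState.tick, NExpr.eval, RExpr.eval, hkW, hib, hget, hqc, m1, m2,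
        m3, Function.update_apply, hq']
    · have hsk' : s ≠ (σ.inbox[k]).num 0 := fun h => hsk h.symm
      rcases ih s hs with h | ⟨h, h'⟩
      · left
        obtain ⟨h1, h2, h3, h4⟩ := h
        constructor <;>
        simp [Prog.exec, loopEnter, MState.tick, NExpr.eval, RExpr.eval, hkW, hib, hget, hqc, m1,
          m2, m3, Function.update_apply, hsk', h1, h2, h3, h4]
      · right
        refine ⟨?_, fun i hi hik => ?_⟩
        · obtain ⟨h1, h2, h3, h4⟩ := h
          constructor <;>
          simp [Prog.exec, loopEnter, MState.tick, NExpr.eval, RExpr.eval, hkW, hib, hget, hqc, m1,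
            m2, m3, Function.update_apply, hsk', h1, h2, h3, h4]
        · rcases Nat.lt_succ_iff_lt_or_eq.1 hik with h | h
          · exact h' i hi h
          · subst h; exact hsk
  rcases key s hs with h | ⟨h, h'⟩
  · exact h
  · have : ∀ q ∈ σ.inbox, q.num 0 ≠ s := by
      intro q hq
      obtain ⟨i, hi, rfl⟩ := List.getElem_of_mem hq
      exact h' i hi hi
    obtain ⟨e1, e2, e3, e4⟩ := hout s hs this
    rw [e1, e2, e3, e4]; exact h

/-- The sum over the first `s` cells with label `ℓ`. -/
def labSum {β : Type*} [AddCommMonoid β] (L : ℕ → ℕ) (V : ℕ → β) (ℓ s : ℕ) : β :=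
  ∑ x ∈ Finset.range s, if L x = ℓ then V x else 0

/-- The sum over the cells `s + 1, …, m - 1` with label `ℓ`. -/
def labSumFrom {β : Type*} [AddCommMonoid β] (L : ℕ → ℕ) (V : ℕ → β) (m ℓ s : ℕ) : β :=
  ∑ x ∈ Finset.Ico (s + 1) m, if L x = ℓ then V x else 0

theorem labSum_succ {β : Type*} [AddCommMonoid β] (L : ℕ → ℕ) (V : ℕ → β) (ℓ s : ℕ) :
    labSum L V ℓ (s + 1) = labSum L V ℓ s + if L s = ℓ then V s else 0 :=
  Finset.sum_range_succ _ _

theorem labSum_eq_zero {β : Type*} [AddCommMonoid β] {L : ℕ → ℕ} {V : ℕ → β} {ℓ s : ℕ}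
    (h : ∀ x < s, L x ≠ ℓ) : labSum L V ℓ s = 0 :=
  Finset.sum_eq_zero fun x hx => by rw [if_neg (h x (Finset.mem_range.1 hx))]

theorem labSumFrom_eq_zero {β : Type*} [AddCommMonoid β] {L : ℕ → ℕ} {V : ℕ → β} {m ℓ s : ℕ}
    (h : ∀ x < m, s < x → L x ≠ ℓ) : labSumFrom L V m ℓ s = 0 :=
  Finset.sum_eq_zero fun x hx => by
    rw [Finset.mem_Ico] at hx
    rw [if_neg (h x hx.2 hx.1)]

theorem labSumFrom_pred {β : Type*} [AddCommMonoid β] (L : ℕ → ℕ) (V : ℕ → β) {m s : ℕ} (ℓ : ℕ)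
    (hs : s + 1 < m) : labSumFrom L V m ℓ s =
      labSumFrom L V m ℓ (s + 1) + if L (s + 1) = ℓ then V (s + 1) else 0 := by
  rw [labSumFrom, Finset.sum_eq_sum_Ico_succ_bot hs, add_comm]; rfl

theorem labSum_add_labSumFrom {β : Type*} [AddCommMonoid β] (L : ℕ → ℕ) (V : ℕ → β) {m s : ℕ}
    (hs : s < m) :
    labSum L V (L s) s + V s + labSumFrom L V m (L s) s = labSum L V (L s) m := by
  rw [labSum, labSum, labSumFrom, ← Finset.sum_range_add_sum_Ico _ (Nat.succ_le_of_lt hs),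
    Finset.sum_range_succ, if_pos rfl]

theorem labSum_le (L V : ℕ → ℕ) (ℓ s : ℕ) :
    labSum L V ℓ s ≤ ∑ x ∈ Finset.range s, V x :=
  Finset.sum_le_sum fun x _ => by split_ifs <;> simp

theorem labSum_mono (L V : ℕ → ℕ) (ℓ : ℕ) {s t : ℕ} (h : s ≤ t) :
    labSum L V ℓ s ≤ labSum L V ℓ t :=
  Finset.sum_le_sum_of_subset (Finset.range_mono h)

theorem labSumFrom_le (L V : ℕ → ℕ) (m ℓ s : ℕ) :
    labSumFrom L V m ℓ s ≤ labSum L V ℓ m := by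
  refine Finset.sum_le_sum_of_subset fun x hx => ?_
  simp only [Finset.mem_Ico, Finset.mem_range] at hx ⊢; exact hx.2

/-- The labels decrease weakly, so slots with equal labels are contiguous: the sum before a slot
continues that of its left neighbour if the labels agree, and it restarts at 0 otherwise. The bound
`hV` excludes overflow of words. -/
theorem prefixSlots_spec (hW : Γ.capacity < Γ.wordBound) (σ : MState (dim a))
    (A L V : ℕ → ℕ) (R : ℕ → ℝ)
    (hσ : ∀ s < Γ.slots a, SlotIs σ s (A s) (L s) (V s) (R s))
    (hL : ∀ s t, s ≤ t → t < Γ.slots a → L t ≤ L s)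
    (hV : ∀ ℓ, labSum L V ℓ (Γ.slots a) < Γ.wordBound) (s : ℕ) (hs : s < Γ.slots a) :
    ((prefixSlots a).exec Γ σ).narr Arr.pre.ix s = labSum L V (L s) s ∧
    ((prefixSlots a).exec Γ σ).rarr RArr.pre.ix s = labSum L R (L s) s := by
  have hm := Γ.slots_le a
  refine (exec_loop_induction (Γ := Γ) _ (slotsE a) _ σ (fun k τ =>
    (∀ s < Γ.slots a, SlotIs τ s (A s) (L s) (V s) (R s)) ∧ ∀ s < k,
    τ.narr Arr.pre.ix s = labSum L V (L s) s ∧ τ.rarr RArr.pre.ix s = labSum L R (L s) s)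
      ⟨fun s hs => (hσ s hs).of_eq rfl rfl rfl rfl, by simp⟩ ?_).2 s hs
  rintro k hk τ ⟨hτ, ih⟩
  replace hk : k < Γ.slots a := hk
  have hk' : k < Γ.capacity := lt_of_lt_of_le hk hm
  have hkW : k % Γ.wordBound = k := Nat.mod_eq_of_lt (by omega)
  refine ⟨fun s hs => (hτ s hs).of_eq
    (exec_narr (by simp [Prog.Writes])) (exec_narr (by simp [Prog.Writes]))
    (exec_narr (by simp [Prog.Writes])) (exec_rarr (by simp [Prog.Writes])), fun s hs => ?_⟩
  have hlab := (hτ k hk).lab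
  have hlt := (labSum_mono L V (L k) hk.le).trans_lt (hV (L k))
  rcases Nat.eq_zero_or_pos k with rfl | hk0
  · obtain rfl : s = 0 := by omega
    simp [Prog.exec, loopEnter, MState.tick, NExpr.eval, RExpr.eval, hkW, hk', BExpr.Holds, labSum,
      Function.update_apply]
  · have hk1 : k - 1 < Γ.slots a := by omega
    have hlab1 := (hτ (k - 1) hk1).lab
    have hsucc : k - 1 + 1 = k := by omega
    by_cases heq : L (k - 1) = L k
    · have hv1 := (hτ (k - 1) hk1).val
      have hv2 := (hτ (k - 1) hk1).rval
      obtain ⟨i1, i2⟩ := ih (k - 1) (by omega)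
      have e1 := labSum_succ L V (L k) (k - 1)
      have e2 := labSum_succ L R (L k) (k - 1)
      rw [hsucc, if_pos heq] at e1 e2
      rw [heq] at i1 i2
      have hmod := Nat.mod_eq_of_lt hlt
      rw [e1] at hmod
      rcases Nat.lt_succ_iff_lt_or_eq.1 hs with h | h
      · have := ih s h
        simp [Prog.exec, loopEnter, MState.tick, NExpr.eval, RExpr.eval, hkW, hk', BExpr.Holds,
          Function.update_apply, hk0, hlab, hlab1, heq, h.ne, this]
      · subst h
        simp [Prog.exec, loopEnter, MState.tick, NExpr.eval, RExpr.eval, hkW, hk', BExpr.Holds,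
          Function.update_apply, hk0, hlab, hlab1, heq, hv1, hv2, i1, i2, e1, e2, hmod]
    · have hz : ∀ x < k, L x ≠ L k := fun x hx h => by
        have h1 := hL x (k - 1) (by omega) hk1
        have h2 := hL (k - 1) k (by omega) hk
        omega
      rcases Nat.lt_succ_iff_lt_or_eq.1 hs with h | h
      · have := ih s h
        simp [Prog.exec, loopEnter, MState.tick, NExpr.eval, RExpr.eval, hkW, hk', BExpr.Holds,
          Function.update_apply, hk0, hlab, hlab1, heq, h.ne, this]
      · subst h
        simp [Prog.exec, loopEnter, MState.tick, NExpr.eval, RExpr.eval, hkW, hk', BExpr.Holds,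
          Function.update_apply, hk0, hlab, hlab1, heq, labSum_eq_zero hz]

theorem suffixSlots_spec (hW : Γ.capacity < Γ.wordBound) (σ : MState (dim a))
    (A L V : ℕ → ℕ) (R : ℕ → ℝ)
    (hσ : ∀ s < Γ.slots a, SlotIs σ s (A s) (L s) (V s) (R s))
    (hL : ∀ s t, s ≤ t → t < Γ.slots a → L t ≤ L s)
    (hV : ∀ ℓ, labSum L V ℓ (Γ.slots a) < Γ.wordBound) (s : ℕ) (hs : s < Γ.slots a) :
    ((suffixSlots a).exec Γ σ).narr Arr.suf.ix s = labSumFrom L V (Γ.slots a) (L s) s ∧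
    ((suffixSlots a).exec Γ σ).rarr RArr.suf.ix s = labSumFrom L R (Γ.slots a) (L s) s := by
  have hm := Γ.slots_le a
  refine (exec_loop_induction (Γ := Γ) _ (slotsE a) _ σ (fun k τ =>
    (∀ s < Γ.slots a, SlotIs τ s (A s) (L s) (V s) (R s)) ∧
    ∀ s < Γ.slots a, Γ.slots a ≤ s + k →
    τ.narr Arr.suf.ix s = labSumFrom L V (Γ.slots a) (L s) s ∧
    τ.rarr RArr.suf.ix s = labSumFrom L R (Γ.slots a) (L s) s)
      ⟨fun s hs => (hσ s hs).of_eq rfl rfl rfl rfl, fun s hs h => by omega⟩ ?_).2 s hs (Nat.le_add_left _ _)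
  rintro k hk τ ⟨hτ, ih⟩
  replace hk : k < Γ.slots a := hk
  have hkW : k % Γ.wordBound = k := Nat.mod_eq_of_lt (by omega)
  -- The slots are visited from right to left; `t` is the slot of pass `k`.
  obtain ⟨t, ht⟩ : ∃ t, t = Γ.slots a - 1 - k := ⟨_, rfl⟩
  have htW : t % Γ.wordBound = t := Nat.mod_eq_of_lt (by omega)
  have htm : t < Γ.slots a := by omega
  have htc : t < Γ.capacity := by omega
  have ht' : 2 * a * (Γ.capacity / dim a) - 1 - k = t := ht.symm
  refine ⟨fun s hs => (hτ s hs).of_eq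
    (exec_narr (by simp [Prog.Writes])) (exec_narr (by simp [Prog.Writes]))
    (exec_narr (by simp [Prog.Writes])) (exec_rarr (by simp [Prog.Writes])), fun s hs hsk => ?_⟩
  have hlab := (hτ t htm).lab
  have hlt := (labSumFrom_le L V (Γ.slots a) (L t) t).trans_lt (hV (L t))
  rcases Nat.eq_zero_or_pos k with rfl | hk0
  · obtain rfl : s = t := by omega
    have hz : Finset.Ico (s + 1) (Γ.slots a) = ∅ := Finset.Ico_eq_empty (by omega)
    simp [Prog.exec, loopEnter, MState.tick, NExpr.eval, RExpr.eval, hkW, htc,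
      BExpr.Holds, labSumFrom, hz, Function.update_apply, ht', htW]
  · have hk1 : t + 1 < Γ.slots a := by omega
    have hlab1 := (hτ (t + 1) hk1).lab
    by_cases heq : L (t + 1) = L t
    · have hv1 := (hτ (t + 1) hk1).val
      have hv2 := (hτ (t + 1) hk1).rval
      obtain ⟨i1, i2⟩ := ih (t + 1) hk1 (by omega)
      have e1 := labSumFrom_pred L V (L t) hk1
      have e2 := labSumFrom_pred L R (L t) hk1
      rw [if_pos heq] at e1 e2
      rw [heq] at i1 i2
      have hmod := Nat.mod_eq_of_lt hlt
      rw [e1] at hmod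
      by_cases h : s = t
      · subst h
        simp [Prog.exec, loopEnter, MState.tick, NExpr.eval, RExpr.eval, hkW, htc,
          BExpr.Holds, ht', htW, Function.update_apply, hk0, hlab, hlab1, heq, hv1, hv2, i1, i2,
          e1, e2, hmod]
      · have := ih s hs (by omega)
        simp [Prog.exec, loopEnter, MState.tick, NExpr.eval, RExpr.eval, hkW, htc,
          BExpr.Holds, ht', htW, Function.update_apply, hk0, hlab, hlab1, heq, h, this]
    · have hz : ∀ x < Γ.slots a, t < x → L x ≠ L t := fun x hx htx h => by
        have h1 := hL t (t + 1) (by omega) hk1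
        have h2 := hL (t + 1) x (by omega) hx
        omega
      by_cases h : s = t
      · subst h
        simp [Prog.exec, loopEnter, MState.tick, NExpr.eval, RExpr.eval, hkW, htc,
          BExpr.Holds, ht', htW, Function.update_apply, hk0, hlab, hlab1, heq,
          labSumFrom_eq_zero hz]
      · have := ih s hs (by omega)
        simp [Prog.exec, loopEnter, MState.tick, NExpr.eval, RExpr.eval, hkW, htc,
          BExpr.Holds, ht', htW, Function.update_apply, hk0, hlab, hlab1, heq, h, this]

end Blocks

end CorrClust

namespace CorrClust

/-! ### The rounds of a cycle on one machine -/

section Scan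

variable {a : ℕ} {Γ : Env}

/-- The slots of a machine hold given data, and the local sums have been computed. -/
structure SlotsReady (Γ : Env) (τ : MState (dim a)) (A L V : ℕ → ℕ) (R : ℕ → ℝ) : Prop where
  slot : ∀ s < Γ.slots a, SlotIs τ s (A s) (L s) (V s) (R s)
  pre : ∀ s < Γ.slots a, τ.narr Arr.pre.ix s = labSum L V (L s) s
  rpre : ∀ s < Γ.slots a, τ.rarr RArr.pre.ix s = labSum L R (L s) s
  suf : ∀ s < Γ.slots a, τ.narr Arr.suf.ix s = labSumFrom L V (Γ.slots a) (L s) s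
  rsuf : ∀ s < Γ.slots a, τ.rarr RArr.suf.ix s = labSumFrom L R (Γ.slots a) (L s) s
  first : τ.nreg Reg.first.ix = L 0
  last : τ.nreg Reg.last.ix = L (Γ.slots a - 1)

theorem SlotsReady.exec {σ : MState (dim a)} {A L V : ℕ → ℕ} {R : ℕ → ℝ}
    (h : SlotsReady Γ σ A L V R) (Γ' : Env) (P : Prog (dim a))
    (h1 : ∀ x ∈ [Arr.addr, .lab, .val, .pre, .suf], ¬ P.Writes (.narr x.ix))
    (h2 : ∀ x ∈ [RArr.val, .pre, .suf], ¬ P.Writes (.rarr x.ix))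
    (h3 : ¬ P.Writes (.nreg Reg.first.ix)) (h4 : ¬ P.Writes (.nreg Reg.last.ix)) :
    SlotsReady Γ (P.exec Γ' σ) A L V R where
  slot s hs := (h.slot s hs).of_eq (exec_narr (h1 _ (by simp))) (exec_narr (h1 _ (by simp)))
    (exec_narr (h1 _ (by simp))) (exec_rarr (h2 _ (by simp)))
  pre s hs := by rw [exec_narr (h1 _ (by simp))]; exact h.pre s hs
  rpre s hs := by rw [exec_rarr (h2 _ (by simp))]; exact h.rpre s hs
  suf s hs := by rw [exec_narr (h1 _ (by simp))]; exact h.suf s hs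
  rsuf s hs := by rw [exec_rarr (h2 _ (by simp))]; exact h.rsuf s hs
  first := by rw [exec_nreg h3]; exact h.first
  last := by rw [exec_nreg h4]; exact h.last

/-- A message of the scan. -/
def scanMsg (d tag ℓ v : ℕ) (w : ℝ) : Msg := ⟨d, ![tag, ℓ, v, 0], w⟩

theorem SlotsReady.slots_sum {σ : MState (dim a)} {A L V : ℕ → ℕ} {R : ℕ → ℝ}
    (h : SlotsReady Γ σ A L V R) (s : ℕ) (hs : s < Γ.slots a) :
    σ.narr Arr.pre.ix s + V s + σ.narr Arr.suf.ix s = labSum L V (L s) (Γ.slots a) := by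
  rw [h.pre s hs, h.suf s hs, labSum_add_labSumFrom L V hs]

theorem slotRound_spec (hW : Γ.capacity < Γ.wordBound) (hW5 : 5 < Γ.wordBound)
    (hm0 : 0 < Γ.slots a) (σ : MState (dim a))
    (hlen : σ.inbox.length ≤ Γ.wordBound)
    (A L V : ℕ → ℕ) (R : ℕ → ℝ)
    (hlt : ∀ q ∈ σ.inbox, q.num 0 < Γ.slots a ∧ ∀ j, q.num j < Γ.wordBound)
    (hin : ∀ q ∈ σ.inbox, A (q.num 0) = q.num 1 ∧ L (q.num 0) = q.num 2 ∧
      V (q.num 0) = q.num 3 ∧ R (q.num 0) = q.val)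
    (hout : ∀ s < Γ.slots a, (∀ q ∈ σ.inbox, q.num 0 ≠ s) → A s = 0 ∧ L s = 0 ∧ V s = 0 ∧ R s = 0)
    (hL : ∀ s t, s ≤ t → t < Γ.slots a → L t ≤ L s) (hLW : ∀ s, L s < Γ.wordBound)
    (hV : ∀ ℓ, labSum L V ℓ (Γ.slots a) < Γ.wordBound) :
    SlotsReady Γ ((slotRound a).exec Γ σ) A L V R ∧
    ((slotRound a).exec Γ σ).nreg Reg.carryL.ix = 0 ∧
    ((slotRound a).exec Γ σ).nreg Reg.carryR.ix = 0 ∧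
    ((slotRound a).exec Γ σ).rreg RReg.carryL.ix = 0 ∧
    ((slotRound a).exec Γ σ).rreg RReg.carryR.ix = 0 ∧
    ((slotRound a).exec Γ σ).nreg Reg.shift.ix = 1 ∧
    ((slotRound a).exec Γ σ).nreg Reg.mode.ix = 2 ∧
    ((slotRound a).exec Γ σ).outbox = σ.outbox ++
      scanMsg (Γ.myId + 1) 0 (L (Γ.slots a - 1)) (labSum L V (L (Γ.slots a - 1)) (Γ.slots a))
        (labSum L R (L (Γ.slots a - 1)) (Γ.slots a)) ::
      (if 0 < Γ.myId then [scanMsg (Γ.myId - 1) 1 (L 0) (labSum L V (L 0) (Γ.slots a))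
        (labSum L R (L 0) (Γ.slots a))] else []) := by
  obtain ⟨σ₁, e₁⟩ : ∃ σ₁, σ₁ = (clearSlots a).exec Γ σ := ⟨_, rfl⟩
  obtain ⟨σ₂, e₂⟩ : ∃ σ₂, σ₂ = (fillSlots a).exec Γ σ₁ := ⟨_, rfl⟩
  obtain ⟨σ₃, e₃⟩ : ∃ σ₃, σ₃ = (prefixSlots a).exec Γ σ₂ := ⟨_, rfl⟩
  obtain ⟨σ₄, e₄⟩ : ∃ σ₄, σ₄ = (suffixSlots a).exec Γ σ₃ := ⟨_, rfl⟩
  have hexec : (slotRound a).exec Γ σ = (initScan a).exec Γ σ₄ := by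
    simp only [e₁, e₂, e₃, e₄, slotRound, Prog.exec]
  have hib : σ₁.inbox = σ.inbox := by rw [e₁, exec_inbox]
  have s₁ : ∀ s < Γ.slots a, SlotIs σ₁ s 0 0 0 0 := by
    rw [e₁]; exact fun s hs => clearSlots_spec hW σ s hs
  have s₂ : ∀ s < Γ.slots a, SlotIs σ₂ s (A s) (L s) (V s) (R s) := by
    rw [e₂]
    exact fillSlots_spec hW σ₁ (by rwa [hib]) A L V R (by rwa [hib]) (by rwa [hib])
      (by rwa [hib]) s₁
  have s₃ : ∀ s < Γ.slots a, SlotIs σ₃ s (A s) (L s) (V s) (R s) := by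
    rw [e₃]
    exact fun s hs => (s₂ s hs).of_eq
      (exec_narr (by simp [Prog.Writes, prefixSlots]))
      (exec_narr (by simp [Prog.Writes, prefixSlots]))
      (exec_narr (by simp [Prog.Writes, prefixSlots]))
      (exec_rarr (by simp [Prog.Writes, prefixSlots]))
  have s₄ : ∀ s < Γ.slots a, SlotIs σ₄ s (A s) (L s) (V s) (R s) := by
    rw [e₄]
    exact fun s hs => (s₃ s hs).of_eq
      (exec_narr (by simp [Prog.Writes, suffixSlots]))
      (exec_narr (by simp [Prog.Writes, suffixSlots]))
      (exec_narr (by simp [Prog.Writes, suffixSlots]))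
      (exec_rarr (by simp [Prog.Writes, suffixSlots]))
  have p := prefixSlots_spec hW σ₂ A L V R s₂ hL hV
  rw [← e₃] at p
  have q := suffixSlots_spec hW σ₃ A L V R s₃ hL hV
  rw [← e₄] at q
  have p1 : σ₄.narr Arr.pre.ix = σ₃.narr Arr.pre.ix := by
    rw [e₄]; exact exec_narr (by simp [Prog.Writes, suffixSlots])
  have p2 : σ₄.rarr RArr.pre.ix = σ₃.rarr RArr.pre.ix := by
    rw [e₄]; exact exec_rarr (by simp [Prog.Writes, suffixSlots])
  have ob : σ₄.outbox = σ.outbox := by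
    rw [e₄, exec_outbox (by simp [Prog.Writes, suffixSlots]), e₃,
      exec_outbox (by simp [Prog.Writes, prefixSlots]), e₂,
      exec_outbox (by simp [Prog.Writes, fillSlots]), e₁,
      exec_outbox (by simp [Prog.Writes, clearSlots])]
  have hm1 : Γ.slots a - 1 < Γ.slots a := by omega
  have l0 := (s₄ 0 hm0).lab
  have l1 := (s₄ _ hm1).lab
  have v0 := (s₄ 0 hm0).val
  have v1 := (s₄ _ hm1).val
  have w0 := (s₄ 0 hm0).rval
  have w1 := (s₄ _ hm1).rval
  have q0 := q 0 hm0
  have q1 := p _ hm1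
  rw [← p1, ← p2] at q1
  have L0 := Nat.mod_eq_of_lt (hLW 0)
  have L1 := Nat.mod_eq_of_lt (hLW (Γ.slots a - 1))
  have t0 := labSum_add_labSumFrom L V hm0
  have t1 := labSum_add_labSumFrom L V hm1
  have u0 := labSum_add_labSumFrom L R hm0
  have u1 := labSum_add_labSumFrom L R hm1
  -- Nothing follows the last slot and nothing precedes the first one, so prefix sum plus value at
  -- the last slot, and suffix sum plus value at the first, are the sums of the whole machine for
  -- these labels.
  have hI : Finset.Ico (Γ.slots a - 1 + 1) (Γ.slots a) = ∅ := Finset.Ico_eq_empty (by omega)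
  have z1 : labSumFrom L V (Γ.slots a) (L (Γ.slots a - 1)) (Γ.slots a - 1) = 0 := by
    rw [labSumFrom, hI, Finset.sum_empty]
  have z2 : labSumFrom L R (Γ.slots a) (L (Γ.slots a - 1)) (Γ.slots a - 1) = 0 := by
    rw [labSumFrom, hI, Finset.sum_empty]
  have z3 : labSum L V (L 0) 0 = 0 := rfl
  have z4 : labSum L R (L 0) 0 = 0 := rfl
  rw [z1, add_zero] at t1
  rw [z2, add_zero] at u1
  rw [z3, zero_add, add_comm] at t0
  rw [z4, zero_add, add_comm] at u0
  have W1 : 1 % Γ.wordBound = 1 := Nat.mod_eq_of_lt (by omega)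
  have W2 : 2 % Γ.wordBound = 2 := Nat.mod_eq_of_lt (by omega)
  have V0 := Nat.mod_eq_of_lt (hV (L 0))
  have V1 := Nat.mod_eq_of_lt (hV (L (Γ.slots a - 1)))
  have hi : (2 * a * (Γ.capacity / dim a)) = Γ.slots a := rfl
  rw [hexec]
  refine ⟨⟨fun s hs => (s₄ s hs).of_eq
      (exec_narr (by simp [Prog.Writes, initScan]))
      (exec_narr (by simp [Prog.Writes, initScan]))
      (exec_narr (by simp [Prog.Writes, initScan]))
      (exec_rarr (by simp [Prog.Writes, initScan])), fun s hs => ?_, fun s hs => ?_, fun s hs => ?_,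
      fun s hs => ?_, ?_, ?_⟩, ?_⟩
  · rw [exec_narr (by simp [Prog.Writes, initScan]), p1]; exact (p s hs).1
  · rw [exec_rarr (by simp [Prog.Writes, initScan]), p2]; exact (p s hs).2
  · rw [exec_narr (by simp [Prog.Writes, initScan])]; exact (q s hs).1
  · rw [exec_rarr (by simp [Prog.Writes, initScan])]; exact (q s hs).2
  · by_cases h0 : 0 < Γ.myId <;>
    simp [initScan, Prog.exec, MState.tick, NExpr.eval, RExpr.eval, BExpr.Holds, h0, hi,
      Function.update_apply, l0, L0]
  · by_cases h0 : 0 < Γ.myId <;>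
    simp [initScan, Prog.exec, MState.tick, NExpr.eval, RExpr.eval, BExpr.Holds, h0, hi,
      Function.update_apply, l1, L1]
  · refine ⟨?_, ?_, ?_, ?_, ?_, ?_, ?_⟩
    rotate_right
    · have f1 : (fun j => NExpr.eval Γ σ₄ (![.const 0, .const (L (Γ.slots a - 1)),
        .const (labSum L V (L (Γ.slots a - 1)) (Γ.slots a)), .const 0] j) % Γ.wordBound) =
          ![0, L (Γ.slots a - 1), labSum L V (L (Γ.slots a - 1)) (Γ.slots a), 0] := by
        funext j; fin_cases j <;> simp [NExpr.eval, L1, V1]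
      by_cases h0 : 0 < Γ.myId
      · simp [initScan, Prog.exec, MState.tick, NExpr.eval, RExpr.eval, BExpr.Holds, h0, hi,
          Function.update_apply, scanMsg, ob]
        refine ⟨⟨?_, ?_⟩, ?_, ?_⟩
        · funext j; fin_cases j <;>
            simp [NExpr.eval, Function.update_apply, hi, l1, L1, q1, v1, t1, V1]
        · rw [q1.2, w1, u1]
        · funext j; fin_cases j <;>
            simp [NExpr.eval, Function.update_apply, hi, l0, L0, q0, v0, t0, V0, W1]
        · rw [q0.2, w0, u0]
      · simp [initScan, Prog.exec, MState.tick, NExpr.eval, RExpr.eval, BExpr.Holds, h0, hi,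
          Function.update_apply, scanMsg, ob]
        refine ⟨?_, ?_⟩
        · funext j; fin_cases j <;>
            simp [NExpr.eval, Function.update_apply, hi, l1, L1, q1, v1, t1, V1]
        · rw [q1.2, w1, u1]
    all_goals
      by_cases h0 : 0 < Γ.myId <;>
      simp [initScan, Prog.exec, MState.tick, NExpr.eval, RExpr.eval, BExpr.Holds, h0, hi,
        Function.update_apply, W1, W2]

/-- The part of a list of messages that is received from the left for a given label. -/
def fromLeft {β : Type*} [AddCommMonoid β] (g : Msg → β) (ℓ : ℕ) (q : Msg) : β :=
  if q.num 0 = 0 ∧ q.num 1 = ℓ then g q else 0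

/-- The part of a list of messages that is received from the right for a given label. -/
def fromRight {β : Type*} [AddCommMonoid β] (g : Msg → β) (ℓ : ℕ) (q : Msg) : β :=
  if q.num 0 ≠ 0 ∧ q.num 1 = ℓ then g q else 0

/-- What the messages of the scan add to the carries. -/
structure Received (Γ : Env) (f l : ℕ) (ib : List Msg) (σ τ : MState (dim a)) : Prop where
  carryL : τ.nreg Reg.carryL.ix =
    (σ.nreg Reg.carryL.ix + (ib.map (fromLeft (fun q => q.num 2) f)).sum) % Γ.wordBound
  carryR : τ.nreg Reg.carryR.ix =
    (σ.nreg Reg.carryR.ix + (ib.map (fromRight (fun q => q.num 2) l)).sum) % Γ.wordBound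
  rcarryL : τ.rreg RReg.carryL.ix =
    σ.rreg RReg.carryL.ix + (ib.map (fromLeft (fun q => q.val) f)).sum
  rcarryR : τ.rreg RReg.carryR.ix =
    σ.rreg RReg.carryR.ix + (ib.map (fromRight (fun q => q.val) l)).sum

theorem scanReceive_spec (σ : MState (dim a)) (hlen : σ.inbox.length < Γ.wordBound)
    (h1 : σ.nreg Reg.carryL.ix < Γ.wordBound) (h2 : σ.nreg Reg.carryR.ix < Γ.wordBound) :
    Received Γ (σ.nreg Reg.first.ix) (σ.nreg Reg.last.ix) σ.inbox σ
      ((scanReceive a).exec Γ σ) := by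
  have key := (exec_loop_induction (Γ := Γ) Reg.idx.ix (NExpr.inboxLen : NExpr (dim a))
    -- The `match` only names the body of the loop.
    (match scanReceive a with | .loop _ _ s => s | _ => .skip) σ
    (fun k τ => τ.inbox = σ.inbox ∧ τ.nreg Reg.first.ix = σ.nreg Reg.first.ix ∧
      τ.nreg Reg.last.ix = σ.nreg Reg.last.ix ∧
      Received Γ (σ.nreg Reg.first.ix) (σ.nreg Reg.last.ix) (σ.inbox.take k) σ τ)
    ⟨rfl, rfl, rfl, by
      constructor <;> simp [MState.tick, Nat.mod_eq_of_lt h1, Nat.mod_eq_of_lt h2]⟩ ?_).2.2.2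
  · have : (NExpr.inboxLen : NExpr (dim a)).eval Γ σ = σ.inbox.length := rfl
    rw [this, List.take_length] at key
    exact key
  · rintro k hk τ ⟨hib, hf, hl, ih⟩
    replace hk : k < σ.inbox.length := hk
    have hkW : k % Γ.wordBound = k := Nat.mod_eq_of_lt (by omega)
    have hget : σ.inbox[k]? = some σ.inbox[k] := List.getElem?_eq_getElem hk
    refine ⟨by rw [exec_inbox]; exact hib, ?_, ?_, ?_⟩
    · rw [exec_nreg (by simp [Prog.Writes, scanReceive])]
      simp [loopEnter, MState.tick, Function.update_apply, hf]
    · rw [exec_nreg (by simp [Prog.Writes, scanReceive])]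
      simp [loopEnter, MState.tick, Function.update_apply, hl]
    · have htN : ∀ φ : Msg → ℕ, ((σ.inbox.take (k + 1)).map φ).sum =
          ((σ.inbox.take k).map φ).sum + φ σ.inbox[k] := fun φ => by
        rw [List.take_add_one, hget]; simp [-List.map_take, -List.take_append_getElem]
      have htR : ∀ φ : Msg → ℝ, ((σ.inbox.take (k + 1)).map φ).sum =
          ((σ.inbox.take k).map φ).sum + φ σ.inbox[k] := fun φ => by
        rw [List.take_add_one, hget]; simp [-List.map_take, -List.take_append_getElem]
      obtain ⟨i1, i2, i3, i4⟩ := ih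
      by_cases h0 : (σ.inbox[k]).num 0 = 0
      · by_cases h1 : (σ.inbox[k]).num 1 = σ.nreg Reg.first.ix
        · constructor <;>
          simp [-List.map_take, scanReceive, Prog.exec, loopEnter, MState.tick, NExpr.eval, RExpr.eval,
            BExpr.Holds, Function.update_apply, hkW, hib, hget, h0, h1, hf, hl, htN, htR, i1, i2, i3,
            i4, fromLeft, fromRight, add_assoc]
        · constructor <;>
          simp [-List.map_take, scanReceive, Prog.exec, loopEnter, MState.tick, NExpr.eval, RExpr.eval,
            BExpr.Holds, Function.update_apply, hkW, hib, hget, h0, h1, hf, hl, htN, htR, i1, i2, i3,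
            i4, fromLeft, fromRight, add_assoc]
      · by_cases h1 : (σ.inbox[k]).num 1 = σ.nreg Reg.last.ix
        · constructor <;>
          simp [-List.map_take, scanReceive, Prog.exec, loopEnter, MState.tick, NExpr.eval, RExpr.eval,
            BExpr.Holds, Function.update_apply, hkW, hib, hget, h0, h1, hf, hl, htN, htR, i1, i2, i3,
            i4, fromLeft, fromRight, add_assoc]
        · constructor <;>
          simp [-List.map_take, scanReceive, Prog.exec, loopEnter, MState.tick, NExpr.eval, RExpr.eval,
            BExpr.Holds, Function.update_apply, hkW, hib, hget, h0, h1, hf, hl, htN, htR, i1, i2, i3,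
            i4, fromLeft, fromRight, add_assoc]

theorem scanSend_spec (hW5 : 5 < Γ.wordBound) (σ : MState (dim a))
    (hs : 2 * σ.nreg Reg.shift.ix < Γ.wordBound)
    (h1 : σ.nreg Reg.carryL.ix < Γ.wordBound) (h2 : σ.nreg Reg.carryR.ix < Γ.wordBound)
    (h3 : σ.nreg Reg.first.ix < Γ.wordBound) (h4 : σ.nreg Reg.last.ix < Γ.wordBound) :
    ((scanSend a).exec Γ σ).nreg Reg.shift.ix = 2 * σ.nreg Reg.shift.ix ∧
    ((scanSend a).exec Γ σ).outbox = σ.outbox ++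
      scanMsg (Γ.myId + σ.nreg Reg.shift.ix) 0 (σ.nreg Reg.first.ix) (σ.nreg Reg.carryL.ix)
        (σ.rreg RReg.carryL.ix) ::
      (if σ.nreg Reg.shift.ix ≤ Γ.myId then [scanMsg (Γ.myId - σ.nreg Reg.shift.ix) 1
        (σ.nreg Reg.last.ix) (σ.nreg Reg.carryR.ix) (σ.rreg RReg.carryR.ix)] else []) := by
  have W1 : 1 % Γ.wordBound = 1 := Nat.mod_eq_of_lt (by omega)
  have e1 := Nat.mod_eq_of_lt h1
  have e2 := Nat.mod_eq_of_lt h2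
  have e3 := Nat.mod_eq_of_lt h3
  have e4 := Nat.mod_eq_of_lt h4
  have e5 := Nat.mod_eq_of_lt hs
  by_cases h0 : σ.nreg Reg.shift.ix ≤ Γ.myId
  · have h0' : ¬ Γ.myId < σ.nreg Reg.shift.ix := by omega
    simp only [scanSend, Prog.exec, MState.tick, NExpr.eval, RExpr.eval, BExpr.Holds, h0, h0',
      not_false_eq_true, if_true, Function.update_self, e5, scanMsg, true_and, List.append_assoc,
      List.append_cancel_left_eq, List.singleton_append, List.cons.injEq, Msg.mk.injEq, and_true]
    constructor <;> funext j <;> fin_cases j <;> simp [NExpr.eval, e1, e2, e3, e4, W1]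
  · have h0' : Γ.myId < σ.nreg Reg.shift.ix := by omega
    simp only [scanSend, Prog.exec, MState.tick, NExpr.eval, RExpr.eval, BExpr.Holds, h0, h0',
      not_true_eq_false, if_false, Function.update_self, e5, scanMsg, true_and, List.append_assoc,
      List.append_cancel_left_eq, List.singleton_append, List.cons.injEq, Msg.mk.injEq, and_true]
    funext j; fin_cases j <;> simp [NExpr.eval, e1, e2, e3, e4, W1]

end Scan

end CorrClust

namespace CorrClust

/-! ### The answers sent by one machine -/

section Replies

variable {a : ℕ} {Γ : Env}

/-- The answer to the request in slot `s`. -/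
def replyMsg (m : ℕ) (A L V : ℕ → ℕ) (R : ℕ → ℝ) (cL cR : ℕ) (dL dR : ℝ) (s : ℕ) : Msg :=
  ⟨(A s - 1) / m, ![(A s - 1) % m, labSum L V (L s) s + (if L s = L 0 then cL else 0),
    labSum L V (L s) m + (if L s = L 0 then cL else 0) + (if L s = L (m - 1) then cR else 0), V s],
    labSum L R (L s) m + (if L s = L 0 then dL else 0) + (if L s = L (m - 1) then dR else 0)⟩

theorem replies_spec (hW : Γ.capacity < Γ.wordBound) (hW5 : 5 < Γ.wordBound)
    (hm0 : 0 < Γ.slots a) (σ : MState (dim a)) (A L V : ℕ → ℕ) (R : ℕ → ℝ)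
    (hσ : SlotsReady Γ σ A L V R)
    (hV : ∀ ℓ, σ.nreg Reg.carryL.ix + labSum L V ℓ (Γ.slots a) + σ.nreg Reg.carryR.ix <
      Γ.wordBound) :
    ((replies a).exec Γ σ).nreg Reg.sum.ix = σ.nreg Reg.carryL.ix +
      labSum L V (L 0) (Γ.slots a) + σ.nreg Reg.carryR.ix ∧
    ((replies a).exec Γ σ).nreg Reg.mode.ix = 3 ∧
    ((replies a).exec Γ σ).outbox = σ.outbox ++
      ((List.range (Γ.slots a)).filter (fun s => 0 < A s)).map
        (replyMsg (Γ.slots a) A L V R (σ.nreg Reg.carryL.ix) (σ.nreg Reg.carryR.ix)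
          (σ.rreg RReg.carryL.ix) (σ.rreg RReg.carryR.ix)) := by
  have hm := Γ.slots_le a
  obtain ⟨σ₁, e₁⟩ : ∃ σ₁, σ₁ = (set a .sum (.add (.add (rg a .carryL)
      (.add (ld a .suf (.const 0)) (ld a .val (.const 0)))) (rg a .carryR))).exec Γ σ := ⟨_, rfl⟩
  have hr₁ : SlotsReady Γ σ₁ A L V R := by
    rw [e₁]
    exact hσ.exec Γ _ (by simp [Prog.Writes]) (by simp [Prog.Writes]) (by simp [Prog.Writes])
      (by simp [Prog.Writes])
  have hsum : σ₁.nreg Reg.sum.ix = σ.nreg Reg.carryL.ix + labSum L V (L 0) (Γ.slots a) +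
      σ.nreg Reg.carryR.ix := by
    have h1 := hσ.slots_sum 0 hm0
    have h2 := hσ.pre 0 hm0
    have h3 := (hσ.slot 0 hm0).val
    rw [h2, show labSum L V (L 0) 0 = 0 from rfl, zero_add, add_comm] at h1
    have h4 := Nat.mod_eq_of_lt (hV (L 0))
    rw [e₁]
    simp [Prog.exec, MState.tick, NExpr.eval, h3, h1, h4]
  have c1 : σ₁.nreg Reg.carryL.ix = σ.nreg Reg.carryL.ix := by
    rw [e₁]; exact exec_nreg (by simp [Prog.Writes])
  have c2 : σ₁.nreg Reg.carryR.ix = σ.nreg Reg.carryR.ix := by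
    rw [e₁]; exact exec_nreg (by simp [Prog.Writes])
  have c3 : σ₁.rreg RReg.carryL.ix = σ.rreg RReg.carryL.ix := by
    rw [e₁]; exact exec_rreg (by simp [Prog.Writes])
  have c4 : σ₁.rreg RReg.carryR.ix = σ.rreg RReg.carryR.ix := by
    rw [e₁]; exact exec_rreg (by simp [Prog.Writes])
  have ob : σ₁.outbox = σ.outbox := by
    rw [e₁]; exact exec_outbox (by simp [Prog.Writes])
  obtain ⟨σ₂, e₂⟩ : ∃ σ₂, σ₂ = (loopIdx a (slotsE a)
      (.ite (.natLt (.const 0) (ld a .addr (rg a .idx))) (reply a) .skip)).exec Γ σ₁ := ⟨_, rfl⟩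
  have hexec : (replies a).exec Γ σ = (set a .mode (.const 3)).exec Γ σ₂ := by
    simp only [e₁, e₂, replies, Prog.exec]
  have hsum₂ : σ₂.nreg Reg.sum.ix = σ₁.nreg Reg.sum.ix := by
    rw [e₂]; exact exec_nreg (by simp [Prog.Writes, reply])
  have W3 : 3 % Γ.wordBound = 3 := Nat.mod_eq_of_lt (by omega)
  rw [hexec]
  refine ⟨?_, ?_, ?_⟩
  · rw [exec_nreg (by simp [Prog.Writes]), hsum₂, hsum]
  · simp [Prog.exec, MState.tick, NExpr.eval, W3]
  rw [exec_outbox (by simp [Prog.Writes]), e₂]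
  refine (exec_loop_induction (Γ := Γ) _ (slotsE a) _ σ₁ (fun k τ =>
    SlotsReady Γ τ A L V R ∧ τ.nreg Reg.carryL.ix = σ.nreg Reg.carryL.ix ∧
    τ.nreg Reg.carryR.ix = σ.nreg Reg.carryR.ix ∧
    τ.rreg RReg.carryL.ix = σ.rreg RReg.carryL.ix ∧
    τ.rreg RReg.carryR.ix = σ.rreg RReg.carryR.ix ∧
    τ.outbox = σ.outbox ++ ((List.range k).filter (fun s => 0 < A s)).map
        (replyMsg (Γ.slots a) A L V R (σ.nreg Reg.carryL.ix) (σ.nreg Reg.carryR.ix)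
          (σ.rreg RReg.carryL.ix) (σ.rreg RReg.carryR.ix)))
    ⟨⟨fun s hs => (hr₁.slot s hs).of_eq rfl rfl rfl rfl, hr₁.pre, hr₁.rpre, hr₁.suf, hr₁.rsuf,
      hr₁.first, hr₁.last⟩, c1, c2, c3, c4, by simp [MState.tick, ob]⟩ ?_).2.2.2.2.2
  rintro k hk τ ⟨hτ, i1, i2, i3, i4, i5⟩
  replace hk : k < Γ.slots a := hk
  have hkW : k % Γ.wordBound = k := Nat.mod_eq_of_lt (by omega)
  have hent : SlotsReady Γ (loopEnter Γ Reg.idx.ix k τ) A L V R :=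
    ⟨fun s hs => (hτ.slot s hs).of_eq rfl rfl rfl rfl, hτ.pre, hτ.rpre, hτ.suf, hτ.rsuf,
      by simpa [loopEnter, MState.tick, Function.update_apply] using hτ.first,
      by simpa [loopEnter, MState.tick, Function.update_apply] using hτ.last⟩
  refine ⟨hent.exec Γ _ (by simp [Prog.Writes, reply]) (by simp [Prog.Writes, reply])
    (by simp [Prog.Writes, reply]) (by simp [Prog.Writes, reply]), ?_, ?_, ?_, ?_, ?_⟩
  · rw [exec_nreg (by simp [Prog.Writes, reply])]
    simpa [loopEnter, MState.tick, Function.update_apply] using i1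
  · rw [exec_nreg (by simp [Prog.Writes, reply])]
    simpa [loopEnter, MState.tick, Function.update_apply] using i2
  · rw [exec_rreg (by simp [Prog.Writes, reply])]
    simpa [loopEnter, MState.tick] using i3
  · rw [exec_rreg (by simp [Prog.Writes, reply])]
    simpa [loopEnter, MState.tick] using i4
  have hA := (hτ.slot k hk).addr
  rw [List.range_succ, List.filter_append]
  by_cases h0 : 0 < A k
  · have hlab := (hτ.slot k hk).lab
    have hval := (hτ.slot k hk).val
    have hrval := (hτ.slot k hk).rval
    have hp := hτ.pre k hk
    have hq := hτ.suf k hk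
    have hrp := hτ.rpre k hk
    have hrq := hτ.rsuf k hk
    have hf := hτ.first
    have hl := hτ.last
    have hi : (2 * a * (Γ.capacity / dim a)) = Γ.slots a := rfl
    have tN := labSum_add_labSumFrom L V hk
    have tR := labSum_add_labSumFrom L R hk
    have hb := hV (L k)
    have b1 : labSum L V (L k) k % Γ.wordBound = labSum L V (L k) k :=
      Nat.mod_eq_of_lt (by omega)
    have b2 : labSumFrom L V (Γ.slots a) (L k) k % Γ.wordBound =
      labSumFrom L V (Γ.slots a) (L k) k := Nat.mod_eq_of_lt (by omega)
    have b3 : (labSum L V (L k) k + σ.nreg Reg.carryL.ix) % Γ.wordBound =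
      labSum L V (L k) k + σ.nreg Reg.carryL.ix := Nat.mod_eq_of_lt (by omega)
    have b4 : (labSumFrom L V (Γ.slots a) (L k) k + σ.nreg Reg.carryR.ix) % Γ.wordBound =
      labSumFrom L V (Γ.slots a) (L k) k + σ.nreg Reg.carryR.ix := Nat.mod_eq_of_lt (by omega)
    have b5 : V k % Γ.wordBound = V k := Nat.mod_eq_of_lt (by omega)
    have b6 : (A k - 1) % Γ.slots a % Γ.wordBound = (A k - 1) % Γ.slots a :=
      Nat.mod_eq_of_lt (by
        have := Nat.mod_lt (A k - 1) hm0
        omega)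
    have hfil : [k].filter (fun s => decide (0 < A s)) = [k] := by simp [h0]
    rw [hfil, List.map_append, ← List.append_assoc, ← i5]
    -- The execution of programs uses classical decidability, `replyMsg` the decidable equality of
    -- ℕ; these rules serve both.
    have P : ∀ c : Prop, c → ∀ (α : Type) (inst : Decidable c) (x y : α), @ite α c inst x y = x :=
      fun c h _ _ _ _ => if_pos h
    have Q : ∀ c : Prop, ¬ c → ∀ (α : Type) (inst : Decidable c) (x y : α),
      @ite α c inst x y = y := fun c h _ _ _ _ => if_neg h
    rcases em (L k = L 0) with h1 | h1 <;> rcases em (L k = L (Γ.slots a - 1)) with h2 | h2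
    all_goals
      have p1 := by first | exact Q _ h1 | exact P _ h1
      have p2 := by first | exact Q _ h2 | exact P _ h2
      simp only [reply, Prog.exec, loopEnter, MState.tick, NExpr.eval, RExpr.eval, BExpr.Holds,
        Function.update_apply, hkW, hA, h0, hlab, hval, hrval, hp, hq, hrp, hrq, hf, hl, i1, i2,
        i3, i4, b1, b2, b3, b4, b5, b6, p1, p2, hi, if_true, if_false, Reg.ix_inj, RReg.ix_inj,
        reduceCtorEq, List.map_cons, List.map_nil, replyMsg, List.append_cancel_left_eq,
        List.cons.injEq, and_true, Msg.mk.injEq, true_and]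
      refine ⟨?_, by linarith⟩
      funext j
      fin_cases j <;>
        simp [NExpr.eval, Function.update_apply, hi, hval, hA, hkW, b1, b2, b3, b4, b5, b6]
      all_goals (rw [Nat.mod_eq_of_lt (by omega)]; omega)
  · have hfil : [k].filter (fun s => decide (0 < A s)) = [] := by simp [h0]
    rw [hfil, List.append_nil, ← i5]
    simp [Prog.exec, loopEnter, MState.tick, NExpr.eval, BExpr.Holds, hkW, hA, h0]

end Replies

end CorrClust

namespace CorrClust

/-! ### One cycle: requests, segmented sums, answers -/

section Deliver

/-- The messages that arrive at machine `i`. -/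
def deliver {M : ℕ} (out : Fin M → List Msg) (i : ℕ) : List Msg :=
  (List.finRange M).flatMap fun j => (out j).filter fun q => q.dst = i

theorem mem_deliver {M : ℕ} {out : Fin M → List Msg} {i : ℕ} {q : Msg} :
    q ∈ deliver out i ↔ ∃ j, q ∈ out j ∧ q.dst = i := by
  simp [deliver]

theorem deliver_sum {M : ℕ} {β : Type*} [AddCommMonoid β] (out : Fin M → List Msg) (i : ℕ)
    (φ : Msg → β) : ((deliver out i).map φ).sum =
      ∑ j, (((out j).filter fun q => q.dst = i).map φ).sum := by
  have h : ∀ l : List (Fin M), ((l.flatMap fun j => (out j).filter fun q => q.dst = i).map φ).sum =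
      (l.map fun j => (((out j).filter fun q => q.dst = i).map φ).sum).sum := by
    intro l
    induction l with
    | nil => simp
    | cons x l ih => simp only [List.flatMap_cons, List.map_append, List.sum_append, List.map_cons,
        List.sum_cons, ih]
  rw [deliver, h, ← List.sum_ofFn, List.ofFn_eq_map]

/-- If destination and first word determine the message, all messages at one machine address
different entries. This gives the bound on the inbox (with `length_le_of_nodup_map`) and shows that
no entry is written twice. -/
theorem deliver_nodup {M : ℕ} (l : Fin M → List ℕ) (g : Fin M → ℕ → Msg)
    (hl : ∀ j, (l j).Nodup)
    (hinj : ∀ j j', ∀ x ∈ l j, ∀ y ∈ l j', (g j x).dst = (g j' y).dst →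
      (g j x).num 0 = (g j' y).num 0 → j = j' ∧ x = y) (i : ℕ) :
    ((deliver (fun j => (l j).map (g j)) i).map fun q => q.num 0).Nodup := by
  refine List.Nodup.map_on ?_ ?_
  · intro q hq q' hq' h
    obtain ⟨j, hj, hd⟩ := mem_deliver.1 hq
    obtain ⟨j', hj', hd'⟩ := mem_deliver.1 hq'
    obtain ⟨x, hx, rfl⟩ := List.mem_map.1 hj
    obtain ⟨y, hy, rfl⟩ := List.mem_map.1 hj'
    obtain ⟨rfl, rfl⟩ := hinj j j' x hx y hy (hd.trans hd'.symm) h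
    rfl
  · rw [deliver, List.nodup_flatMap]
    refine ⟨fun j _ => List.Nodup.filter _ ?_, ?_⟩
    · refine List.Nodup.map_on (fun x hx y hy h => ?_) (hl j)
      exact (hinj j j x hx y hy (by rw [h]) (by rw [h])).2
    · refine (List.nodup_finRange M).imp_of_mem ?_
      intro j j' _ _ hne q hq hq'
      rw [List.mem_filter, List.mem_map] at hq hq'
      obtain ⟨⟨x, hx, rfl⟩, -⟩ := hq
      obtain ⟨⟨y, hy, h⟩, -⟩ := hq'
      exact hne (hinj j j' x hx y hy (by rw [h]) (by rw [h])).1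

theorem length_le_of_nodup_map {l : List Msg} {m : ℕ} (h : (l.map fun q => q.num 0).Nodup)
    (hm : ∀ q ∈ l, q.num 0 < m) : l.length ≤ m := by
  have := (List.Nodup.subperm h (l₂ := List.range m) (by
    intro x hx
    obtain ⟨q, hq, rfl⟩ := List.mem_map.1 hx
    exact List.mem_range.2 (hm q hq))).length_le
  simpa using this

end Deliver

/-- The requests of a cycle.  The home cell `h` belongs to machine `h / m`; the machine `j` has
requests from its first `cnt j` home cells. -/
structure Requests where
  cnt : ℕ → ℕ
  pos : ℕ → ℕ
  lab : ℕ → ℕ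
  val : ℕ → ℕ
  rval : ℕ → ℝ

/-! ### Segmented sums of abstract requests, and windows that double -/

namespace Requests

variable (Q : Requests) (M m : ℕ)

/-- The home cells with a request. -/
def occ : Finset ℕ := (Finset.range (M * m)).filter fun h => h % m < Q.cnt (h / m)

/-- The slots of a request cycle. -/
def slotSum {β : Type*} [AddCommMonoid β] (g : ℕ → β) (p : ℕ) : β :=
  ∑ h ∈ Q.occ M m, if Q.pos h = p then g h else 0

/-- The sum of `g` over the requests with label `ℓ`. -/
def total {β : Type*} [AddCommMonoid β] (g : ℕ → β) (ℓ : ℕ) : β :=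
  ∑ h ∈ Q.occ M m, if Q.lab h = ℓ then g h else 0

/-- The sum of `g` over the requests with label `ℓ` at a position less than `p`. -/
def before {β : Type*} [AddCommMonoid β] (g : ℕ → β) (ℓ p : ℕ) : β :=
  ∑ h ∈ Q.occ M m, if Q.lab h = ℓ ∧ Q.pos h < p then g h else 0

/-- The message with the request of the home cell `h`. -/
def msg (h : ℕ) : Msg := ⟨Q.pos h / m, ![Q.pos h % m, h + 1, Q.lab h, Q.val h], Q.rval h⟩

/-- The message with the answer for the home cell `h`. -/
noncomputable def answer (h : ℕ) : Msg :=
  ⟨h / m, ![h % m, Q.before M m Q.val (Q.lab h) (Q.pos h), Q.total M m Q.val (Q.lab h), Q.val h],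
    Q.total M m Q.rval (Q.lab h)⟩

/-- The conditions under which the requests can be served. -/
structure Valid (W : ℕ) : Prop where
  m_pos : 0 < m
  cnt_le : ∀ j, Q.cnt j ≤ m
  pos_lt : ∀ h ∈ Q.occ M m, Q.pos h < M * m
  inj : ∀ h ∈ Q.occ M m, ∀ h' ∈ Q.occ M m, Q.pos h = Q.pos h' → h = h'
  lab_lt : ∀ h ∈ Q.occ M m, Q.lab h < W
  anti : ∀ h ∈ Q.occ M m, ∀ h' ∈ Q.occ M m, Q.pos h ≤ Q.pos h' → Q.lab h' ≤ Q.lab h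
  -- An empty slot reads as label 0, so it may not precede a slot with a positive label; if all
  -- labels are 0, gaps are harmless.
  dense : ∀ h ∈ Q.occ M m, 0 < Q.lab h → ∀ p < Q.pos h, ∃ h' ∈ Q.occ M m, Q.pos h' = p
  sum_lt : ∑ h ∈ Q.occ M m, Q.val h < W
  size_lt : M * m < W

variable {Q M m}

theorem mem_occ (hm : 0 < m) {j e : ℕ} (hj : j < M) (he : e < m) :
    j * m + e ∈ Q.occ M m ↔ e < Q.cnt j := by
  have h1 : (j * m + e) % m = e := by
    rw [Nat.mul_add_mod_of_lt he]
  have h2 : (j * m + e) / m = j := by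
    rw [Nat.add_div_of_dvd_right (Dvd.intro_left j rfl), Nat.mul_div_cancel _ hm,
      Nat.div_eq_of_lt he, add_zero]
  have h3 : j * m + e < M * m := by
    calc j * m + e < j * m + m := by omega
      _ = (j + 1) * m := by ring
      _ ≤ M * m := Nat.mul_le_mul_right _ hj
  simp [occ, h1, h2, h3]

theorem slotSum_pos {W : ℕ} (hQ : Q.Valid M m W) {β : Type*} [AddCommMonoid β] (g : ℕ → β) {h : ℕ}
    (hh : h ∈ Q.occ M m) : Q.slotSum M m g (Q.pos h) = g h := by
  rw [slotSum, Finset.sum_eq_single_of_mem h hh, if_pos rfl]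
  intro h' hh' hne
  rw [if_neg fun e => hne (hQ.inj _ hh' _ hh e)]

theorem slotSum_eq_zero {β : Type*} [AddCommMonoid β] (g : ℕ → β) {p : ℕ}
    (hp : ∀ h ∈ Q.occ M m, Q.pos h ≠ p) : Q.slotSum M m g p = 0 :=
  Finset.sum_eq_zero fun h hh => if_neg (hp h hh)

theorem slotLab_anti {W : ℕ} (hQ : Q.Valid M m W) {p q : ℕ} (hpq : p ≤ q) :
    Q.slotSum M m Q.lab q ≤ Q.slotSum M m Q.lab p := by
  by_cases hq : ∃ h ∈ Q.occ M m, Q.pos h = q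
  · obtain ⟨h, hh, rfl⟩ := hq
    rw [slotSum_pos hQ _ hh]
    rcases Nat.eq_zero_or_pos (Q.lab h) with h0 | h0
    · rw [h0]; exact Nat.zero_le _
    rcases hpq.lt_or_eq with hlt | rfl
    · obtain ⟨h', hh', rfl⟩ := hQ.dense h hh h0 p hlt
      rw [slotSum_pos hQ _ hh']
      exact hQ.anti _ hh' _ hh hpq
    · rw [slotSum_pos hQ _ hh]
  · push Not at hq
    rw [slotSum_eq_zero _ hq]; exact Nat.zero_le _

theorem ite_slotSum {W : ℕ} (hQ : Q.Valid M m W) {β : Type*} [AddCommMonoid β] (g : ℕ → β)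
    (ℓ p : ℕ) : (if Q.slotSum M m Q.lab p = ℓ then Q.slotSum M m g p else 0) =
      ∑ h ∈ Q.occ M m, if Q.pos h = p then (if Q.lab h = ℓ then g h else 0) else 0 := by
  by_cases hp : ∃ h ∈ Q.occ M m, Q.pos h = p
  · obtain ⟨h, hh, rfl⟩ := hp
    rw [slotSum_pos hQ _ hh, slotSum_pos hQ _ hh]
    exact (slotSum_pos hQ (fun h => if Q.lab h = ℓ then g h else 0) hh).symm
  · push Not at hp
    rw [slotSum_eq_zero g hp, ite_self]
    exact (slotSum_eq_zero (fun h => if Q.lab h = ℓ then g h else 0) hp).symm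

/-- Each request occupies exactly one slot, so exchanging the two sums turns a sum over slots into
one over home cells. -/
theorem sum_range_ite_slotSum {W : ℕ} (hQ : Q.Valid M m W) {β : Type*} [AddCommMonoid β]
    (g : ℕ → β) (ℓ P : ℕ) :
    (∑ p ∈ Finset.range P, if Q.slotSum M m Q.lab p = ℓ then Q.slotSum M m g p else 0) =
      Q.before M m g ℓ P := by
  simp_rw [ite_slotSum hQ]
  rw [Finset.sum_comm, before]
  refine Finset.sum_congr rfl fun h hh => ?_
  rw [Finset.sum_ite_eq]
  simp only [Finset.mem_range]
  split_ifs with h1 h2 h3 h3 <;> simp_all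

theorem before_eq_total {W : ℕ} (hQ : Q.Valid M m W) {β : Type*} [AddCommMonoid β]
    (g : ℕ → β) (ℓ : ℕ) : Q.before M m g ℓ (M * m) = Q.total M m g ℓ := by
  refine Finset.sum_congr rfl fun h hh => ?_
  simp [hQ.pos_lt h hh]

theorem sum_range_mul_add {β : Type*} [AddCommMonoid β] (F : ℕ → β) (i m s : ℕ) :
    ∑ p ∈ Finset.range (i * m + s), F p =
      ∑ j ∈ Finset.range i, ∑ x ∈ Finset.range m, F (j * m + x) +
        ∑ x ∈ Finset.range s, F (i * m + x) := by
  have h : ∀ i, ∑ p ∈ Finset.range (i * m), F p =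
      ∑ j ∈ Finset.range i, ∑ x ∈ Finset.range m, F (j * m + x) := by
    intro i
    induction i with
    | zero => simp
    | succ i ih => rw [Nat.succ_mul, Finset.sum_range_add, ih, Finset.sum_range_succ]
  rw [Finset.sum_range_add, h]

/-- The data in the slots of machine `i`. -/
def slotAt (m i : ℕ) {β : Type*} (F : ℕ → β) (s : ℕ) : β := F (i * m + s)

variable (Q M m)

/-- The labels in the slots of machine `i`. -/
def labAt (i : ℕ) : ℕ → ℕ := slotAt m i (Q.slotSum M m Q.lab)

/-- The sum over the slots of machine `j` with label `ℓ`. -/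
def block {β : Type*} [AddCommMonoid β] (g : ℕ → β) (j ℓ : ℕ) : β :=
  labSum (Q.labAt M m j) (slotAt m j (Q.slotSum M m g)) ℓ m

variable {Q M m}

theorem labAt_anti {W : ℕ} (hQ : Q.Valid M m W) {i s t : ℕ} (hst : s ≤ t) :
    Q.labAt M m i t ≤ Q.labAt M m i s :=
  slotLab_anti hQ (Nat.add_le_add_left hst _)

theorem labAt_anti_of_lt {W : ℕ} (hQ : Q.Valid M m W) {i j s t : ℕ} (hij : i < j) (hs : s < m) :
    Q.labAt M m j t ≤ Q.labAt M m i s := by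
  refine slotLab_anti hQ ?_
  calc i * m + s ≤ (i + 1) * m := by rw [add_mul]; omega
    _ ≤ j * m := Nat.mul_le_mul_right _ hij
    _ ≤ j * m + t := Nat.le_add_right _ _

theorem block_eq_zero_of_left {W : ℕ} (hQ : Q.Valid M m W) {β : Type*} [AddCommMonoid β]
    (g : ℕ → β) {i j ℓ s : ℕ} (hij : i < j) (hℓ : ℓ < Q.labAt M m j s) :
    Q.block M m g i ℓ = 0 :=
  labSum_eq_zero fun x hx he => by
    have := labAt_anti_of_lt hQ (t := s) hij hx
    omega

theorem block_eq_zero_of_right {W : ℕ} (hQ : Q.Valid M m W) {β : Type*} [AddCommMonoid β]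
    (g : ℕ → β) {i j ℓ s : ℕ} (hij : i < j) (hs : s < m) (hℓ : Q.labAt M m i s < ℓ) :
    Q.block M m g j ℓ = 0 :=
  labSum_eq_zero fun x hx he => by
    have := labAt_anti_of_lt hQ (t := x) hij hs
    omega

theorem sum_block_add_labSum {W : ℕ} (hQ : Q.Valid M m W) {β : Type*} [AddCommMonoid β]
    (g : ℕ → β) (ℓ i s : ℕ) :
    ∑ j ∈ Finset.range i, Q.block M m g j ℓ +
      labSum (Q.labAt M m i) (slotAt m i (Q.slotSum M m g)) ℓ s =
        Q.before M m g ℓ (i * m + s) := by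
  rw [← sum_range_ite_slotSum hQ, sum_range_mul_add]; rfl

theorem sum_block {W : ℕ} (hQ : Q.Valid M m W) {β : Type*} [AddCommMonoid β]
    (g : ℕ → β) (ℓ : ℕ) :
    ∑ j ∈ Finset.range M, Q.block M m g j ℓ = Q.total M m g ℓ := by
  have := sum_block_add_labSum hQ g ℓ M 0
  rw [labSum, Finset.sum_range_zero, add_zero, add_zero, before_eq_total hQ] at this
  exact this

/-- The sum over the blocks of the `P` machines to the left of machine `i`. -/
def leftWindow (Q : Requests) (M m : ℕ) {β : Type*} [AddCommMonoid β] (g : ℕ → β) (i P ℓ : ℕ) : β :=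
  ∑ j ∈ Finset.Ico (i - P) i, Q.block M m g j ℓ

/-- The sum over the blocks of the `P` machines to the right of machine `i`. -/
def rightWindow (Q : Requests) (M m : ℕ) {β : Type*} [AddCommMonoid β] (g : ℕ → β)
    (i P ℓ : ℕ) : β :=
  ∑ j ∈ Finset.Ico (i + 1) (min (i + 1 + P) M), Q.block M m g j ℓ

/-- If machine `i - P` begins with the same label, its own window is exactly the missing half. If
not, it begins with a larger label, all slots further left have labels at least as large, and the
missing half vanishes. So one message and one comparison suffice. -/
theorem leftWindow_double {W : ℕ} (hQ : Q.Valid M m W) {β : Type*} [AddCommMonoid β]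
    (g : ℕ → β) (i P : ℕ) :
    leftWindow Q M m g i (2 * P) (Q.labAt M m i 0) =
      leftWindow Q M m g i P (Q.labAt M m i 0) +
        if P ≤ i ∧ Q.labAt M m (i - P) 0 = Q.labAt M m i 0 then
          leftWindow Q M m g (i - P) P (Q.labAt M m (i - P) 0) else 0 := by
  have hsplit : leftWindow Q M m g i (2 * P) (Q.labAt M m i 0) =
      (∑ j ∈ Finset.Ico (i - 2 * P) (i - P), Q.block M m g j (Q.labAt M m i 0)) +
      leftWindow Q M m g i P (Q.labAt M m i 0) := by
    rw [leftWindow, leftWindow, Finset.sum_Ico_consecutive _ (by omega) (by omega)]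
  rw [hsplit, add_comm]
  congr 1
  by_cases hP : P ≤ i
  · by_cases hl : Q.labAt M m (i - P) 0 = Q.labAt M m i 0
    · rw [if_pos ⟨hP, hl⟩, leftWindow, hl, show i - P - P = i - 2 * P by omega]
    · rw [if_neg fun h => hl h.2]
      refine Finset.sum_eq_zero fun j hj => ?_
      rw [Finset.mem_Ico] at hj
      have hlt : Q.labAt M m i 0 < Q.labAt M m (i - P) 0 := by
        refine lt_of_le_of_ne ?_ (Ne.symm hl)
        rcases Nat.eq_zero_or_pos P with rfl | hP0
        · simp
        · exact labAt_anti_of_lt hQ (by omega) hQ.m_pos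
      exact block_eq_zero_of_left hQ g hj.2 hlt
  · rw [if_neg fun h => hP h.1, Finset.Ico_eq_empty (by omega), Finset.sum_empty]

theorem rightWindow_double {W : ℕ} (hQ : Q.Valid M m W) {β : Type*} [AddCommMonoid β]
    (g : ℕ → β) (i P : ℕ) :
    rightWindow Q M m g i (2 * P) (Q.labAt M m i (m - 1)) =
      rightWindow Q M m g i P (Q.labAt M m i (m - 1)) +
        if i + P < M ∧ Q.labAt M m (i + P) (m - 1) = Q.labAt M m i (m - 1) then
          rightWindow Q M m g (i + P) P (Q.labAt M m (i + P) (m - 1)) else 0 := by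
  have hm := hQ.m_pos
  by_cases hP : i + P < M
  · have hsplit : rightWindow Q M m g i (2 * P) (Q.labAt M m i (m - 1)) =
        rightWindow Q M m g i P (Q.labAt M m i (m - 1)) +
        ∑ j ∈ Finset.Ico (i + P + 1) (min (i + P + 1 + P) M),
          Q.block M m g j (Q.labAt M m i (m - 1)) := by
      rw [rightWindow, rightWindow, show min (i + 1 + P) M = i + P + 1 by omega,
        show min (i + 1 + 2 * P) M = min (i + P + 1 + P) M by omega,
        Finset.sum_Ico_consecutive _ (by omega) (by omega)]
    rw [hsplit]
    congr 1
    by_cases hl : Q.labAt M m (i + P) (m - 1) = Q.labAt M m i (m - 1)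
    · rw [if_pos ⟨hP, hl⟩, rightWindow, hl]
    · rw [if_neg fun h => hl h.2]
      refine Finset.sum_eq_zero fun j hj => ?_
      rw [Finset.mem_Ico] at hj
      have hlt : Q.labAt M m (i + P) (m - 1) < Q.labAt M m i (m - 1) := by
        refine lt_of_le_of_ne ?_ hl
        rcases Nat.eq_zero_or_pos P with rfl | hP0
        · simp
        · exact labAt_anti_of_lt hQ (by omega) (by omega)
      exact block_eq_zero_of_right hQ g (i := i + P) (s := m - 1) (by omega) (by omega) hlt
  · rw [if_neg fun h => hP h.1, add_zero, rightWindow, rightWindow,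
      show min (i + 1 + 2 * P) M = min (i + 1 + P) M by omega]

/-- The first step compares with the last label of the neighbour: by monotonicity a label of machine
`i - 1` can equal the first label of machine `i` only if the last one does. -/
theorem leftWindow_one {W : ℕ} (hQ : Q.Valid M m W) {β : Type*} [AddCommMonoid β]
    (g : ℕ → β) (i : ℕ) :
    leftWindow Q M m g i 1 (Q.labAt M m i 0) =
      if 1 ≤ i ∧ Q.labAt M m (i - 1) (m - 1) = Q.labAt M m i 0 then
        Q.block M m g (i - 1) (Q.labAt M m (i - 1) (m - 1)) else 0 := by
  by_cases hi : 1 ≤ i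
  · have hI : Finset.Ico (i - 1) i = {i - 1} := by
      ext x; simp only [Finset.mem_Ico, Finset.mem_singleton]; omega
    rw [leftWindow, hI, Finset.sum_singleton]
    have hm := hQ.m_pos
    by_cases hl : Q.labAt M m (i - 1) (m - 1) = Q.labAt M m i 0
    · rw [if_pos ⟨hi, hl⟩, hl]
    · rw [if_neg fun h => hl h.2]
      refine labSum_eq_zero fun x hx he => hl ?_
      have h1 := labAt_anti_of_lt hQ (i := i - 1) (j := i) (s := m - 1) (t := 0) (by omega)
        (by omega)
      have h2 := labAt_anti hQ (i := i - 1) (s := x) (t := m - 1) (by omega)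
      omega
  · rw [if_neg fun h => hi h.1, leftWindow, Finset.Ico_eq_empty (by omega), Finset.sum_empty]

theorem rightWindow_one {W : ℕ} (hQ : Q.Valid M m W) {β : Type*} [AddCommMonoid β]
    (g : ℕ → β) (i : ℕ) :
    rightWindow Q M m g i 1 (Q.labAt M m i (m - 1)) =
      if i + 1 < M ∧ Q.labAt M m (i + 1) 0 = Q.labAt M m i (m - 1) then
        Q.block M m g (i + 1) (Q.labAt M m (i + 1) 0) else 0 := by
  by_cases hi : i + 1 < M
  · have hI : Finset.Ico (i + 1) (min (i + 1 + 1) M) = {i + 1} := by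
      ext x; simp only [Finset.mem_Ico, Finset.mem_singleton]; omega
    rw [rightWindow, hI, Finset.sum_singleton]
    have hm := hQ.m_pos
    by_cases hl : Q.labAt M m (i + 1) 0 = Q.labAt M m i (m - 1)
    · rw [if_pos ⟨hi, hl⟩, hl]
    · rw [if_neg fun h => hl h.2]
      refine labSum_eq_zero fun x hx he => hl ?_
      have h1 := labAt_anti_of_lt hQ (i := i) (j := i + 1) (s := m - 1) (t := 0) (by omega)
        (by omega)
      have h2 := labAt_anti hQ (i := i + 1) (s := 0) (t := x) (by omega)
      omega
  · rw [if_neg fun h => hi h.1, rightWindow, Finset.Ico_eq_empty (by omega), Finset.sum_empty]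

/-- A label smaller than that of the first slot does not occur on any machine to the left, so only
the first run of a machine needs the carry; for `P ≥ i` the window covers all machines to the left.
-/
theorem before_eq {W : ℕ} (hQ : Q.Valid M m W) {β : Type*} [AddCommMonoid β]
    (g : ℕ → β) {i P s : ℕ} (hP : i ≤ P) (hs : s < m) :
    labSum (Q.labAt M m i) (slotAt m i (Q.slotSum M m g)) (Q.labAt M m i s) s +
      (if Q.labAt M m i s = Q.labAt M m i 0 then
        leftWindow Q M m g i P (Q.labAt M m i 0) else 0) =
      Q.before M m g (Q.labAt M m i s) (i * m + s) := by
  rw [← sum_block_add_labSum hQ, add_comm]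
  congr 1
  split_ifs with h
  · rw [leftWindow, Nat.sub_eq_zero_of_le hP, ← h, Finset.range_eq_Ico]
  · refine (Finset.sum_eq_zero fun j hj => ?_).symm
    exact block_eq_zero_of_left hQ g (Finset.mem_range.1 hj)
      (lt_of_le_of_ne (labAt_anti hQ (Nat.zero_le s)) h)

theorem total_eq {W : ℕ} (hQ : Q.Valid M m W) {β : Type*} [AddCommMonoid β]
    (g : ℕ → β) {i P s : ℕ} (hi : i < M) (hP : M ≤ P) (hs : s < m) :
    Q.block M m g i (Q.labAt M m i s) +
      (if Q.labAt M m i s = Q.labAt M m i 0 then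
        leftWindow Q M m g i P (Q.labAt M m i 0) else 0) +
      (if Q.labAt M m i s = Q.labAt M m i (m - 1) then
        rightWindow Q M m g i P (Q.labAt M m i (m - 1)) else 0) =
      Q.total M m g (Q.labAt M m i s) := by
  have e1 : (if Q.labAt M m i s = Q.labAt M m i 0 then
        leftWindow Q M m g i P (Q.labAt M m i 0) else 0) =
      ∑ j ∈ Finset.range i, Q.block M m g j (Q.labAt M m i s) := by
    split_ifs with h
    · rw [leftWindow, Nat.sub_eq_zero_of_le (by omega), ← h, Finset.range_eq_Ico]
    · refine (Finset.sum_eq_zero fun j hj => ?_).symm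
      exact block_eq_zero_of_left hQ g (Finset.mem_range.1 hj)
        (lt_of_le_of_ne (labAt_anti hQ (Nat.zero_le s)) h)
  have e2 : (if Q.labAt M m i s = Q.labAt M m i (m - 1) then
        rightWindow Q M m g i P (Q.labAt M m i (m - 1)) else 0) =
      ∑ j ∈ Finset.Ico (i + 1) M, Q.block M m g j (Q.labAt M m i s) := by
    split_ifs with h
    · rw [rightWindow, ← h, show min (i + 1 + P) M = M by omega]
    · refine (Finset.sum_eq_zero fun j hj => ?_).symm
      rw [Finset.mem_Ico] at hj
      exact block_eq_zero_of_right hQ g (i := i) (s := m - 1) (by omega) (by omega)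
        (lt_of_le_of_ne (labAt_anti hQ (by omega)) (Ne.symm h))
  rw [e1, e2, ← sum_block hQ, ← Finset.sum_range_add_sum_Ico _ (Nat.succ_le_of_lt hi),
    Finset.sum_range_succ, add_comm (Q.block M m g i _)]

theorem block_le (j ℓ : ℕ) : Q.block M m Q.val j ℓ ≤
    ∑ x ∈ Finset.range m, Q.slotSum M m Q.val (j * m + x) :=
  labSum_le _ _ _ _

/-- The three sums live on disjoint sets of machines, so their labels need not agree. This is the
bound that excludes overflow in the whole scan. -/
theorem windows_le {W : ℕ} (hQ : Q.Valid M m W) {i : ℕ} (hi : i < M) (P ℓ₁ ℓ₂ ℓ₃ : ℕ) :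
    leftWindow Q M m Q.val i P ℓ₁ + Q.block M m Q.val i ℓ₂ + rightWindow Q M m Q.val i P ℓ₃ ≤
      ∑ h ∈ Q.occ M m, Q.val h := by
  set F : ℕ → ℕ := fun j => ∑ x ∈ Finset.range m, Q.slotSum M m Q.val (j * m + x)
  have h1 : leftWindow Q M m Q.val i P ℓ₁ ≤ ∑ j ∈ Finset.range i, F j := by
    refine (Finset.sum_le_sum fun j _ => block_le j ℓ₁).trans ?_
    refine Finset.sum_le_sum_of_subset fun x hx => ?_
    rw [Finset.mem_Ico] at hx; exact Finset.mem_range.2 hx.2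
  have h2 : rightWindow Q M m Q.val i P ℓ₃ ≤ ∑ j ∈ Finset.Ico (i + 1) M, F j := by
    refine (Finset.sum_le_sum fun j _ => block_le j ℓ₃).trans ?_
    refine Finset.sum_le_sum_of_subset fun x hx => ?_
    rw [Finset.mem_Ico] at hx ⊢; omega
  have h3 : ∑ j ∈ Finset.range M, F j = ∑ h ∈ Q.occ M m, Q.val h := by
    have := sum_range_mul_add (Q.slotSum M m Q.val) M m 0
    rw [Finset.sum_range_zero, add_zero, add_zero] at this
    rw [← this]
    unfold slotSum
    rw [Finset.sum_comm]
    refine Finset.sum_congr rfl fun h hh => ?_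
    rw [Finset.sum_ite_eq, if_pos (Finset.mem_range.2 (hQ.pos_lt h hh))]
  rw [← Finset.sum_range_add_sum_Ico _ (show i + 1 ≤ M from hi), Finset.sum_range_succ] at h3
  have h4 : Q.block M m Q.val i ℓ₂ ≤ F i := block_le i ℓ₂
  omega

end Requests

end CorrClust

namespace CorrClust

/-! ### Invariants of the machine states during a cycle -/

section Cycle

variable {a : ℕ}

/-- The number of slots of a machine. -/
def Setup.slots (a : ℕ) (S : Setup) : ℕ := 2 * a * (S.capacity / dim a)

/-- The size conditions on a setup. -/
structure Setup.Fits (a : ℕ) (S : Setup) : Prop where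
  cap : S.capacity < S.wordBound
  big : 5 < S.wordBound
  slots_pos : 0 < S.slots a
  machines : 2 * S.numMachines < S.wordBound

theorem SlotsReady.congr {Γ Γ' : Env} {τ : MState (dim a)} {A L V : ℕ → ℕ} {R : ℕ → ℝ}
    (h : SlotsReady Γ τ A L V R) (hs : Γ'.slots a = Γ.slots a) : SlotsReady Γ' τ A L V R := by
  obtain ⟨h1, h2, h3, h4, h5, h6, h7⟩ := h
  rw [← hs] at h1 h2 h3 h4 h5 h7
  exact ⟨h1, h2, h3, h4, h5, h6, h7⟩

theorem SlotsReady.of_same {Γ : Env} {σ τ : MState (dim a)} {A L V : ℕ → ℕ} {R : ℕ → ℝ}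
    (h : SlotsReady Γ σ A L V R) (h1 : τ.narr = σ.narr) (h2 : τ.rarr = σ.rarr)
    (h3 : τ.nreg = σ.nreg) : SlotsReady Γ τ A L V R where
  slot s hs := (h.slot s hs).of_eq (by rw [h1]) (by rw [h1]) (by rw [h1]) (by rw [h2])
  pre s hs := by rw [h1]; exact h.pre s hs
  rpre s hs := by rw [h2]; exact h.rpre s hs
  suf s hs := by rw [h1]; exact h.suf s hs
  rsuf s hs := by rw [h2]; exact h.rsuf s hs
  first := by rw [h3]; exact h.first
  last := by rw [h3]; exact h.last

/-- The state at the start of the local computation of a round, after the tests for the mode. -/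
def roundStart (σ : MState (dim a)) (k : ℕ) : MState (dim a) :=
  { σ with outbox := [], draws := 0, work := σ.work + k }

/-- Each test of the mode costs four operations; mode 1 is recognized by the second test, modes 2
and 3 by the third. -/
theorem clusterProg_mode_one {Γ : Env} {σ : MState (dim a)} (hh : σ.halted = false)
    (hm : σ.nreg Reg.mode.ix = 1) :
    localRound (clusterProg a) Γ σ = (slotRound a).exec Γ (roundStart σ 8) := by
  simp [localRound, hh, clusterProg, Prog.exec, BExpr.Holds, NExpr.eval, hm, MState.tick,
    roundStart, BExpr.cost, NExpr.cost]

theorem clusterProg_mode_two {Γ : Env} {σ : MState (dim a)} (hh : σ.halted = false)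
    (hm : σ.nreg Reg.mode.ix = 2) :
    localRound (clusterProg a) Γ σ = (scanRound a).exec Γ (roundStart σ 12) := by
  simp [localRound, hh, clusterProg, Prog.exec, BExpr.Holds, NExpr.eval, hm, MState.tick,
    roundStart, BExpr.cost, NExpr.cost]

theorem clusterProg_mode_three {Γ : Env} {σ : MState (dim a)} (hh : σ.halted = false)
    (hm : σ.nreg Reg.mode.ix = 3) :
    localRound (clusterProg a) Γ σ = (homeRound a).exec Γ (roundStart σ 12) := by
  simp [localRound, hh, clusterProg, Prog.exec, BExpr.Holds, NExpr.eval, hm, MState.tick,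
    roundStart, BExpr.cost, NExpr.cost]

theorem clusterProg_mode_zero {Γ : Env} {σ : MState (dim a)} (hh : σ.halted = false)
    (hm : σ.nreg Reg.mode.ix = 0) :
    localRound (clusterProg a) Γ σ =
      (startCycle a).exec Γ ((loadInput a).exec Γ (roundStart σ 4)) := by
  simp [localRound, hh, clusterProg, Prog.exec, BExpr.Holds, NExpr.eval, hm, MState.tick,
    roundStart, BExpr.cost, NExpr.cost]

/-- The components that are not changed between the requests and the answers. -/
def homeLocs (a : ℕ) : List (Loc (dim a)) :=
  [.nreg Reg.kind.ix, .nreg Reg.bit.ix, .nreg Reg.total.ix, .nreg Reg.len.ix, .rreg RReg.thr.ix,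
    .narr Arr.outL.ix, .narr Arr.outR.ix, .narr Arr.vtx.ix, .narr Arr.pos.ix, .narr Arr.status.ix,
    .narr Arr.prio.ix, .rarr RArr.dist.ix, .rarr RArr.weight.ix, .halted]

/-- The data of the input records and the variables of the algorithm are the same. -/
def Frame (σ τ : MState (dim a)) : Prop := ∀ ℓ ∈ homeLocs a, ℓ.Same σ τ

theorem Frame.trans {σ τ υ : MState (dim a)} (h : Frame σ τ) (h' : Frame τ υ) : Frame σ υ :=
  fun ℓ hℓ => (h ℓ hℓ).trans' (h' ℓ hℓ)

theorem Frame.exec {Γ : Env} (P : Prog (dim a)) (σ : MState (dim a))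
    (h : ∀ ℓ ∈ homeLocs a, ¬ P.Writes ℓ) : Frame σ (P.exec Γ σ) :=
  fun ℓ hℓ => exec_same P σ (h ℓ hℓ)

theorem Frame.roundStart (σ : MState (dim a)) (k : ℕ) : Frame σ (roundStart σ k) := by
  intro ℓ hℓ
  cases ℓ <;> simp_all [Loc.Same, CorrClust.roundStart, homeLocs]

theorem Frame.with_inbox (σ : MState (dim a)) (ib : List Msg) : Frame σ { σ with inbox := ib } := by
  intro ℓ hℓ
  cases ℓ <;> simp [Loc.Same]

theorem mpcRound_apply (S : Setup) (P : Prog (dim a)) (ω : Tape) (t : ℕ)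
    (σ : Fin S.numMachines → MState (dim a)) (i : Fin S.numMachines) :
    mpcRound P S ω t σ i = { localRound P (S.env ω t i) (σ i) with
      inbox := deliver (fun j => (localRound P (S.env ω t j) (σ j)).outbox) i } := rfl

theorem mpcRound_eq {S : Setup} {P : Prog (dim a)} {ω : Tape} {t : ℕ}
    {σ τ : Fin S.numMachines → MState (dim a)} {out : Fin S.numMachines → List Msg}
    (h : ∀ i, localRound P (S.env ω t i) (σ i) = τ i) (ho : ∀ i, (τ i).outbox = out i)
    (i : Fin S.numMachines) :
    mpcRound P S ω t σ i = { τ i with inbox := deliver out i } := by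
  rw [mpcRound_apply, h]
  simp only [h, ho]

/-- The messages of machine `j` in a step of the scan. -/
def scanOut (P : ℕ) (f l vL vR : ℕ → ℕ) (wL wR : ℕ → ℝ) (j : ℕ) : List Msg :=
  scanMsg (j + P) 0 (f j) (vL j) (wL j) ::
    if P ≤ j then [scanMsg (j - P) 1 (l j) (vR j) (wR j)] else []

theorem sum_fin_ite_shift {M : ℕ} {β : Type*} [AddCommMonoid β] (F : ℕ → β) {i P : ℕ}
    (hi : i < M) (p : ℕ → Prop) [DecidablePred p] :
    (∑ j : Fin M, if (j : ℕ) + P = i ∧ p j then F j else 0) =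
      if P ≤ i ∧ p (i - P) then F (i - P) else 0 := by
  by_cases hP : P ≤ i
  · rw [Finset.sum_eq_single (⟨i - P, by omega⟩ : Fin M)]
    · simp [hP]
    · intro j _ hj
      rw [if_neg]
      rintro ⟨h, -⟩
      exact hj (Fin.ext (by simp; omega))
    · simp
  · rw [if_neg (fun h => hP h.1)]
    refine Finset.sum_eq_zero fun j _ => if_neg ?_
    rintro ⟨h, -⟩; omega

theorem sum_fin_ite_unshift {M : ℕ} {β : Type*} [AddCommMonoid β] (F : ℕ → β) {i P : ℕ}
    (p : ℕ → Prop) [DecidablePred p] :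
    (∑ j : Fin M, if (P ≤ (j : ℕ) ∧ (j : ℕ) - P = i) ∧ p j then F j else 0) =
      if i + P < M ∧ p (i + P) then F (i + P) else 0 := by
  by_cases hP : i + P < M
  · rw [Finset.sum_eq_single (⟨i + P, hP⟩ : Fin M)]
    · simp [hP]
    · intro j _ hj
      rw [if_neg]
      rintro ⟨h, -⟩
      exact hj (Fin.ext (by simp; omega))
    · simp
  · rw [if_neg (fun h => hP h.1)]
    refine Finset.sum_eq_zero fun j _ => if_neg ?_
    rintro ⟨h, -⟩; have := j.2; omega

theorem scanOut_filter_sum {β : Type*} [AddCommMonoid β] (P : ℕ) (f l vL vR : ℕ → ℕ)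
    (wL wR : ℕ → ℝ) (j i : ℕ) (φ : Msg → β) :
    (((scanOut P f l vL vR wL wR j).filter fun q => q.dst = i).map φ).sum =
      (if j + P = i then φ (scanMsg (j + P) 0 (f j) (vL j) (wL j)) else 0) +
      if P ≤ j ∧ j - P = i then φ (scanMsg (j - P) 1 (l j) (vR j) (wR j)) else 0 := by
  by_cases h1 : j + P = i <;> by_cases h2 : P ≤ j <;> by_cases h3 : j - P = i <;>
    simp [scanOut, scanMsg, List.filter_cons, h1, h2, h3]

theorem deliver_scanOut_left {M : ℕ} {β : Type*} [AddCommMonoid β] (P : ℕ) (f l vL vR : ℕ → ℕ)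
    (wL wR : ℕ → ℝ) {i : ℕ} (hi : i < M) (ℓ : ℕ) (g : Msg → β) :
    ((deliver (fun j : Fin M => scanOut P f l vL vR wL wR j) i).map (fromLeft g ℓ)).sum =
      if P ≤ i ∧ f (i - P) = ℓ then
        g (scanMsg (i - P + P) 0 (f (i - P)) (vL (i - P)) (wL (i - P))) else 0 := by
  rw [deliver_sum, ← sum_fin_ite_shift (fun j => g (scanMsg (j + P) 0 (f j) (vL j) (wL j))) hi
    (fun j => f j = ℓ)]
  refine Finset.sum_congr rfl fun j _ => ?_
  rw [scanOut_filter_sum]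
  by_cases h1 : (j : ℕ) + P = i <;> by_cases h2 : f j = ℓ <;>
    simp [fromLeft, scanMsg, h1, h2]

theorem deliver_scanOut_right {M : ℕ} {β : Type*} [AddCommMonoid β] (P : ℕ) (f l vL vR : ℕ → ℕ)
    (wL wR : ℕ → ℝ) (i : ℕ) (ℓ : ℕ) (g : Msg → β) :
    ((deliver (fun j : Fin M => scanOut P f l vL vR wL wR j) i).map (fromRight g ℓ)).sum =
      if i + P < M ∧ l (i + P) = ℓ then
        g (scanMsg (i + P - P) 1 (l (i + P)) (vR (i + P)) (wR (i + P))) else 0 := by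
  rw [deliver_sum, ← sum_fin_ite_unshift (fun j => g (scanMsg (j - P) 1 (l j) (vR j) (wR j)))
    (fun j => l j = ℓ)]
  refine Finset.sum_congr rfl fun j _ => ?_
  rw [scanOut_filter_sum]
  by_cases h1 : P ≤ (j : ℕ) ∧ (j : ℕ) - P = i <;> by_cases h2 : l j = ℓ <;>
    simp [fromRight, scanMsg, h1, h2]

theorem deliver_scanOut_length {M : ℕ} (P : ℕ) (f l vL vR : ℕ → ℕ) (wL wR : ℕ → ℝ) {i : ℕ}
    (hi : i < M) :
    (deliver (fun j : Fin M => scanOut P f l vL vR wL wR j) i).length ≤ 2 := by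
  have h := deliver_sum (fun j : Fin M => scanOut P f l vL vR wL wR j) i (fun _ => 1)
  have h1 := sum_fin_ite_shift (M := M) (fun _ => 1) (P := P) hi (fun _ => True)
  have h2 := sum_fin_ite_unshift (M := M) (fun _ => 1) (P := P) (i := i) (fun _ => True)
  simp only [scanOut_filter_sum, Finset.sum_add_distrib, and_true] at h h1 h2
  rw [h1, h2] at h
  simp only [List.map_const', List.sum_replicate, smul_eq_mul, mul_one] at h
  rw [h]
  split_ifs <;> simp

theorem scanOut_length (P : ℕ) (f l vL vR : ℕ → ℕ) (wL wR : ℕ → ℝ) (j : ℕ) :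
    (scanOut P f l vL vR wL wR j).length ≤ 2 := by
  rw [scanOut]; split_ifs <;> simp

/-- A machine that is running and has small message boxes. -/
structure Light (a : ℕ) (S : Setup) (σ : MState (dim a)) : Prop where
  running : σ.halted = false
  inbox_le : σ.inbox.length ≤ S.slots a + 2
  outbox_le : σ.outbox.length ≤ S.slots a + 2

/-- The messages with the requests of machine `j`. -/
def Requests.posts (Q : Requests) (m j : ℕ) : List Msg :=
  (List.range (Q.cnt j)).map fun e => Q.msg m (j * m + e)

/-- The requests have been posted. -/
structure Posted (Q : Requests) (S : Setup) (σ : Fin S.numMachines → MState (dim a)) : Prop where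
  light : ∀ i, Light a S (σ i)
  mode : ∀ i, (σ i).nreg Reg.mode.ix = 1
  inbox : ∀ i, (σ i).inbox = deliver (fun j : Fin S.numMachines => Q.posts (S.slots a) j) i

/-- The state before a step of the scan over the machines in which each machine knows the sum over
the `P` machines on either side. -/
structure Scanning (Q : Requests) (S : Setup) (P : ℕ)
    (σ : Fin S.numMachines → MState (dim a)) : Prop where
  light : ∀ i, Light a S (σ i)
  mode : ∀ i, (σ i).nreg Reg.mode.ix = 2
  shift : ∀ i, (σ i).nreg Reg.shift.ix = P
  inbox_le : ∀ i, (σ i).inbox.length ≤ 2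
  ready : ∀ ω t i, SlotsReady (S.env ω t i) (σ i)
    (Requests.slotAt (S.slots a) i (Q.slotSum S.numMachines (S.slots a) fun h => h + 1))
    (Q.labAt S.numMachines (S.slots a) i)
    (Requests.slotAt (S.slots a) i (Q.slotSum S.numMachines (S.slots a) Q.val))
    (Requests.slotAt (S.slots a) i (Q.slotSum S.numMachines (S.slots a) Q.rval))
  -- The window of length `P` is split between the carry and the messages that have arrived but are
  -- not yet added.
  carryL : ∀ i : Fin S.numMachines, (σ i).nreg Reg.carryL.ix + ((σ i).inbox.map
      (fromLeft (fun q => q.num 2) (Q.labAt S.numMachines (S.slots a) i 0))).sum =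
    Requests.leftWindow Q S.numMachines (S.slots a) Q.val i P
      (Q.labAt S.numMachines (S.slots a) i 0)
  carryR : ∀ i : Fin S.numMachines, (σ i).nreg Reg.carryR.ix + ((σ i).inbox.map
      (fromRight (fun q => q.num 2)
        (Q.labAt S.numMachines (S.slots a) i (S.slots a - 1)))).sum =
    Requests.rightWindow Q S.numMachines (S.slots a) Q.val i P
      (Q.labAt S.numMachines (S.slots a) i (S.slots a - 1))
  rcarryL : ∀ i : Fin S.numMachines, (σ i).rreg RReg.carryL.ix + ((σ i).inbox.map
      (fromLeft (fun q => q.val) (Q.labAt S.numMachines (S.slots a) i 0))).sum =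
    Requests.leftWindow Q S.numMachines (S.slots a) Q.rval i P
      (Q.labAt S.numMachines (S.slots a) i 0)
  rcarryR : ∀ i : Fin S.numMachines, (σ i).rreg RReg.carryR.ix + ((σ i).inbox.map
      (fromRight (fun q => q.val)
        (Q.labAt S.numMachines (S.slots a) i (S.slots a - 1)))).sum =
    Requests.rightWindow Q S.numMachines (S.slots a) Q.rval i P
      (Q.labAt S.numMachines (S.slots a) i (S.slots a - 1))

/-- The answers have arrived. -/
structure Answered (Q : Requests) (S : Setup) (σ : Fin S.numMachines → MState (dim a)) :
    Prop where
  light : ∀ i, Light a S (σ i)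
  mode : ∀ i, (σ i).nreg Reg.mode.ix = 3
  mem : ∀ (i : Fin S.numMachines) q, q ∈ (σ i).inbox ↔ ∃ e < Q.cnt i,
    q = Q.answer S.numMachines (S.slots a) (i * S.slots a + e)
  nodup : ∀ i, ((σ i).inbox.map fun q => q.num 0).Nodup
  length_le : ∀ i, (σ i).inbox.length ≤ S.slots a
  sum_lt : ∀ i, (σ i).nreg Reg.sum.ix < S.wordBound
  sum : (∀ h ∈ Q.occ S.numMachines (S.slots a), Q.lab h = 0) → ∀ i,
    (σ i).nreg Reg.sum.ix = ∑ h ∈ Q.occ S.numMachines (S.slots a), Q.val h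

end Cycle

end CorrClust

namespace CorrClust

/-! ### The cycle round by round -/

section Steps

variable {a : ℕ} {Q : Requests} {S : Setup} {σ : Fin S.numMachines → MState (dim a)}

theorem Requests.home_lt {M m h : ℕ} (hh : h ∈ Q.occ M m) : h < M * m :=
  Finset.mem_range.1 (Finset.mem_filter.1 hh).1

theorem Requests.mem_deliver_posts {M m W : ℕ} (hQ : Q.Valid M m W) {i : ℕ} {q : Msg} :
    q ∈ deliver (fun j : Fin M => Q.posts m j) i ↔
      ∃ h ∈ Q.occ M m, Q.pos h / m = i ∧ q = Q.msg m h := by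
  have hm := hQ.m_pos
  rw [mem_deliver]
  constructor
  · rintro ⟨j, hj, hd⟩
    obtain ⟨e, he, rfl⟩ := List.mem_map.1 hj
    rw [List.mem_range] at he
    exact ⟨_, (Requests.mem_occ hm j.2 (he.trans_le (hQ.cnt_le j))).2 he, hd, rfl⟩
  · rintro ⟨h, hh, hd, rfl⟩
    have hlt := Requests.home_lt hh
    refine ⟨⟨h / m, Nat.div_lt_of_lt_mul (by rwa [mul_comm])⟩, List.mem_map.2 ⟨h % m, ?_, ?_⟩, hd⟩
    · exact List.mem_range.2 (Finset.mem_filter.1 hh).2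
    · rw [Nat.div_add_mod']

theorem Requests.deliver_posts_nodup {M m W : ℕ} (hQ : Q.Valid M m W) (i : ℕ) :
    ((deliver (fun j : Fin M => Q.posts m j) i).map fun q => q.num 0).Nodup := by
  have hm := hQ.m_pos
  refine deliver_nodup (fun j : Fin M => List.range (Q.cnt j))
    (fun j e => Q.msg m (j * m + e)) (fun j => List.nodup_range) ?_ i
  intro j j' x hx y hy hd hn
  rw [List.mem_range] at hx hy
  have hx' := hx.trans_le (hQ.cnt_le j)
  have hy' := hy.trans_le (hQ.cnt_le j')
  have hp : Q.pos (j * m + x) = Q.pos (j' * m + y) := by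
    rw [← Nat.div_add_mod' (Q.pos (j * m + x)) m, ← Nat.div_add_mod' (Q.pos (j' * m + y)) m]
    have e1 : Q.pos (j * m + x) / m = Q.pos (j' * m + y) / m := hd
    have e2 : Q.pos (j * m + x) % m = Q.pos (j' * m + y) % m := hn
    rw [e1, e2]
  have heq := hQ.inj _ ((Requests.mem_occ hm j.2 hx').2 hx) _
    ((Requests.mem_occ hm j'.2 hy').2 hy) hp
  have e1 : (j * m + x) / m = (j' * m + y) / m := by rw [heq]
  have e2 : (j * m + x) % m = (j' * m + y) % m := by rw [heq]
  rw [Nat.mul_add_mod_of_lt hx', Nat.mul_add_mod_of_lt hy'] at e2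
  rw [mul_comm (j : ℕ), mul_comm (j' : ℕ), Nat.mul_add_div hm, Nat.mul_add_div hm,
    Nat.div_eq_of_lt hx', Nat.div_eq_of_lt hy', add_zero, add_zero] at e1
  exact ⟨Fin.ext e1, e2⟩

theorem Requests.deliver_posts_length {M m W : ℕ} (hQ : Q.Valid M m W) (i : ℕ) :
    (deliver (fun j : Fin M => Q.posts m j) i).length ≤ m := by
  refine length_le_of_nodup_map (Requests.deliver_posts_nodup hQ i) ?_
  intro q hq
  obtain ⟨h, -, -, rfl⟩ := (Requests.mem_deliver_posts hQ).1 hq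
  exact Nat.mod_lt _ hQ.m_pos

theorem Requests.slotSum_lab_lt {M m W : ℕ} (hQ : Q.Valid M m W) (p : ℕ) :
    Q.slotSum M m Q.lab p < W := by
  by_cases hp : ∃ h ∈ Q.occ M m, Q.pos h = p
  · obtain ⟨h, hh, rfl⟩ := hp
    rw [Requests.slotSum_pos hQ _ hh]; exact hQ.lab_lt h hh
  · push Not at hp
    rw [Requests.slotSum_eq_zero _ hp]; exact Nat.zero_lt_of_lt hQ.size_lt

theorem Requests.slots_lt {M m W i : ℕ} (hQ : Q.Valid M m W) (hi : i < M) : m < W :=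
  (Nat.le_mul_of_pos_left m (Nat.zero_lt_of_lt hi)).trans_lt hQ.size_lt

theorem slotRound_loopsLe {Γ : Env} {ib : List Msg} {B : ℕ} (h1 : ib.length ≤ B)
    (h2 : Γ.slots a ≤ B) : (slotRound a).LoopsLe Γ ib B := by
  have h3 : ∀ σ : MState (dim a), (slotsE a).eval Γ σ ≤ B := fun σ => h2
  have h4 : ∀ σ : MState (dim a), σ.inbox = ib → NExpr.inboxLen.eval Γ σ ≤ B :=
    fun σ h => by simpa [NExpr.eval, h] using h1
  simp only [slotRound, clearSlots, fillSlots, prefixSlots, suffixSlots, initScan, Prog.LoopsLe, h3,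
    implies_true, true_and, and_true]
  exact h4

theorem slotRound_cost (B : ℕ) : (slotRound a).cost B ≤ 1000 * (B + 1) := by
  simp [slotRound, clearSlots, fillSlots, prefixSlots, suffixSlots, initScan, Prog.cost,
    NExpr.cost, RExpr.cost, BExpr.cost, Fin.sum_univ_four]
  omega

theorem Posted.round (hS : S.Fits a) (hQ : Q.Valid S.numMachines (S.slots a) S.wordBound)
    (h : Posted Q S σ) (ω : Tape) (t : ℕ) :
    Scanning Q S 1 (mpcRound (clusterProg a) S ω t σ) ∧
    ∀ i, Frame (σ i) (mpcRound (clusterProg a) S ω t σ i) ∧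
      (mpcRound (clusterProg a) S ω t σ i).work ≤ (σ i).work + 2000 * (S.slots a + 1) := by
  have hm := hQ.m_pos
  have hloc : ∀ i, localRound (clusterProg a) (S.env ω t i) (σ i) =
      (slotRound a).exec (S.env ω t i) (roundStart (σ i) 8) :=
    fun i => clusterProg_mode_one (h.light i).running (h.mode i)
  have hlen : ∀ i, (σ i).inbox.length ≤ S.slots a := fun i => by
    rw [h.inbox i]; exact Requests.deliver_posts_length hQ i
  have key := fun i : Fin S.numMachines => slotRound_spec (Γ := S.env ω t i) hS.cap hS.big
    hS.slots_pos (roundStart (σ i) 8)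
    ((hlen i).trans (Requests.slots_lt hQ i.2).le)
    (Requests.slotAt (S.slots a) i (Q.slotSum S.numMachines (S.slots a) fun h => h + 1))
    (Q.labAt S.numMachines (S.slots a) i)
    (Requests.slotAt (S.slots a) i (Q.slotSum S.numMachines (S.slots a) Q.val))
    (Requests.slotAt (S.slots a) i (Q.slotSum S.numMachines (S.slots a) Q.rval))
    (by
      intro q hq
      have hq' : q ∈ deliver (fun j : Fin S.numMachines => Q.posts (S.slots a) j) i := by
        rw [← h.inbox i]; exact hq
      obtain ⟨h, hh, hp, rfl⟩ := (Requests.mem_deliver_posts hQ).1 hq'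
      have h1 : Q.pos h % S.slots a < S.slots a := Nat.mod_lt _ hm
      have h2 := Requests.slots_lt hQ i.2
      have h3 := Requests.home_lt hh
      have h4 := hQ.size_lt
      have h5 := hQ.lab_lt h hh
      have h6 := (Finset.single_le_sum (f := Q.val) (fun _ _ => Nat.zero_le _) hh).trans_lt
        hQ.sum_lt
      refine ⟨h1, fun j => ?_⟩
      show (Q.msg (S.slots a) h).num j < S.wordBound
      fin_cases j <;> simp [Requests.msg] <;> omega)
    (by
      intro q hq
      have hq' : q ∈ deliver (fun j : Fin S.numMachines => Q.posts (S.slots a) j) i := by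
        rw [← h.inbox i]; exact hq
      obtain ⟨h, hh, hp, rfl⟩ := (Requests.mem_deliver_posts hQ).1 hq'
      have e : (i : ℕ) * S.slots a + (Q.msg (S.slots a) h).num 0 = Q.pos h := by
        rw [← hp]; exact Nat.div_add_mod' _ _
      simp only [Requests.slotAt, Requests.labAt, e, Requests.slotSum_pos hQ _ hh]
      simp [Requests.msg])
    (by
      intro s hs hq
      have hz : ∀ h ∈ Q.occ S.numMachines (S.slots a), Q.pos h ≠ i * S.slots a + s := by
        intro h' hh' he
        refine hq (Q.msg (S.slots a) h') ?_ ?_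
        · show _ ∈ (σ i).inbox
          rw [h.inbox i]
          refine (Requests.mem_deliver_posts hQ).2 ⟨h', hh', ?_, rfl⟩
          rw [he, mul_comm, Nat.mul_add_div hm, Nat.div_eq_of_lt (show s < S.slots a from hs),
            add_zero]
        · show Q.pos h' % S.slots a = s
          rw [he]; exact Nat.mul_add_mod_of_lt hs
      simp only [Requests.slotAt, Requests.labAt, Requests.slotSum_eq_zero _ hz, and_self])
    (fun s t hst _ => Requests.labAt_anti hQ hst)
    (fun s => Requests.slotSum_lab_lt hQ _)
    (fun ℓ => lt_of_le_of_lt (by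
      have := Requests.windows_le hQ i.2 0 0 ℓ 0
      exact (Nat.le_add_left _ _).trans ((Nat.le_add_right _ _).trans this)) hQ.sum_lt)
  have hout : ∀ j : Fin S.numMachines,
      ((slotRound a).exec (S.env ω t j) (roundStart (σ j) 8)).outbox =
      scanOut 1 (fun j => Q.labAt S.numMachines (S.slots a) j (S.slots a - 1))
        (fun j => Q.labAt S.numMachines (S.slots a) j 0)
        (fun j => Q.block S.numMachines (S.slots a) Q.val j
          (Q.labAt S.numMachines (S.slots a) j (S.slots a - 1)))
        (fun j => Q.block S.numMachines (S.slots a) Q.val j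
          (Q.labAt S.numMachines (S.slots a) j 0))
        (fun j => Q.block S.numMachines (S.slots a) Q.rval j
          (Q.labAt S.numMachines (S.slots a) j (S.slots a - 1)))
        (fun j => Q.block S.numMachines (S.slots a) Q.rval j
          (Q.labAt S.numMachines (S.slots a) j 0)) j := by
    intro j
    rw [(key j).2.2.2.2.2.2.2]; rfl
  have hinb := mpcRound_eq hloc hout
  have hframe : ∀ i, Frame (σ i) ((slotRound a).exec (S.env ω t i) (roundStart (σ i) 8)) :=
    fun i => (Frame.roundStart _ _).trans (Frame.exec _ _ (by
      simp [homeLocs, slotRound, clearSlots, fillSlots, prefixSlots, suffixSlots, initScan,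
        Prog.Writes]))
  refine ⟨⟨fun i => ⟨?_, ?_, ?_⟩, fun i => ?_, fun i => ?_, fun i => ?_, fun ω' t' i => ?_,
    fun i => ?_, fun i => ?_, fun i => ?_, fun i => ?_⟩, fun i => ⟨?_, ?_⟩⟩ <;> rw [hinb i]
  · have : Loc.Same _ _ _ := hframe i .halted (by simp [homeLocs])
    exact Eq.trans this (h.light i).running
  · exact (deliver_scanOut_length _ _ _ _ _ _ _ i.2).trans (Nat.le_add_left _ _)
  · show ((slotRound a).exec (S.env ω t i) (roundStart (σ i) 8)).outbox.length ≤ _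
    rw [hout]
    exact (scanOut_length _ _ _ _ _ _ _ i).trans (Nat.le_add_left _ _)
  · exact (key i).2.2.2.2.2.2.1
  · exact (key i).2.2.2.2.2.1
  · exact deliver_scanOut_length _ _ _ _ _ _ _ i.2
  · exact SlotsReady.congr (SlotsReady.of_same (key i).1 rfl rfl rfl) rfl
  · rw [deliver_scanOut_left _ _ _ _ _ _ _ i.2, Requests.leftWindow_one hQ]
    exact (congrArg (· + _) (key i).2.1).trans (zero_add _)
  · rw [deliver_scanOut_right, Requests.rightWindow_one hQ]
    exact (congrArg (· + _) (key i).2.2.1).trans (zero_add _)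
  · rw [deliver_scanOut_left _ _ _ _ _ _ _ i.2, Requests.leftWindow_one hQ]
    exact (congrArg (· + _) (key i).2.2.2.1).trans (zero_add _)
  · rw [deliver_scanOut_right, Requests.rightWindow_one hQ]
    exact (congrArg (· + _) (key i).2.2.2.2.1).trans (zero_add _)
  · exact (hframe i).trans (Frame.with_inbox _ _)
  · have h1 := exec_work_le (Γ := S.env ω t i) (B := S.slots a) (slotRound a) (roundStart (σ i) 8)
      (slotRound_loopsLe (hlen i) le_rfl)
    have h2 := slotRound_cost (a := a) (S.slots a)
    have h3 : (roundStart (σ i) 8).work = (σ i).work + 8 := rfl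
    show ((slotRound a).exec (S.env ω t i) (roundStart (σ i) 8)).work ≤ _
    omega

end Steps

end CorrClust

namespace CorrClust

section Steps

variable {a : ℕ} {Q : Requests} {S : Setup} {σ : Fin S.numMachines → MState (dim a)}

/-- The state of a machine after the messages of the scan have been received. -/
noncomputable def received (Γ : Env) (σ : MState (dim a)) : MState (dim a) :=
  ((scanReceive a).exec Γ (roundStart σ 12)).tick 4

theorem scanRound_of_lt {Γ : Env} {σ : MState (dim a)}
    (h : σ.nreg Reg.shift.ix < Γ.numMachines) :
    (scanRound a).exec Γ (roundStart σ 12) = (scanSend a).exec Γ (received Γ σ) := by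
  have h1 : ((scanReceive a).exec Γ (roundStart σ 12)).nreg Reg.shift.ix =
      σ.nreg Reg.shift.ix := exec_nreg (by simp [Prog.Writes, scanReceive])
  simp [scanRound, Prog.exec, BExpr.Holds, NExpr.eval, h1, h, received, BExpr.cost, NExpr.cost]

theorem scanRound_of_le {Γ : Env} {σ : MState (dim a)}
    (h : Γ.numMachines ≤ σ.nreg Reg.shift.ix) :
    (scanRound a).exec Γ (roundStart σ 12) = (replies a).exec Γ (received Γ σ) := by
  have h1 : ((scanReceive a).exec Γ (roundStart σ 12)).nreg Reg.shift.ix =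
      σ.nreg Reg.shift.ix := exec_nreg (by simp [Prog.Writes, scanReceive])
  simp [scanRound, Prog.exec, BExpr.Holds, NExpr.eval, h1, h, received, BExpr.cost, NExpr.cost]

theorem received_frame (Γ : Env) (σ : MState (dim a)) : Frame σ (received Γ σ) :=
  ((Frame.roundStart σ 12).trans (Frame.exec (scanReceive a) _ (by
    simp [homeLocs, scanReceive, Prog.Writes]))).trans (fun ℓ _ => by cases ℓ <;> rfl)

theorem received_work {Γ : Env} {σ : MState (dim a)} (h : σ.inbox.length ≤ 2) :
    (received Γ σ).work ≤ σ.work + 200 := by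
  have h4 : ∀ τ : MState (dim a), τ.inbox = (roundStart σ 12).inbox →
      NExpr.inboxLen.eval Γ τ ≤ 2 := fun τ hτ => by
    show τ.inbox.length ≤ 2
    rw [hτ]; exact h
  have h1 := exec_work_le (Γ := Γ) (B := 2) (scanReceive a) (roundStart σ 12)
    (by simpa [scanReceive, Prog.LoopsLe] using h4)
  have h2 : (scanReceive a).cost 2 ≤ 150 := by
    simp [scanReceive, Prog.cost, NExpr.cost, RExpr.cost, BExpr.cost]
  have h3 : (roundStart σ 12).work = σ.work + 12 := rfl
  show ((scanReceive a).exec Γ (roundStart σ 12)).work + 4 ≤ _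
  omega

/-- The state of the machines after the messages of the scan have been received. -/
structure Collected (Q : Requests) (S : Setup) (P : ℕ) (Γ : Env) (i : ℕ)
    (τ : MState (dim a)) : Prop where
  outbox : τ.outbox = []
  ready : SlotsReady Γ τ
    (Requests.slotAt (S.slots a) i (Q.slotSum S.numMachines (S.slots a) fun h => h + 1))
    (Q.labAt S.numMachines (S.slots a) i)
    (Requests.slotAt (S.slots a) i (Q.slotSum S.numMachines (S.slots a) Q.val))
    (Requests.slotAt (S.slots a) i (Q.slotSum S.numMachines (S.slots a) Q.rval))
  mode : τ.nreg Reg.mode.ix = 2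
  shift : τ.nreg Reg.shift.ix = P
  first : τ.nreg Reg.first.ix = Q.labAt S.numMachines (S.slots a) i 0
  last : τ.nreg Reg.last.ix = Q.labAt S.numMachines (S.slots a) i (S.slots a - 1)
  carryL : τ.nreg Reg.carryL.ix = Requests.leftWindow Q S.numMachines (S.slots a) Q.val i P
    (Q.labAt S.numMachines (S.slots a) i 0)
  carryR : τ.nreg Reg.carryR.ix = Requests.rightWindow Q S.numMachines (S.slots a) Q.val i P
    (Q.labAt S.numMachines (S.slots a) i (S.slots a - 1))
  rcarryL : τ.rreg RReg.carryL.ix = Requests.leftWindow Q S.numMachines (S.slots a) Q.rval i P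
    (Q.labAt S.numMachines (S.slots a) i 0)
  rcarryR : τ.rreg RReg.carryR.ix = Requests.rightWindow Q S.numMachines (S.slots a) Q.rval i P
    (Q.labAt S.numMachines (S.slots a) i (S.slots a - 1))

theorem Scanning.collected (hS : S.Fits a)
    (hQ : Q.Valid S.numMachines (S.slots a) S.wordBound) {P : ℕ} (h : Scanning Q S P σ)
    (ω : Tape) (t : ℕ) (i : Fin S.numMachines) :
    Collected Q S P (S.env ω t i) i (received (S.env ω t i) (σ i)) := by
  have hb := fun ℓ₁ ℓ₂ ℓ₃ => (Requests.windows_le hQ i.2 P ℓ₁ ℓ₂ ℓ₃).trans_lt hQ.sum_lt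
  have hL := h.carryL i
  have hR := h.carryR i
  have b := hb (Q.labAt S.numMachines (S.slots a) i 0) 0
    (Q.labAt S.numMachines (S.slots a) i (S.slots a - 1))
  have hr := h.ready ω t i
  have hfirst : (σ i).nreg Reg.first.ix = Q.labAt S.numMachines (S.slots a) i 0 := hr.first
  have hlast : (σ i).nreg Reg.last.ix = Q.labAt S.numMachines (S.slots a) i (S.slots a - 1) :=
    hr.last
  have hs := scanReceive_spec (Γ := S.env ω t i) (roundStart (σ i) 12)
    (show (σ i).inbox.length < S.wordBound by have := hS.big; have := h.inbox_le i; omega)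
    (show (σ i).nreg Reg.carryL.ix < S.wordBound by omega)
    (show (σ i).nreg Reg.carryR.ix < S.wordBound by omega)
  rw [show (roundStart (σ i) 12).nreg Reg.first.ix = _ from hfirst,
    show (roundStart (σ i) 12).nreg Reg.last.ix = _ from hlast] at hs
  have hready : SlotsReady (S.env ω t i) ((scanReceive a).exec (S.env ω t i) (roundStart (σ i) 12))
      _ _ _ _ := (hr.of_same (τ := roundStart (σ i) 12) rfl rfl rfl).exec (S.env ω t i)
      (scanReceive a) (by simp [Prog.Writes, scanReceive]) (by simp [Prog.Writes, scanReceive])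
      (by simp [Prog.Writes, scanReceive]) (by simp [Prog.Writes, scanReceive])
  constructor
  · exact exec_outbox (Γ := S.env ω t i) (P := scanReceive a) (σ := roundStart (σ i) 12)
      (by simp [Prog.Writes, scanReceive])
  · exact hready.of_same rfl rfl rfl
  · exact (exec_nreg (Γ := S.env ω t i) (P := scanReceive a) (σ := roundStart (σ i) 12)
      (by simp [Prog.Writes, scanReceive])).trans (h.mode i)
  · exact (exec_nreg (Γ := S.env ω t i) (P := scanReceive a) (σ := roundStart (σ i) 12)
      (by simp [Prog.Writes, scanReceive])).trans (h.shift i)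
  · exact hready.first
  · exact hready.last
  · refine hs.carryL.trans ?_
    rw [← hL]
    exact Nat.mod_eq_of_lt (by rw [← hL] at b; exact lt_of_le_of_lt (by
      show _ ≤ (σ i).nreg Reg.carryL.ix + _ + _ + _
      exact (Nat.le_add_right _ _).trans (Nat.le_add_right _ _)) b)
  · refine hs.carryR.trans ?_
    rw [← hR]
    exact Nat.mod_eq_of_lt (by rw [← hR] at b; exact lt_of_le_of_lt (by
      show (σ i).nreg Reg.carryR.ix + _ ≤ _
      exact Nat.le_add_left _ _) b)
  · exact hs.rcarryL.trans (h.rcarryL i)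
  · exact hs.rcarryR.trans (h.rcarryR i)

theorem Scanning.round (hS : S.Fits a) (hQ : Q.Valid S.numMachines (S.slots a) S.wordBound)
    {P : ℕ} (hP : P < S.numMachines) (h : Scanning Q S P σ) (ω : Tape) (t : ℕ) :
    Scanning Q S (2 * P) (mpcRound (clusterProg a) S ω t σ) ∧
    ∀ i, Frame (σ i) (mpcRound (clusterProg a) S ω t σ i) ∧
      (mpcRound (clusterProg a) S ω t σ i).work ≤ (σ i).work + 300 := by
  have hm := hQ.m_pos
  have hcol := h.collected hS hQ ω t
  have hloc : ∀ i, localRound (clusterProg a) (S.env ω t i) (σ i) =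
      (scanSend a).exec (S.env ω t i) (received (S.env ω t i) (σ i)) := fun i => by
    rw [clusterProg_mode_two (h.light i).running (h.mode i),
      scanRound_of_lt (by rw [h.shift i]; exact hP)]
  have key := fun i : Fin S.numMachines => scanSend_spec (Γ := S.env ω t i) hS.big
    (received (S.env ω t i) (σ i))
    (by rw [(hcol i).shift]; have := hS.machines; show 2 * P < S.wordBound; omega)
    (by
      rw [(hcol i).carryL]
      have := (Requests.windows_le hQ i.2 P (Q.labAt S.numMachines (S.slots a) i 0) 0 0).trans_lt
        hQ.sum_lt
      show _ < S.wordBound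
      omega)
    (by
      rw [(hcol i).carryR]
      have := (Requests.windows_le hQ i.2 P 0 0
        (Q.labAt S.numMachines (S.slots a) i (S.slots a - 1))).trans_lt hQ.sum_lt
      show _ < S.wordBound
      omega)
    (by rw [(hcol i).first]; exact Requests.slotSum_lab_lt hQ _)
    (by rw [(hcol i).last]; exact Requests.slotSum_lab_lt hQ _)
  have hout : ∀ j : Fin S.numMachines,
      ((scanSend a).exec (S.env ω t j) (received (S.env ω t j) (σ j))).outbox =
      scanOut P (fun j => Q.labAt S.numMachines (S.slots a) j 0)
        (fun j => Q.labAt S.numMachines (S.slots a) j (S.slots a - 1))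
        (fun j => Requests.leftWindow Q S.numMachines (S.slots a) Q.val j P
          (Q.labAt S.numMachines (S.slots a) j 0))
        (fun j => Requests.rightWindow Q S.numMachines (S.slots a) Q.val j P
          (Q.labAt S.numMachines (S.slots a) j (S.slots a - 1)))
        (fun j => Requests.leftWindow Q S.numMachines (S.slots a) Q.rval j P
          (Q.labAt S.numMachines (S.slots a) j 0))
        (fun j => Requests.rightWindow Q S.numMachines (S.slots a) Q.rval j P
          (Q.labAt S.numMachines (S.slots a) j (S.slots a - 1))) j := by
    intro j
    have hj := hcol j
    rw [(key j).2, hj.outbox, hj.shift, hj.first, hj.last, hj.carryL, hj.carryR, hj.rcarryL,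
      hj.rcarryR]
    rfl
  have hinb := mpcRound_eq hloc hout
  have hframe : ∀ i, Frame (σ i) ((scanSend a).exec (S.env ω t i)
      (received (S.env ω t i) (σ i))) :=
    fun i => (received_frame _ _).trans (Frame.exec _ _ (by
      simp [homeLocs, scanSend, Prog.Writes]))
  refine ⟨⟨fun i => ⟨?_, ?_, ?_⟩, fun i => ?_, fun i => ?_, fun i => ?_, fun ω' t' i => ?_,
    fun i => ?_, fun i => ?_, fun i => ?_, fun i => ?_⟩, fun i => ⟨?_, ?_⟩⟩ <;> rw [hinb i]
  · have : Loc.Same _ _ _ := hframe i .halted (by simp [homeLocs])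
    exact Eq.trans this (h.light i).running
  · exact (deliver_scanOut_length _ _ _ _ _ _ _ i.2).trans (Nat.le_add_left _ _)
  · show ((scanSend a).exec (S.env ω t i) (received (S.env ω t i) (σ i))).outbox.length ≤ _
    rw [hout]
    exact (scanOut_length _ _ _ _ _ _ _ i).trans (Nat.le_add_left _ _)
  · exact (exec_nreg (Γ := S.env ω t i) (P := scanSend a) (by simp [Prog.Writes, scanSend])).trans
      (hcol i).mode
  · exact (key i).1.trans (by rw [(hcol i).shift])
  · exact deliver_scanOut_length _ _ _ _ _ _ _ i.2
  · exact SlotsReady.congr (SlotsReady.of_same ((hcol i).ready.exec (S.env ω t i)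
      (scanSend a) (by simp [Prog.Writes, scanSend]) (by simp [Prog.Writes, scanSend])
      (by simp [Prog.Writes, scanSend]) (by simp [Prog.Writes, scanSend])) rfl rfl rfl) rfl
  · rw [deliver_scanOut_left _ _ _ _ _ _ _ i.2, Requests.leftWindow_double hQ]
    refine congrArg (· + _) ?_
    exact (exec_nreg (Γ := S.env ω t i) (P := scanSend a) (by simp [Prog.Writes, scanSend])).trans
      (hcol i).carryL
  · rw [deliver_scanOut_right, Requests.rightWindow_double hQ]
    refine congrArg (· + _) ?_
    exact (exec_nreg (Γ := S.env ω t i) (P := scanSend a) (by simp [Prog.Writes, scanSend])).trans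
      (hcol i).carryR
  · rw [deliver_scanOut_left _ _ _ _ _ _ _ i.2, Requests.leftWindow_double hQ]
    refine congrArg (· + _) ?_
    exact (exec_rreg (Γ := S.env ω t i) (P := scanSend a) (by simp [Prog.Writes, scanSend])).trans
      (hcol i).rcarryL
  · rw [deliver_scanOut_right, Requests.rightWindow_double hQ]
    refine congrArg (· + _) ?_
    exact (exec_rreg (Γ := S.env ω t i) (P := scanSend a) (by simp [Prog.Writes, scanSend])).trans
      (hcol i).rcarryR
  · exact (hframe i).trans (Frame.with_inbox _ _)
  · have h1 := exec_work_le (Γ := S.env ω t i) (B := 0) (scanSend a)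
      (received (S.env ω t i) (σ i)) (by simp [scanSend, Prog.LoopsLe])
    have h2 : (scanSend a).cost 0 ≤ 100 := by
      simp [scanSend, Prog.cost, NExpr.cost, RExpr.cost, BExpr.cost, Fin.sum_univ_four]
    have h3 := received_work (Γ := S.env ω t i) (h.inbox_le i)
    show ((scanSend a).exec (S.env ω t i) (received (S.env ω t i) (σ i))).work ≤ _
    omega

theorem replies_loopsLe {Γ : Env} {ib : List Msg} : (replies a).LoopsLe Γ ib (Γ.slots a) := by
  have h3 : ∀ σ : MState (dim a), (slotsE a).eval Γ σ ≤ Γ.slots a := fun σ => le_rfl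
  simp only [replies, reply, Prog.LoopsLe, h3, implies_true, true_and, and_true]

theorem replies_cost (B : ℕ) : (replies a).cost B ≤ 1000 * (B + 1) := by
  simp [replies, reply, Prog.cost, NExpr.cost, RExpr.cost, BExpr.cost, Fin.sum_univ_four]
  omega

theorem Scanning.finish (hS : S.Fits a) (hQ : Q.Valid S.numMachines (S.slots a) S.wordBound)
    {P : ℕ} (hP : S.numMachines ≤ P) (h : Scanning Q S P σ) (ω : Tape) (t : ℕ) :
    Answered Q S (mpcRound (clusterProg a) S ω t σ) ∧
    ∀ i, Frame (σ i) (mpcRound (clusterProg a) S ω t σ i) ∧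
      (mpcRound (clusterProg a) S ω t σ i).work ≤ (σ i).work + 2000 * (S.slots a + 1) := by
  have hm := hQ.m_pos
  have hcol := h.collected hS hQ ω t
  have hloc : ∀ i, localRound (clusterProg a) (S.env ω t i) (σ i) =
      (replies a).exec (S.env ω t i) (received (S.env ω t i) (σ i)) := fun i => by
    rw [clusterProg_mode_two (h.light i).running (h.mode i),
      scanRound_of_le (by rw [h.shift i]; exact hP)]
  have key := fun i : Fin S.numMachines => replies_spec (Γ := S.env ω t i) hS.cap hS.big
    hS.slots_pos (received (S.env ω t i) (σ i)) _ _ _ _ (hcol i).ready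
    (by
      intro ℓ
      rw [(hcol i).carryL, (hcol i).carryR]
      exact (Requests.windows_le hQ i.2 P _ ℓ _).trans_lt hQ.sum_lt)
  -- the slots with a request, and what is sent from them
  set A : ℕ → ℕ → ℕ := fun j => Requests.slotAt (S.slots a) j
    (Q.slotSum S.numMachines (S.slots a) fun h => h + 1) with hA
  set L : ℕ → List ℕ := fun j => (List.range (S.slots a)).filter (fun s => 0 < A j s) with hL
  have hslot : ∀ j s, s ∈ L j → ∃ h ∈ Q.occ S.numMachines (S.slots a),
      Q.pos h = j * S.slots a + s ∧ s < S.slots a := by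
    intro j s hs
    rw [hL, List.mem_filter, List.mem_range] at hs
    by_contra hne
    push Not at hne
    have : A j s = 0 := Requests.slotSum_eq_zero _ fun h hh he => by
      have := hne h hh he; omega
    simp [this] at hs
  have hans : ∀ (j : Fin S.numMachines) (h : ℕ), h ∈ Q.occ S.numMachines (S.slots a) →
      ∀ s < S.slots a, Q.pos h = j * S.slots a + s →
      replyMsg (S.slots a) (A j) (Q.labAt S.numMachines (S.slots a) j)
        (Requests.slotAt (S.slots a) j (Q.slotSum S.numMachines (S.slots a) Q.val))
        (Requests.slotAt (S.slots a) j (Q.slotSum S.numMachines (S.slots a) Q.rval))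
        ((received (S.env ω t j) (σ j)).nreg Reg.carryL.ix)
        ((received (S.env ω t j) (σ j)).nreg Reg.carryR.ix)
        ((received (S.env ω t j) (σ j)).rreg RReg.carryL.ix)
        ((received (S.env ω t j) (σ j)).rreg RReg.carryR.ix) s =
      Q.answer S.numMachines (S.slots a) h := by
    intro j h hh s hs hp
    have hAs : A j s = h + 1 := by
      show Q.slotSum S.numMachines (S.slots a) (fun h => h + 1) (j * S.slots a + s) = h + 1
      rw [← hp]; exact Requests.slotSum_pos hQ _ hh
    have hLs : Q.labAt S.numMachines (S.slots a) j s = Q.lab h := by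
      show Q.slotSum S.numMachines (S.slots a) Q.lab (j * S.slots a + s) = _
      rw [← hp]; exact Requests.slotSum_pos hQ _ hh
    have hVs : Requests.slotAt (S.slots a) j (Q.slotSum S.numMachines (S.slots a) Q.val) s =
        Q.val h := by
      show Q.slotSum S.numMachines (S.slots a) Q.val (j * S.slots a + s) = _
      rw [← hp]; exact Requests.slotSum_pos hQ _ hh
    have hj := hcol j
    have e1 := Requests.before_eq hQ Q.val (i := j) (P := P) (s := s)
      (by have := j.2; omega) hs
    have e2 := Requests.total_eq hQ Q.val (i := j) (P := P) (s := s) j.2 hP hs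
    have e3 := Requests.total_eq hQ Q.rval (i := j) (P := P) (s := s) j.2 hP hs
    rw [Requests.block] at e2 e3
    rw [replyMsg, hj.carryL, hj.carryR, hj.rcarryL, hj.rcarryR, e1, e2, e3, hAs, hLs, hVs,
      Requests.answer, hp]
    rfl
  have hout : ∀ j : Fin S.numMachines,
      ((replies a).exec (S.env ω t j) (received (S.env ω t j) (σ j))).outbox =
      (L j).map (replyMsg (S.slots a) (A j) (Q.labAt S.numMachines (S.slots a) j)
        (Requests.slotAt (S.slots a) j (Q.slotSum S.numMachines (S.slots a) Q.val))
        (Requests.slotAt (S.slots a) j (Q.slotSum S.numMachines (S.slots a) Q.rval))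
        ((received (S.env ω t j) (σ j)).nreg Reg.carryL.ix)
        ((received (S.env ω t j) (σ j)).nreg Reg.carryR.ix)
        ((received (S.env ω t j) (σ j)).rreg RReg.carryL.ix)
        ((received (S.env ω t j) (σ j)).rreg RReg.carryR.ix)) := by
    intro j
    rw [(key j).2.2, (hcol j).outbox]
    rfl
  have hinb := mpcRound_eq hloc hout
  have hframe : ∀ i, Frame (σ i) ((replies a).exec (S.env ω t i)
      (received (S.env ω t i) (σ i))) :=
    fun i => (received_frame _ _).trans (Frame.exec _ _ (by
      simp [homeLocs, replies, reply, Prog.Writes]))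
  have hmem : ∀ (i : Fin S.numMachines) q,
      q ∈ (mpcRound (clusterProg a) S ω t σ i).inbox ↔ ∃ e < Q.cnt i,
        q = Q.answer S.numMachines (S.slots a) (i * S.slots a + e) := by
    intro i q
    rw [hinb i]
    show q ∈ deliver _ _ ↔ _
    rw [mem_deliver]
    constructor
    · rintro ⟨j, hj, hd⟩
      obtain ⟨s, hs, rfl⟩ := List.mem_map.1 hj
      obtain ⟨h, hh, hp, hsm⟩ := hslot j s hs
      rw [hans j h hh s hsm hp] at hd ⊢
      have hd' : h / S.slots a = i := hd
      refine ⟨h % S.slots a, ?_, ?_⟩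
      · rw [← hd']; exact (Finset.mem_filter.1 hh).2
      · rw [← hd', Nat.div_add_mod']
    · rintro ⟨e, he, rfl⟩
      have hem := he.trans_le (hQ.cnt_le i)
      have hh := (Requests.mem_occ hm i.2 hem).2 he
      have hlt := hQ.pos_lt _ hh
      have hpe := Nat.div_add_mod' (Q.pos (i * S.slots a + e)) (S.slots a)
      have hsm := Nat.mod_lt (Q.pos (i * S.slots a + e)) hm
      refine ⟨⟨Q.pos (i * S.slots a + e) / S.slots a, Nat.div_lt_of_lt_mul
        (by rw [mul_comm (S.slots a) S.numMachines]; exact hlt)⟩,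
        List.mem_map.2 ⟨Q.pos (i * S.slots a + e) % S.slots a, ?_, ?_⟩, ?_⟩
      · rw [hL, List.mem_filter, List.mem_range]
        refine ⟨hsm, ?_⟩
        have : A (Q.pos (i * S.slots a + e) / S.slots a) (Q.pos (i * S.slots a + e) % S.slots a) =
            i * S.slots a + e + 1 := by
          show Q.slotSum S.numMachines (S.slots a) (fun h => h + 1) (_ * S.slots a + _) = _
          rw [hpe]; exact Requests.slotSum_pos hQ _ hh
        simp [this]
      · exact hans _ _ hh _ hsm hpe.symm
      · show (i * S.slots a + e) / S.slots a = i
        rw [mul_comm, Nat.mul_add_div hm, Nat.div_eq_of_lt hem, add_zero]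
  have hnodup : ∀ i, ((mpcRound (clusterProg a) S ω t σ i).inbox.map fun q => q.num 0).Nodup := by
    intro i
    rw [hinb i]
    refine deliver_nodup (fun j : Fin S.numMachines => L j) _
      (fun j => List.nodup_range.filter _) ?_ i
    intro j j' x hx y hy hd hn
    obtain ⟨h, hh, hp, hxm⟩ := hslot j x hx
    obtain ⟨h', hh', hp', hym⟩ := hslot j' y hy
    rw [hans j h hh x hxm hp, hans j' h' hh' y hym hp'] at hd hn
    have e1 : h / S.slots a = h' / S.slots a := hd
    have e2 : h % S.slots a = h' % S.slots a := hn
    have e3 : h = h' := by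
      rw [← Nat.div_add_mod' h (S.slots a), ← Nat.div_add_mod' h' (S.slots a), e1, e2]
    subst e3
    rw [hp] at hp'
    have e4 : (j * S.slots a + x) % S.slots a = (j' * S.slots a + y) % S.slots a := by rw [hp']
    have e5 : (j * S.slots a + x) / S.slots a = (j' * S.slots a + y) / S.slots a := by rw [hp']
    rw [Nat.mul_add_mod_of_lt hxm, Nat.mul_add_mod_of_lt hym] at e4
    rw [mul_comm (j : ℕ), mul_comm (j' : ℕ), Nat.mul_add_div hm, Nat.mul_add_div hm,
      Nat.div_eq_of_lt hxm, Nat.div_eq_of_lt hym, add_zero, add_zero] at e5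
    exact ⟨Fin.ext e5, e4⟩
  have hlen : ∀ i, (mpcRound (clusterProg a) S ω t σ i).inbox.length ≤ S.slots a := by
    intro i
    refine length_le_of_nodup_map (hnodup i) ?_
    intro q hq
    obtain ⟨e, -, rfl⟩ := (hmem i q).1 hq
    exact Nat.mod_lt _ hm
  refine ⟨⟨fun i => ⟨?_, (hlen i).trans (Nat.le_add_right _ _), ?_⟩, fun i => ?_, hmem, hnodup,
    hlen, fun i => ?_, fun h0 i => ?_⟩, fun i => ⟨?_, ?_⟩⟩
  · rw [hinb i]
    have : Loc.Same _ _ _ := hframe i .halted (by simp [homeLocs])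
    exact Eq.trans this (h.light i).running
  · rw [hinb i]
    show ((replies a).exec (S.env ω t i) (received (S.env ω t i) (σ i))).outbox.length ≤ _
    rw [hout, List.length_map]
    refine (List.length_filter_le _ _).trans ?_
    rw [List.length_range]; exact Nat.le_add_right _ _
  · rw [hinb i]; exact (key i).2.1
  · rw [hinb i]
    refine lt_of_eq_of_lt (key i).1 ?_
    rw [(hcol i).carryL, (hcol i).carryR]
    exact (Requests.windows_le hQ i.2 P _ _ _).trans_lt hQ.sum_lt
  · rw [hinb i]
    refine (key i).1.trans ?_
    have hz : ∀ p, Q.slotSum S.numMachines (S.slots a) Q.lab p = 0 := fun p =>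
      Finset.sum_eq_zero fun h hh => by rw [h0 h hh, ite_self]
    have hz' : ∀ j s, Q.labAt S.numMachines (S.slots a) j s = 0 := fun j s => hz _
    have e2 := Requests.total_eq hQ Q.val (i := i) (P := P) (s := 0) i.2 hP hm
    rw [if_pos rfl, if_pos (by rw [hz', hz']), Requests.block] at e2
    rw [(hcol i).carryL, (hcol i).carryR, add_comm (Requests.leftWindow _ _ _ _ _ _ _)]
    refine e2.trans ?_
    rw [Requests.total]
    refine Finset.sum_congr rfl fun h hh => ?_
    rw [if_pos (by rw [h0 h hh, hz'])]
  · rw [hinb i]; exact (hframe i).trans (Frame.with_inbox _ _)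
  · rw [hinb i]
    have h1 := exec_work_le (Γ := S.env ω t i) (B := S.slots a) (replies a)
      (received (S.env ω t i) (σ i)) replies_loopsLe
    have h2 := replies_cost (a := a) (S.slots a)
    have h3 := received_work (Γ := S.env ω t i) (h.inbox_le i)
    show ((replies a).exec (S.env ω t i) (received (S.env ω t i) (σ i))).work ≤ _
    omega

/-- The number of rounds from the arrival of the requests to the arrival of the answers. -/
def Setup.scanLen (S : Setup) : ℕ := Nat.clog 2 S.numMachines + 2

/-- What a part of the computation leaves unchanged, and its work. -/
structure Quiet (S : Setup) (B : ℕ) (σ τ : Fin S.numMachines → MState (dim a)) : Prop where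
  frame : ∀ i, Frame (σ i) (τ i)
  work : ∀ i, (τ i).work ≤ (σ i).work + B

theorem Posted.cycle (hS : S.Fits a) (hQ : Q.Valid S.numMachines (S.slots a) S.wordBound)
    {ω : Tape} {R : ℕ → Fin S.numMachines → MState (dim a)}
    (hR : ∀ t, R (t + 1) = mpcRound (clusterProg a) S ω t (R t)) {t : ℕ}
    (h : Posted Q S (R t)) :
    Answered Q S (R (t + S.scanLen)) ∧
    Quiet S (4000 * (S.slots a + 1) + 300 * Nat.clog 2 S.numMachines) (R t) (R (t + S.scanLen)) ∧
    ∀ s ≤ S.scanLen, ∀ i, Light a S (R (t + s) i) := by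
  have h1 := h.round hS hQ ω t
  rw [← hR] at h1
  -- For `k` below the logarithm, `2 ^ k` is less than the number of machines and the program scans
  -- on; at the logarithm the windows cover everything and it answers.
  have scan : ∀ k ≤ Nat.clog 2 S.numMachines, Scanning Q S (2 ^ k) (R (t + (1 + k))) ∧
      Quiet S (2000 * (S.slots a + 1) + 300 * k) (R t) (R (t + (1 + k))) := by
    intro k
    induction k with
    | zero => exact fun _ => ⟨h1.1, fun i => (h1.2 i).1, fun i => (h1.2 i).2⟩
    | succ k ih =>
      intro hk
      obtain ⟨i1, i2, i3⟩ := ih (by omega)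
      have hlt : 2 ^ k < S.numMachines :=
        (Nat.lt_clog_iff_pow_lt one_lt_two).1 (by omega)
      obtain ⟨s1, s2⟩ := i1.round hS hQ hlt ω (t + (1 + k))
      rw [← hR] at s1 s2
      rw [show t + (1 + (k + 1)) = t + (1 + k) + 1 by omega]
      refine ⟨?_, fun i => (i2 i).trans (s2 i).1, fun i => ?_⟩
      · rw [pow_succ, mul_comm]; exact s1
      · refine (s2 i).2.trans ((Nat.add_le_add_right (i3 i) 300).trans (le_of_eq ?_))
        ring
  obtain ⟨c1, c2, c3⟩ := scan _ le_rfl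
  obtain ⟨f1, f2⟩ := c1.finish hS hQ (Nat.le_pow_clog one_lt_two _) ω _
  rw [← hR] at f1 f2
  have hlen : t + (1 + Nat.clog 2 S.numMachines) + 1 = t + S.scanLen := by
    rw [Setup.scanLen]; omega
  rw [hlen] at f1 f2
  refine ⟨f1, ⟨fun i => (c2 i).trans (f2 i).1, fun i => ?_⟩, fun s hs i => ?_⟩
  · have := (f2 i).2
    have := c3 i
    omega
  · rcases Nat.eq_zero_or_pos s with rfl | h0
    · exact h.light i
    rcases hs.lt_or_eq with hs | rfl
    · obtain ⟨k, rfl⟩ : ∃ k, s = 1 + k := ⟨s - 1, by omega⟩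
      exact (scan k (by rw [Setup.scanLen] at hs; omega)).1.light i
    · exact f1.light i

end Steps

end CorrClust

namespace CorrClust

/-! ### The home cells and their summands -/

section Home

/-- The radius of the core of a cluster. -/
noncomputable def coreR (ε : ℝ) : ℝ := (1 - 6 * ε) / 5

/-- The radius of a cluster. -/
noncomputable def hullR (ε : ℝ) : ℝ := (2 - 2 * ε) / 5

/-- The radius within which two vertices cannot both be pivots. -/
noncomputable def nearR (ε : ℝ) : ℝ := (4 + ε) / 5

/-- The variables of the algorithm; `pos` is indexed by home cells. -/
structure AlgState (n : ℕ) where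
  kind : ℕ
  bit : ℕ
  total : ℕ
  thr : ℝ
  pos : ℕ → ℕ
  weight : Fin n → ℝ
  status : Fin n → ℕ
  prio : Fin n → ℕ

variable {n a : ℕ}

/-- The endpoint of a pair that belongs to the home cell `e`. -/
def own (p : Fin n × Fin n) (e : ℕ) : Fin n := if e % 2 = 0 then p.1 else p.2

/-- The other endpoint. -/
def other (p : Fin n × Fin n) (e : ℕ) : Fin n := if e % 2 = 0 then p.2 else p.1

/-- The memory of a machine with the input pairs `l` agrees with the variables of the algorithm;
`o` is the number of its first home cell. -/
structure HomeIs (x : Fin n → Fin n → ℝ) (l : List (Fin n × Fin n)) (o : ℕ) (g : AlgState n)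
    (σ : MState (dim a)) : Prop where
  kind : σ.nreg Reg.kind.ix = g.kind
  bit : σ.nreg Reg.bit.ix = g.bit
  total : σ.nreg Reg.total.ix = g.total
  thr : σ.rreg RReg.thr.ix = g.thr
  len : σ.nreg Reg.len.ix = l.length
  dist : ∀ j (hj : j < l.length), σ.rarr RArr.dist.ix j = x l[j].1 l[j].2
  vtx : ∀ e (he : e < 2 * l.length), σ.narr Arr.vtx.ix e = own (l[e / 2]'(by omega)) e
  pos : ∀ e < 2 * l.length, σ.narr Arr.pos.ix e = g.pos (o + e)
  status : ∀ e (he : e < 2 * l.length),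
    σ.narr Arr.status.ix e = g.status (own (l[e / 2]'(by omega)) e)
  prio : ∀ e (he : e < 2 * l.length),
    σ.narr Arr.prio.ix e = g.prio (own (l[e / 2]'(by omega)) e)
  weight : ∀ e (he : e < 2 * l.length),
    σ.rarr RArr.weight.ix e = g.weight (own (l[e / 2]'(by omega)) e)

theorem HomeIs.frame {x : Fin n → Fin n → ℝ} {l : List (Fin n × Fin n)} {o : ℕ} {g : AlgState n}
    {σ τ : MState (dim a)} (h : HomeIs x l o g σ) (hf : Frame σ τ) : HomeIs x l o g τ := by
  have f := fun ℓ hℓ => hf ℓ hℓ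
  simp only [homeLocs, List.mem_cons, List.not_mem_nil, or_false, forall_eq_or_imp, forall_eq,
    Loc.Same] at f
  obtain ⟨f1, f2, f3, f4, f5, f6, f7, f8, f9, f10, f11, f12, f13, f14⟩ := f
  exact ⟨f1 ▸ h.kind, f2 ▸ h.bit, f3 ▸ h.total, f5 ▸ h.thr, f4 ▸ h.len, f12 ▸ h.dist, f8 ▸ h.vtx,
    f9 ▸ h.pos, f10 ▸ h.status, f11 ▸ h.prio, f13 ▸ h.weight⟩

/-- The vertex is undecided, and its weight reaches the threshold. -/
def AlgState.Active (g : AlgState n) (u : Fin n) : Prop := g.status u = 0 ∧ g.thr ≤ g.weight u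

open scoped Classical in
/-- The integer that the endpoint `u` of the pair `uv` contributes; `b` is `0` for the first
endpoint, and `ξ` is the random draw for the pair. -/
noncomputable def AlgState.cval (g : AlgState n) (ε : ℝ) (x : Fin n → Fin n → ℝ) (ξ b : ℕ)
    (u v : Fin n) : ℕ :=
  match g.kind with
  | 0 => if g.bit = 0 then 1 else u / g.bit % 2
  | 1 => 0
  | 2 => if u = v ∧ b = 0 then ξ else 0
  | 3 => if u = v ∧ b = 0 ∧ g.Active u then 1 else 0
  | 4 => if u ≠ v ∧ x u v ≤ nearR ε ∧ g.Active u ∧ g.Active v ∧ g.prio u ≤ g.prio v then 1 else 0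
  | _ => if u = v then (if b = 0 ∧ g.status u = 1 then u + 1 else 0)
      else if x u v ≤ hullR ε ∧ g.status v = 1 then v + 1 else 0

open scoped Classical in
/-- The real number that the endpoint `u` of the pair `uv` contributes. -/
noncomputable def AlgState.crval (g : AlgState n) (ε : ℝ) (x : Fin n → Fin n → ℝ) (ξ b : ℕ)
    (u v : Fin n) : ℝ :=
  match g.kind with
  | 1 => if u = v then (if b = 0 then coreR ε else 0)
      else if x u v < coreR ε then coreR ε - x u v else 0
  | 2 => if u ≠ v ∧ x u v ≤ nearR ε ∧ g.status v = 1 then 1 else 0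
  | _ => 0

/-- A pair is stored once, with both endpoints; the summand of the second endpoint is that of the
first with exchanged roles, by the symmetry of `x`. The index `b` matters only for self-loops, where
both endpoints are the same vertex and only one of them may contribute. -/
theorem contribution_spec {Γ : Env} {x : Fin n → Fin n → ℝ} {l : List (Fin n × Fin n)} {o : ℕ}
    {g : AlgState n} {τ : MState (dim a)} (hx : ∀ u v, x u v = x v u)
    (hn : Γ.numVertices = n) (hW : 2 * n + 6 < Γ.wordBound) (hg : g.kind ≤ 5)
    (h : HomeIs x l o g τ) {k : ℕ} (hk : k < l.length)
    (hidx : τ.nreg Reg.idx.ix = k) (h0 : τ.nreg Reg.tmp₀.ix = 0) (h1 : τ.nreg Reg.tmp₁.ix = 0)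
    (r0 : τ.rreg RReg.tmp₀.ix = 0) (r1 : τ.rreg RReg.tmp₁.ix = 0) :
    ((byKind a (contribution a)).exec Γ τ).nreg Reg.tmp₀.ix =
      g.cval Γ.eps x (Γ.rnd τ.draws (2 * n)) 0 l[k].1 l[k].2 ∧
    ((byKind a (contribution a)).exec Γ τ).nreg Reg.tmp₁.ix =
      g.cval Γ.eps x (Γ.rnd τ.draws (2 * n)) 1 l[k].2 l[k].1 ∧
    ((byKind a (contribution a)).exec Γ τ).rreg RReg.tmp₀.ix =
      g.crval Γ.eps x (Γ.rnd τ.draws (2 * n)) 0 l[k].1 l[k].2 ∧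
    ((byKind a (contribution a)).exec Γ τ).rreg RReg.tmp₁.ix =
      g.crval Γ.eps x (Γ.rnd τ.draws (2 * n)) 1 l[k].2 l[k].1 ∧
    ((byKind a (contribution a)).exec Γ τ).draws =
      τ.draws + (if g.kind = 2 then 1 else 0) := by
  have e0 : 2 * k < 2 * l.length := by omega
  have e1 : 2 * k + 1 < 2 * l.length := by omega
  have d0 : 2 * k / 2 = k := by omega
  have d1 : (2 * k + 1) / 2 = k := by omega
  have m1 : (2 * k + 1) % 2 = 1 := by omega
  have v0 := h.vtx _ e0
  have v1 := h.vtx _ e1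
  have s0 := h.status _ e0
  have s1 := h.status _ e1
  have p0 := h.prio _ e0
  have p1 := h.prio _ e1
  have w0 := h.weight _ e0
  have w1 := h.weight _ e1
  have dk := h.dist _ hk
  simp only [d0, d1, own, m1, Nat.mul_mod_right, if_true, one_ne_zero, if_false] at v0 v1 s0 s1 p0 p1 w0 w1
  have hxk : x l[k].2 l[k].1 = x l[k].1 l[k].2 := hx _ _
  obtain ⟨⟨u, v⟩, hp⟩ : ∃ p, l[k] = p := ⟨_, rfl⟩
  simp only [hp] at v0 v1 s0 s1 p0 p1 w0 w1 dk hxk ⊢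
  have hu := u.2
  have hv := v.2
  have W0 : 0 % Γ.wordBound = 0 := Nat.zero_mod _
  have W1 : 1 % Γ.wordBound = 1 := Nat.mod_eq_of_lt (by omega)
  have Wu : ((u : ℕ) + 1) % Γ.wordBound = u + 1 := Nat.mod_eq_of_lt (by omega)
  have Wv : ((v : ℕ) + 1) % Γ.wordBound = v + 1 := Nat.mod_eq_of_lt (by omega)
  have Wm : ∀ y, y % 2 % Γ.wordBound = y % 2 := fun y => Nat.mod_eq_of_lt (by omega)
  have Wr : (Γ.rnd τ.draws (2 * n) : ℕ) % Γ.wordBound = Γ.rnd τ.draws (2 * n) :=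
    Nat.mod_eq_of_lt (by have := (Γ.rnd τ.draws (2 * n)).2; omega)
  have hr : (Γ.rnd τ.draws (2 * Γ.numVertices) : ℕ) = Γ.rnd τ.draws (2 * n) := by rw [hn]
  have hthr := h.thr
  have hbit := h.bit
  have hkd := h.kind
  have huv : (u : ℕ) = v ↔ u = v := Fin.val_inj
  have hvu : v = u ↔ u = v := eq_comm
  clear h hx hp
  obtain hk0 | hk0 | hk0 | hk0 | hk0 | hk0 : g.kind = 0 ∨ g.kind = 1 ∨ g.kind = 2 ∨ g.kind = 3 ∨
    g.kind = 4 ∨ g.kind = 5 := by omega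
  · by_cases hb : g.bit = 0 <;>
      simp [byKind, contribution, Prog.exec, MState.tick, NExpr.eval, RExpr.eval, BExpr.Holds,
        Function.update_apply, AlgState.cval, AlgState.crval, hkd, hk0, hbit, hb, hidx, v0, v1, W1, Wm, r0, r1]
  · by_cases hb : u = v <;> by_cases hc : x u v < (1 - 6 * Γ.eps) / 5 <;>
      simp [byKind, contribution, Prog.exec, MState.tick, NExpr.eval, RExpr.eval, BExpr.Holds,
        Function.update_apply, AlgState.cval, AlgState.crval, hkd, hk0, hb, hc, hidx, v0, v1,
        huv, hvu, dk, h0, h1, r0, r1, coreR, hxk]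
  · by_cases hb : u = v
    · subst hb
      simp [byKind, contribution, Prog.exec, MState.tick, NExpr.eval, RExpr.eval, BExpr.Holds,
        Function.update_apply, AlgState.cval, AlgState.crval, hkd, hk0, hidx, v0, v1,
        huv, hvu, dk, h0, h1, r0, r1, hxk]
      rw [hr, Wr]
    by_cases hc : x u v ≤ (4 + Γ.eps) / 5
    · by_cases h3 : g.status u = 1 <;> by_cases h4 : g.status v = 1 <;>
      simp [byKind, contribution, Prog.exec, MState.tick, NExpr.eval, RExpr.eval, BExpr.Holds,
        Function.update_apply, AlgState.cval, AlgState.crval, hkd, hk0, hb, hc, hidx, v0, v1,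
        huv, hvu, dk, h0, h1, r0, r1, nearR, hxk, s0, s1, h3, h4]
    · simp [byKind, contribution, Prog.exec, MState.tick, NExpr.eval, RExpr.eval, BExpr.Holds,
        Function.update_apply, AlgState.cval, AlgState.crval, hkd, hk0, hb, hc, hidx, v0, v1,
        huv, hvu, dk, h0, h1, r0, r1, nearR, hxk, s0, s1]
  · by_cases hb : u = v
    · subst hb
      by_cases h3 : g.status u = 0 <;> by_cases h4 : g.thr ≤ g.weight u <;>
      simp [byKind, contribution, Prog.exec, MState.tick, NExpr.eval, RExpr.eval, BExpr.Holds,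
        Function.update_apply, AlgState.cval, AlgState.crval, AlgState.Active, hkd, hk0, hidx, v0, v1,
        huv, hvu, dk, h0, h1, r0, r1, hxk, s0, s1, w0, w1, h3, h4, hthr, W1]
    · simp [byKind, contribution, Prog.exec, MState.tick, NExpr.eval, RExpr.eval, BExpr.Holds,
        Function.update_apply, AlgState.cval, AlgState.crval, AlgState.Active, hkd, hk0, hidx, v0, v1, hb,
        huv, hvu, dk, h0, h1, r0, r1, hxk, s0, s1, w0, w1, hthr, W1]
  · by_cases hb : u = v
    · simp [byKind, contribution, Prog.exec, MState.tick, NExpr.eval, RExpr.eval, BExpr.Holds,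
        Function.update_apply, AlgState.cval, AlgState.crval, AlgState.Active, hkd, hk0, hidx, v0, v1, hb,
        huv, hvu, dk, h0, h1, r0, r1, hxk, s0, s1, w0, w1, hthr, W1]
    by_cases hc : x u v ≤ (4 + Γ.eps) / 5 ∧ ((g.status u = 0 ∧ g.status v = 0) ∧
        (g.thr ≤ g.weight u ∧ g.thr ≤ g.weight v))
    · obtain ⟨c1, ⟨c2, c3⟩, c4, c5⟩ := hc
      by_cases h3 : g.prio u ≤ g.prio v <;> by_cases h4 : g.prio v ≤ g.prio u <;>
      simp [byKind, contribution, Prog.exec, MState.tick, NExpr.eval, RExpr.eval, BExpr.Holds,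
        Function.update_apply, AlgState.cval, AlgState.crval, AlgState.Active, hkd, hk0, hidx, v0, v1, hb,
        huv, hvu, dk, h0, h1, r0, r1, hxk, s0, s1, w0, w1, hthr, W1, c1, c2, c3, c4, c5, h3, h4, p0, p1, nearR]
    · have hc1 : ¬ (x u v ≤ nearR Γ.eps ∧ g.Active u ∧ g.Active v ∧ g.prio u ≤ g.prio v) := by
        rintro ⟨q1, q2, q3, q4⟩
        exact hc ⟨q1, ⟨q2.1, q3.1⟩, q2.2, q3.2⟩
      have hc2 : ¬ (x u v ≤ nearR Γ.eps ∧ g.Active v ∧ g.Active u ∧ g.prio v ≤ g.prio u) := by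
        rintro ⟨q1, q2, q3, q4⟩
        exact hc ⟨q1, ⟨q3.1, q2.1⟩, q3.2, q2.2⟩
      simp only [byKind, contribution, Prog.exec, MState.tick, NExpr.eval, RExpr.eval, BExpr.Holds,
        AlgState.cval, AlgState.crval, hkd, hk0, hidx, v0, v1, huv, dk, s0, s1, w0, w1, hthr, hxk]
      simp [Prog.exec, MState.tick, NExpr.eval, RExpr.eval, BExpr.Holds, hkd, hk0, hidx, v0, v1, huv, dk, s0, s1,
        w0, w1, hthr, hxk, hb, hvu, hc, hc1, hc2, h0, h1, r0, r1]
  · by_cases hb : u = v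
    · subst hb
      by_cases h3 : g.status u = 1 <;>
      simp [byKind, contribution, Prog.exec, MState.tick, NExpr.eval, RExpr.eval, BExpr.Holds,
        Function.update_apply, AlgState.cval, AlgState.crval, hkd, hk0, hidx, v0, v1,
        huv, hvu, dk, h0, h1, r0, r1, hxk, s0, s1, h3, Wu]
    by_cases hc : x u v ≤ (2 - 2 * Γ.eps) / 5
    · by_cases h3 : g.status u = 1 <;> by_cases h4 : g.status v = 1 <;>
      simp [byKind, contribution, Prog.exec, MState.tick, NExpr.eval, RExpr.eval, BExpr.Holds,
        Function.update_apply, AlgState.cval, AlgState.crval, hkd, hk0, hb, hc, hidx, v0, v1,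
        huv, hvu, dk, h0, h1, r0, r1, hullR, hxk, s0, s1, h3, h4, Wu, Wv]
    · simp [byKind, contribution, Prog.exec, MState.tick, NExpr.eval, RExpr.eval, BExpr.Holds,
        Function.update_apply, AlgState.cval, AlgState.crval, hkd, hk0, hb, hc, hidx, v0, v1,
        huv, hvu, dk, h0, h1, r0, r1, hullR, hxk, s0, s1]

end Home

end CorrClust

namespace CorrClust

/-! ### Posting the requests of a cycle -/

section StartCycle

variable {n a : ℕ} {Γ : Env}

theorem AlgState.cval_congr {g : AlgState n} (hg : g.kind ≠ 2) (ε : ℝ) (x : Fin n → Fin n → ℝ)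
    (ξ ξ' b : ℕ) (u v : Fin n) : g.cval ε x ξ b u v = g.cval ε x ξ' b u v := by
  rw [AlgState.cval, AlgState.cval]
  split <;> first | rfl | contradiction

theorem AlgState.crval_congr (g : AlgState n) (ε : ℝ) (x : Fin n → Fin n → ℝ)
    (ξ ξ' b : ℕ) (u v : Fin n) : g.crval ε x ξ b u v = g.crval ε x ξ' b u v := rfl

theorem AlgState.cval_le (g : AlgState n) (ε : ℝ) (x : Fin n → Fin n → ℝ)
    {ξ : ℕ} (hξ : ξ ≤ 2 * n) (b : ℕ) (u v : Fin n) : g.cval ε x ξ b u v ≤ 2 * n + 1 := by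
  have hu := u.2
  have hv := v.2
  rw [AlgState.cval]
  split
  all_goals try split_ifs
  all_goals omega

/-- The requests of the home cells from `o` on are those of the variables `g` for the input
pairs `l`. -/
structure Requests.IsFor (Q : Requests) (ε : ℝ) (x : Fin n → Fin n → ℝ) (l : List (Fin n × Fin n))
    (o : ℕ) (g : AlgState n) (ξ : ℕ → ℕ) : Prop where
  pos : ∀ e < 2 * l.length, Q.pos (o + e) = g.pos (o + e)
  lab : ∀ e (he : e < 2 * l.length), Q.lab (o + e) =
    if g.kind = 0 ∨ g.kind = 3 then 0 else n - own (l[e / 2]'(by omega)) e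
  val : ∀ e (he : e < 2 * l.length), Q.val (o + e) = g.cval ε x (ξ (e / 2)) (e % 2)
    (own (l[e / 2]'(by omega)) e) (other (l[e / 2]'(by omega)) e)
  rval : ∀ e (he : e < 2 * l.length), Q.rval (o + e) = g.crval ε x (ξ (e / 2)) (e % 2)
    (own (l[e / 2]'(by omega)) e) (other (l[e / 2]'(by omega)) e)

theorem requests_spec {x : Fin n → Fin n → ℝ} {l : List (Fin n × Fin n)} {o k : ℕ}
    {g : AlgState n} {τ : MState (dim a)} {Q : Requests} {ξ : ℕ → ℕ} {ε : ℝ}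
    (hn : Γ.numVertices = n) (hm0 : 0 < Γ.slots a) (hmW : Γ.slots a < Γ.wordBound)
    (hW : 2 * n + 6 < Γ.wordBound) (ho : o = Γ.myId * Γ.slots a)
    (hoW : o + 2 * l.length < Γ.wordBound) (hQ : Q.IsFor ε x l o g ξ) (hξ : ∀ j, ξ j ≤ 2 * n)
    (h : HomeIs x l o g τ) (hk : k < l.length) (hidx : τ.nreg Reg.idx.ix = k)
    (h0 : τ.nreg Reg.tmp₀.ix = g.cval ε x (ξ k) 0 l[k].1 l[k].2)
    (h1 : τ.nreg Reg.tmp₁.ix = g.cval ε x (ξ k) 1 l[k].2 l[k].1)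
    (r0 : τ.rreg RReg.tmp₀.ix = g.crval ε x (ξ k) 0 l[k].1 l[k].2)
    (r1 : τ.rreg RReg.tmp₁.ix = g.crval ε x (ξ k) 1 l[k].2 l[k].1) :
    ((requests a).exec Γ τ).outbox = τ.outbox ++ [Q.msg (Γ.slots a) (o + 2 * k),
      Q.msg (Γ.slots a) (o + (2 * k + 1))] := by
  have e0 : 2 * k < 2 * l.length := by omega
  have e1 : 2 * k + 1 < 2 * l.length := by omega
  have d0 : 2 * k / 2 = k := by omega
  have d1 : (2 * k + 1) / 2 = k := by omega
  have m1 : (2 * k + 1) % 2 = 1 := by omega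
  have v0 := h.vtx _ e0
  have v1 := h.vtx _ e1
  have p0 := h.pos _ e0
  have p1 := h.pos _ e1
  have q0 := hQ.pos _ e0
  have q1 := hQ.pos _ e1
  have l0 := hQ.lab _ e0
  have l1 := hQ.lab _ e1
  have x0 := hQ.val _ e0
  have x1 := hQ.val _ e1
  have y0 := hQ.rval _ e0
  have y1 := hQ.rval _ e1
  have b0 := g.cval_le ε x (hξ k) 0 l[k].1 l[k].2
  have b1 := g.cval_le ε x (hξ k) 1 l[k].2 l[k].1
  simp only [d0, d1, own, other, m1, Nat.mul_mod_right, if_true, one_ne_zero, if_false] at v0 v1 l0 l1 x0 x1 y0 y1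
  rw [← x0] at h0 b0
  rw [← x1] at h1 b1
  rw [← y0] at r0
  rw [← y1] at r1
  have X0 : Q.val (o + 2 * k) % Γ.wordBound = Q.val (o + 2 * k) := Nat.mod_eq_of_lt (by omega)
  have X1 : Q.val (o + (2 * k + 1)) % Γ.wordBound = Q.val (o + (2 * k + 1)) :=
    Nat.mod_eq_of_lt (by omega)
  have L0 : (n - (l[k].1 : ℕ)) % Γ.wordBound = n - l[k].1 := Nat.mod_eq_of_lt (by omega)
  have L1 : (n - (l[k].2 : ℕ)) % Γ.wordBound = n - l[k].2 := Nat.mod_eq_of_lt (by omega)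
  have P0 : g.pos (o + 2 * k) % Γ.slots a % Γ.wordBound = g.pos (o + 2 * k) % Γ.slots a :=
    Nat.mod_eq_of_lt ((Nat.mod_lt _ hm0).trans hmW)
  have P1 : g.pos (o + (2 * k + 1)) % Γ.slots a % Γ.wordBound =
      g.pos (o + (2 * k + 1)) % Γ.slots a :=
    Nat.mod_eq_of_lt ((Nat.mod_lt _ hm0).trans hmW)
  have H0 : (o + 2 * k + 1) % Γ.wordBound = o + 2 * k + 1 := Nat.mod_eq_of_lt (by omega)
  have H1 : (o + (2 * k + 1) + 1) % Γ.wordBound = o + (2 * k + 1) + 1 :=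
    Nat.mod_eq_of_lt (by omega)
  have hi : (2 * a * (Γ.capacity / dim a)) = Γ.slots a := rfl
  have hkd := h.kind
  by_cases hc : g.kind = 0 ∨ g.kind = 3
  · rw [if_pos hc] at l0 l1
    have hc' : ¬ (¬ g.kind = 0 ∧ ¬ g.kind = 3) := by tauto
    simp only [requests, Prog.exec, MState.tick, BExpr.Holds, NExpr.eval, RExpr.eval, hkd, hc', hi,
      hidx, p0, p1, if_false, Requests.msg, q0, q1, r0, r1, List.append_assoc, List.cons_append,
      List.nil_append, List.append_cancel_left_eq, List.cons.injEq, Msg.mk.injEq, true_and,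
      and_true]
    refine ⟨?_, ?_⟩ <;> funext j <;> fin_cases j <;>
      simp [NExpr.eval, hi, hidx, p0, p1, P0, P1, ← ho, H0, H1, l0, l1, h0, h1, X0, X1]
  · rw [if_neg hc] at l0 l1
    have hc' : (¬ g.kind = 0 ∧ ¬ g.kind = 3) := by tauto
    simp only [requests, Prog.exec, MState.tick, BExpr.Holds, NExpr.eval, RExpr.eval, hkd, hi, hc',
      not_false_eq_true, and_self, hidx, p0, p1, if_true, Requests.msg, q0, q1, r0, r1,
      List.append_assoc, List.cons_append, List.nil_append, List.append_cancel_left_eq,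
      List.cons.injEq, Msg.mk.injEq, true_and, and_true]
    refine ⟨?_, ?_⟩ <;> funext j <;> fin_cases j <;>
      simp [NExpr.eval, hi, hidx, p0, p1, P0, P1, ← ho, H0, H1, l0, l1, h0, h1, X0, X1, v0, v1, hn,
        L0, L1]

theorem Frame.loopEnter (σ : MState (dim a)) (k : ℕ) : Frame σ (loopEnter Γ Reg.idx.ix k σ) := by
  intro ℓ hℓ
  cases ℓ <;> simp_all [Loc.Same, CorrClust.loopEnter, homeLocs, MState.tick]
  rcases hℓ with rfl | rfl | rfl | rfl <;> simp [Function.update_apply]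

theorem Frame.tick (σ : MState (dim a)) (k : ℕ) : Frame σ (σ.tick k) := by
  intro ℓ hℓ
  cases ℓ <;> rfl

theorem startCycle_frame (σ : MState (dim a)) : Frame σ ((startCycle a).exec Γ σ) :=
  Frame.exec _ _ (by
    simp [homeLocs, startCycle, byKind, contribution, requests, Prog.Writes])

theorem startCycle_spec {x : Fin n → Fin n → ℝ} {l : List (Fin n × Fin n)} {o : ℕ}
    {g : AlgState n} {σ : MState (dim a)} {Q : Requests} {ξ : ℕ → ℕ}
    (hx : ∀ u v, x u v = x v u)
    (hn : Γ.numVertices = n) (hcap : Γ.capacity < Γ.wordBound) (hm0 : 0 < Γ.slots a)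
    (hW : 2 * n + 6 < Γ.wordBound) (ho : o = Γ.myId * Γ.slots a)
    (hl : 2 * l.length ≤ Γ.slots a)
    (hoW : o + 2 * l.length < Γ.wordBound) (hQ : Q.IsFor Γ.eps x l o g ξ)
    (hξ : ∀ j, ξ j = Γ.rnd j (2 * n)) (hg : g.kind ≤ 5)
    (h : HomeIs x l o g σ) (hob : σ.outbox = []) (hd : σ.draws = 0) :
    ((startCycle a).exec Γ σ).outbox =
      (List.range (2 * l.length)).map (fun e => Q.msg (Γ.slots a) (o + e)) ∧
    ((startCycle a).exec Γ σ).nreg Reg.mode.ix = 1 := by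
  have hmc := Γ.slots_le a
  have W1 : 1 % Γ.wordBound = 1 := Nat.mod_eq_of_lt (by omega)
  refine ⟨?_, by simp [startCycle, Prog.exec, MState.tick, NExpr.eval, W1]⟩
  rw [startCycle, Prog.exec, exec_outbox (P := set a _ _) (by simp [Prog.Writes])]
  have hrec : (recordsE a).eval Γ σ = a * (Γ.capacity / dim a) := rfl
  have hlr : l.length ≤ a * (Γ.capacity / dim a) := by
    rw [Env.slots, mul_assoc] at hl; omega
  have key := exec_loop_induction (Γ := Γ) Reg.idx.ix (recordsE a)
    (match startCycle a with | .seq (.loop _ _ s) _ => s | _ => .skip) σ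
    -- In a cycle of kind 2 record `k` uses draw `k`. The minimum accounts for the passes beyond the
    -- last record, which do nothing.
    (fun k τ => HomeIs x l o g τ ∧ τ.draws = (if g.kind = 2 then min k l.length else 0) ∧
      τ.outbox = (List.range (2 * min k l.length)).map (fun e => Q.msg (Γ.slots a) (o + e)))
    ⟨h.frame (Frame.tick _ _), by simp [MState.tick, hd], by simp [MState.tick, hob]⟩ ?_
  · obtain ⟨-, -, key⟩ := key
    rw [hrec, min_eq_right hlr] at key
    exact key
  · rintro k hk τ ⟨i1, i2, i3⟩
    rw [hrec] at hk
    have hac : a * (Γ.capacity / dim a) ≤ Γ.slots a := by rw [Env.slots, mul_assoc]; omega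
    have hkW : k % Γ.wordBound = k := Nat.mod_eq_of_lt (by omega)
    have hlen := i1.len
    by_cases hkl : k < l.length
    · obtain ⟨τ₁, E₁⟩ : ∃ τ₁, τ₁ = (Prog.seq (set a .tmp₀ (.const 0)) <| .seq (set a .tmp₁ (.const 0)) <|
          .seq (rset a .tmp₀ (.ofNat (.const 0))) (rset a .tmp₁ (.ofNat (.const 0)))).exec Γ
          ((loopEnter Γ Reg.idx.ix k τ).tick 4) := ⟨_, rfl⟩
      obtain ⟨τ₂, E₂⟩ : ∃ τ₂, τ₂ = (byKind a (contribution a)).exec Γ τ₁ := ⟨_, rfl⟩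
      have hexec : (match startCycle a with | .seq (.loop _ _ s) _ => s | _ => .skip).exec Γ
          (loopEnter Γ Reg.idx.ix k τ) = (requests a).exec Γ τ₂ := by
        rw [E₂, E₁]
        simp [startCycle, Prog.exec, BExpr.Holds, NExpr.eval, loopEnter, MState.tick,
          Function.update_apply, hkW, hlen, hkl, BExpr.cost, NExpr.cost]
      rw [hexec]
      have f₁ : HomeIs x l o g τ₁ := by
        rw [E₁]
        exact i1.frame (((Frame.loopEnter τ k).trans (Frame.tick _ _)).trans
          (Frame.exec _ _ (by simp [homeLocs, Prog.Writes])))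
      have f₂ : HomeIs x l o g τ₂ := by
        rw [E₂]
        exact f₁.frame (Frame.exec _ _ (by simp [homeLocs, byKind, contribution, Prog.Writes]))
      have idx₁ : τ₁.nreg Reg.idx.ix = k := by
        rw [E₁, exec_nreg (by simp [Prog.Writes])]
        simp [loopEnter, MState.tick, hkW]
      have idx₂ : τ₂.nreg Reg.idx.ix = k := by
        rw [E₂, exec_nreg (by simp [byKind, contribution, Prog.Writes]), idx₁]
      have ob₂ : τ₂.outbox = τ.outbox := by
        rw [E₂, exec_outbox (by simp [byKind, contribution, Prog.Writes]), E₁,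
          exec_outbox (by simp [Prog.Writes])]
        rfl
      have dr₁ : τ₁.draws = τ.draws := by
        rw [E₁, exec_draws (by simp [Prog.Writes])]; rfl
      obtain ⟨c1, c2, c3, c4, c5⟩ := contribution_spec hx hn hW hg f₁ hkl idx₁
        (by rw [E₁]; simp [Prog.exec, MState.tick, NExpr.eval])
        (by rw [E₁]; simp [Prog.exec, MState.tick, NExpr.eval])
        (by rw [E₁]; simp [Prog.exec, MState.tick, NExpr.eval, RExpr.eval])
        (by rw [E₁]; simp [Prog.exec, MState.tick, NExpr.eval, RExpr.eval])
      rw [← E₂] at c1 c2 c3 c4 c5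
      have hcv : ∀ b u v, g.cval Γ.eps x (Γ.rnd τ₁.draws (2 * n)) b u v =
          g.cval Γ.eps x (ξ k) b u v := by
        intro b u v
        by_cases h2 : g.kind = 2
        · rw [dr₁, i2, if_pos h2, min_eq_left hkl.le, hξ]
        · exact AlgState.cval_congr h2 _ _ _ _ _ _ _
      rw [hcv] at c1 c2
      rw [g.crval_congr _ _ _ (ξ k)] at c3 c4
      have hξ' : ∀ j, ξ j ≤ 2 * n := fun j => by
        rw [hξ]; exact Nat.lt_succ_iff.1 (Γ.rnd j (2 * n)).2
      have hr := requests_spec hn hm0 (by omega) hW ho hoW hQ hξ' f₂ hkl idx₂ c1 c2 c3 c4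
      have m1 : min k l.length = k := min_eq_left hkl.le
      have m2 : min (k + 1) l.length = k + 1 := min_eq_left hkl
      refine ⟨f₂.frame (Frame.exec _ _ (by simp [homeLocs, requests, Prog.Writes])), ?_, ?_⟩
      · rw [exec_draws (by simp [requests, Prog.Writes]), c5, dr₁, i2, m1, m2]
        split_ifs <;> rfl
      · rw [hr, ob₂, i3, m1, m2, mul_add, mul_one, List.range_succ, List.range_succ]
        simp
    · have m1 : min k l.length = l.length := min_eq_right (by omega)
      have m2 : min (k + 1) l.length = l.length := min_eq_right (by omega)
      have hexec : (match startCycle a with | .seq (.loop _ _ s) _ => s | _ => .skip).exec Γ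
          (loopEnter Γ Reg.idx.ix k τ) = (loopEnter Γ Reg.idx.ix k τ).tick 5 := by
        simp [startCycle, Prog.exec, BExpr.Holds, NExpr.eval, loopEnter, MState.tick,
          Function.update_apply, hkW, hlen, hkl, BExpr.cost, NExpr.cost]
      rw [hexec]
      refine ⟨i1.frame ((Frame.loopEnter τ k).trans (Frame.tick _ _)), ?_, ?_⟩
      · rw [m2, ← m1]; exact i2
      · rw [m2, ← m1]; exact i3

end StartCycle

end CorrClust

namespace CorrClust

/-! ### The effect of the answers on one machine -/

section Update

variable {n a : ℕ} {Γ : Env}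

/-- The data that a machine stores for one of its home cells. -/
structure Cell where
  pos : ℕ
  status : ℕ
  prio : ℕ
  out : ℕ
  weight : ℝ

/-- The data of the home cell `e`. -/
def MState.cell (τ : MState (dim a)) (e : ℕ) : Cell where
  pos := τ.narr Arr.pos.ix e
  status := τ.narr Arr.status.ix e
  prio := τ.narr Arr.prio.ix e
  out := if e % 2 = 0 then τ.narr Arr.outL.ix (e / 2) else τ.narr Arr.outR.ix (e / 2)
  weight := τ.rarr RArr.weight.ix e

open scoped Classical in
/-- The effect of an answer on a home cell. -/
noncomputable def Cell.next (W kind total sum : ℕ) (thr : ℝ) (vtx : ℕ) (q : Msg) (c : Cell) : Cell :=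
  match kind with
  | 0 => { c with pos := (if q.num 3 = 1 then total - sum + q.num 1 else c.pos - q.num 1) % W }
  | 1 => { c with weight := q.val }
  | 2 => { c with
      prio := q.num 2 % W, status := if 0 < q.val ∧ c.status = 0 then 2 else c.status }
  | 3 => c
  | 4 => { c with
      status := if c.status = 0 ∧ thr ≤ c.weight ∧ q.num 2 = 0 then 1 else c.status }
  | _ => { c with out := (if q.num 2 = 0 then vtx else q.num 2 - 1) % W }

/-- The pass of the loop of `update`. -/
def updateBody (a : ℕ) : Prog (dim a) :=
  .seq (set a .tmp₀ (.inboxNum (rg a .idx) 0)) (byKind a (updateOne a))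

theorem updateBody_spec (hW : 5 < Γ.wordBound) (hcap : Γ.capacity < Γ.wordBound)
    {τ : MState (dim a)} {k : ℕ} {q : Msg} (hidx : τ.nreg Reg.idx.ix = k)
    (hq : τ.inbox[k]? = some q) (he : q.num 0 < Γ.capacity) {κ : ℕ}
    (hκ : τ.nreg Reg.kind.ix = κ) (hκ5 : κ ≤ 5) (e : ℕ) :
    ((updateBody a).exec Γ τ).cell e =
      if e = q.num 0 then
        (τ.cell e).next Γ.wordBound κ (τ.nreg Reg.total.ix) (τ.nreg Reg.sum.ix)
          (τ.rreg RReg.thr.ix) (τ.narr Arr.vtx.ix e) q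
      else τ.cell e := by
  have W1 : 1 % Γ.wordBound = 1 := Nat.mod_eq_of_lt (by omega)
  have W2 : 2 % Γ.wordBound = 2 := Nat.mod_eq_of_lt (by omega)
  have We : q.num 0 % Γ.wordBound = q.num 0 := Nat.mod_eq_of_lt (by omega)
  have he2 : q.num 0 / 2 < Γ.capacity := by omega
  obtain rfl | rfl | rfl | rfl | rfl | rfl : κ = 0 ∨ κ = 1 ∨ κ = 2 ∨ κ = 3 ∨ κ = 4 ∨ κ = 5 := by
    omega
  · by_cases hc : q.num 3 = 1 <;> by_cases hee : e = q.num 0 <;>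
    simp [updateBody, byKind, updateOne, Prog.exec, MState.tick, NExpr.eval, RExpr.eval,
      BExpr.Holds, Function.update_apply, hidx, hq, hκ, We, he, MState.cell, Cell.next, hc, hee]
  · by_cases hee : e = q.num 0 <;>
    simp [updateBody, byKind, updateOne, Prog.exec, MState.tick, NExpr.eval, RExpr.eval,
      BExpr.Holds, Function.update_apply, hidx, hq, hκ, We, he, MState.cell, Cell.next, hee]
  · by_cases hc : 0 < q.val ∧ τ.narr Arr.status.ix (q.num 0) = 0
    · by_cases hee : e = q.num 0 <;>
      simp [updateBody, byKind, updateOne, Prog.exec, MState.tick, NExpr.eval, RExpr.eval,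
        BExpr.Holds, Function.update_apply, hidx, hq, hκ, We, he, MState.cell, Cell.next, hee, hc,
        W2]
    · by_cases hee : e = q.num 0 <;>
      simp [updateBody, byKind, updateOne, Prog.exec, MState.tick, NExpr.eval, RExpr.eval,
        BExpr.Holds, Function.update_apply, hidx, hq, hκ, We, he, MState.cell, Cell.next, hee, hc]
  · by_cases hee : e = q.num 0 <;>
    simp [updateBody, byKind, updateOne, Prog.exec, MState.tick, NExpr.eval, RExpr.eval,
      BExpr.Holds, Function.update_apply, hidx, hq, hκ, We, he, MState.cell, Cell.next, hee]
  · by_cases hc : τ.narr Arr.status.ix (q.num 0) = 0 ∧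
        τ.rreg RReg.thr.ix ≤ τ.rarr RArr.weight.ix (q.num 0) ∧ q.num 2 = 0
    · by_cases hee : e = q.num 0 <;>
      simp [updateBody, byKind, updateOne, Prog.exec, MState.tick, NExpr.eval, RExpr.eval,
        BExpr.Holds, Function.update_apply, hidx, hq, hκ, We, he, MState.cell, Cell.next, hee, hc,
        W1]
    · by_cases hee : e = q.num 0 <;>
      simp [updateBody, byKind, updateOne, Prog.exec, MState.tick, NExpr.eval, RExpr.eval,
        BExpr.Holds, Function.update_apply, hidx, hq, hκ, We, he, MState.cell, Cell.next, hee, hc]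
  · by_cases hee : e = q.num 0
    · subst hee
      by_cases hc : q.num 2 = 0 <;> rcases Nat.mod_two_eq_zero_or_one (q.num 0) with h2 | h2 <;>
      simp [updateBody, byKind, updateOne, Prog.exec, MState.tick, NExpr.eval, RExpr.eval,
        BExpr.Holds, Function.update_apply, hidx, hq, hκ, We, he, he2, MState.cell, Cell.next, hc,
        h2]
    -- The outputs of even and odd cells are in different arrays, and different cells of equal
    -- parity have different entries.
    · have key : q.num 0 % 2 = e % 2 → e / 2 ≠ q.num 0 / 2 := by omega
      by_cases hc : q.num 2 = 0 <;> rcases Nat.mod_two_eq_zero_or_one (q.num 0) with h2 | h2 <;>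
        rcases Nat.mod_two_eq_zero_or_one e with h3 | h3 <;>
      simp [updateBody, byKind, updateOne, Prog.exec, MState.tick, NExpr.eval, RExpr.eval,
        BExpr.Holds, Function.update_apply, hidx, hq, hκ, We, he, he2, MState.cell, Cell.next, hc,
        h2, h3, hee]
      all_goals
        intro h4
        exact absurd h4 (key (by omega))

/-- The components that `update` does not change. -/
def keepLocs (a : ℕ) : List (Loc (dim a)) :=
  [.nreg Reg.kind.ix, .nreg Reg.bit.ix, .nreg Reg.total.ix, .nreg Reg.len.ix, .nreg Reg.sum.ix,
    .rreg RReg.thr.ix, .narr Arr.vtx.ix, .rarr RArr.dist.ix, .outbox, .halted, .draws]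

theorem updateBody_keeps (ℓ : Loc (dim a)) (hℓ : ℓ ∈ keepLocs a) : ¬ (updateBody a).Writes ℓ := by
  revert ℓ
  simp [keepLocs, updateBody, byKind, updateOne, Prog.Writes]

theorem update_keeps (ℓ : Loc (dim a)) (hℓ : ℓ ∈ keepLocs a) : ¬ (update a).Writes ℓ := by
  revert ℓ
  simp [keepLocs, update, byKind, updateOne, Prog.Writes]

/-- The answers address distinct cells, so each addressed cell is updated exactly once, from its old
content, and the order of the answers is irrelevant. -/
theorem update_spec (hW : 5 < Γ.wordBound) (hcap : Γ.capacity < Γ.wordBound)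
    {σ : MState (dim a)} (hlen : σ.inbox.length < Γ.wordBound)
    (hnd : (σ.inbox.map fun q => q.num 0).Nodup) (he : ∀ q ∈ σ.inbox, q.num 0 < Γ.capacity) {κ : ℕ}
    (hκ : σ.nreg Reg.kind.ix = κ) (hκ5 : κ ≤ 5) {q : Msg} (hq : q ∈ σ.inbox) :
    ((update a).exec Γ σ).cell (q.num 0) =
      (σ.cell (q.num 0)).next Γ.wordBound κ (σ.nreg Reg.total.ix) (σ.nreg Reg.sum.ix)
          (σ.rreg RReg.thr.ix) (σ.narr Arr.vtx.ix (q.num 0)) q := by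
  have key := exec_loop_induction (Γ := Γ) Reg.idx.ix (NExpr.inboxLen : NExpr (dim a))
    (updateBody a) σ
    (fun k τ => τ.inbox = σ.inbox ∧ (∀ ℓ ∈ keepLocs a, ℓ.Same σ τ) ∧
      ∀ i (hi : i < σ.inbox.length), τ.cell (σ.inbox[i].num 0) = if i < k then
        (σ.cell (σ.inbox[i].num 0)).next Γ.wordBound κ (σ.nreg Reg.total.ix) (σ.nreg Reg.sum.ix)
          (σ.rreg RReg.thr.ix) (σ.narr Arr.vtx.ix (σ.inbox[i].num 0)) σ.inbox[i]
        else σ.cell (σ.inbox[i].num 0))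
    ⟨rfl, fun ℓ _ => by cases ℓ <;> rfl, fun i hi => by simp [MState.tick, MState.cell]⟩ ?_
  · obtain ⟨i, hi, rfl⟩ := List.getElem_of_mem hq
    refine (key.2.2 i hi).trans (if_pos hi)
  · rintro k hk τ ⟨h1, h2, h3⟩
    replace hk : k < σ.inbox.length := hk
    have hkW : k % Γ.wordBound = k := Nat.mod_eq_of_lt (by omega)
    have hs : ∀ ℓ ∈ keepLocs a, ℓ.Same σ (loopEnter Γ Reg.idx.ix k τ) := by
      intro ℓ hℓ
      refine (h2 ℓ hℓ).trans' ?_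
      cases ℓ <;> simp_all [Loc.Same, loopEnter, keepLocs, MState.tick]
      rcases hℓ with rfl | rfl | rfl | rfl | rfl <;> simp [Function.update_apply]
    have hs' := hs
    simp only [keepLocs, List.mem_cons, List.not_mem_nil, or_false, forall_eq_or_imp, forall_eq,
      Loc.Same] at hs'
    obtain ⟨f1, f2, f3, f4, f5, f6, f7, f8, f9, f10⟩ := hs'
    refine ⟨by rw [exec_inbox]; exact h1,
      fun ℓ hℓ => (hs ℓ hℓ).trans' (exec_same _ _ (updateBody_keeps ℓ hℓ)), fun i hi => ?_⟩
    have hcell : ∀ e, (loopEnter Γ Reg.idx.ix k τ).cell e = τ.cell e := fun e => rfl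
    have hget : (loopEnter Γ Reg.idx.ix k τ).inbox[k]? = some σ.inbox[k] := by
      show τ.inbox[k]? = _
      rw [h1]; exact List.getElem?_eq_getElem hk
    rw [updateBody_spec hW hcap (k := k) (q := σ.inbox[k]) (κ := κ)
      (by simp [loopEnter, MState.tick, hkW]) hget (he _ (List.getElem_mem hk))
      (f1.trans hκ) hκ5, hcell, h3 i hi, f3, f5, f6, f7]
    by_cases hik : i = k
    · subst hik
      simp
    · have hne : σ.inbox[i].num 0 ≠ σ.inbox[k].num 0 := by
        intro h
        refine hik ((List.Nodup.getElem_inj_iff hnd (hi := by simpa) (hj := by simpa)).1 ?_)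
        simpa using h
      rw [if_neg hne]
      by_cases hlt : i < k
      · rw [if_pos hlt, if_pos (by omega)]
      · rw [if_neg hlt, if_neg (by omega)]


/-- The registers after the choice of the next kind of cycle. -/
noncomputable def nextThr (n : ℕ) (ε : ℝ) (kind sum : ℕ) (thr : ℝ) : ℝ :=
  if kind = 1 then n * coreR ε else if kind = 3 ∧ sum = 0 then thr / (1 + ε) else thr

/-- The place value of the next cycle. -/
def nextBit (kind bit : ℕ) : ℕ := if kind = 0 then (if bit = 0 then 1 else 2 * bit) else bit

open scoped Classical in
/-- The kind of the next cycle. -/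
noncomputable def nextKd (n : ℕ) (ε : ℝ) (kind bit sum : ℕ) (thr : ℝ) : ℕ :=
  match kind with
  | 0 => if n ≤ nextBit 0 bit then 1 else 0
  | 1 => 2
  | 2 => 3
  | 3 => if sum = 0 ∧ thr ≤ coreR ε then 5 else 4
  | 4 => 2
  | _ => 5

theorem nextKind_spec (hn : Γ.numVertices = n) (hW : 2 * n + 6 < Γ.wordBound)
    {σ : MState (dim a)} {κ b s : ℕ} {θ : ℝ}
    (hκ : σ.nreg Reg.kind.ix = κ) (hκ5 : κ < 5) (hb : σ.nreg Reg.bit.ix = b) (hbn : 2 * b < Γ.wordBound)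
    (hs : σ.nreg Reg.sum.ix = s) (hθ : σ.rreg RReg.thr.ix = θ) :
    ((nextKind a).exec Γ σ).nreg Reg.kind.ix = nextKd n Γ.eps κ b s θ ∧
    ((nextKind a).exec Γ σ).nreg Reg.bit.ix = nextBit κ b ∧
    ((nextKind a).exec Γ σ).rreg RReg.thr.ix = nextThr n Γ.eps κ s θ := by
  have W1 : 1 % Γ.wordBound = 1 := Nat.mod_eq_of_lt (by omega)
  have W2 : 2 % Γ.wordBound = 2 := Nat.mod_eq_of_lt (by omega)
  have W3 : 3 % Γ.wordBound = 3 := Nat.mod_eq_of_lt (by omega)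
  have W4 : 4 % Γ.wordBound = 4 := Nat.mod_eq_of_lt (by omega)
  have W5 : 5 % Γ.wordBound = 5 := Nat.mod_eq_of_lt (by omega)
  have Wb : 2 * b % Γ.wordBound = 2 * b := Nat.mod_eq_of_lt hbn
  obtain rfl | rfl | rfl | rfl | rfl : κ = 0 ∨ κ = 1 ∨ κ = 2 ∨ κ = 3 ∨ κ = 4 := by omega
  · by_cases hb0 : b = 0
    · by_cases hn1 : n ≤ 1 <;>
      simp [nextKind, byKind, Prog.exec, MState.tick, NExpr.eval, RExpr.eval, BExpr.Holds,
        Function.update_apply, hκ, hb, hb0, hn, hn1, W1, hθ, nextKd, nextBit, nextThr]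
    · by_cases hn1 : n ≤ 2 * b <;>
      simp [nextKind, byKind, Prog.exec, MState.tick, NExpr.eval, RExpr.eval, BExpr.Holds,
        Function.update_apply, hκ, hb, hb0, hn, hn1, W1, Wb, hθ, nextKd, nextBit, nextThr]
  · simp [nextKind, byKind, Prog.exec, MState.tick, NExpr.eval, RExpr.eval, BExpr.Holds,
        Function.update_apply, hκ, hb, hn, W2, hθ, nextKd, nextBit, nextThr, coreR]
  · simp [nextKind, byKind, Prog.exec, MState.tick, NExpr.eval, RExpr.eval, BExpr.Holds,
        Function.update_apply, hκ, hb, hn, W3, hθ, nextKd, nextBit, nextThr, coreR]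
  · by_cases h0 : s = 0
    · by_cases h1 : θ ≤ (1 - 6 * Γ.eps) / 5 <;>
      simp [nextKind, byKind, Prog.exec, MState.tick, NExpr.eval, RExpr.eval, BExpr.Holds,
        Function.update_apply, hκ, hb, hn, W4, W5, hθ, hs, h0, h1, nextKd, nextBit, nextThr, coreR]
    · simp [nextKind, byKind, Prog.exec, MState.tick, NExpr.eval, RExpr.eval, BExpr.Holds,
        Function.update_apply, hκ, hb, hn, W4, hθ, hs, h0, nextKd, nextBit, nextThr, coreR]
  · simp [nextKind, byKind, Prog.exec, MState.tick, NExpr.eval, RExpr.eval, BExpr.Holds,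
        Function.update_apply, hκ, hb, hn, W2, hθ, nextKd, nextBit, nextThr, coreR]

end Update

end CorrClust

namespace CorrClust

/-! ### The algorithm on global variables -/

section HomeRound

variable {n a M : ℕ}

/-- A function of the endpoints of the input pairs, as a function of the home cells. -/
def homeMap {β : Type*} [Zero β] (D : Fin M → List (Fin n × Fin n)) (m : ℕ) (ξ : ℕ → ℕ → ℕ)
    (F : ℕ → ℕ → Fin n → Fin n → β) (h : ℕ) : β :=
  if hi : h / m < M then
    if hj : h % m / 2 < (D ⟨h / m, hi⟩).length then
      F (ξ (h / m) (h % m / 2)) (h % m % 2) (own ((D ⟨h / m, hi⟩)[h % m / 2]) (h % m))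
        (other ((D ⟨h / m, hi⟩)[h % m / 2]) (h % m))
    else 0
  else 0

theorem homeMap_apply {β : Type*} [Zero β] (D : Fin M → List (Fin n × Fin n)) {m : ℕ}
    (ξ : ℕ → ℕ → ℕ) (F : ℕ → ℕ → Fin n → Fin n → β) (i : Fin M) (hm : 2 * (D i).length ≤ m)
    {e : ℕ} (he : e < 2 * (D i).length) :
    homeMap D m ξ F (i * m + e) = F (ξ i (e / 2)) (e % 2) (own ((D i)[e / 2]'(by omega)) e)
      (other ((D i)[e / 2]'(by omega)) e) := by
  have he' : e < m := by omega
  have h1 : (i * m + e) / m = i := by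
    rw [mul_comm, Nat.mul_add_div (by omega), Nat.div_eq_of_lt he', add_zero]
  have h2 : (i * m + e) % m = e := Nat.mul_add_mod_of_lt he'
  simp only [homeMap, h1, h2, Fin.is_lt, dif_pos, show e / 2 < (D i).length by omega, Fin.eta]

/-- The requests of a cycle; `ξ i j` is the random draw of machine `i` for its pair `j`. -/
noncomputable def reqs (ε : ℝ) (x : Fin n → Fin n → ℝ) (D : Fin M → List (Fin n × Fin n)) (m : ℕ)
    (g : AlgState n) (ξ : ℕ → ℕ → ℕ) : Requests where
  cnt j := if hj : j < M then 2 * (D ⟨j, hj⟩).length else 0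
  pos := g.pos
  lab := homeMap D m ξ fun _ _ u _ => if g.kind = 0 ∨ g.kind = 3 then 0 else n - u
  val := homeMap D m ξ (g.cval ε x)
  rval := homeMap D m ξ (g.crval ε x)

variable {ε : ℝ} {x : Fin n → Fin n → ℝ} {D : Fin M → List (Fin n × Fin n)} {m : ℕ}
  {g : AlgState n} {ξ : ℕ → ℕ → ℕ}

theorem reqs_cnt (i : Fin M) : (reqs ε x D m g ξ).cnt i = 2 * (D i).length := by
  simp [reqs]

theorem reqs_isFor (i : Fin M) (hm : 2 * (D i).length ≤ m) :
    (reqs ε x D m g ξ).IsFor ε x (D i) (i * m) g (ξ i) :=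
  ⟨fun _ _ => rfl, fun _ he => homeMap_apply D ξ
    (fun _ _ u _ => if g.kind = 0 ∨ g.kind = 3 then 0 else n - u) i hm he, fun _ he => homeMap_apply D ξ _ i hm he,
    fun _ he => homeMap_apply D ξ _ i hm he⟩

open scoped Classical in
/-- The variables of the algorithm after a cycle. -/
noncomputable def AlgState.next (M m : ℕ) (ε : ℝ) (Q : Requests) (g : AlgState n) : AlgState n where
  kind := nextKd n ε g.kind g.bit (∑ h ∈ Q.occ M m, Q.val h) g.thr
  bit := nextBit g.kind g.bit
  total := if g.kind = 0 ∧ g.bit = 0 then ∑ h ∈ Q.occ M m, Q.val h else g.total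
  thr := nextThr n ε g.kind (∑ h ∈ Q.occ M m, Q.val h) g.thr
  pos h := if g.kind = 0 then
      if Q.val h = 1 then
        (if g.kind = 0 ∧ g.bit = 0 then ∑ h ∈ Q.occ M m, Q.val h else g.total) -
          (∑ h ∈ Q.occ M m, Q.val h) + Q.before M m Q.val 0 (g.pos h)
      else g.pos h - Q.before M m Q.val 0 (g.pos h)
    else g.pos h
  weight u := if g.kind = 1 then Q.total M m Q.rval (n - u) else g.weight u
  status u := if g.kind = 2 ∧ 0 < Q.total M m Q.rval (n - u) ∧ g.status u = 0 then 2
    else if g.kind = 4 ∧ g.Active u ∧ Q.total M m Q.val (n - u) = 0 then 1 else g.status u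
  prio u := if g.kind = 2 then Q.total M m Q.val (n - u) else g.prio u

/-- The part of the round in which the answers are used. -/
noncomputable def homeUpdate (Γ : Env) (σ : MState (dim a)) : MState (dim a) :=
  (update a).exec Γ ((setTotal a).exec Γ (roundStart σ 12))

theorem homeUpdate_spec {Γ : Env} (hW : 5 < Γ.wordBound) (hcap : Γ.capacity < Γ.wordBound)
    {l : List (Fin n × Fin n)} {o : ℕ} {σ : MState (dim a)} (h : HomeIs x l o g σ)
    (hlen : σ.inbox.length < Γ.wordBound)
    (hnd : (σ.inbox.map fun q => q.num 0).Nodup) (he : ∀ q ∈ σ.inbox, q.num 0 < Γ.capacity)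
    (hκ5 : g.kind ≤ 5) (hsum : σ.nreg Reg.sum.ix < Γ.wordBound) :
    (∀ ℓ ∈ keepLocs a, ℓ.Same (roundStart σ 12) (homeUpdate Γ σ) ∨ ℓ = .nreg Reg.total.ix) ∧
    (homeUpdate Γ σ).nreg Reg.total.ix =
      (if g.kind = 0 ∧ g.bit = 0 then σ.nreg Reg.sum.ix else g.total) ∧
    ∀ q ∈ σ.inbox, (homeUpdate Γ σ).cell (q.num 0) =
      (σ.cell (q.num 0)).next Γ.wordBound g.kind
        (if g.kind = 0 ∧ g.bit = 0 then σ.nreg Reg.sum.ix else g.total) (σ.nreg Reg.sum.ix)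
        g.thr (σ.narr Arr.vtx.ix (q.num 0)) q := by
  have htot : ((setTotal a).exec Γ (roundStart σ 12)).nreg Reg.total.ix =
      (if g.kind = 0 ∧ g.bit = 0 then σ.nreg Reg.sum.ix else g.total) := by
    have e1 : (roundStart σ 12).nreg Reg.kind.ix = g.kind := h.kind
    have e2 : (roundStart σ 12).nreg Reg.bit.ix = g.bit := h.bit
    have e3 : (roundStart σ 12).nreg Reg.total.ix = g.total := h.total
    have e4 : (roundStart σ 12).nreg Reg.sum.ix = σ.nreg Reg.sum.ix := rfl
    by_cases hc : g.kind = 0 ∧ g.bit = 0 <;>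
      simp [setTotal, Prog.exec, BExpr.Holds, NExpr.eval, MState.tick, e1, e2, e3, e4, hc,
        Nat.mod_eq_of_lt hsum]
  have hkeep : ∀ ℓ ∈ keepLocs a, ℓ ≠ .nreg Reg.total.ix →
      ℓ.Same (roundStart σ 12) ((setTotal a).exec Γ (roundStart σ 12)) := fun ℓ hℓ hne =>
    exec_same _ _ (by
      rw [setTotal, Prog.Writes, Prog.Writes, Prog.Writes]
      simpa using hne)
  refine ⟨fun ℓ hℓ => ?_, ?_, fun q hq => ?_⟩
  · by_cases hne : ℓ = .nreg Reg.total.ix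
    · exact Or.inr hne
    · exact Or.inl ((hkeep ℓ hℓ hne).trans' (exec_same _ _ (update_keeps ℓ hℓ)))
  · rw [homeUpdate, exec_nreg (update_keeps _ (by simp [keepLocs])), htot]
  · have hib : ((setTotal a).exec Γ (roundStart σ 12)).inbox = σ.inbox := exec_inbox _ _
    have hna : ((setTotal a).exec Γ (roundStart σ 12)).narr = σ.narr :=
      funext fun y => exec_narr (by simp [setTotal, Prog.Writes])
    have hra : ((setTotal a).exec Γ (roundStart σ 12)).rarr = σ.rarr :=
      funext fun y => exec_rarr (by simp [setTotal, Prog.Writes])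
    have hcell : ∀ e, ((setTotal a).exec Γ (roundStart σ 12)).cell e = σ.cell e := fun e => by
      simp only [MState.cell, hna, hra]
    rw [homeUpdate, update_spec hW hcap (κ := g.kind) (by rw [hib]; exact hlen)
      (by rw [hib]; exact hnd)
      (by rw [hib]; exact he) ?_ hκ5 (by rw [hib]; exact hq), hcell, htot, hna]
    · congr 1
      · exact hkeep (.nreg Reg.sum.ix) (by simp [keepLocs]) (by simp)
      · exact Eq.trans (hkeep (.rreg RReg.thr.ix) (by simp [keepLocs]) (by simp)) h.thr
    · exact Eq.trans (hkeep (.nreg Reg.kind.ix) (by simp [keepLocs]) (by simp)) h.kind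

theorem homeRound_of_lt {Γ : Env} {σ : MState (dim a)}
    (h : (homeUpdate Γ σ).nreg Reg.kind.ix ≠ 5) :
    (homeRound a).exec Γ (roundStart σ 12) =
      (startCycle a).exec Γ ((nextKind a).exec Γ ((homeUpdate Γ σ).tick 4)) := by
  rw [homeUpdate] at h
  simp [homeRound, Prog.exec, BExpr.Holds, NExpr.eval, h, homeUpdate, BExpr.cost, NExpr.cost]

theorem homeRound_of_eq {Γ : Env} {σ : MState (dim a)}
    (h : (homeUpdate Γ σ).nreg Reg.kind.ix = 5) :
    (homeRound a).exec Γ (roundStart σ 12) =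
      (Prog.halt : Prog (dim a)).exec Γ ((homeUpdate Γ σ).tick 4) := by
  rw [homeUpdate] at h
  simp [homeRound, Prog.exec, BExpr.Holds, NExpr.eval, h, homeUpdate, BExpr.cost, NExpr.cost]

theorem homeRound_loopsLe {Γ : Env} {ib : List Msg} {B : ℕ} (h1 : ib.length ≤ B)
    (h2 : Γ.slots a ≤ B) : (homeRound a).LoopsLe Γ ib B := by
  have h3 : ∀ σ : MState (dim a), (recordsE a).eval Γ σ ≤ B := fun σ => by
    refine le_trans ?_ h2
    show a * (Γ.capacity / dim a) ≤ 2 * a * (Γ.capacity / dim a)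
    exact Nat.mul_le_mul_right _ (by omega)
  have h4 : ∀ σ : MState (dim a), σ.inbox = ib → NExpr.inboxLen.eval Γ σ ≤ B :=
    fun σ h => by simpa [NExpr.eval, h] using h1
  simp only [homeRound, setTotal, update, updateOne, byKind, nextKind, startCycle, contribution,
    requests, Prog.LoopsLe, h3, Matrix.cons_val, implies_true, true_and, and_true]
  exact h4

theorem homeRound_cost (B : ℕ) : (homeRound a).cost B ≤ 5000 * (B + 1) := by
  simp [homeRound, setTotal, update, updateOne, byKind, nextKind, startCycle, contribution,
    requests, Prog.cost, NExpr.cost, RExpr.cost, BExpr.cost, Fin.sum_univ_four]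
  omega

/-- Unless all labels are 0, the register `sum` holds different partial sums on different machines.
Outside kind 3 the next kind and the next threshold (`nextThr_congr`) ignore it, so all machines
stay synchronized. -/
theorem nextKd_congr {κ : ℕ} (h : κ ≠ 3) (b s s' : ℕ) (θ : ℝ) :
    nextKd n ε κ b s θ = nextKd n ε κ b s' θ := by
  match κ, h with
  | 0, _ => rfl
  | 1, _ => rfl
  | 2, _ => rfl
  | 4, _ => rfl
  | k + 5, _ => rfl

theorem nextKd_le (κ b s : ℕ) (θ : ℝ) : nextKd n ε κ b s θ ≤ 5 := by
  unfold nextKd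
  split
  all_goals try split_ifs
  all_goals omega

theorem nextThr_congr {κ : ℕ} (h : κ ≠ 3) (s s' : ℕ) (θ : ℝ) :
    nextThr n ε κ s θ = nextThr n ε κ s' θ := by
  simp [nextThr, h]

end HomeRound

/-! ### One home round on all machines -/

section HomeRoundGlobal

variable {n a : ℕ} {S : Setup} {x : Fin n → Fin n → ℝ} {ω : Tape} {t : ℕ}
  {D : Fin S.numMachines → List (Fin n × Fin n)} {g : AlgState n}
  {σ : Fin S.numMachines → MState (dim a)}

/-- The memories of all machines agree with the variables of the algorithm. -/
def Config (S : Setup) (x : Fin n → Fin n → ℝ) (D : Fin S.numMachines → List (Fin n × Fin n))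
    (g : AlgState n) (σ : Fin S.numMachines → MState (dim a)) : Prop :=
  ∀ i, HomeIs x (D i) (i * S.slots a) g (σ i)

/-- The random draws of a round. -/
def drawsOf (n : ℕ) (ω : Tape) (t : ℕ) (i j : ℕ) : ℕ := ω (i, t, j, 2 * n)

theorem Requests.total_le {M m W : ℕ} {Q : Requests} (hQ : Q.Valid M m W) (ℓ : ℕ) :
    Q.total M m Q.val ℓ < W :=
  lt_of_le_of_lt (Finset.sum_le_sum fun h _ => by split_ifs <;> simp) hQ.sum_lt

variable (hS : S.Fits a) (hW : 2 * n + 6 < S.wordBound)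
  (hD : ∀ i, 2 * (D i).length ≤ S.slots a) {ξ : ℕ → ℕ → ℕ}

include hS hD in
theorem answered_cell (hQ : (reqs S.eps x D (S.slots a) g ξ).Valid S.numMachines (S.slots a)
      S.wordBound) (hκ : g.kind ≤ 5)
    (hA : Answered (reqs S.eps x D (S.slots a) g ξ) S σ) (hC : Config S x D g σ) (i : Fin S.numMachines) :
    (∀ ℓ ∈ keepLocs a, ℓ.Same (roundStart (σ i) 12) (homeUpdate (S.env ω t i) (σ i)) ∨
      ℓ = .nreg Reg.total.ix) ∧
    (homeUpdate (S.env ω t i) (σ i)).nreg Reg.total.ix =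
      (if g.kind = 0 ∧ g.bit = 0 then (σ i).nreg Reg.sum.ix else g.total) ∧
    ∀ e < 2 * (D i).length, (homeUpdate (S.env ω t i) (σ i)).cell e =
      ((σ i).cell e).next S.wordBound g.kind
        (if g.kind = 0 ∧ g.bit = 0 then (σ i).nreg Reg.sum.ix else g.total)
        ((σ i).nreg Reg.sum.ix) g.thr ((σ i).narr Arr.vtx.ix e)
        ((reqs S.eps x D (S.slots a) g ξ).answer S.numMachines (S.slots a)
          (i * S.slots a + e)) := by
  have hm := hQ.m_pos
  have hmc : S.slots a ≤ S.capacity := (S.env ω t i).slots_le a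
  obtain ⟨h1, h2, h3⟩ := homeUpdate_spec (Γ := S.env ω t i) hS.big hS.cap (hC i)
    (by show _ < S.wordBound
        have := hA.length_le i; have := hS.cap; omega) (hA.nodup i)
    (by intro q hq
        obtain ⟨e, -, rfl⟩ := (hA.mem i q).1 hq
        show _ % _ < S.capacity
        exact (Nat.mod_lt _ hm).trans_le hmc) hκ (hA.sum_lt i)
  refine ⟨h1, h2, fun e he => ?_⟩
  have hem : e < S.slots a := he.trans_le (hD i)
  have := h3 _ ((hA.mem i _).2 ⟨e, by rw [reqs_cnt]; exact he, rfl⟩)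
  rw [show ((reqs S.eps x D (S.slots a) g ξ).answer S.numMachines (S.slots a)
      (i * S.slots a + e)).num 0 = e from Nat.mul_add_mod_of_lt hem] at this
  exact this

include hS hW hD in
theorem homeRound_step (hx : ∀ u v, x u v = x v u) (hSn : S.numVertices = n)
    (hQ : (reqs S.eps x D (S.slots a) g ξ).Valid S.numMachines (S.slots a)
      S.wordBound) (hκ : g.kind < 5) (hbit : 2 * g.bit < S.wordBound)
    (hA : Answered (reqs S.eps x D (S.slots a) g ξ) S σ) (hC : Config S x D g σ) {g' : AlgState n}
    (hg' : g' = g.next S.numMachines (S.slots a) S.eps (reqs S.eps x D (S.slots a) g ξ))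
    (hQ' : (reqs S.eps x D (S.slots a) g' (drawsOf n ω t)).Valid S.numMachines (S.slots a)
      S.wordBound) :
    Config S x D g' (mpcRound (clusterProg a) S ω t σ) ∧
    Posted (reqs S.eps x D (S.slots a) g' (drawsOf n ω t)) S
      (mpcRound (clusterProg a) S ω t σ) ∧
    ∀ i, (mpcRound (clusterProg a) S ω t σ i).work ≤ (σ i).work + 6000 * (S.slots a + 1) := by
  have hm := hQ.m_pos
  set Q := reqs S.eps x D (S.slots a) g ξ with hQd
  set s := ∑ h ∈ Q.occ S.numMachines (S.slots a), Q.val h with hs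
  -- In these two kinds all labels are 0, hence `sum` is the global sum on every machine.
  have hsum' : g.kind = 0 ∨ g.kind = 3 → ∀ i, (σ i).nreg Reg.sum.ix = s := by
    intro hk i
    refine hA.sum (fun h hh => ?_) i
    have hlt := Requests.home_lt hh
    have hc := (Finset.mem_filter.1 hh).2
    simp [hQd, reqs, homeMap, hk]
  have hcell := answered_cell (ω := ω) (t := t) hS hD hQ (by omega) hA hC
  have hkeep : ∀ i, (∀ ℓ ∈ keepLocs a, ℓ ≠ .nreg Reg.total.ix →
      ℓ.Same (roundStart (σ i) 12) ((homeUpdate (S.env ω t i) (σ i)).tick 4)) := fun i ℓ hℓ hne =>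
    ((hcell i).1 ℓ hℓ).resolve_right hne
  have hloc : ∀ i, localRound (clusterProg a) (S.env ω t i) (σ i) =
      (homeRound a).exec (S.env ω t i) (roundStart (σ i) 12) := fun i =>
    clusterProg_mode_three (hA.light i).running (hA.mode i)
  have hkd : ∀ i, (homeUpdate (S.env ω t i) (σ i)).nreg Reg.kind.ix = g.kind := fun i =>
    Eq.trans (hkeep i (.nreg Reg.kind.ix) (by simp [keepLocs]) (by simp)) (hC i).kind
  have hexec := fun i => homeRound_of_lt (Γ := S.env ω t i) (σ := σ i)
    (by rw [hkd i]; omega)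
  have hnk := fun i => nextKind_spec (a := a) (Γ := S.env ω t i) hSn hW
    (σ := (homeUpdate (S.env ω t i) (σ i)).tick 4) (hkd i) hκ
    (Eq.trans (hkeep i (.nreg Reg.bit.ix) (by simp [keepLocs]) (by simp)) (hC i).bit) hbit
    (hkeep i (.nreg Reg.sum.ix) (by simp [keepLocs]) (by simp))
    (Eq.trans (hkeep i (.rreg RReg.thr.ix) (by simp [keepLocs]) (by simp)) (hC i).thr)
  -- The validity of the next requests shows that the new positions fit into words, so the reduction
  -- modulo the word bound in `Cell.next` has no effect.
  have hposW : ∀ i : Fin S.numMachines, ∀ e < 2 * (D i).length,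
      g'.pos (i * S.slots a + e) < S.wordBound := by
    intro i e he
    have hem : e < S.slots a := he.trans_le (hD i)
    exact (hQ'.pos_lt _ ((Requests.mem_occ hm i.2 hem).2 (by rw [reqs_cnt]; exact he))).trans
      hQ'.size_lt
  -- the state before the requests are sent
  have hhome : ∀ i, HomeIs x (D i) (i * S.slots a) g'
      ((nextKind a).exec (S.env ω t i) ((homeUpdate (S.env ω t i) (σ i)).tick 4)) := by
    intro i
    have hna : ∀ y, ((nextKind a).exec (S.env ω t i)
        ((homeUpdate (S.env ω t i) (σ i)).tick 4)).narr y =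
        (homeUpdate (S.env ω t i) (σ i)).narr y :=
      fun y => exec_narr (by simp [nextKind, byKind, Prog.Writes])
    have hra : ∀ y, ((nextKind a).exec (S.env ω t i)
        ((homeUpdate (S.env ω t i) (σ i)).tick 4)).rarr y =
        (homeUpdate (S.env ω t i) (σ i)).rarr y :=
      fun y => exec_rarr (by simp [nextKind, byKind, Prog.Writes])
    have htot : (if g.kind = 0 ∧ g.bit = 0 then (σ i).nreg Reg.sum.ix else g.total) =
        (if g.kind = 0 ∧ g.bit = 0 then s else g.total) := by
      by_cases hc : g.kind = 0 ∧ g.bit = 0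
      · rw [if_pos hc, if_pos hc, hsum' (Or.inl hc.1)]
      · rw [if_neg hc, if_neg hc]
    have hvtx : (homeUpdate (S.env ω t i) (σ i)).narr Arr.vtx.ix = (σ i).narr Arr.vtx.ix :=
      hkeep i (.narr Arr.vtx.ix) (by simp [keepLocs]) (by simp)
    have hfor := reqs_isFor (ε := S.eps) (x := x) (g := g) (ξ := ξ) i (hD i)
    have ans : ∀ e (he : e < 2 * (D i).length),
        (homeUpdate (S.env ω t i) (σ i)).narr Arr.pos.ix e = g'.pos (i * S.slots a + e) ∧
        (homeUpdate (S.env ω t i) (σ i)).narr Arr.status.ix e =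
          g'.status (own ((D i)[e / 2]'(by omega)) e) ∧
        (homeUpdate (S.env ω t i) (σ i)).narr Arr.prio.ix e =
          g'.prio (own ((D i)[e / 2]'(by omega)) e) ∧
        (homeUpdate (S.env ω t i) (σ i)).rarr RArr.weight.ix e =
          g'.weight (own ((D i)[e / 2]'(by omega)) e) := by
      intro e he
      have hc := (hcell i).2.2 e he
      rw [htot, ← hQd] at hc
      have c1 := congrArg Cell.pos hc
      have c2 := congrArg Cell.status hc
      have c3 := congrArg Cell.prio hc
      have c4 := congrArg Cell.weight hc
      have p1 := (hC i).pos e he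
      have p2 := (hC i).status e he
      have p3 := (hC i).prio e he
      have p4 := (hC i).weight e he
      have hlab := hfor.lab e he
      have hv := hfor.val e he
      have hWp := hposW i e he
      rw [← hQd] at hlab hv
      have hpos : Q.pos (i * S.slots a + e) = g.pos (i * S.slots a + e) := rfl
      simp only [MState.cell] at c1 c2 c3 c4
      rw [c1, c2, c3, c4]
      obtain hk | hk | hk | hk | hk : g.kind = 0 ∨ g.kind = 1 ∨ g.kind = 2 ∨ g.kind = 3 ∨
        g.kind = 4 := by omega
      · rw [if_pos (Or.inl hk)] at hlab
        have hss := hsum' (Or.inl hk) i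
        rw [hg'] at hWp
        simp only [AlgState.next, hk, true_and, if_true] at hWp
        simp [Cell.next, hk, Requests.answer, hg', AlgState.next, p1, p2, p3, p4, hss, hlab, hpos]
        rw [Nat.mod_eq_of_lt]
        exact hWp
      · rw [if_neg (by omega)] at hlab
        simp [Cell.next, hk, Requests.answer, hg', AlgState.next, p1, p2, p3, p4, hlab]
      · rw [if_neg (by omega)] at hlab
        have hb := Requests.total_le hQ (n - own ((D i)[e / 2]'(by omega)) e)
        simp [Cell.next, hk, Requests.answer, hg', AlgState.next, p1, p2, p3, p4, hlab,
          Nat.mod_eq_of_lt hb]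
      · simp [Cell.next, hk, hg', AlgState.next, p1, p2, p3, p4]
      · rw [if_neg (by omega)] at hlab
        simp [Cell.next, hk, Requests.answer, hg', AlgState.next, AlgState.Active, p1, p2, p3, p4,
          hlab, and_assoc]
    refine ⟨?_, ?_, ?_, ?_, ?_, ?_, ?_, ?_, ?_, ?_, ?_⟩
    · rw [(hnk i).1, hg']
      by_cases hk : g.kind = 3
      · rw [show (roundStart (σ i) 12).nreg Reg.sum.ix = s from hsum' (Or.inr hk) i]; rfl
      · exact nextKd_congr hk _ _ _ _
    · rw [(hnk i).2.1, hg']; rfl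
    · rw [exec_nreg (by simp [nextKind, byKind, Prog.Writes]), hg']
      exact ((hcell i).2.1).trans htot
    · rw [(hnk i).2.2, hg']
      by_cases hk : g.kind = 3
      · rw [show (roundStart (σ i) 12).nreg Reg.sum.ix = s from hsum' (Or.inr hk) i]; rfl
      · exact nextThr_congr hk _ _ _
    · rw [exec_nreg (by simp [nextKind, byKind, Prog.Writes])]
      exact Eq.trans (hkeep i (.nreg Reg.len.ix) (by simp [keepLocs]) (by simp)) (hC i).len
    · rw [hra]
      have : (homeUpdate (S.env ω t i) (σ i)).rarr RArr.dist.ix = (σ i).rarr RArr.dist.ix :=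
        hkeep i (.rarr RArr.dist.ix) (by simp [keepLocs]) (by simp)
      rw [this]; exact (hC i).dist
    · rw [hna, hvtx]; exact (hC i).vtx
    · rw [hna]; exact fun e he => (ans e he).1
    · rw [hna]; exact fun e he => (ans e he).2.1
    · rw [hna]; exact fun e he => (ans e he).2.2.1
    · rw [hra]; exact fun e he => (ans e he).2.2.2
  have hkd5 : g'.kind ≤ 5 := by
    rw [hg']
    exact nextKd_le _ _ _ _
  have hstart := fun i : Fin S.numMachines => startCycle_spec (Γ := S.env ω t i) (l := D i)
    (o := i * S.slots a) (Q := reqs S.eps x D (S.slots a) g' (drawsOf n ω t))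
    (ξ := drawsOf n ω t i) hx hSn hS.cap hS.slots_pos hW rfl (hD i)
    (by
      have h1 : (i : ℕ) * S.slots a + S.slots a ≤ S.numMachines * S.slots a := by
        rw [← Nat.succ_mul]; exact Nat.mul_le_mul_right _ i.2
      have h2 := hD i
      have h3 := hQ.size_lt
      show _ < S.wordBound
      omega)
    (reqs_isFor i (hD i)) (fun j => rfl) hkd5 (hhome i)
    (by
      rw [exec_outbox (by simp [nextKind, byKind, Prog.Writes])]
      exact hkeep i .outbox (by simp [keepLocs]) (by simp))
    (by
      rw [exec_draws (by simp [nextKind, byKind, Prog.Writes])]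
      exact hkeep i .draws (by simp [keepLocs]) (by simp))
  have hloc' := fun i => (hloc i).trans (hexec i)
  have hout : ∀ i : Fin S.numMachines, ((startCycle a).exec (S.env ω t i)
      ((nextKind a).exec (S.env ω t i) ((homeUpdate (S.env ω t i) (σ i)).tick 4))).outbox =
      (reqs S.eps x D (S.slots a) g' (drawsOf n ω t)).posts (S.slots a) i := fun i => by
    rw [(hstart i).1, Requests.posts, reqs_cnt]; rfl
  have hround := mpcRound_eq hloc' hout
  refine ⟨fun i => ?_, ⟨fun i => ⟨?_, ?_, ?_⟩, fun i => ?_, fun i => ?_⟩, fun i => ?_⟩ <;>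
    rw [hround i]
  · exact ((hhome i).frame (startCycle_frame _)).frame (Frame.with_inbox _ _)
  · refine Eq.trans (exec_halted (Γ := S.env ω t i) (P := startCycle a) (by simp [startCycle,
      byKind, contribution, requests, Prog.Writes])) ?_
    rw [exec_halted (by simp [nextKind, byKind, Prog.Writes])]
    exact Eq.trans (hkeep i .halted (by simp [keepLocs]) (by simp)) (hA.light i).running
  · exact (Requests.deliver_posts_length hQ' i).trans (Nat.le_add_right _ _)
  · show ((startCycle a).exec _ _).outbox.length ≤ _
    rw [hout, Requests.posts, List.length_map, List.length_range]
    exact (hQ'.cnt_le i).trans (Nat.le_add_right _ _)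
  · exact (hstart i).2
  · show ((startCycle a).exec _ _).work ≤ _
    rw [← hexec]
    have h1 := exec_work_le (Γ := S.env ω t i) (B := S.slots a) (homeRound a)
      (roundStart (σ i) 12) (homeRound_loopsLe (hA.length_le i) le_rfl)
    have h2 := homeRound_cost (a := a) (S.slots a)
    have h3 : (roundStart (σ i) 12).work = (σ i).work + 12 := rfl
    omega

include hS hD in
theorem homeRound_halt
    (hQ : (reqs S.eps x D (S.slots a) g ξ).Valid S.numMachines (S.slots a)
      S.wordBound) (hκ : g.kind = 5)
    (hA : Answered (reqs S.eps x D (S.slots a) g ξ) S σ) (hC : Config S x D g σ) (i : Fin S.numMachines) :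
    (mpcRound (clusterProg a) S ω t σ i).halted = true ∧
    (mpcRound (clusterProg a) S ω t σ i).inbox = [] ∧
    (mpcRound (clusterProg a) S ω t σ i).outbox = [] ∧
    (mpcRound (clusterProg a) S ω t σ i).work ≤ (σ i).work + 6000 * (S.slots a + 1) ∧
    ∀ e (he : e < 2 * (D i).length), ((mpcRound (clusterProg a) S ω t σ i).cell e).out =
      (if (reqs S.eps x D (S.slots a) g ξ).total S.numMachines (S.slots a)
          (reqs S.eps x D (S.slots a) g ξ).val (n - own ((D i)[e / 2]'(by omega)) e) = 0 then
        (own ((D i)[e / 2]'(by omega)) e : ℕ) else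
        (reqs S.eps x D (S.slots a) g ξ).total S.numMachines (S.slots a)
          (reqs S.eps x D (S.slots a) g ξ).val (n - own ((D i)[e / 2]'(by omega)) e) - 1) %
        S.wordBound := by
  have hcell := answered_cell (ω := ω) (t := t) hS hD hQ (by omega) hA hC
  have hkeep : ∀ i, (∀ ℓ ∈ keepLocs a, ℓ ≠ .nreg Reg.total.ix →
      ℓ.Same (roundStart (σ i) 12) ((homeUpdate (S.env ω t i) (σ i)).tick 4)) := fun i ℓ hℓ hne =>
    ((hcell i).1 ℓ hℓ).resolve_right hne
  have hloc : ∀ i, localRound (clusterProg a) (S.env ω t i) (σ i) =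
      (homeRound a).exec (S.env ω t i) (roundStart (σ i) 12) := fun i =>
    clusterProg_mode_three (hA.light i).running (hA.mode i)
  have hkd : ∀ i, (homeUpdate (S.env ω t i) (σ i)).nreg Reg.kind.ix = 5 := fun i =>
    (Eq.trans (hkeep i (.nreg Reg.kind.ix) (by simp [keepLocs]) (by simp)) (hC i).kind).trans hκ
  have hexec := fun i => homeRound_of_eq (Γ := S.env ω t i) (σ := σ i) (hkd i)
  have hob : ∀ i, ((Prog.halt : Prog (dim a)).exec (S.env ω t i)
      ((homeUpdate (S.env ω t i) (σ i)).tick 4)).outbox = [] := fun i =>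
    hkeep i .outbox (by simp [keepLocs]) (by simp)
  rw [mpcRound_eq (fun i => (hloc i).trans (hexec i)) hob i]
  refine ⟨rfl, ?_, hob i, ?_, fun e he => ?_⟩
  · show deliver (fun i : Fin S.numMachines => []) (i : ℕ) = []
    simp [deliver]
  · show ((Prog.halt : Prog (dim a)).exec (S.env ω t i) _).work ≤ _
    rw [← hexec]
    have h1 := exec_work_le (Γ := S.env ω t i) (B := S.slots a) (homeRound a)
      (roundStart (σ i) 12) (homeRound_loopsLe (hA.length_le i) le_rfl)
    have h2 := homeRound_cost (a := a) (S.slots a)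
    have h3 : (roundStart (σ i) 12).work = (σ i).work + 12 := rfl
    omega
  · have hc := (hcell i).2.2 e he
    have hfor := reqs_isFor (ε := S.eps) (x := x) (g := g) (ξ := ξ) i (hD i)
    have hlab := hfor.lab e he
    rw [if_neg (by omega)] at hlab
    refine (congrArg Cell.out hc).trans ?_
    rw [hκ]
    simp only [Cell.next, Requests.answer, hlab, (hC i).vtx e he]
    rfl

end HomeRoundGlobal

end CorrClust

namespace CorrClust

/-! ### The first round -/

section Load

variable {n a : ℕ}

/-- The initial values of the variables of the algorithm. -/
def AlgState.start (n : ℕ) : AlgState n where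
  kind := 0
  bit := 0
  total := 0
  thr := 0
  pos := id
  weight := 0
  status := 0
  prio := 0

theorem loadInput_spec {Γ : Env} {G : SimpleGraph (Fin n)} {x : Fin n → Fin n → ℝ}
    {l : List (Fin n × Fin n)} {o i : ℕ} (hcap : Γ.capacity < Γ.wordBound) (hn : n < Γ.wordBound)
    (hl : 2 * l.length ≤ Γ.slots a) (ho : o = Γ.myId * Γ.slots a)
    (hoW : o + 2 * l.length < Γ.wordBound) {σ : MState (dim a)} {k₀ : ℕ}
    (hσ : σ = roundStart (initState (dim a) (l.map (inputRecord G x i))) k₀) :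
    HomeIs x l o (AlgState.start n) ((loadInput a).exec Γ σ) := by
  have hmc := Γ.slots_le a
  have hlen : σ.inbox.length = l.length := by rw [hσ]; simp [roundStart, initState]
  have hmod : l.length % Γ.wordBound = l.length := Nat.mod_eq_of_lt (by omega)
  obtain ⟨σ₁, e₁⟩ : ∃ σ₁, σ₁ = (set a .len .inboxLen).exec Γ σ := ⟨_, rfl⟩
  have hexec : (loadInput a).exec Γ σ =
      (match loadInput a with | .seq _ s => s | s => s).exec Γ σ₁ := by rw [e₁]; rfl
  have hib : σ₁.inbox = l.map (inputRecord G x i) := by rw [e₁, hσ]; rfl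
  have hlen₁ : σ₁.nreg Reg.len.ix = l.length := by
    rw [e₁]; simp [Prog.exec, MState.tick, NExpr.eval, hlen, hmod]
  have key := exec_loop_induction (Γ := Γ) Reg.idx.ix (NExpr.inboxLen : NExpr (dim a))
    (match loadInput a with | .seq _ (.loop _ _ s) => s | s => s) σ₁
    (fun k τ => τ.inbox = σ₁.inbox ∧
      (∀ j (hj : j < l.length), j < k → τ.rarr RArr.dist.ix j = x l[j].1 l[j].2) ∧
      (∀ e (he : e < 2 * l.length), e < 2 * k →
        τ.narr Arr.vtx.ix e = own (l[e / 2]'(by omega)) e) ∧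
      (∀ e (he : e < 2 * l.length), e < 2 * k → τ.narr Arr.pos.ix e = o + e))
    ⟨rfl, by simp, by simp, by simp⟩ ?_
  · obtain ⟨-, k1, k2, k3⟩ := key
    have hev : (NExpr.inboxLen : NExpr (dim a)).eval Γ σ₁ = l.length := by
      simp [NExpr.eval, hib]
    rw [hev] at k1 k2 k3
    have z1 : ∀ y, y ≠ Reg.idx → y ≠ Reg.tmp₀ → y ≠ Reg.len →
        ((loadInput a).exec Γ σ).nreg y.ix = 0 := by
      intro y h1 h2 h3
      rw [exec_nreg (by simp [loadInput, Prog.Writes, h1, h2, h3]), hσ]; rfl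
    have z2 : ∀ y, y ≠ Arr.vtx → y ≠ Arr.pos → ((loadInput a).exec Γ σ).narr y.ix = fun _ => 0 := by
      intro y h1 h2
      rw [exec_narr (by simp [loadInput, Prog.Writes, h1, h2]), hσ]; rfl
    have z3 : ∀ y, y ≠ RArr.dist → ((loadInput a).exec Γ σ).rarr y.ix = fun _ => 0 := by
      intro y h1
      rw [exec_rarr (by simp [loadInput, Prog.Writes, h1]), hσ]; rfl
    refine ⟨z1 _ (by simp) (by simp) (by simp), z1 _ (by simp) (by simp) (by simp),
      z1 _ (by simp) (by simp) (by simp), ?_, ?_, fun j hj => ?_, fun e he => ?_, fun e he => ?_,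
      fun e he => ?_, fun e he => ?_, fun e he => ?_⟩
    · rw [exec_rreg (by simp [loadInput, Prog.Writes]), hσ]; rfl
    · rw [hexec, exec_nreg (by simp [loadInput, Prog.Writes]), hlen₁]
    · rw [hexec]; exact k1 j hj hj
    · rw [hexec]; exact k2 e he he
    · rw [hexec]; exact k3 e he he
    · rw [z2 _ (by simp) (by simp)]; rfl
    · rw [z2 _ (by simp) (by simp)]; rfl
    · rw [z3 _ (by simp)]; rfl
  · rintro k hk τ ⟨i1, i2, i3, i4⟩
    replace hk : k < l.length := by simpa [NExpr.eval, hib] using hk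
    have hkW : k % Γ.wordBound = k := Nat.mod_eq_of_lt (by omega)
    have hkW2 : 2 * k % Γ.wordBound = 2 * k := Nat.mod_eq_of_lt (by omega)
    have hget : τ.inbox[k]? = some (inputRecord G x i l[k]) := by
      rw [i1, hib]; simp [hk]
    have w1 : (l[k].1 : ℕ) % Γ.wordBound = l[k].1 := Nat.mod_eq_of_lt (l[k].1.2.trans hn)
    have w2 : (l[k].2 : ℕ) % Γ.wordBound = l[k].2 := Nat.mod_eq_of_lt (l[k].2.2.trans hn)
    have w3 : (o + 2 * k) % Γ.wordBound = o + 2 * k := Nat.mod_eq_of_lt (by omega)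
    have w4 : (o + (2 * k + 1)) % Γ.wordBound = o + (2 * k + 1) := Nat.mod_eq_of_lt (by omega)
    have c0 : k < Γ.capacity := by omega
    have c1 : 2 * k < Γ.capacity := by omega
    have c2 : 2 * k + 1 < Γ.capacity := by omega
    have hi : (2 * a * (Γ.capacity / dim a)) = Γ.slots a := rfl
    refine ⟨by rw [exec_inbox]; exact i1, fun j hj hjk => ?_, fun e he hek => ?_,
      fun e he hek => ?_⟩
    · by_cases h : j = k
      · subst h
        simp [loadInput, Prog.exec, loopEnter, MState.tick, NExpr.eval, RExpr.eval,
          Function.update_apply, hkW, hkW2, hget, inputRecord, c0, c1, c2, hi]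
      · simp [loadInput, Prog.exec, loopEnter, MState.tick, NExpr.eval, RExpr.eval,
          Function.update_apply, hkW, hkW2, hget, inputRecord, c0, c1, c2, hi, h,
          i2 j hj (by omega)]
    · by_cases h : e = 2 * k
      · subst h
        have hd : 2 * k / 2 = k := by omega
        simp [loadInput, Prog.exec, loopEnter, MState.tick, NExpr.eval, RExpr.eval,
          Function.update_apply, hkW, hkW2, hget, inputRecord, c0, c1, c2, hi, own, hd, w1, w2]
      · by_cases h' : e = 2 * k + 1
        · subst h'
          have hd : (2 * k + 1) / 2 = k := by omega
          have hd' : (2 * k + 1) % 2 = 1 := by omega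
          simp [loadInput, Prog.exec, loopEnter, MState.tick, NExpr.eval, RExpr.eval,
            Function.update_apply, hkW, hkW2, hget, inputRecord, c0, c1, c2, hi, own, hd, hd', w1,
            w2]
        · simp [loadInput, Prog.exec, loopEnter, MState.tick, NExpr.eval, RExpr.eval,
            Function.update_apply, hkW, hkW2, hget, inputRecord, c0, c1, c2, hi, h, h',
            i3 e he (by omega)]
    · by_cases h : e = 2 * k
      · subst h
        simp [loadInput, Prog.exec, loopEnter, MState.tick, NExpr.eval, RExpr.eval,
          Function.update_apply, hkW, hkW2, hget, inputRecord, c0, c1, c2, hi, ← ho, w3]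
      · by_cases h' : e = 2 * k + 1
        · subst h'
          simp [loadInput, Prog.exec, loopEnter, MState.tick, NExpr.eval, RExpr.eval,
            Function.update_apply, hkW, hkW2, hget, inputRecord, c0, c1, c2, hi, ← ho, w4]
        · simp [loadInput, Prog.exec, loopEnter, MState.tick, NExpr.eval, RExpr.eval,
            Function.update_apply, hkW, hkW2, hget, inputRecord, c0, c1, c2, hi, h, h',
            i4 e he (by omega)]

theorem load_cost (B : ℕ) : (Prog.seq (loadInput a) (startCycle a)).cost B ≤ 5000 * (B + 1) := by
  simp [loadInput, byKind, startCycle, contribution,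
    requests, Prog.cost, NExpr.cost, RExpr.cost, BExpr.cost, Fin.sum_univ_four]
  omega

theorem load_loopsLe {Γ : Env} {ib : List Msg} {B : ℕ} (h1 : ib.length ≤ B)
    (h2 : Γ.slots a ≤ B) : (Prog.seq (loadInput a) (startCycle a)).LoopsLe Γ ib B := by
  have h3 : ∀ σ : MState (dim a), (recordsE a).eval Γ σ ≤ B := fun σ => by
    refine le_trans ?_ h2
    show a * (Γ.capacity / dim a) ≤ 2 * a * (Γ.capacity / dim a)
    exact Nat.mul_le_mul_right _ (by omega)
  have h4 : ∀ σ : MState (dim a), σ.inbox = ib → NExpr.inboxLen.eval Γ σ ≤ B :=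
    fun σ h => by simpa [NExpr.eval, h] using h1
  simp only [loadInput, byKind, startCycle, contribution,
    requests, Prog.LoopsLe, h3, Matrix.cons_val, implies_true, true_and, and_true]
  exact h4

variable {S : Setup} {x : Fin n → Fin n → ℝ} {ω : Tape} {t : ℕ}
  {D : Fin S.numMachines → List (Fin n × Fin n)} {G : SimpleGraph (Fin n)}

theorem load_step (hS : S.Fits a) (hW : 2 * n + 6 < S.wordBound)
    (hD : ∀ i, 2 * (D i).length ≤ S.slots a) (hx : ∀ u v, x u v = x v u) (hSn : S.numVertices = n)
    (hQ : (reqs S.eps x D (S.slots a) (AlgState.start n) (drawsOf n ω 0)).Valid S.numMachines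
      (S.slots a) S.wordBound) :
    Config S x D (AlgState.start n) (roundingRun (clusterProg a) S G x D ω 1) ∧
    Posted (reqs S.eps x D (S.slots a) (AlgState.start n) (drawsOf n ω 0)) S
      (roundingRun (clusterProg a) S G x D ω 1) ∧
    ∀ i, (roundingRun (clusterProg a) S G x D ω 1 i).work ≤ 6000 * (S.slots a + 1) := by
  have hm := hQ.m_pos
  have hoW : ∀ i : Fin S.numMachines, (i : ℕ) * S.slots a + 2 * (D i).length < S.wordBound := by
    intro i
    have h1 : (i : ℕ) * S.slots a + S.slots a ≤ S.numMachines * S.slots a := by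
      rw [← Nat.succ_mul]; exact Nat.mul_le_mul_right _ i.2
    have h2 := hD i
    have h3 := hQ.size_lt
    omega
  set σ := roundingRun (clusterProg a) S G x D ω 0 with hσ
  have hrun : roundingRun (clusterProg a) S G x D ω 1 = mpcRound (clusterProg a) S ω 0 σ := rfl
  have hloc : ∀ i, localRound (clusterProg a) (S.env ω 0 i) (σ i) =
      (startCycle a).exec (S.env ω 0 i) ((loadInput a).exec (S.env ω 0 i) (roundStart (σ i) 4)) :=
    fun i => clusterProg_mode_zero rfl rfl
  have hhome := fun i : Fin S.numMachines => loadInput_spec (a := a) (Γ := S.env ω 0 i) (G := G)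
    (x := x) (l := D i) (o := i * S.slots a) (i := i) hS.cap
    (by show n < S.wordBound; omega) (hD i) rfl
    (hoW i) (σ := roundStart (σ i) 4) rfl
  have hstart := fun i : Fin S.numMachines => startCycle_spec (Γ := S.env ω 0 i) (l := D i)
    (o := i * S.slots a) (Q := reqs S.eps x D (S.slots a) (AlgState.start n) (drawsOf n ω 0))
    (ξ := drawsOf n ω 0 i) hx hSn hS.cap hS.slots_pos hW rfl (hD i) (hoW i)
    (reqs_isFor i (hD i)) (fun j => rfl) (Nat.zero_le _) (hhome i)
    (by rw [exec_outbox (by simp [loadInput, Prog.Writes])]; rfl)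
    (by rw [exec_draws (by simp [loadInput, Prog.Writes])]; rfl)
  have hout : ∀ i : Fin S.numMachines, ((startCycle a).exec (S.env ω 0 i)
      ((loadInput a).exec (S.env ω 0 i) (roundStart (σ i) 4))).outbox =
      (reqs S.eps x D (S.slots a) (AlgState.start n) (drawsOf n ω 0)).posts (S.slots a) i := fun i => by
    rw [(hstart i).1, Requests.posts, reqs_cnt]; rfl
  have hround := mpcRound_eq hloc hout
  rw [hrun]
  refine ⟨fun i => ?_, ⟨fun i => ⟨?_, ?_, ?_⟩, fun i => ?_, fun i => ?_⟩, fun i => ?_⟩ <;>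
    rw [hround i]
  · exact ((hhome i).frame (startCycle_frame _)).frame (Frame.with_inbox _ _)
  · refine Eq.trans (exec_halted (Γ := S.env ω 0 i) (P := startCycle a) (by simp [startCycle,
      byKind, contribution, requests, Prog.Writes])) ?_
    rw [exec_halted (by simp [loadInput, Prog.Writes])]
    rfl
  · exact (Requests.deliver_posts_length hQ i).trans (Nat.le_add_right _ _)
  · show ((startCycle a).exec _ _).outbox.length ≤ _
    rw [hout, Requests.posts, List.length_map, List.length_range]
    exact (hQ.cnt_le i).trans (Nat.le_add_right _ _)
  · exact (hstart i).2
  · have h1 := exec_work_le (Γ := S.env ω 0 i) (B := S.slots a)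
      (Prog.seq (loadInput a) (startCycle a)) (roundStart (σ i) 4) (load_loopsLe (by
        have : (roundStart (σ i) 4).inbox.length = (D i).length := by
          show ((D i).map _).length = _
          rw [List.length_map]
        rw [this]; have := hD i; omega) le_rfl)
    have h2 := load_cost (a := a) (S.slots a)
    have h3 : (roundStart (σ i) 4).work = 4 := rfl
    show ((Prog.seq (loadInput a) (startCycle a)).exec (S.env ω 0 i) (roundStart (σ i) 4)).work ≤ _
    omega

end Load

end CorrClust

namespace CorrClust

/-! ### From sums over home cells to sums over pairs -/

section Sums

variable {n M : ℕ} {β : Type*} [AddCommMonoid β]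

theorem sum_occ (Q : Requests) {m : ℕ} (hm : 0 < m) (hcnt : ∀ j, Q.cnt j ≤ m) (f : ℕ → β) :
    ∑ h ∈ Q.occ M m, f h = ∑ i : Fin M, ∑ e ∈ Finset.range (Q.cnt i), f (i * m + e) := by
  rw [Requests.occ, Finset.sum_filter]
  have := Requests.sum_range_mul_add (fun h => if h % m < Q.cnt (h / m) then f h else 0) M m 0
  rw [Finset.sum_range_zero, add_zero, add_zero] at this
  rw [this, Finset.sum_range]
  refine Finset.sum_congr rfl fun i _ => ?_
  have h1 : ∀ e ∈ Finset.range m, (if (i * m + e) % m < Q.cnt ((i * m + e) / m)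
      then f (i * m + e) else 0) = if e < Q.cnt i then f (i * m + e) else 0 := by
    intro e he
    rw [Finset.mem_range] at he
    rw [Nat.mul_add_mod_of_lt he, mul_comm (i : ℕ), Nat.mul_add_div hm, Nat.div_eq_of_lt he,
      add_zero]
  rw [Finset.sum_congr rfl h1, ← Finset.sum_filter]
  congr 1
  ext e
  have := hcnt i
  simp only [Finset.mem_filter, Finset.mem_range]
  omega

theorem sum_occ_homeMap {m : ℕ} (hm : 0 < m) {D : Fin M → List (Fin n × Fin n)}
    (hD : ∀ i, 2 * (D i).length ≤ m) (ε : ℝ) (x : Fin n → Fin n → ℝ) (g : AlgState n)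
    (ξ : ℕ → ℕ → ℕ) (F : ℕ → ℕ → Fin n → Fin n → β) :
    ∑ h ∈ (reqs ε x D m g ξ).occ M m, homeMap D m ξ F h =
      ∑ i : Fin M, ∑ j : Fin (D i).length,
        (F (ξ i j) 0 ((D i).get j).1 ((D i).get j).2 +
          F (ξ i j) 1 ((D i).get j).2 ((D i).get j).1) := by
  rw [sum_occ _ hm]
  · refine Finset.sum_congr rfl fun i _ => ?_
    rw [reqs_cnt]
    have := Requests.sum_range_mul_add (fun e => homeMap D m ξ F (i * m + e)) (D i).length 2 0
    rw [Finset.sum_range_zero, add_zero, add_zero] at this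
    rw [mul_comm, this, Finset.sum_range]
    refine Finset.sum_congr rfl fun j _ => ?_
    have hj := j.2
    rw [Finset.sum_range_succ, Finset.sum_range_one,
      homeMap_apply D ξ F i (hD i) (by omega), homeMap_apply D ξ F i (hD i) (by omega)]
    have e0 : ((j : ℕ) * 2 + 0) / 2 = j := by omega
    have e1 : ((j : ℕ) * 2 + 1) / 2 = j := by omega
    have e2 : ((j : ℕ) * 2 + 0) % 2 = 0 := by omega
    have e3 : ((j : ℕ) * 2 + 1) % 2 = 1 := by omega
    simp only [own, other, e0, e1, e2, e3, List.get_eq_getElem, if_true, one_ne_zero, if_false]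
  · intro j
    by_cases hj : j < M
    · simpa [reqs, hj] using hD ⟨j, hj⟩
    · simp [reqs, hj]

theorem sum_pairs {K : Finset (Fin n × Fin n)} {b : ℕ} {D : Fin M → List (Fin n × Fin n)}
    (hD : IsDistribution K b D) (φ : Fin n × Fin n → β) :
    ∑ i : Fin M, ∑ j : Fin (D i).length, φ ((D i).get j) = ∑ p ∈ K, φ p := by
  have h1 : ∀ i, ∑ j : Fin (D i).length, φ ((D i).get j) =
      ((D i : Multiset (Fin n × Fin n)).map φ).sum := by
    intro i
    rw [Multiset.map_coe, Multiset.sum_coe, ← List.sum_ofFn, List.ofFn_eq_map]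
    rw [show (fun j => φ ((D i).get j)) = φ ∘ (D i).get from rfl, ← List.map_map,
      List.map_get_finRange]
  simp_rw [h1]
  show _ = (K.val.map φ).sum
  rw [← hD.partition]
  have := map_sum (Multiset.sumAddMonoidHom.comp (Multiset.mapAddMonoidHom φ))
    (fun i => (D i : Multiset (Fin n × Fin n))) Finset.univ
  exact this.symm

open scoped Classical in
-- A pair is represented with its smaller endpoint first, so `u` meets the pair `uv` once, as first
-- or as second endpoint; by `hF` this makes no difference. The self-loop meets `u` twice, with both
-- indices.
theorem sum_relevant {G : SimpleGraph (Fin n)} {x : Fin n → Fin n → ℝ}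
    (hx : ∀ u v, x u v = x v u) (F : ℕ → Fin n → Fin n → β)
    (hF : ∀ u v, u ≠ v → F 0 u v = F 1 u v) (u : Fin n) :
    (∑ p ∈ relevantPairs G x, ((if p.1 = u then F 0 p.1 p.2 else 0) +
      if p.2 = u then F 1 p.2 p.1 else 0)) =
      (F 0 u u + F 1 u u) + ∑ v ∈ Finset.univ.erase u,
        if G.Adj u v ∨ x u v < 1 then F 0 u v else 0 := by
  rw [relevantPairs, Finset.sum_filter, ← Finset.univ_product_univ, Finset.sum_product]
  have h1 : ∀ w v : Fin n, (if w ≤ v ∧ (w = v ∨ G.Adj w v ∨ x w v < 1) then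
      ((if w = u then F 0 w v else 0) + if v = u then F 1 v w else 0) else 0) =
      (if w = u then (if u ≤ v ∧ (u = v ∨ G.Adj u v ∨ x u v < 1) then F 0 u v else 0) else 0) +
      (if v = u then (if w ≤ u ∧ (w = u ∨ G.Adj w u ∨ x w u < 1) then F 1 u w else 0) else 0) := by
    intro w v
    by_cases hw : w = u
    · subst hw
      by_cases hv : v = w
      · subst hv; simp
      · simp [hv]
    · by_cases hv : v = u
      · subst hv; simp [hw]
      · simp [hw, hv]
  simp_rw [h1, Finset.sum_add_distrib]
  rw [Finset.sum_comm]
  simp only [Finset.sum_ite_eq', Finset.mem_univ, if_true]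
  rw [← Finset.sum_add_distrib, ← Finset.add_sum_erase _ _ (Finset.mem_univ u)]
  congr 1
  · simp
  · refine Finset.sum_congr rfl fun v hv => ?_
    have hvu : v ≠ u := Finset.ne_of_mem_erase hv
    have ha : G.Adj v u ↔ G.Adj u v := G.adj_comm _ _
    rcases lt_or_gt_of_ne hvu with h | h
    · simp [h.le, h.not_ge, hvu, hvu.symm, ha, hx v u, hF u v hvu.symm]
    · simp [h.le, h.not_ge, hvu, hvu.symm, ha, hx v u]

/-- The indicator of `(u, u)` sums to 1 over all records. The unique record found in this way is the
place where the priority of `u` is drawn. -/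
theorem exists_self_record {G : SimpleGraph (Fin n)} {x : Fin n → Fin n → ℝ} {b : ℕ}
    {D : Fin M → List (Fin n × Fin n)} (hD : IsDistribution (relevantPairs G x) b D) (u : Fin n) :
    ∃ (i : Fin M) (j : Fin (D i).length), (D i).get j = (u, u) ∧
      ∀ (i' : Fin M) (j' : Fin (D i').length), (D i').get j' = (u, u) →
        (i' : ℕ) = i ∧ (j' : ℕ) = j := by
  classical
  have hsum := sum_pairs hD (fun p => if p = (u, u) then 1 else 0)
  rw [Finset.sum_ite_eq', if_pos (by simp [relevantPairs])] at hsum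
  have hex : ∃ (i : Fin M) (j : Fin (D i).length), (D i).get j = (u, u) := by
    by_contra hne
    push Not at hne
    simp [hne, -List.get_eq_getElem] at hsum
  obtain ⟨i, j, hij⟩ := hex
  refine ⟨i, j, hij, fun i' j' hij' => ?_⟩
  have f1 : ∀ (k : Fin M) (j : Fin (D k).length), (if (D k).get j = (u, u) then 1 else 0) ≤
      ∑ j : Fin (D k).length, if (D k).get j = (u, u) then 1 else 0 := fun k j =>
    Finset.single_le_sum (f := fun j : Fin (D k).length =>
      if (D k).get j = (u, u) then 1 else 0) (fun _ _ => Nat.zero_le _) (Finset.mem_univ j)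
  have hi : i' = i := by
    by_contra hne
    have h1 := Finset.add_le_sum (f := fun i => ∑ j : Fin (D i).length,
      if (D i).get j = (u, u) then 1 else 0) (fun _ _ => Nat.zero_le _) (Finset.mem_univ i')
      (Finset.mem_univ i) hne
    have h2 := f1 i j
    have h3 := f1 i' j'
    simp only [hij, hij', if_true] at h2 h3
    omega
  subst hi
  refine ⟨rfl, ?_⟩
  by_contra hne
  have h1 := Finset.add_le_sum (f := fun j : Fin (D i').length =>
    if (D i').get j = (u, u) then 1 else 0) (fun _ _ => Nat.zero_le _) (Finset.mem_univ j')
    (Finset.mem_univ j) (fun h => hne (congrArg Fin.val h))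
  have h2 := Finset.single_le_sum (f := fun i => ∑ j : Fin (D i).length,
      if (D i).get j = (u, u) then 1 else 0) (fun _ _ => Nat.zero_le _) (Finset.mem_univ i')
  simp only [hij, hij', if_true] at h1
  omega

end Sums

end CorrClust

namespace CorrClust

/-! ### Stable partitions of ranks -/

section Rank

/-- The positions of the elements of `H` are `0, …, |H| - 1`. -/
def IsRank (H : Finset ℕ) (pos : ℕ → ℕ) : Prop :=
  (∀ h ∈ H, ∀ h' ∈ H, pos h = pos h' → h = h') ∧ ∀ h ∈ H, pos h < H.card

variable {H : Finset ℕ} {pos w : ℕ → ℕ}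

theorem IsRank.dense (hr : IsRank H pos) {p : ℕ} (hp : p < H.card) : ∃ h ∈ H, pos h = p := by
  have := Finset.surj_on_of_inj_on_of_card_le (s := H) (t := Finset.range H.card)
    (fun h _ => pos h) (fun h hh => Finset.mem_range.2 (hr.2 h hh))
    (fun h h' hh hh' e => hr.1 h hh h' hh' e) (by simp) p (Finset.mem_range.2 hp)
  obtain ⟨h, hh, e⟩ := this
  exact ⟨h, hh, e.symm⟩

theorem IsRank.card_below (hr : IsRank H pos) {h : ℕ} (hh : h ∈ H) :
    (∑ h' ∈ H, if pos h' < pos h then 1 else 0) = pos h := by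
  rw [← Finset.card_filter]
  have himg : (H.filter fun h' => pos h' < pos h).image pos = Finset.range (pos h) := by
    ext p
    simp only [Finset.mem_image, Finset.mem_filter, Finset.mem_range]
    constructor
    · rintro ⟨h', ⟨-, h2⟩, rfl⟩
      exact h2
    · intro hp
      obtain ⟨h', hh', rfl⟩ := hr.dense (hp.trans (hr.2 h hh))
      exact ⟨h', ⟨hh', hp⟩, rfl⟩
  have hc : ((H.filter fun h' => pos h' < pos h).image pos).card =
      (H.filter fun h' => pos h' < pos h).card := Finset.card_image_of_injOn ?_
  · rw [← hc, himg, Finset.card_range]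
  intro y hy z hz e
  exact hr.1 y (Finset.mem_filter.1 hy).1 z (Finset.mem_filter.1 hz).1 e

theorem sum_below_add_le {q : ℕ} {h : ℕ} (hh : h ∈ H) (hq : pos h < q) :
    (∑ h' ∈ H, if pos h' < pos h then w h' else 0) + w h ≤
      ∑ h' ∈ H, if pos h' < q then w h' else 0 := by
  have : w h = ∑ h' ∈ H, if h' = h then w h' else 0 := by
    rw [Finset.sum_ite_eq', if_pos hh]
  rw [this, ← Finset.sum_add_distrib]
  refine Finset.sum_le_sum fun h' _ => ?_
  by_cases e : h' = h
  · subst e; simp [hq]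
  · by_cases h1 : pos h' < pos h
    · simp [e, h1, h1.trans hq]
    · simp [e, h1]

theorem sum_below_add_le_sum {h : ℕ} (hh : h ∈ H) :
    (∑ h' ∈ H, if pos h' < pos h then w h' else 0) + w h ≤ ∑ h' ∈ H, w h' := by
  refine (sum_below_add_le hh (Nat.lt_succ_self _)).trans (Finset.sum_le_sum fun h' _ => ?_)
  split_ifs <;> simp

/-- A stable partition by a bit turns ranks into ranks. -/
theorem IsRank.partition (hr : IsRank H pos) {val pos' : ℕ → ℕ} (hv : ∀ h ∈ H, val h ≤ 1)
    (hpos' : ∀ h ∈ H, pos' h = if val h = 1 then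
      H.card - (∑ h' ∈ H, val h') + ∑ h' ∈ H, (if pos h' < pos h then val h' else 0)
      else pos h - ∑ h' ∈ H, (if pos h' < pos h then val h' else 0)) :
    IsRank H pos' ∧ ∀ h ∈ H, ∀ h' ∈ H,
      val h < val h' ∨ val h = val h' ∧ pos h < pos h' → pos' h < pos' h' := by
  have hcard : H.card = ∑ h' ∈ H, val h' + ∑ h' ∈ H, (1 - val h') := by
    rw [← Finset.sum_add_distrib, Finset.card_eq_sum_ones]
    exact Finset.sum_congr rfl fun h hh => by have := hv h hh; omega
  -- A rank counts the ones and the zeros before it; subtracting the ones leaves the number of zeros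
  -- before, the new position of a zero.
  have hsplit : ∀ h ∈ H, pos h = (∑ h' ∈ H, if pos h' < pos h then val h' else 0) +
      ∑ h' ∈ H, if pos h' < pos h then 1 - val h' else 0 := by
    intro h hh
    rw [← Finset.sum_add_distrib]
    refine (hr.card_below hh).symm.trans (Finset.sum_congr rfl fun h' hh' => ?_)
    have := hv h' hh'
    split_ifs <;> omega
  have hord : ∀ h ∈ H, ∀ h' ∈ H,
      val h < val h' ∨ val h = val h' ∧ pos h < pos h' → pos' h < pos' h' := by
    intro h hh h' hh' hlt
    rw [hpos' h hh, hpos' h' hh']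
    have a1 := sum_below_add_le_sum (pos := pos) (w := fun h => 1 - val h) hh
    have e1 := hsplit h hh
    have e2 := hsplit h' hh'
    have v1 := hv h hh
    have v2 := hv h' hh'
    rcases hlt with hlt | ⟨he, hlt⟩
    · rw [if_neg (by omega), if_pos (by omega)]
      omega
    · have a2 := sum_below_add_le (w := val) hh hlt
      have a3 := sum_below_add_le (w := fun h => 1 - val h) hh hlt
      by_cases h1 : val h = 1
      · rw [if_pos h1, if_pos (by omega)]
        omega
      · rw [if_neg h1, if_neg (by omega)]
        omega
  refine ⟨⟨fun h hh h' hh' he => ?_, fun h hh => ?_⟩, hord⟩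
  · by_contra hne
    have hp : pos h ≠ pos h' := fun e => hne (hr.1 h hh h' hh' e)
    have o1 := hord h hh h' hh'
    have o2 := hord h' hh' h hh
    omega
  · rw [hpos' h hh]
    have a1 := sum_below_add_le_sum (pos := pos) (w := val) hh
    have a2 := hr.2 h hh
    split_ifs with h1 <;> omega

theorem isRank_count (H : Finset ℕ) :
    IsRank H fun h => ∑ h' ∈ H, if h' < h then 1 else 0 := by
  have hlt : ∀ h ∈ H, ∀ h' ∈ H, h < h' →
      (∑ k ∈ H, if k < h then 1 else 0) < ∑ k ∈ H, if k < h' then 1 else 0 := fun h hh h' hh' hl =>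
    sum_below_add_le (pos := id) (w := fun _ => 1) hh hl
  refine ⟨fun h hh h' hh' he => ?_, fun h hh => ?_⟩
  · rcases lt_trichotomy h h' with hl | hl | hl
    · exact absurd he (hlt h hh h' hh' hl).ne
    · exact hl
    · exact absurd he (hlt h' hh' h hh hl).ne'
  · rw [Finset.card_eq_sum_ones]
    exact sum_below_add_le_sum (pos := id) (w := fun _ => 1) hh

end Rank

/-! ### The radix sort of the home cells -/

section Radix

variable {n M m : ℕ} {ε : ℝ} {x : Fin n → Fin n → ℝ} {D : Fin M → List (Fin n × Fin n)}
  {g : AlgState n} {ξ : ℕ → ℕ → ℕ}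

/-- The home cells in use. -/
def homeSet (D : Fin M → List (Fin n × Fin n)) (m : ℕ) : Finset ℕ :=
  (Finset.range (M * m)).filter fun h =>
    h % m < if hj : h / m < M then 2 * (D ⟨h / m, hj⟩).length else 0

theorem occ_reqs : (reqs ε x D m g ξ).occ M m = homeSet D m := rfl

/-- The vertex of a home cell. -/
def homeVtx (D : Fin M → List (Fin n × Fin n)) (m : ℕ) : ℕ → ℕ :=
  homeMap D m (fun _ _ => 0) fun _ _ u _ => (u : ℕ)

theorem exists_home {h : ℕ} (hh : h ∈ homeSet D m) :
    ∃ u v : Fin n, homeVtx D m h = u ∧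
      ∀ (β : Type) [Zero β] (ξ : ℕ → ℕ → ℕ) (F : ℕ → ℕ → Fin n → Fin n → β),
        homeMap D m ξ F h = F (ξ (h / m) (h % m / 2)) (h % m % 2) u v := by
  simp only [homeSet, Finset.mem_filter] at hh
  obtain ⟨-, h2⟩ := hh
  by_cases hi : h / m < M
  · rw [dif_pos hi] at h2
    have hj : h % m / 2 < (D ⟨h / m, hi⟩).length := by omega
    refine ⟨own ((D ⟨h / m, hi⟩)[h % m / 2]) (h % m),
      other ((D ⟨h / m, hi⟩)[h % m / 2]) (h % m), ?_, fun β _ ξ F => ?_⟩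
    · simp only [homeVtx, homeMap, dif_pos hi, dif_pos hj]
    · simp only [homeMap, dif_pos hi, dif_pos hj]
  · rw [dif_neg hi] at h2
    omega

theorem homeVtx_lt {h : ℕ} (hh : h ∈ homeSet D m) : homeVtx D m h < n := by
  obtain ⟨u, v, e, -⟩ := exists_home hh
  exact e ▸ u.2

theorem reqs_val_zero (hk : g.kind = 0) {h : ℕ} (hh : h ∈ homeSet D m) :
    (reqs ε x D m g ξ).val h = if g.bit = 0 then 1 else homeVtx D m h / g.bit % 2 := by
  obtain ⟨u, v, e, hF⟩ := exists_home hh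
  rw [e]
  refine (hF ℕ ξ (g.cval ε x)).trans ?_
  simp [AlgState.cval, hk]

theorem reqs_lab {h : ℕ} (hh : h ∈ homeSet D m) :
    (reqs ε x D m g ξ).lab h = if g.kind = 0 ∨ g.kind = 3 then 0 else n - homeVtx D m h := by
  obtain ⟨u, v, e, hF⟩ := exists_home hh
  rw [e]
  exact hF ℕ ξ fun _ _ u _ => if g.kind = 0 ∨ g.kind = 3 then 0 else n - u

/-- How far the home cells are sorted by their vertices. -/
def RadixInv (D : Fin M → List (Fin n × Fin n)) (m : ℕ) (g : AlgState n) : Prop :=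
  -- Three stages: positions with gaps before the first cycle; ranks sorted by the vertices modulo
  -- the current place value; ranks sorted by the vertices.
  (g.kind = 0 ∧ g.bit = 0 ∧ g.pos = id) ∨
  IsRank (homeSet D m) g.pos ∧
  ((g.kind = 0 ∧ 1 ≤ g.bit ∧ g.bit < n ∧ g.total = (homeSet D m).card ∧
    ∀ h ∈ homeSet D m, ∀ h' ∈ homeSet D m,
      homeVtx D m h % g.bit < homeVtx D m h' % g.bit → g.pos h < g.pos h') ∨
  (1 ≤ g.kind ∧ g.bit < 2 * n ∧
    ∀ h ∈ homeSet D m, ∀ h' ∈ homeSet D m,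
      homeVtx D m h < homeVtx D m h' → g.pos h < g.pos h'))

theorem RadixInv.bit_lt (h : RadixInv D m g) (hn : 2 ≤ n) : g.bit < 2 * n := by
  rcases h with h | ⟨-, h | h⟩ <;> omega

theorem nextKd_pos {κ b s : ℕ} {θ : ℝ} (h : 1 ≤ κ) : 1 ≤ nextKd n ε κ b s θ := by
  unfold nextKd
  split
  all_goals try split_ifs
  all_goals omega

theorem reqs_before_zero (hk : g.kind = 0) (φ : ℕ → ℕ) (p : ℕ) :
    (reqs ε x D m g ξ).before M m φ 0 p =
      ∑ h' ∈ homeSet D m, if g.pos h' < p then φ h' else 0 := by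
  refine Finset.sum_congr (occ_reqs) fun h hh => ?_
  have : (reqs ε x D m g ξ).lab h = 0 := by rw [reqs_lab hh, if_pos (Or.inl hk)]
  rw [this]
  simp [reqs]

theorem RadixInv.next (hn : 2 ≤ n) (h : RadixInv D m g) :
    RadixInv D m (g.next M m ε (reqs ε x D m g ξ)) := by
  have hsum : ∑ h ∈ (reqs ε x D m g ξ).occ M m, (reqs ε x D m g ξ).val h =
    ∑ h ∈ homeSet D m, (reqs ε x D m g ξ).val h := rfl
  rcases h with ⟨hk, hb, hp⟩ | ⟨hr, ⟨hk, hb1, hbn, htot, hs⟩ | ⟨hk, hb, hs⟩⟩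
  · have hv : ∀ h ∈ homeSet D m, (reqs ε x D m g ξ).val h = 1 := fun h hh => by
      rw [reqs_val_zero hk hh, if_pos hb]
    have hpos : ∀ h ∈ homeSet D m, (g.next M m ε (reqs ε x D m g ξ)).pos h =
        ∑ h' ∈ homeSet D m, if h' < h then 1 else 0 := by
      intro h hh
      simp only [AlgState.next, hk, hb, if_true, hv h hh, and_self, reqs_before_zero hk,
        Nat.sub_self, zero_add, hp, id]
      exact Finset.sum_congr rfl fun h' hh' => by rw [hv h' hh']
    refine Or.inr ⟨?_, Or.inl ⟨?_, ?_, ?_, ?_, ?_⟩⟩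
    · obtain ⟨h1, h2⟩ := isRank_count (homeSet D m)
      exact ⟨fun h hh h' hh' => by rw [hpos h hh, hpos h' hh']; exact h1 h hh h' hh',
        fun h hh => by rw [hpos h hh]; exact h2 h hh⟩
    · simp only [AlgState.next, nextKd, hk, hb, nextBit, if_true]
      rw [if_neg (by omega)]
    · simp [AlgState.next, nextBit, hk, hb]
    · simp only [AlgState.next, nextBit, hk, hb, if_true]; omega
    · simp only [AlgState.next, hk, hb, and_self, if_true, hsum, Finset.sum_congr rfl hv]
      simp
    · intro h _ h' _ hlt
      simp [AlgState.next, nextBit, hk, hb, Nat.mod_one] at hlt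
  · have hb0 : g.bit ≠ 0 := by omega
    have hv : ∀ h ∈ homeSet D m, (reqs ε x D m g ξ).val h = homeVtx D m h / g.bit % 2 :=
      fun h hh => by rw [reqs_val_zero hk hh, if_neg hb0]
    obtain ⟨hr', hord⟩ := hr.partition (val := (reqs ε x D m g ξ).val)
      (pos' := (g.next M m ε (reqs ε x D m g ξ)).pos)
      (fun h hh => by rw [hv h hh]; omega)
      (fun h hh => by
        simp only [AlgState.next, hk, hb0, if_true, and_false, if_false, reqs_before_zero hk, htot,
          hsum])
    have hord' : ∀ h ∈ homeSet D m, ∀ h' ∈ homeSet D m,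
        homeVtx D m h % (g.bit * 2) < homeVtx D m h' % (g.bit * 2) →
        (g.next M m ε (reqs ε x D m g ξ)).pos h < (g.next M m ε (reqs ε x D m g ξ)).pos h' := by
      intro h hh h' hh' hlt
      -- A residue modulo twice the place value is the residue modulo the place value plus the new
      -- digit times the place value: the new digit decides, and for equal digits the old order,
      -- which the partition preserves.
      rw [Nat.mod_mul, Nat.mod_mul, ← hv h hh, ← hv h' hh'] at hlt
      refine hord h hh h' hh' ?_
      have m1 := Nat.mod_lt (homeVtx D m h) hb1
      have m2 := Nat.mod_lt (homeVtx D m h') hb1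
      have v1 : (reqs ε x D m g ξ).val h ≤ 1 := by rw [hv h hh]; omega
      have v2 : (reqs ε x D m g ξ).val h' ≤ 1 := by rw [hv h' hh']; omega
      obtain e1 | e1 : (reqs ε x D m g ξ).val h = 0 ∨ (reqs ε x D m g ξ).val h = 1 := by omega
      · obtain e2 | e2 : (reqs ε x D m g ξ).val h' = 0 ∨ (reqs ε x D m g ξ).val h' = 1 := by omega
        · rw [e1, e2] at hlt
          exact Or.inr ⟨e1.trans e2.symm, hs h hh h' hh' (by omega)⟩
        · left; omega
      · obtain e2 | e2 : (reqs ε x D m g ξ).val h' = 0 ∨ (reqs ε x D m g ξ).val h' = 1 := by omega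
        · rw [e1, e2, mul_one, mul_zero] at hlt
          omega
        · rw [e1, e2, mul_one] at hlt
          exact Or.inr ⟨e1.trans e2.symm, hs h hh h' hh' (by omega)⟩
    have hbit : (g.next M m ε (reqs ε x D m g ξ)).bit = g.bit * 2 := by
      simp only [AlgState.next, nextBit, hk, hb0, if_true, if_false]; omega
    have hkind : (g.next M m ε (reqs ε x D m g ξ)).kind = if n ≤ g.bit * 2 then 1 else 0 := by
      simp only [AlgState.next, nextKd, nextBit, hk, hb0, if_true, if_false, mul_comm 2]
    by_cases hc : n ≤ g.bit * 2
    · rw [if_pos hc] at hkind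
      refine Or.inr ⟨hr', Or.inr ⟨hkind.ge, by omega, fun h hh h' hh' hlt => ?_⟩⟩
      refine hord' h hh h' hh' ?_
      rwa [Nat.mod_eq_of_lt ((homeVtx_lt hh).trans_le hc),
        Nat.mod_eq_of_lt ((homeVtx_lt hh').trans_le hc)]
    · rw [if_neg hc] at hkind
      refine Or.inr ⟨hr', Or.inl ⟨hkind, by omega, by omega, ?_, by rw [hbit]; exact hord'⟩⟩
      simp [AlgState.next, hb0, htot]
  · have hk0 : g.kind ≠ 0 := by omega
    have hpos : (g.next M m ε (reqs ε x D m g ξ)).pos = g.pos := by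
      funext h; simp [AlgState.next, hk0]
    have hbit : (g.next M m ε (reqs ε x D m g ξ)).bit = g.bit := by
      simp [AlgState.next, nextBit, hk0]
    refine Or.inr ⟨by rwa [hpos], Or.inr ⟨nextKd_pos hk, by rwa [hbit], by rwa [hpos]⟩⟩

/-- Labels `n - u` are used only after the sorting, when the positions are ranks ordered by
vertices: then they have no gaps and the labels decrease. In kinds 0 and 3 all labels are 0 and
nothing is to be checked. No summand exceeds `2 * n + 1`. -/
theorem RadixInv.valid {W : ℕ} (hn : 2 ≤ n) (h : RadixInv D m g) (hm : 0 < m)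
    (hD : ∀ i, 2 * (D i).length ≤ m) (hξ : ∀ i j, ξ i j ≤ 2 * n) (hnW : n < W)
    (hW : (2 * n + 1) * (M * m) < W) : (reqs ε x D m g ξ).Valid M m W where
  m_pos := hm
  cnt_le j := by
    by_cases hj : j < M
    · simpa [reqs, hj] using hD ⟨j, hj⟩
    · simp [reqs, hj]
  pos_lt k hk := by
    have hk' : k < M * m := Finset.mem_range.1 (Finset.mem_filter.1 hk).1
    rcases h with ⟨-, -, hp⟩ | ⟨hr, -⟩
    · show g.pos k < _
      rw [hp]; exact hk'
    · refine (hr.2 k hk).trans_le ((Finset.card_filter_le _ _).trans ?_)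
      rw [Finset.card_range]
  inj := by
    rcases h with ⟨-, -, hp⟩ | ⟨hr, -⟩
    · intro k _ k' _ he
      change g.pos k = g.pos k' at he
      rwa [hp] at he
    · exact hr.1
  lab_lt k hk := by
    rw [reqs_lab hk]
    split_ifs <;> omega
  anti k hk k' hk' hle := by
    rw [reqs_lab hk, reqs_lab hk']
    by_cases hc : g.kind = 0 ∨ g.kind = 3
    · simp [hc]
    · rw [if_neg hc, if_neg hc]
      rcases h with h | ⟨hr, h | h⟩
      · omega
      · omega
      · have := h.2.2 k' hk' k hk
        change g.pos k ≤ g.pos k' at hle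
        omega
  dense k hk hl p hp := by
    rw [reqs_lab hk] at hl
    rcases h with h | ⟨hr, -⟩
    · simp [h.1] at hl
    · exact hr.dense (lt_trans hp (hr.2 k hk))
  sum_lt := by
    refine lt_of_le_of_lt (Finset.sum_le_card_nsmul _ _ (2 * n + 1) fun k hk => ?_) ?_
    · obtain ⟨u, v, -, hF⟩ := exists_home hk
      rw [show (reqs ε x D m g ξ).val k = _ from hF ℕ ξ (g.cval ε x)]
      exact g.cval_le ε x (hξ _ _) _ u v
    · refine lt_of_le_of_lt ?_ hW
      rw [smul_eq_mul, mul_comm]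
      refine Nat.mul_le_mul_left _ ((Finset.card_filter_le _ _).trans ?_)
      rw [Finset.card_range]
  size_lt := lt_of_le_of_lt (Nat.le_mul_of_pos_left _ (by omega)) hW

end Radix

end CorrClust

namespace CorrClust

/-! ### The machines simulate the algorithm -/

section Simulation

variable {n a : ℕ}

/-- The conditions on an instance under which the simulation of the algorithm is correct. -/
structure Regular (a : ℕ) {n : ℕ} (S : Setup) (x : Fin n → Fin n → ℝ)
    (D : Fin S.numMachines → List (Fin n × Fin n)) : Prop where
  fits : S.Fits a
  two_le : 2 ≤ n
  word : 4 * n + 6 < S.wordBound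
  load : ∀ i, 2 * (D i).length ≤ S.slots a
  symm : ∀ u v, x u v = x v u
  num : S.numVertices = n
  size : (2 * n + 1) * (S.numMachines * S.slots a) < S.wordBound

theorem Regular.word' {a n : ℕ} {S : Setup} {x : Fin n → Fin n → ℝ}
    {D : Fin S.numMachines → List (Fin n × Fin n)} (hR : Regular a S x D) :
    2 * n + 6 < S.wordBound := by
  have := hR.word
  omega

/-- The variables of the algorithm after `c` cycles, each of which takes `p` rounds. -/
noncomputable def algRun {M : ℕ} (ε : ℝ) (x : Fin n → Fin n → ℝ)
    (D : Fin M → List (Fin n × Fin n)) (m p : ℕ) (ω : Tape) : ℕ → AlgState n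
  | 0 => AlgState.start n
  | c + 1 => (algRun ε x D m p ω c).next M m ε
      (reqs ε x D m (algRun ε x D m p ω c) (drawsOf n ω (c * p)))

/-- The cluster ID of a vertex, as computed from the answers of the last cycle. -/
noncomputable def clusterId {M : ℕ} (ε : ℝ) (x : Fin n → Fin n → ℝ)
    (D : Fin M → List (Fin n × Fin n)) (m : ℕ) (g : AlgState n) (ξ : ℕ → ℕ → ℕ) (u : Fin n) : ℕ :=
  if (reqs ε x D m g ξ).total M m (reqs ε x D m g ξ).val (n - u) = 0 then (u : ℕ)
  else (reqs ε x D m g ξ).total M m (reqs ε x D m g ξ).val (n - u) - 1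

variable {S : Setup} {x : Fin n → Fin n → ℝ} {ω : Tape}
  {D : Fin S.numMachines → List (Fin n × Fin n)} {G : SimpleGraph (Fin n)}

/-- A bound for the work of a machine in one cycle. -/
def Setup.cycleWork (a : ℕ) (S : Setup) : ℕ :=
  10000 * (S.slots a + 1) + 300 * Nat.clog 2 S.numMachines

theorem drawsOf_le (t i j : ℕ) : drawsOf n ω t i j ≤ 2 * n :=
  Nat.lt_succ_iff.1 (ω (i, t, j, 2 * n)).2

theorem algRun_radix (hR : Regular a S x D) (c : ℕ) :
    RadixInv D (S.slots a) (algRun S.eps x D (S.slots a) (S.scanLen + 1) ω c) := by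
  induction c with
  | zero => exact Or.inl ⟨rfl, rfl, rfl⟩
  | succ c ih => exact ih.next hR.two_le

theorem algRun_valid (hR : Regular a S x D) (c t : ℕ) :
    (reqs S.eps x D (S.slots a) (algRun S.eps x D (S.slots a) (S.scanLen + 1) ω c)
      (drawsOf n ω t)).Valid S.numMachines (S.slots a) S.wordBound :=
  (algRun_radix hR c).valid hR.two_le hR.fits.slots_pos hR.load (drawsOf_le t)
    (by have := hR.word; omega) hR.size

/-- A cycle consists of `scanLen` rounds from the arrival of the requests to that of the answers and
of one home round. So the requests of cycle `c` are computed, with the draws of that round, in round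
`c * (scanLen + 1)`, and they are present one round later. -/
theorem algRun_simulates (hR : Regular a S x D) (G : SimpleGraph (Fin n)) {c : ℕ}
    (hc : ∀ c' < c, (algRun S.eps x D (S.slots a) (S.scanLen + 1) ω c').kind < 5) :
    Config S x D (algRun S.eps x D (S.slots a) (S.scanLen + 1) ω c)
      (roundingRun (clusterProg a) S G x D ω (c * (S.scanLen + 1) + 1)) ∧
    Posted (reqs S.eps x D (S.slots a) (algRun S.eps x D (S.slots a) (S.scanLen + 1) ω c)
      (drawsOf n ω (c * (S.scanLen + 1)))) S
      (roundingRun (clusterProg a) S G x D ω (c * (S.scanLen + 1) + 1)) ∧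
    (∀ i, (roundingRun (clusterProg a) S G x D ω (c * (S.scanLen + 1) + 1) i).work ≤
      (c + 1) * S.cycleWork a) ∧
    ∀ t, 1 ≤ t → t ≤ c * (S.scanLen + 1) + 1 → ∀ i,
      Light a S (roundingRun (clusterProg a) S G x D ω t i) := by
  induction c with
  | zero =>
    obtain ⟨h1, h2, h3⟩ := load_step (G := G) hR.fits hR.word' hR.load hR.symm hR.num
      (algRun_valid hR 0 0)
    rw [zero_mul, zero_add]
    refine ⟨h1, h2, fun i => (h3 i).trans ?_, fun t ht ht' i => ?_⟩
    · rw [Setup.cycleWork]; omega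
    · obtain rfl : t = 1 := by omega
      exact h2.light i
  | succ c ih =>
    obtain ⟨hC, hP, hw, hl⟩ := ih fun c' hc' => hc c' (by omega)
    obtain ⟨hA, hq, hl'⟩ := hP.cycle hR.fits (algRun_valid hR c _)
      (R := roundingRun (clusterProg a) S G x D ω) (fun t => rfl)
    have e1 : c * (S.scanLen + 1) + 1 + S.scanLen = (c + 1) * (S.scanLen + 1) := by ring
    rw [e1] at hA hq
    obtain ⟨s1, s2, s3⟩ := homeRound_step (ω := ω) (t := (c + 1) * (S.scanLen + 1)) hR.fits hR.word'
      hR.load hR.symm hR.num (algRun_valid hR c _) (hc c (Nat.lt_succ_self c))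
      (by have := (algRun_radix (ω := ω) hR c).bit_lt hR.two_le
          have := hR.word
          omega)
      hA (fun i => (hC i).frame (hq.frame i)) (g' := algRun S.eps x D (S.slots a) (S.scanLen + 1) ω (c + 1))
      rfl (algRun_valid hR (c + 1) _)
    refine ⟨s1, s2, fun i => ?_, fun t ht ht' i => ?_⟩
    · refine (s3 i).trans ?_
      have := hq.work i
      have := hw i
      have e2 : (c + 1 + 1) * S.cycleWork a = (c + 1) * S.cycleWork a + S.cycleWork a := by ring
      rw [e2]
      simp only [Setup.cycleWork] at *
      omega
    · rcases le_or_gt t (c * (S.scanLen + 1) + 1) with h | h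
      · exact hl t ht h i
      · rcases Nat.lt_or_ge t ((c + 1) * (S.scanLen + 1) + 1) with h' | h'
        · obtain ⟨s, rfl⟩ := Nat.exists_eq_add_of_le h.le
          exact hl' s (by omega) i
        · obtain rfl : t = (c + 1) * (S.scanLen + 1) + 1 := by omega
          exact s2.light i

/-- Halted machines with empty message boxes form a fixed point of the round map. This carries the
output and the bounds to all later times. -/
theorem frozen (G : SimpleGraph (Fin n)) {t : ℕ}
    (hh : ∀ i, (roundingRun (clusterProg a) S G x D ω t i).halted = true)
    (hi : ∀ i, (roundingRun (clusterProg a) S G x D ω t i).inbox = [])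
    (ho : ∀ i, (roundingRun (clusterProg a) S G x D ω t i).outbox = []) (s : ℕ) :
    roundingRun (clusterProg a) S G x D ω (t + s) = roundingRun (clusterProg a) S G x D ω t := by
  induction s with
  | zero => rfl
  | succ s ih =>
    show mpcRound (clusterProg a) S ω (t + s) (roundingRun (clusterProg a) S G x D ω (t + s)) = _
    rw [ih]
    have hloc : ∀ i, localRound (clusterProg a) (S.env ω (t + s) i)
        (roundingRun (clusterProg a) S G x D ω t i) =
        roundingRun (clusterProg a) S G x D ω t i := by
      intro i
      rw [localRound, if_pos (hh i), ← ho i]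
    funext i
    rw [mpcRound]
    simp only [hloc]
    rw [show ((List.finRange S.numMachines).flatMap fun j =>
      (roundingRun (clusterProg a) S G x D ω t j).outbox.filter fun m => m.dst = (i : ℕ)) =
        (roundingRun (clusterProg a) S G x D ω t i).inbox by rw [hi i]; simp [ho]]

theorem algRun_halts (hR : Regular a S x D) (G : SimpleGraph (Fin n)) {c : ℕ}
    (hc : ∀ c' < c, (algRun S.eps x D (S.slots a) (S.scanLen + 1) ω c').kind < 5)
    (h5 : (algRun S.eps x D (S.slots a) (S.scanLen + 1) ω c).kind = 5) :
    (∀ t, 1 ≤ t → t ≤ (c + 1) * (S.scanLen + 1) → ∀ i,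
      Light a S (roundingRun (clusterProg a) S G x D ω t i)) ∧
    ∀ t ≥ (c + 1) * (S.scanLen + 1) + 1, ∀ i,
      (roundingRun (clusterProg a) S G x D ω t i).halted = true ∧
      (roundingRun (clusterProg a) S G x D ω t i).inbox = [] ∧
      (roundingRun (clusterProg a) S G x D ω t i).outbox = [] ∧
      (roundingRun (clusterProg a) S G x D ω t i).work ≤ (c + 2) * S.cycleWork a ∧
      ∀ e (he : e < 2 * (D i).length), ((roundingRun (clusterProg a) S G x D ω t i).cell e).out =
        clusterId S.eps x D (S.slots a) (algRun S.eps x D (S.slots a) (S.scanLen + 1) ω c)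
          (drawsOf n ω (c * (S.scanLen + 1))) (own ((D i)[e / 2]'(by omega)) e) % S.wordBound := by
  obtain ⟨hC, hP, hw, hl⟩ := algRun_simulates hR G hc
  obtain ⟨hA, hq, hl'⟩ := hP.cycle hR.fits (algRun_valid hR c _)
    (R := roundingRun (clusterProg a) S G x D ω) (fun t => rfl)
  have e1 : c * (S.scanLen + 1) + 1 + S.scanLen = (c + 1) * (S.scanLen + 1) := by ring
  rw [e1] at hA hq
  have hH := fun i => homeRound_halt (ω := ω) (t := (c + 1) * (S.scanLen + 1)) hR.fits hR.load
    (algRun_valid hR c _) h5 hA (fun i => (hC i).frame (hq.frame i)) i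
  refine ⟨fun t ht ht' i => ?_, fun t ht => ?_⟩
  · rcases le_or_gt t (c * (S.scanLen + 1) + 1) with h | h
    · exact hl t ht h i
    · obtain ⟨s, rfl⟩ := Nat.exists_eq_add_of_le h.le
      exact hl' s (by omega) i
  · have hfr := frozen (ω := ω) (D := D) (x := x) (a := a) G (t := (c + 1) * (S.scanLen + 1) + 1)
      (fun i => (hH i).1) (fun i => (hH i).2.1) (fun i => (hH i).2.2.1)
      (t - ((c + 1) * (S.scanLen + 1) + 1))
    rw [Nat.add_sub_of_le ht] at hfr
    rw [hfr]
    intro i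
    obtain ⟨h1, h2, h3, h4, h6⟩ := hH i
    refine ⟨h1, h2, h3, h4.trans ?_, h6⟩
    have := hq.work i
    have := hw i
    have e2 : (c + 2) * S.cycleWork a = (c + 1) * S.cycleWork a + S.cycleWork a := by ring
    rw [e2]
    simp only [Setup.cycleWork] at *
    omega

theorem algRun_kind_le (ε : ℝ) (m p c : ℕ) : (algRun ε x D m p ω c).kind ≤ 5 := by
  cases c with
  | zero => exact Nat.zero_le _
  | succ c => exact nextKd_le _ _ _ _

theorem exists_first_halt (ε : ℝ) (m p : ℕ) {c : ℕ} (h : (algRun ε x D m p ω c).kind = 5) :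
    ∃ c₀ ≤ c, (∀ c' < c₀, (algRun ε x D m p ω c').kind < 5) ∧ (algRun ε x D m p ω c₀).kind = 5 := by
  classical
  have hex : ∃ c, (algRun ε x D m p ω c).kind = 5 := ⟨c, h⟩
  refine ⟨Nat.find hex, Nat.find_le h, fun c' hc' => ?_, Nat.find_spec hex⟩
  exact lt_of_le_of_ne (algRun_kind_le ε m p c') (Nat.find_min hex hc')

/-- The message boxes are small at all times. -/
theorem run_boxes_le (hR : Regular a S x D) (G : SimpleGraph (Fin n)) (ω : Tape) (t : ℕ)
    (i : Fin S.numMachines) :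
    (roundingRun (clusterProg a) S G x D ω t i).inbox.length ≤ S.slots a + 2 ∧
    (roundingRun (clusterProg a) S G x D ω t i).outbox.length ≤ S.slots a + 2 := by
  rcases Nat.eq_zero_or_pos t with rfl | ht
  · constructor
    · show ((D i).map _).length ≤ _
      rw [List.length_map]
      have := hR.load i
      omega
    · exact Nat.zero_le _
  by_cases h5 : ∃ c, (algRun S.eps x D (S.slots a) (S.scanLen + 1) ω c).kind = 5
  · obtain ⟨c, h5⟩ := h5
    obtain ⟨c₀, -, hc, h5⟩ := exists_first_halt _ _ _ h5
    obtain ⟨h1, h2⟩ := algRun_halts hR G hc h5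
    rcases Nat.lt_or_ge t ((c₀ + 1) * (S.scanLen + 1) + 1) with h | h
    · have := h1 t ht (by omega) i
      exact ⟨this.inbox_le, this.outbox_le⟩
    · obtain ⟨-, h3, h4, -⟩ := h2 t h i
      rw [h3, h4]
      simp
  · push Not at h5
    -- If the algorithm never stops, the simulation of `t` cycles covers round `t`.
    have := (algRun_simulates (ω := ω) hR G (c := t)
      (fun c _ => lt_of_le_of_ne (algRun_kind_le _ _ _ c) (h5 c))).2.2.2 t ht (by nlinarith) i
    exact ⟨this.inbox_le, this.outbox_le⟩

/-- The run halts only after the last cycle, and the output is then the clustering of that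
cycle. -/
theorem run_output (hR : Regular a S x D) (hM : 0 < S.numMachines) (G : SimpleGraph (Fin n))
    {t : ℕ} (ht : AllHalted (roundingRun (clusterProg a) S G x D ω t)) :
    ∃ c, (∀ c' < c, (algRun S.eps x D (S.slots a) (S.scanLen + 1) ω c').kind < 5) ∧
      (algRun S.eps x D (S.slots a) (S.scanLen + 1) ω c).kind = 5 ∧
      Outputs (Arr.outL.ix : Fin (dim a)) Arr.outR.ix D (roundingRun (clusterProg a) S G x D ω t)
        fun u => clusterId S.eps x D (S.slots a)
          (algRun S.eps x D (S.slots a) (S.scanLen + 1) ω c)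
          (drawsOf n ω (c * (S.scanLen + 1))) u % S.wordBound := by
  have ht0 : 1 ≤ t := by
    rcases Nat.eq_zero_or_pos t with rfl | h
    · exact absurd (ht ⟨0, hM⟩) (by show ¬ (false = true); simp)
    · exact h
  by_cases h5 : ∃ c, (algRun S.eps x D (S.slots a) (S.scanLen + 1) ω c).kind = 5
  · obtain ⟨c, h5⟩ := h5
    obtain ⟨c₀, -, hc, h5⟩ := exists_first_halt _ _ _ h5
    obtain ⟨h1, h2⟩ := algRun_halts hR G hc h5
    rcases Nat.lt_or_ge t ((c₀ + 1) * (S.scanLen + 1) + 1) with h | h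
    · have h3 := (h1 t ht0 (by omega) ⟨0, hM⟩).running
      rw [ht ⟨0, hM⟩] at h3
      cases h3
    · refine ⟨c₀, hc, h5, fun i j => ?_⟩
      have h3 := (h2 t h i).2.2.2.2
      have hj := j.2
      have e0 := h3 (2 * j) (by omega)
      have e1 := h3 (2 * j + 1) (by omega)
      have d0 : 2 * (j : ℕ) / 2 = j := by omega
      have d1 : (2 * (j : ℕ) + 1) / 2 = j := by omega
      have d2 : 2 * (j : ℕ) % 2 = 0 := by omega
      have d3 : (2 * (j : ℕ) + 1) % 2 = 1 := by omega
      simp only [MState.cell, own, d0, d1, d2, d3, if_true, one_ne_zero, if_false] at e0 e1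
      exact ⟨e0, e1⟩
  · push Not at h5
    have h3 := ((algRun_simulates (ω := ω) hR G (c := t)
      (fun c _ => lt_of_le_of_ne (algRun_kind_le _ _ _ c) (h5 c))).2.2.2 t ht0 (by nlinarith)
      ⟨0, hM⟩).running
    rw [ht ⟨0, hM⟩] at h3
    cases h3

theorem run_halts (hR : Regular a S x D) (G : SimpleGraph (Fin n)) {c : ℕ}
    (h : (algRun S.eps x D (S.slots a) (S.scanLen + 1) ω c).kind = 5) :
    AllHalted (roundingRun (clusterProg a) S G x D ω ((c + 1) * (S.scanLen + 1) + 1)) ∧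
    ∀ i, (roundingRun (clusterProg a) S G x D ω ((c + 1) * (S.scanLen + 1) + 1) i).work ≤
      (c + 2) * S.cycleWork a := by
  obtain ⟨c₀, hle, hc, h5⟩ := exists_first_halt _ _ _ h
  obtain ⟨-, h2⟩ := algRun_halts hR G hc h5
  have hge : (c + 1) * (S.scanLen + 1) + 1 ≥ (c₀ + 1) * (S.scanLen + 1) + 1 := by
    have : (c₀ + 1) * (S.scanLen + 1) ≤ (c + 1) * (S.scanLen + 1) :=
      Nat.mul_le_mul_right _ (by omega)
    omega
  exact ⟨fun i => (h2 _ hge i).1, fun i => ((h2 _ hge i).2.2.2.1).trans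
    (Nat.mul_le_mul_right _ (by omega))⟩

end Simulation

end CorrClust

namespace CorrClust

/-! ### The rounding and its cost -/

section Rounding

variable {n : ℕ} {ε : ℝ} {x : Fin n → Fin n → ℝ}

open scoped Classical in
/-- The weight of a vertex: it measures how much of the core of a cluster around the vertex is
present. -/
noncomputable def coreWeight (ε : ℝ) (x : Fin n → Fin n → ℝ) (u : Fin n) : ℝ :=
  coreR ε + ∑ v ∈ Finset.univ.erase u, if x u v < coreR ε then coreR ε - x u v else 0

/-- The LP values with zero diagonal. -/
def offDiag (x : Fin n → Fin n → ℝ) (u v : Fin n) : ℝ := if u = v then 0 else x u v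

theorem offDiag_symm (hx : IsApproxLP ε x) (u v : Fin n) : offDiag x u v = offDiag x v u := by
  unfold offDiag
  by_cases h : u = v
  · simp [h]
  · rw [if_neg h, if_neg (Ne.symm h), hx.symm]

theorem offDiag_nonneg (hx : IsApproxLP ε x) (u v : Fin n) : 0 ≤ offDiag x u v := by
  unfold offDiag
  split_ifs
  · exact le_rfl
  · exact hx.nonneg u v

theorem offDiag_le_one (hx : IsApproxLP ε x) (u v : Fin n) : offDiag x u v ≤ 1 := by
  unfold offDiag
  split_ifs
  · exact zero_le_one
  · exact hx.le_one u v

/-- The hypotheses leave the diagonal values of `x` arbitrary; after setting them to 0 the cases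
with coinciding vertices must be checked separately. -/
theorem offDiag_triangle (hx : IsApproxLP ε x) (hε : 0 ≤ ε) (u v w : Fin n) :
    offDiag x v w ≤ offDiag x u v + offDiag x u w + ε := by
  by_cases h1 : v = w
  · have := offDiag_nonneg hx u v
    have := offDiag_nonneg hx u w
    rw [show offDiag x v w = 0 by simp [offDiag, h1]]
    linarith
  · by_cases h2 : u = v
    · subst h2
      have := offDiag_nonneg hx u u
      linarith
    · by_cases h3 : u = w
      · subst h3
        have := offDiag_nonneg hx u u
        rw [offDiag_symm hx v u]
        linarith
      · simp only [offDiag, h1, h2, h3, if_false]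
        exact hx.triangle u v w

theorem coreWeight_eq (hr : 0 ≤ coreR ε) (u : Fin n) :
    coreWeight ε x u = ∑ v, max 0 (coreR ε - offDiag x u v) := by
  rw [← Finset.add_sum_erase _ _ (Finset.mem_univ u), coreWeight]
  congr 1
  · simp [offDiag, hr]
  · refine Finset.sum_congr rfl fun v hv => ?_
    rw [offDiag, if_neg (Finset.ne_of_mem_erase hv).symm]
    split_ifs with h
    · rw [max_eq_right (by linarith)]
    · rw [max_eq_left (by linarith)]

/-- The analysis of the rounding: `I` is a set of pivots, and `f` assigns each vertex to the pivot
of its hull, if there is one. -/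
theorem cost_le_of_pivots (hε₀ : 0 < ε) (hε₁ : ε ≤ 1 / 20) (G : SimpleGraph (Fin n))
    (hx : IsApproxLP ε x) (I : Fin n → Prop)
    (hcov : ∀ u, ¬ I u → ∃ w, I w ∧ x u w ≤ nearR ε ∧
      coreWeight ε x u ≤ (1 + ε) * coreWeight ε x w)
    (f : Fin n → ℕ) (hin : ∀ u w, I w → offDiag x u w ≤ hullR ε → f u = w)
    (hout : ∀ u, (∀ w, I w → hullR ε < offDiag x u w) → f u = u) (u : Fin n) :
    (clusterCost G f u : ℝ) ≤ (5 + 55 * ε) * lpCost G x u := by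
  classical
  set q : ℝ := 1 / (5 + 55 * ε) with hq
  have hpos : (0 : ℝ) < 5 + 55 * ε := by linarith
  have hq0 : 0 < q := by positivity
  have hr0 : 0 < coreR ε := by unfold coreR; linarith
  -- Equivalent to 5(1+ε) ≤ (1-6ε)(5+55ε), that is 330ε² ≤ 20ε, which holds for ε ≤ 1/20. The loss
  -- of 1+ε in the weights is paid for here.
  have hqr : (1 + ε) * q ≤ coreR ε := by
    rw [hq, coreR, mul_one_div, div_le_iff₀ hpos]
    nlinarith
  have hqr' : q ≤ coreR ε := by nlinarith
  have hr : coreR ε = (1 - 6 * ε) / 5 := rfl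
  have hh : hullR ε = (2 - 2 * ε) / 5 := rfl
  have hN : nearR ε = (4 + ε) / 5 := rfl
  set d := offDiag x with hd
  have ds := offDiag_symm hx
  have d0 := offDiag_nonneg hx
  have d1 := offDiag_le_one hx
  have dt := offDiag_triangle hx hε₀.le
  rw [← hd] at ds d0 d1 dt
  have dself : ∀ u, d u u = 0 := fun u => by simp [hd, offDiag]
  have dne : ∀ v, v ≠ u → x u v = d u v := fun v hv => by simp [hd, offDiag, hv.symm]
  -- vertices of the same cluster
  have hsame : ∀ v, v ≠ u → f u = f v → ∃ w, I w ∧ d u w ≤ hullR ε ∧ d v w ≤ hullR ε := by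
    intro v hv he
    by_cases h1 : ∃ w, I w ∧ d u w ≤ hullR ε
    · obtain ⟨w, hw, h1⟩ := h1
      by_cases h2 : ∃ w', I w' ∧ d v w' ≤ hullR ε
      · obtain ⟨w', hw', h2⟩ := h2
        rw [hin u w hw h1, hin v w' hw' h2] at he
        obtain rfl : w = w' := Fin.ext he
        exact ⟨w, hw, h1, h2⟩
      · push Not at h2
        rw [hin u w hw h1, hout v h2] at he
        obtain rfl : w = v := Fin.ext he
        exact absurd (h2 w hw) (by rw [dself]; simp; rw [hh]; linarith)
    · push Not at h1
      by_cases h2 : ∃ w', I w' ∧ d v w' ≤ hullR ε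
      · obtain ⟨w', hw', h2⟩ := h2
        rw [hout u h1, hin v w' hw' h2] at he
        obtain rfl : u = w' := Fin.ext he
        exact absurd (h1 u hw') (by rw [dself]; simp; rw [hh]; linarith)
      · push Not at h2
        rw [hout u h1, hout v h2] at he
        exact absurd (Fin.ext he).symm hv
  -- the profit of a pair
  set P : Fin n → ℝ := fun v => (if G.Adj u v then x u v else 1 - x u v) -
    q * (if (G.Adj u v ∧ f u ≠ f v) ∨ (¬ G.Adj u v ∧ f u = f v) then 1 else 0) with hP
  have P_same : ∀ v, v ≠ u → f u = f v → ∀ y, y ≤ d u v → y ≤ 1 - d u v - q → y ≤ P v := by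
    intro v hv he y h1 h2
    by_cases hg : G.Adj u v <;> simp [hP, hg, he, dne v hv] <;> linarith
  have P_diff : ∀ v, v ≠ u → f u ≠ f v → ∀ y, y ≤ d u v - q → y ≤ 1 - d u v → y ≤ P v := by
    intro v hv he y h1 h2
    by_cases hg : G.Adj u v <;> simp [hP, hg, he, dne v hv] <;> linarith
  -- Two vertices of one hull have distance at most 2h+ε = s, and 1-s = r+ε is at least `q`.
  have P_same0 : ∀ v, v ≠ u → f u = f v → 0 ≤ P v := by
    intro v hv he
    obtain ⟨w, hw, h1, h2⟩ := hsame v hv he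
    have := dt w u v
    rw [ds w u, ds w v] at this
    refine P_same v hv he 0 (d0 u v) ?_
    linarith
  have P_diff0 : ∀ v, v ≠ u → f u ≠ f v → q ≤ d u v → 0 ≤ P v := by
    intro v hv he h1
    refine P_diff v hv he 0 (by linarith) ?_
    linarith [d1 u v]
  -- A loss occurs only for a +edge that is cut at distance less than `q`.
  have P_loss : ∀ v, v ≠ u → - max 0 (q - d u v) ≤ P v := by
    intro v hv
    by_cases he : f u = f v
    · have h1 := P_same0 v hv he
      have h2 := le_max_left 0 (q - d u v)
      linarith
    · refine P_diff v hv he _ ?_ ?_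
      · linarith [le_max_right 0 (q - d u v)]
      · linarith [le_max_left 0 (q - d u v), d1 u v]
  have key : 0 ≤ ∑ v ∈ Finset.univ.erase u, P v := by
    by_cases hu : I u
    · refine Finset.sum_nonneg fun v hv => ?_
      have hv := Finset.ne_of_mem_erase hv
      by_cases he : f u = f v
      · exact P_same0 v hv he
      · refine P_diff0 v hv he ?_
        by_contra hlt
        push Not at hlt
        have h1 := hin v u hu (by rw [ds v u]; linarith)
        have h2 := hin u u hu (by rw [dself]; linarith)
        exact he (h2.trans h1.symm)
    · obtain ⟨w, hw, hnear, hL⟩ := hcov u hu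
      have hwu : w ≠ u := fun h => hu (h ▸ hw)
      rw [dne w hwu] at hnear
      -- Deep inside the hull of `w`, all vertices within distance `q` of `u` also belong to the
      -- hull, and no such edge is cut.
      by_cases hc1 : d u w ≤ hullR ε - q - ε
      · have hfu := hin u w hw (by linarith)
        refine Finset.sum_nonneg fun v hv => ?_
        have hv := Finset.ne_of_mem_erase hv
        by_cases he : f u = f v
        · exact P_same0 v hv he
        · refine P_diff0 v hv he ?_
          by_contra hlt
          push Not at hlt
          have h1 := hin v w hw (by have := dt u v w; linarith)
          exact he (hfu.trans h1.symm)
      · push Not at hc1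
        -- A vertex `v` of the core of `w` earns r - d(w,v), whether `u` lies in the hull or not.
        -- Inside, d(u,v) is large enough since h-q-2ε = 2r-q ≥ r; outside, 1-d(u,v) is large enough
        -- since d(u,w) ≤ s and r = 1-s-ε.
        have hgain : ∀ v, v ≠ u → max 0 (coreR ε - d w v) - max 0 (q - d u v) ≤ P v := by
          intro v hv
          rcases le_or_gt (coreR ε) (d w v) with h1 | h1
          · rw [max_eq_left (by linarith), zero_sub]
            exact P_loss v hv
          · rw [max_eq_right (by linarith)]
            have h2 := le_max_left 0 (q - d u v)
            suffices coreR ε - d w v ≤ P v by linarith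
            have hfv := hin v w hw (by rw [ds v w]; linarith)
            have t1 := dt v u w
            have t2 := dt w u v
            rw [ds v u, ds v w] at t1
            rw [ds w u] at t2
            by_cases hc2 : d u w ≤ hullR ε
            · refine P_same v hv ((hin u w hw hc2).trans hfv.symm) _ ?_ ?_ <;> linarith
            · push Not at hc2
              refine P_diff v hv (fun he => ?_) _ ?_ ?_
              · obtain ⟨w', hw', e1, e2⟩ := hsame v hv he
                have h3 := hin u w' hw' e1
                rw [hfv] at he
                rw [h3] at he
                obtain rfl : w' = w := Fin.ext he
                linarith
              · linarith
              · linarith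
        -- The vertex `u` itself is not in the core of `w`, so leaving it out changes nothing.
        have hLw : ∑ v ∈ Finset.univ.erase u, max 0 (coreR ε - d w v) = coreWeight ε x w := by
          rw [coreWeight_eq hr0.le, ← Finset.add_sum_erase _ _ (Finset.mem_univ u)]
          rw [max_eq_left (a := 0) (b := coreR ε - offDiag x w u), zero_add]
          rw [← hd, ds w u]
          linarith
        -- As q ≤ r, the function max(0, q-d) is at most q/r times max(0, r-d).
        have hLu : ∑ v ∈ Finset.univ.erase u, max 0 (q - d u v) ≤
            q / coreR ε * coreWeight ε x u := by
          rw [coreWeight_eq hr0.le, Finset.mul_sum]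
          refine (Finset.sum_le_sum fun v _ => ?_).trans (Finset.sum_le_sum_of_subset_of_nonneg
            (Finset.erase_subset u _) fun v _ _ => by positivity)
          refine max_le (by positivity) ?_
          have h1 : q - d u v ≤ q / coreR ε * (coreR ε - d u v) := by
            have h2 : q / coreR ε ≤ 1 := (div_le_one hr0).2 hqr'
            have h3 : q / coreR ε * coreR ε = q := div_mul_cancel₀ _ hr0.ne'
            nlinarith [d0 u v]
          exact h1.trans (mul_le_mul_of_nonneg_left (le_max_right _ _) (by positivity))
        have hLw0 : 0 ≤ coreWeight ε x w := by
          rw [coreWeight_eq hr0.le]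
          exact Finset.sum_nonneg fun v _ => le_max_left _ _
        have hfin : q / coreR ε * coreWeight ε x u ≤ coreWeight ε x w := by
          calc q / coreR ε * coreWeight ε x u
              ≤ q / coreR ε * ((1 + ε) * coreWeight ε x w) :=
                mul_le_mul_of_nonneg_left hL (by positivity)
            _ = ((1 + ε) * q) / coreR ε * coreWeight ε x w := by ring
            _ ≤ 1 * coreWeight ε x w :=
                mul_le_mul_of_nonneg_right ((div_le_one hr0).2 hqr) hLw0
            _ = _ := one_mul _
        have hs := Finset.sum_le_sum (s := Finset.univ.erase u)
          (fun v hv => hgain v (Finset.ne_of_mem_erase hv))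
        rw [Finset.sum_sub_distrib, hLw] at hs
        linarith
  have hsum : ∑ v ∈ Finset.univ.erase u, P v = lpCost G x u - q * clusterCost G f u := by
    rw [hP, Finset.sum_sub_distrib, ← Finset.mul_sum, Finset.sum_boole]
    rfl
  rw [hsum] at key
  have : (clusterCost G f u : ℝ) = (5 + 55 * ε) * (q * clusterCost G f u) := by
    rw [hq]; field_simp
  rw [this]
  exact mul_le_mul_of_nonneg_left (by linarith) hpos.le

end Rounding

end CorrClust

namespace CorrClust

/-! ### The meaning of the answers in each kind of cycle -/

section Totals

variable {n M m : ℕ} {ε : ℝ} {x : Fin n → Fin n → ℝ} {D : Fin M → List (Fin n × Fin n)}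
  {g : AlgState n} {ξ : ℕ → ℕ → ℕ} {G : SimpleGraph (Fin n)} {b : ℕ}

theorem total_homeMap {β : Type} [AddCommMonoid β] (hm : 0 < m) (hD : ∀ i, 2 * (D i).length ≤ m)
    (hk : ¬ (g.kind = 0 ∨ g.kind = 3)) (F : ℕ → ℕ → Fin n → Fin n → β) (u : Fin n) :
    (reqs ε x D m g ξ).total M m (homeMap D m ξ F) (n - u) =
      ∑ i : Fin M, ∑ j : Fin (D i).length,
        ((if ((D i).get j).1 = u then F (ξ i j) 0 ((D i).get j).1 ((D i).get j).2 else 0) +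
          if ((D i).get j).2 = u then F (ξ i j) 1 ((D i).get j).2 ((D i).get j).1 else 0) := by
  rw [← sum_occ_homeMap hm hD ε x g ξ fun ζ b w v => if w = u then F ζ b w v else 0,
    Requests.total]
  refine Finset.sum_congr rfl fun h hh => ?_
  obtain ⟨w, v, e, hF⟩ := exists_home (D := D) hh
  rw [reqs_lab hh, if_neg hk, e, hF, hF]
  have hw := w.2
  have hu := u.2
  by_cases hc : w = u
  · rw [if_pos hc, if_pos (by rw [hc])]
  · rw [if_neg hc, if_neg]
    intro h'
    exact hc (Fin.ext (by omega))

open scoped Classical in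
-- Pairs outside `K` are -edges of LP value 1, and by `h0` their summands would be 0. So the sum
-- over the records at `u` is the sum over all other vertices plus the two self-loop terms.
theorem total_relevant {β : Type} [AddCommMonoid β] (hm : 0 < m)
    (hD : ∀ i, 2 * (D i).length ≤ m) (hx : ∀ u v, x u v = x v u)
    (hK : IsDistribution (relevantPairs G x) b D)
    (hk : ¬ (g.kind = 0 ∨ g.kind = 3)) (F : ℕ → ℕ → Fin n → Fin n → β)
    (hξ : ∀ ζ b u v, F ζ b u v = F 0 b u v) (hF : ∀ u v, u ≠ v → F 0 0 u v = F 0 1 u v)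
    (h0 : ∀ u v, u ≠ v → 1 ≤ x u v → F 0 0 u v = 0) (u : Fin n) :
    (reqs ε x D m g ξ).total M m (homeMap D m ξ F) (n - u) =
      (F 0 0 u u + F 0 1 u u) + ∑ v ∈ Finset.univ.erase u, F 0 0 u v := by
  rw [total_homeMap hm hD hk]
  simp_rw [hξ (ξ _ _)]
  rw [sum_pairs hK (fun p => (if p.1 = u then F 0 0 p.1 p.2 else 0) +
    if p.2 = u then F 0 1 p.2 p.1 else 0), sum_relevant hx (F 0) hF]
  congr 1
  refine Finset.sum_congr rfl fun v hv => ?_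
  split_ifs with h
  · rfl
  · push Not at h
    exact (h0 u v (Finset.ne_of_mem_erase hv).symm h.2).symm

theorem nearR_lt_one (hε : ε ≤ 1 / 20) : nearR ε < 1 := by unfold nearR; linarith

theorem hullR_lt_one (hε : 0 < ε) : hullR ε < 1 := by unfold hullR; linarith

theorem coreR_lt_one (hε : 0 < ε) : coreR ε < 1 := by unfold coreR; linarith

variable (hm : 0 < m) (hD : ∀ i, 2 * (D i).length ≤ m) (hx : ∀ u v, x u v = x v u)
  (hK : IsDistribution (relevantPairs G x) b D) (hε₀ : 0 < ε) (hε₁ : ε ≤ 1 / 20)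

include hm hD hx hK hε₀ in
theorem total_weight (hk : g.kind = 1) (u : Fin n) :
    (reqs ε x D m g ξ).total M m (reqs ε x D m g ξ).rval (n - u) = coreWeight ε x u := by
  classical
  refine (total_relevant hm hD hx hK (by omega) (g.crval ε x) (fun ζ b u v => ?_)
    (fun u v h => ?_) (fun u v h h1 => ?_) u).trans ?_
  · simp [AlgState.crval, hk]
  · simp [AlgState.crval, hk, h]
  · have := coreR_lt_one hε₀
    simp only [AlgState.crval, hk, if_neg h]
    rw [if_neg (by linarith)]
  · simp only [AlgState.crval, hk, if_true, one_ne_zero, if_false, add_zero, coreWeight]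
    congr 1
    refine Finset.sum_congr rfl fun v hv => ?_
    rw [if_neg (Finset.ne_of_mem_erase hv).symm]

include hm hD hx hK hε₁ in
-- In this cycle the integer field of the requests carries the priority, so the near pivots are
-- counted in the real field.
theorem total_near_pos (hk : g.kind = 2) (u : Fin n) :
    0 < (reqs ε x D m g ξ).total M m (reqs ε x D m g ξ).rval (n - u) ↔
      ∃ v, v ≠ u ∧ x u v ≤ nearR ε ∧ g.status v = 1 := by
  classical
  have h1 : (reqs ε x D m g ξ).total M m (reqs ε x D m g ξ).rval (n - u) =
      ∑ v ∈ Finset.univ.erase u, if x u v ≤ nearR ε ∧ g.status v = 1 then (1 : ℝ) else 0 := by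
    refine (total_relevant hm hD hx hK (by omega) (g.crval ε x) (fun ζ b u v => ?_)
      (fun u v h => ?_) (fun u v h h1 => ?_) u).trans ?_
    · simp [AlgState.crval, hk]
    · simp [AlgState.crval, hk, h]
    · have := nearR_lt_one hε₁
      simp only [AlgState.crval, hk]
      rw [if_neg]
      rintro ⟨-, h2, -⟩
      linarith
    · simp only [AlgState.crval, hk]
      rw [if_neg (by simp), add_zero, zero_add]
      refine Finset.sum_congr rfl fun v hv => ?_
      simp [(Finset.ne_of_mem_erase hv).symm]
  rw [h1, Finset.sum_pos_iff_of_nonneg (fun v _ => by split_ifs <;> simp)]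
  constructor
  · rintro ⟨v, hv, h⟩
    by_cases hc : x u v ≤ nearR ε ∧ g.status v = 1
    · exact ⟨v, Finset.ne_of_mem_erase hv, hc⟩
    · rw [if_neg hc] at h
      exact absurd h (lt_irrefl _)
  · rintro ⟨v, hv, h⟩
    refine ⟨v, Finset.mem_erase.2 ⟨hv, Finset.mem_univ v⟩, ?_⟩
    rw [if_pos h]
    exact one_pos

include hm hD in
theorem total_prio (hk : g.kind = 2) {u : Fin n} {i : Fin M} {j : Fin (D i).length}
    (hij : (D i).get j = (u, u))
    (huniq : ∀ (i' : Fin M) (j' : Fin (D i').length), (D i').get j' = (u, u) →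
      (i' : ℕ) = i ∧ (j' : ℕ) = j) :
    (reqs ε x D m g ξ).total M m (reqs ε x D m g ξ).val (n - u) = ξ i j := by
  classical
  refine (total_homeMap hm hD (by omega) (g.cval ε x) u).trans ?_
  have hz : ∀ (i' : Fin M) (j' : Fin (D i').length),
      ((if ((D i').get j').1 = u then g.cval ε x (ξ i' j') 0 ((D i').get j').1 ((D i').get j').2
        else 0) +
      if ((D i').get j').2 = u then g.cval ε x (ξ i' j') 1 ((D i').get j').2 ((D i').get j').1
        else 0) = if (D i').get j' = (u, u) then ξ i' j' else 0 := by
    intro i' j'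
    obtain ⟨⟨v, w⟩, hp⟩ : ∃ p, (D i').get j' = p := ⟨_, rfl⟩
    rw [hp]
    simp only [AlgState.cval, hk, Prod.mk.injEq]
    by_cases h1 : v = u <;> by_cases h2 : w = u <;> by_cases h3 : v = w <;>
      simp_all
  simp_rw [hz]
  rw [Finset.sum_eq_single_of_mem i (Finset.mem_univ i), Finset.sum_eq_single_of_mem j
    (Finset.mem_univ j), if_pos hij]
  · intro j' _ hne
    rw [if_neg]
    intro h
    exact hne (Fin.ext (huniq i j' h).2)
  · intro i' _ hne
    refine Finset.sum_eq_zero fun j' _ => ?_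
    rw [if_neg]
    intro h
    exact hne (Fin.ext (huniq i' j' h).1)

include hm hD hK in
theorem sum_active_eq_zero (hk : g.kind = 3) :
    ∑ h ∈ (reqs ε x D m g ξ).occ M m, (reqs ε x D m g ξ).val h = 0 ↔ ∀ u, ¬ g.Active u := by
  classical
  have h1 := sum_occ_homeMap hm hD ε x g ξ (g.cval ε x)
  have h2 : ∀ ζ b u v, g.cval ε x ζ b u v = g.cval ε x 0 b u v := fun ζ b u v => by
    simp [AlgState.cval, hk]
  simp_rw [h2 (ξ _ _)] at h1
  rw [sum_pairs hK (fun p => g.cval ε x 0 0 p.1 p.2 + g.cval ε x 0 1 p.2 p.1)] at h1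
  rw [show ∑ h ∈ (reqs ε x D m g ξ).occ M m, (reqs ε x D m g ξ).val h = _ from h1,
    Finset.sum_eq_zero_iff]
  constructor
  · intro h u hu
    have := h (u, u) (by simp [relevantPairs])
    simp [AlgState.cval, hk, hu] at this
  · rintro h ⟨u, v⟩ -
    simp [AlgState.cval, hk, h]

include hm hD hx hK hε₁ in
theorem total_conflict_eq_zero (hk : g.kind = 4) (u : Fin n) :
    (reqs ε x D m g ξ).total M m (reqs ε x D m g ξ).val (n - u) = 0 ↔
      ∀ v, v ≠ u → x u v ≤ nearR ε → g.Active u → g.Active v → g.prio v < g.prio u := by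
  classical
  have h1 : (reqs ε x D m g ξ).total M m (reqs ε x D m g ξ).val (n - u) =
      ∑ v ∈ Finset.univ.erase u, if x u v ≤ nearR ε ∧ g.Active u ∧ g.Active v ∧
        g.prio u ≤ g.prio v then 1 else 0 := by
    refine (total_relevant hm hD hx hK (by omega) (g.cval ε x) (fun ζ b u v => ?_)
      (fun u v h => ?_) (fun u v h h1 => ?_) u).trans ?_
    · simp [AlgState.cval, hk]
    · simp [AlgState.cval, hk, h]
    · have := nearR_lt_one hε₁
      simp only [AlgState.cval, hk]
      rw [if_neg]
      rintro ⟨-, h2, -⟩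
      linarith
    · simp only [AlgState.cval, hk]
      rw [if_neg (by simp), add_zero, zero_add]
      refine Finset.sum_congr rfl fun v hv => ?_
      simp [(Finset.ne_of_mem_erase hv).symm]
  rw [h1, Finset.sum_eq_zero_iff]
  constructor
  · intro h v hv h2 h3 h4
    have := h v (Finset.mem_erase.2 ⟨hv, Finset.mem_univ v⟩)
    by_contra h5
    rw [if_pos ⟨h2, h3, h4, not_lt.1 h5⟩] at this
    exact one_ne_zero this
  · intro h v hv
    rw [if_neg]
    rintro ⟨h2, h3, h4, h5⟩
    exact absurd (h v (Finset.ne_of_mem_erase hv) h2 h3 h4) (not_lt.2 h5)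

open scoped Classical in
include hm hD hx hK hε₀ hε₁ in
theorem total_pivot (hk : g.kind = 5) (u : Fin n) :
    (reqs ε x D m g ξ).total M m (reqs ε x D m g ξ).val (n - u) =
      ∑ v, if offDiag x u v ≤ hullR ε ∧ g.status v = 1 then (v : ℕ) + 1 else 0 := by
  have hh : 0 ≤ hullR ε := by unfold hullR; linarith
  rw [← Finset.add_sum_erase _ _ (Finset.mem_univ u)]
  refine (total_relevant hm hD hx hK (by omega) (g.cval ε x) (fun ζ b u v => ?_)
    (fun u v h => ?_) (fun u v h h1 => ?_) u).trans ?_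
  · simp [AlgState.cval, hk]
  · simp [AlgState.cval, hk, h]
  · have := hullR_lt_one hε₀
    simp only [AlgState.cval, hk, if_neg h]
    rw [if_neg]
    rintro ⟨h2, -⟩
    linarith
  · simp only [AlgState.cval, hk, offDiag, if_true, hh, true_and, one_ne_zero, false_and,
      if_false, add_zero]
    congr 1
    refine Finset.sum_congr rfl fun v hv => ?_
    simp [(Finset.ne_of_mem_erase hv).symm]

end Totals

end CorrClust

namespace CorrClust

/-! ### The invariants of the choice of pivots -/

section Invariant

variable {n M m : ℕ} {ε : ℝ} {x : Fin n → Fin n → ℝ} {D : Fin M → List (Fin n × Fin n)}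
  {g : AlgState n} {ξ : ℕ → ℕ → ℕ} {G : SimpleGraph (Fin n)} {b : ℕ}

/-- The invariants of the choice of the pivots. -/
structure PivotInv (ε : ℝ) (x : Fin n → Fin n → ℝ) (g : AlgState n) : Prop where
  weight : ∀ u, g.weight u = coreWeight ε x u
  status_le : ∀ u, g.status u ≤ 2
  far : ∀ u v, u ≠ v → g.status u = 1 → g.status v = 1 → nearR ε < x u v
  dominated : ∀ u, g.status u = 2 → ∃ w, g.status w = 1 ∧ x u w ≤ nearR ε ∧
    coreWeight ε x u ≤ (1 + ε) * coreWeight ε x w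
  undecided : ∀ u, g.status u = 0 → g.kind ≠ 5 ∧ coreWeight ε x u ≤ (1 + ε) * g.thr
  -- The neighbours of new pivots stay undecided from a cycle of kind 4 to the next one of kind 2.
  -- The comparison of weights is recorded when the pivot is chosen and is used when the neighbour
  -- is marked.
  undecided_near : ∀ u v, g.status u = 0 → g.status v = 1 → x u v ≤ nearR ε →
    coreWeight ε x u ≤ (1 + ε) * coreWeight ε x v
  clean : g.kind = 3 ∨ g.kind = 4 → ∀ u v, g.status u = 0 → g.status v = 1 → nearR ε < x u v

/-- The invariants of the whole algorithm. -/
def AlgInv (ε : ℝ) (x : Fin n → Fin n → ℝ) (g : AlgState n) : Prop :=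
  (g.kind < 2 ∧ ∀ u, g.status u = 0) ∨ (2 ≤ g.kind ∧ PivotInv ε x g)

theorem coreR_pos (hε₁ : ε ≤ 1 / 20) : 0 < coreR ε := by unfold coreR; linarith

theorem coreR_le_coreWeight (hε₁ : ε ≤ 1 / 20) (u : Fin n) : coreR ε ≤ coreWeight ε x u := by
  rw [coreWeight]
  refine le_add_of_nonneg_right (Finset.sum_nonneg fun v _ => ?_)
  split_ifs with h
  · linarith
  · exact le_rfl

theorem coreWeight_le (hε₁ : ε ≤ 1 / 20) (hx0 : ∀ u v, 0 ≤ x u v) (u : Fin n) :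
    coreWeight ε x u ≤ n * coreR ε := by
  rw [coreWeight_eq (coreR_pos hε₁).le]
  refine (Finset.sum_le_card_nsmul _ _ (coreR ε) fun v _ => ?_).trans ?_
  · refine max_le (coreR_pos hε₁).le ?_
    have : 0 ≤ offDiag x u v := by
      unfold offDiag
      split_ifs
      · exact le_rfl
      · exact hx0 u v
    linarith
  · simp

section Next

variable (hm : 0 < m) (hD : ∀ i, 2 * (D i).length ≤ m) (hx : IsApproxLP ε x)
  (hK : IsDistribution (relevantPairs G x) b D) (hε₀ : 0 < ε) (hε₁ : ε ≤ 1 / 20)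

theorem next_of_kind_zero (hk : g.kind = 0) :
    (g.next M m ε (reqs ε x D m g ξ)).kind < 2 ∧
    (g.next M m ε (reqs ε x D m g ξ)).status = g.status := by
  constructor
  · simp only [AlgState.next, hk, nextKd]; split_ifs <;> omega
  · funext u; simp [AlgState.next, hk]

include hm hD hx hK hε₀ in
theorem next_of_kind_one (hk : g.kind = 1) :
    (g.next M m ε (reqs ε x D m g ξ)).kind = 2 ∧
    (g.next M m ε (reqs ε x D m g ξ)).thr = n * coreR ε ∧
    (g.next M m ε (reqs ε x D m g ξ)).weight = coreWeight ε x ∧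
    (g.next M m ε (reqs ε x D m g ξ)).status = g.status := by
  refine ⟨by simp [AlgState.next, hk, nextKd], by simp [AlgState.next, hk, nextThr], ?_, ?_⟩
  · funext u
    simp only [AlgState.next, hk, if_true]
    exact total_weight hm hD hx.symm hK hε₀ hk u
  · funext u; simp [AlgState.next, hk]

open scoped Classical in
include hm hD hx hK hε₁ in
theorem next_of_kind_two (hk : g.kind = 2) :
    (g.next M m ε (reqs ε x D m g ξ)).kind = 3 ∧
    (g.next M m ε (reqs ε x D m g ξ)).thr = g.thr ∧
    (g.next M m ε (reqs ε x D m g ξ)).weight = g.weight ∧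
    (∀ u, (g.next M m ε (reqs ε x D m g ξ)).status u =
      if g.status u = 0 ∧ ∃ v, v ≠ u ∧ x u v ≤ nearR ε ∧ g.status v = 1 then 2 else g.status u) ∧
    ∀ (u : Fin n) (i : Fin M) (j : Fin (D i).length), (D i).get j = (u, u) →
      (∀ (i' : Fin M) (j' : Fin (D i').length), (D i').get j' = (u, u) →
        (i' : ℕ) = i ∧ (j' : ℕ) = j) →
      (g.next M m ε (reqs ε x D m g ξ)).prio u = ξ i j := by
  refine ⟨by simp [AlgState.next, hk, nextKd], by simp [AlgState.next, hk, nextThr],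
    by funext u; simp [AlgState.next, hk], fun u => ?_, fun u i j hij hu => ?_⟩
  · have := total_near_pos (ξ := ξ) hm hD hx.symm hK hε₁ hk u
    simp only [AlgState.next, hk, true_and, this]
    by_cases h : g.status u = 0 ∧ ∃ v, v ≠ u ∧ x u v ≤ nearR ε ∧ g.status v = 1
    · rw [if_pos h, if_pos h.symm]
    · rw [if_neg h, if_neg (fun h' => h h'.symm), if_neg (by omega)]
  · simp only [AlgState.next, hk, if_true]
    exact total_prio hm hD hk hij hu

open scoped Classical in
include hm hD hK in
theorem next_of_kind_three (hk : g.kind = 3) :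
    (g.next M m ε (reqs ε x D m g ξ)).kind =
      (if (∀ u, ¬ g.Active u) ∧ g.thr ≤ coreR ε then 5 else 4) ∧
    (g.next M m ε (reqs ε x D m g ξ)).thr =
      (if ∀ u, ¬ g.Active u then g.thr / (1 + ε) else g.thr) ∧
    (g.next M m ε (reqs ε x D m g ξ)).weight = g.weight ∧
    (g.next M m ε (reqs ε x D m g ξ)).status = g.status ∧
    (g.next M m ε (reqs ε x D m g ξ)).prio = g.prio := by
  have := sum_active_eq_zero (ε := ε) (ξ := ξ) hm hD hK hk
  refine ⟨?_, ?_, by funext u; simp [AlgState.next, hk], by funext u; simp [AlgState.next, hk],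
    by funext u; simp [AlgState.next, hk]⟩
  · simp only [AlgState.next, hk, nextKd, this]
  · simp only [AlgState.next, hk, nextThr, this]
    simp

open scoped Classical in
include hm hD hx hK hε₁ in
theorem next_of_kind_four (hk : g.kind = 4) :
    (g.next M m ε (reqs ε x D m g ξ)).kind = 2 ∧
    (g.next M m ε (reqs ε x D m g ξ)).thr = g.thr ∧
    (g.next M m ε (reqs ε x D m g ξ)).weight = g.weight ∧
    ∀ u, (g.next M m ε (reqs ε x D m g ξ)).status u =
      if g.Active u ∧ ∀ v, v ≠ u → x u v ≤ nearR ε → g.Active v → g.prio v < g.prio u then 1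
      else g.status u := by
  refine ⟨by simp [AlgState.next, hk, nextKd], by simp [AlgState.next, hk, nextThr],
    by funext u; simp [AlgState.next, hk], fun u => ?_⟩
  have := total_conflict_eq_zero (ξ := ξ) hm hD hx.symm hK hε₁ hk u
  simp only [AlgState.next, hk, this, true_and]
  rw [if_neg (by omega)]
  by_cases h : g.Active u ∧ ∀ v, v ≠ u → x u v ≤ nearR ε → g.Active v → g.prio v < g.prio u
  · rw [if_pos h, if_pos ⟨h.1, fun v h1 h2 _ h3 => h.2 v h1 h2 h3⟩]
  · rw [if_neg h, if_neg fun h' => h ⟨h'.1, fun v h1 h2 h3 => h'.2 v h1 h2 h'.1 h3⟩]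

include hm hD hx hK hε₀ hε₁ in
theorem AlgInv.next (h : AlgInv ε x g) (hk5 : g.kind < 5) :
    AlgInv ε x (g.next M m ε (reqs ε x D m g ξ)) := by
  classical
  obtain ⟨g', hg'⟩ : ∃ g', g' = g.next M m ε (reqs ε x D m g ξ) := ⟨_, rfl⟩
  rw [← hg']
  have hε : (0 : ℝ) < 1 + ε := by linarith
  obtain hk | hk | hk | hk | hk : g.kind = 0 ∨ g.kind = 1 ∨ g.kind = 2 ∨ g.kind = 3 ∨
    g.kind = 4 := by omega
  · have h0 := (h.resolve_right (by omega)).2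
    obtain ⟨h1, h2⟩ := next_of_kind_zero (ε := ε) (x := x) (D := D) (m := m) (ξ := ξ) hk
    rw [← hg'] at h1 h2
    exact Or.inl ⟨h1, by rwa [h2]⟩
  · have h0 := (h.resolve_right (by omega)).2
    obtain ⟨h1, h2, h3, h4⟩ := next_of_kind_one (ξ := ξ) hm hD hx hK hε₀ hk
    rw [← hg'] at h1 h2 h3 h4
    refine Or.inr ⟨h1.ge, ⟨fun u => by rw [h3], fun u => by rw [h4, h0]; omega,
      fun u v _ hu => ?_, fun u hu => ?_, fun u _ => ⟨by omega, ?_⟩, fun u v _ hv => ?_, fun hk => ?_⟩⟩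
    · rw [h4, h0] at hu; omega
    · rw [h4, h0] at hu; omega
    · rw [h2]
      have h5 := coreWeight_le hε₁ hx.nonneg u
      have h6 := coreR_pos hε₁
      nlinarith [mul_nonneg (Nat.cast_nonneg (α := ℝ) n) h6.le]
    · rw [h4, h0] at hv; omega
    · omega
  · have h0 := (h.resolve_left (by omega)).2
    obtain ⟨h1, h2, h3, h4, -⟩ := next_of_kind_two (ξ := ξ) hm hD hx hK hε₁ hk
    rw [← hg'] at h1 h2 h3 h4
    have s1 : ∀ u, g'.status u = 1 ↔ g.status u = 1 := fun u => by
      rw [h4]; split_ifs with h5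
      · omega
      · rfl
    have s0 : ∀ u, g'.status u = 0 → g.status u = 0 ∧
        ¬ ∃ v, v ≠ u ∧ x u v ≤ nearR ε ∧ g.status v = 1 := fun u hu => by
      rw [h4] at hu; split_ifs at hu with h5
      exact ⟨hu, fun h6 => h5 ⟨hu, h6⟩⟩
    refine Or.inr ⟨by omega, ⟨fun u => by rw [h3, h0.weight], fun u => ?_,
      fun u v hne hu hv => h0.far u v hne ((s1 u).1 hu) ((s1 v).1 hv), fun u hu => ?_,
      fun u hu => ⟨by omega, ?_⟩, fun u v hu hv => ?_, fun _ u v hu hv => ?_⟩⟩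
    · rw [h4]; split_ifs
      · exact le_rfl
      · exact h0.status_le u
    · simp only [s1]
      rw [h4] at hu
      split_ifs at hu with h5
      · obtain ⟨h5, v, -, h7, h8⟩ := h5
        exact ⟨v, h8, h7, h0.undecided_near u v h5 h8 h7⟩
      · exact h0.dominated u hu
    · rw [h2]; exact (h0.undecided u (s0 u hu).1).2
    · exact h0.undecided_near u v (s0 u hu).1 ((s1 v).1 hv)
    · by_contra h5
      push Not at h5
      refine (s0 u hu).2 ⟨v, ?_, h5, (s1 v).1 hv⟩
      rintro rfl
      omega
  · have h0 := (h.resolve_left (by omega)).2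
    obtain ⟨h1, h2, h3, h4, -⟩ := next_of_kind_three (ξ := ξ) (ε := ε) hm hD hK hk
    rw [← hg'] at h1 h2 h3 h4
    refine Or.inr ⟨by rw [h1]; split_ifs <;> omega, ⟨fun u => by rw [h3, h0.weight],
      by rw [h4]; exact h0.status_le, by rw [h4]; exact h0.far, by rw [h4]; exact h0.dominated,
      ?_, by rw [h4]; exact h0.undecided_near, fun _ => by rw [h4]; exact h0.clean (Or.inl hk)⟩⟩
    intro u hu
    rw [h4] at hu
    constructor
    · rw [h1]
      split_ifs with h5
      -- At the end the threshold is at most the smallest possible weight, so an undecided vertex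
      -- would be active.
      · refine absurd ⟨hu, ?_⟩ (h5.1 u)
        rw [h0.weight]
        exact h5.2.trans (coreR_le_coreWeight hε₁ u)
      · omega
    · rw [h2]
      split_ifs with h5
      -- Without active vertices every undecided weight is below the old threshold, which is 1+ε
      -- times the new one.
      · rw [mul_div_cancel₀ _ hε.ne']
        by_contra h6
        push Not at h6
        exact h5 u ⟨hu, by rw [h0.weight]; exact h6.le⟩
      · exact (h0.undecided u hu).2
  · have h0 := (h.resolve_left (by omega)).2
    obtain ⟨h1, h2, h3, h4⟩ := next_of_kind_four (ξ := ξ) hm hD hx hK hε₁ hk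
    rw [← hg'] at h1 h2 h3 h4
    have s0 : ∀ u, g'.status u = 0 → g.status u = 0 := fun u hu => by
      rw [h4] at hu; split_ifs at hu with h5
      exact hu
    have s1 : ∀ u, g.status u = 1 → g'.status u = 1 := fun u hu => by
      rw [h4]; split_ifs with h5
      · rfl
      · exact hu
    have s1' : ∀ u, g'.status u = 1 → g.status u = 1 ∨ (g.Active u ∧
        ∀ v, v ≠ u → x u v ≤ nearR ε → g.Active v → g.prio v < g.prio u) := fun u hu => by
      rw [h4] at hu; split_ifs at hu with h5
      · exact Or.inr h5
      · exact Or.inl hu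
    refine Or.inr ⟨by omega, ⟨fun u => by rw [h3, h0.weight], fun u => ?_,
      fun u v hne hu hv => ?_, fun u hu => ?_, fun u hu => ⟨by omega, ?_⟩, fun u v hu hv hn => ?_,
      by omega⟩⟩
    · rw [h4]; split_ifs
      · omega
      · exact h0.status_le u
    · rcases s1' u hu with hu' | ⟨hu1, hu2⟩
      · rcases s1' v hv with hv' | ⟨hv1, -⟩
        · exact h0.far u v hne hu' hv'
        · rw [hx.symm]
          exact h0.clean (Or.inr hk) v u hv1.1 hu'
      · rcases s1' v hv with hv' | ⟨hv1, hv2⟩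
        · exact h0.clean (Or.inr hk) u v hu1.1 hv'
        -- Of two near winners each would have a strictly larger priority than the other.
        · by_contra h5
          push Not at h5
          have a1 := hu2 v hne.symm h5 hv1
          have a2 := hv2 u hne (by rwa [hx.symm]) hu1
          omega
    · rw [h4] at hu; split_ifs at hu with h5
      · omega
      · obtain ⟨w, h6, h7⟩ := h0.dominated u hu
        exact ⟨w, s1 w h6, h7⟩
    · rw [h2]; exact (h0.undecided u (s0 u hu)).2
    · rcases s1' v hv with hv' | ⟨hv1, -⟩
      · exact h0.undecided_near u v (s0 u hu) hv' hn
      -- The new pivot was active, so its weight is at least the threshold, while that of `u` is at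
      -- most 1+ε times the threshold.
      · refine (h0.undecided u (s0 u hu)).2.trans (mul_le_mul_of_nonneg_left ?_ hε.le)
        rw [← h0.weight]
        exact hv1.2

include hm hD hx hK hε₀ hε₁ in
/-- The clustering of the last cycle is good. -/
theorem AlgInv.cost_le (h : AlgInv ε x g) (hk : g.kind = 5) (u : Fin n) :
    (clusterCost G (clusterId ε x D m g ξ) u : ℝ) ≤ (5 + 55 * ε) * lpCost G x u := by
  classical
  have h0 := (h.resolve_left (by omega)).2
  have hh : hullR ε = (2 - 2 * ε) / 5 := rfl
  have hN : nearR ε = (4 + ε) / 5 := rfl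
  have htot := total_pivot (ξ := ξ) hm hD hx.symm hK hε₀ hε₁ hk
  refine cost_le_of_pivots hε₀ hε₁ G hx (fun w => g.status w = 1) (fun v hv => ?_) _
    (fun v w hw hvw => ?_) (fun v hv => ?_) u
  · refine h0.dominated v ?_
    have h1 := h0.status_le v
    have h2 : g.status v ≠ 0 := fun h2 => (h0.undecided v h2).1 hk
    omega
  -- Two pivots whose hulls contain `v` would have distance at most 2h+ε = s. So the sum has a
  -- single nonzero term, from which the pivot can be read off.
  · have hs : ∀ w' ∈ (Finset.univ : Finset (Fin n)), w' ≠ w →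
        (if offDiag x v w' ≤ hullR ε ∧ g.status w' = 1 then (w' : ℕ) + 1 else 0) = 0 := by
      intro w' _ hne
      rw [if_neg]
      rintro ⟨h1, h2⟩
      have h3 := h0.far w' w hne h2 hw
      have h4 := offDiag_triangle hx hε₀.le v w' w
      rw [show offDiag x w' w = x w' w by simp [offDiag, hne]] at h4
      linarith
    rw [clusterId, htot v, Finset.sum_eq_single_of_mem w (Finset.mem_univ w) hs,
      if_pos (show _ ∧ _ from ⟨hvw, hw⟩)]
    simp
  · rw [clusterId, htot v, Finset.sum_eq_zero, if_pos rfl]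
    intro w _
    rw [if_neg]
    rintro ⟨h1, h2⟩
    exact absurd (hv w h2) (not_lt.2 h1)

include hm hD hx hK hε₀ hε₁ in
theorem clusterId_lt (h : AlgInv ε x g) (hk : g.kind = 5) (u : Fin n) :
    clusterId ε x D m g ξ u < n := by
  classical
  have h0 := (h.resolve_left (by omega)).2
  have hh : hullR ε = (2 - 2 * ε) / 5 := rfl
  have hN : nearR ε = (4 + ε) / 5 := rfl
  have htot := total_pivot (ξ := ξ) hm hD hx.symm hK hε₀ hε₁ hk u
  by_cases hex : ∃ w, offDiag x u w ≤ hullR ε ∧ g.status w = 1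
  · obtain ⟨w, hvw, hw⟩ := hex
    have hs : ∀ w' ∈ (Finset.univ : Finset (Fin n)), w' ≠ w →
        (if offDiag x u w' ≤ hullR ε ∧ g.status w' = 1 then (w' : ℕ) + 1 else 0) = 0 := by
      intro w' _ hne
      rw [if_neg]
      rintro ⟨h1, h2⟩
      have h3 := h0.far w' w hne h2 hw
      have h4 := offDiag_triangle hx hε₀.le u w' w
      rw [show offDiag x w' w = x w' w by simp [offDiag, hne]] at h4
      linarith
    rw [clusterId, htot, Finset.sum_eq_single_of_mem w (Finset.mem_univ w) hs,
      if_pos (show _ ∧ _ from ⟨hvw, hw⟩)]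
    simp
  · push Not at hex
    rw [clusterId, htot, Finset.sum_eq_zero, if_pos rfl]
    · exact u.2
    · intro w _
      rw [if_neg]
      rintro ⟨h1, h2⟩
      exact hex w h1 h2

end Next

end Invariant

section Output

variable {n a b : ℕ} {S : Setup} {x : Fin n → Fin n → ℝ} {ω : Tape}
  {D : Fin S.numMachines → List (Fin n × Fin n)} {G : SimpleGraph (Fin n)}

theorem algRun_inv (hR : Regular a S x D) (hx : IsApproxLP S.eps x)
    (hK : IsDistribution (relevantPairs G x) b D) (hε₀ : 0 < S.eps) (hε₁ : S.eps ≤ 1 / 20) {c : ℕ}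
    (hc : ∀ c' < c, (algRun S.eps x D (S.slots a) (S.scanLen + 1) ω c').kind < 5) :
    AlgInv S.eps x (algRun S.eps x D (S.slots a) (S.scanLen + 1) ω c) := by
  induction c with
  | zero => exact Or.inl ⟨by show 0 < 2; omega, fun u => rfl⟩
  | succ c ih =>
    exact (ih fun c' hc' => hc c' (by omega)).next hR.fits.slots_pos hR.load hx hK hε₀ hε₁
      (hc c (Nat.lt_succ_self c))

theorem run_correct (hR : Regular a S x D) (hM : 0 < S.numMachines) (hx : IsApproxLP S.eps x)
    (hK : IsDistribution (relevantPairs G x) b D) (hε₀ : 0 < S.eps) (hε₁ : S.eps ≤ 1 / 20) {t : ℕ}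
    (ht : AllHalted (roundingRun (clusterProg a) S G x D ω t)) :
    ∃ f : Fin n → ℕ, Outputs (Arr.outL.ix : Fin (dim a)) Arr.outR.ix D
        (roundingRun (clusterProg a) S G x D ω t) f ∧
      ∀ u, (clusterCost G f u : ℝ) ≤ (5 + 55 * S.eps) * lpCost G x u := by
  obtain ⟨c, hc, h5, ho⟩ := run_output hR hM G ht
  have hI := algRun_inv hR hx hK hε₀ hε₁ hc
  refine ⟨_, ?_, hI.cost_le (ξ := drawsOf n ω (c * (S.scanLen + 1))) hR.fits.slots_pos hR.load hx hK
    hε₀ hε₁ h5⟩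
  convert ho using 2 with u
  refine (Nat.mod_eq_of_lt ((clusterId_lt hR.fits.slots_pos hR.load hx hK hε₀ hε₁ hI h5 u).trans
    ?_)).symm
  have := hR.word
  omega

end Output

end CorrClust

namespace CorrClust

/-! ### The probability of having the strictly largest priority -/

section Counting

/-- Bernoulli's inequality for the power D+1 of 1 - 1/(K+1). -/
theorem pow_sub_le_pow (K D : ℕ) :
    ((K : ℝ) + 1) ^ (D + 1) - (D + 1) * ((K : ℝ) + 1) ^ D ≤ (K : ℝ) ^ (D + 1) := by
  have hK : (0 : ℝ) < K + 1 := by positivity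
  have h := one_add_mul_le_pow (a := -(1 / ((K : ℝ) + 1)))
    (by have : 1 / ((K : ℝ) + 1) ≤ 1 := by
          rw [div_le_one hK]; linarith [Nat.cast_nonneg (α := ℝ) K]
        linarith) (D + 1)
  have e : (K : ℝ) = (K + 1) * (1 + -(1 / ((K : ℝ) + 1))) := by field_simp; ring
  have e2 : (K : ℝ) ^ (D + 1) = ((K : ℝ) + 1) ^ (D + 1) * (1 + -(1 / ((K : ℝ) + 1))) ^ (D + 1) := by
    rw [← mul_pow, ← e]
  rw [e2]
  refine le_trans (le_of_eq ?_) (mul_le_mul_of_nonneg_left h (by positivity))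
  push_cast
  field_simp
  ring

/-- A discrete form of ∫ t^D dt: by `pow_sub_le_pow` each difference of consecutive powers is at
most (D+1) times the next summand. -/
theorem pow_le_sum_pow (K D : ℕ) :
    (K : ℝ) ^ (D + 1) ≤ (D + 1) * ∑ j ∈ Finset.range (K + 1), (j : ℝ) ^ D := by
  induction K with
  | zero => simp; positivity
  | succ K ih =>
    rw [Finset.sum_range_succ, mul_add]
    have := pow_sub_le_pow K D
    push_cast at *
    linarith

open scoped Classical in
/-- The probability that a given element of a set has the largest priority of that set. -/
theorem card_strict_max {V : Type*} [Fintype V] [DecidableEq V] {K : ℕ} {S : Finset V} {v : V} (hv : v ∈ S)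
    (hK : 2 * S.card ≤ K + 1) :
    ((K : ℝ) + 1) ^ Fintype.card V ≤ 2 * S.card *
      (Finset.univ.filter fun X : V → Fin (K + 1) => ∀ u ∈ S, u ≠ v → X u < X v).card := by
  obtain ⟨D, hDc⟩ : ∃ D, S.card = D + 1 :=
    ⟨S.card - 1, by have := Finset.card_pos.2 ⟨v, hv⟩; omega⟩
  -- If the value at `v` is `j`, the other D elements of the set have `j` choices each, and the
  -- elements outside the set are free.
  have hcard : (Finset.univ.filter fun X : V → Fin (K + 1) =>
      ∀ u ∈ S, u ≠ v → X u < X v).card =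
      ∑ j : Fin (K + 1), (j : ℕ) ^ D * (K + 1) ^ (Fintype.card V - S.card) := by
    rw [Finset.card_eq_sum_card_fiberwise (f := fun X => X v) (t := Finset.univ)
      (fun _ _ => by simp)]
    refine Finset.sum_congr rfl fun j _ => ?_
    have : ((Finset.univ.filter fun X : V → Fin (K + 1) =>
        ∀ u ∈ S, u ≠ v → X u < X v).filter fun X => X v = j) =
        Fintype.piFinset fun u => if u = v then {j} else if u ∈ S then Finset.Iio j
          else Finset.univ := by
      ext X
      simp only [Finset.mem_filter, Finset.mem_univ, true_and, Fintype.mem_piFinset]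
      constructor
      · rintro ⟨h1, rfl⟩ u
        split_ifs with h2 h3
        · simp [h2]
        · simpa using h1 u h3 h2
        · simp
      · intro h
        have hj : X v = j := by simpa using h v
        refine ⟨fun u hu hne => ?_, hj⟩
        have := h u
        rw [if_neg hne, if_pos hu, Finset.mem_Iio] at this
        rwa [hj]
    rw [this, Fintype.card_piFinset, ← Finset.prod_mul_prod_compl S, ← Finset.mul_prod_erase S _ hv]
    have p1 : ∀ u ∈ S.erase v, (if u = v then {j} else if u ∈ S then Finset.Iio j
          else Finset.univ : Finset (Fin (K + 1))).card = j := by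
      intro u hu
      rw [if_neg (Finset.ne_of_mem_erase hu), if_pos (Finset.mem_of_mem_erase hu), Fin.card_Iio]
    have p2 : ∀ u ∈ Sᶜ, (if u = v then {j} else if u ∈ S then Finset.Iio j
          else Finset.univ : Finset (Fin (K + 1))).card = K + 1 := by
      intro u hu
      rw [Finset.mem_compl] at hu
      have hne : u ≠ v := fun h => hu (h ▸ hv)
      rw [if_neg hne, if_neg hu, Finset.card_univ, Fintype.card_fin]
    rw [Finset.prod_congr rfl p1, Finset.prod_congr rfl p2, Finset.prod_const, Finset.prod_const,
      Finset.card_erase_of_mem hv, Finset.card_compl, if_pos rfl, Finset.card_singleton, one_mul,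
      hDc, Nat.add_sub_cancel]
  rw [hcard]
  push_cast
  rw [← Finset.sum_mul, Fin.sum_univ_eq_sum_range (fun j => (j : ℝ) ^ D) (K + 1)]
  have h1 := pow_le_sum_pow K D
  have h2 := pow_sub_le_pow K D
  have h3 : (2 * ((D : ℝ) + 1)) ≤ K + 1 := by
    rw [hDc] at hK
    exact_mod_cast hK
  -- Priorities may coincide; since the range is at least twice as large as the set, this costs only
  -- a factor 2.
  have h4 : ((K : ℝ) + 1) ^ (D + 1) ≤ 2 * (K : ℝ) ^ (D + 1) := by
    have : 2 * ((D : ℝ) + 1) * ((K : ℝ) + 1) ^ D ≤ (K + 1) * ((K : ℝ) + 1) ^ D :=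
      mul_le_mul_of_nonneg_right h3 (by positivity)
    rw [pow_succ] at h2 ⊢
    nlinarith
  have h5 : S.card ≤ Fintype.card V := Finset.card_le_univ S
  have h6 : ((K : ℝ) + 1) ^ Fintype.card V =
      ((K : ℝ) + 1) ^ (D + 1) * ((K : ℝ) + 1) ^ (Fintype.card V - S.card) := by
    rw [← pow_add]
    congr 1
    omega
  rw [h6, hDc]
  push_cast
  have h7 : (0 : ℝ) ≤ ((K : ℝ) + 1) ^ (Fintype.card V - (D + 1)) := by positivity
  calc _ ≤ (2 * ((D + 1) * ∑ j ∈ Finset.range (K + 1), (j : ℝ) ^ D)) *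
        ((K : ℝ) + 1) ^ (Fintype.card V - (D + 1)) :=
        mul_le_mul_of_nonneg_right (by linarith) h7
    _ = _ := by ring

end Counting

/-! ### The expected progress of one step of Luby's method -/

section Luby

variable {V : Type*} [Fintype V] [DecidableEq V] {K : ℕ} {nr : V → V → Prop} {A : Finset V}

open scoped Classical in
/-- The closed neighbourhood of `v` in `A`. -/
noncomputable def nbrs (nr : V → V → Prop) (A : Finset V) (v : V) : Finset V :=
  A.filter fun u => u = v ∨ nr v u

/-- The number of ordered pairs of equal or adjacent elements of `A`. -/
noncomputable def pairCount (nr : V → V → Prop) (A : Finset V) : ℕ :=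
  ∑ v ∈ A, (nbrs nr A v).card

open scoped Classical in
/-- The elements of `A` whose priority exceeds that of all neighbours. -/
noncomputable def winners (nr : V → V → Prop) (A : Finset V) (X : V → Fin (K + 1)) : Finset V :=
  A.filter fun u => ∀ v ∈ A, nr u v → X v < X u

open scoped Classical in
/-- What is left of `U` after the removal of the winners and their neighbours. -/
noncomputable def residual (nr : V → V → Prop) (U A : Finset V) (X : V → Fin (K + 1)) : Finset V :=
  U.filter fun u => ∀ w ∈ winners nr A X, ¬ (u = w ∨ nr u w)

theorem card_le_pairCount (nr : V → V → Prop) (A : Finset V) : A.card ≤ pairCount nr A := by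
  classical
  rw [pairCount, Finset.card_eq_sum_ones]
  refine Finset.sum_le_sum fun v hv => Finset.card_pos.2 ⟨v, ?_⟩
  simp [nbrs, hv]

theorem pairCount_le (nr : V → V → Prop) (A : Finset V) : pairCount nr A ≤ Fintype.card V ^ 2 := by
  classical
  rw [pairCount, sq]
  refine (Finset.sum_le_card_nsmul _ _ (Fintype.card V) fun v _ => Finset.card_le_univ _).trans ?_
  rw [smul_eq_mul]
  exact Nat.mul_le_mul_right _ (Finset.card_le_univ _)

/-- The average of the pairs that are left after one step. -/
theorem sum_pairCount_residual (hirr : ∀ u, ¬ nr u u) (hs : ∀ u v, nr u v → nr v u)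
    (hK : 2 * Fintype.card V ≤ K + 1) :
    ∑ X : V → Fin (K + 1), (pairCount nr (residual nr A A X) : ℝ) ≤
      3 / 4 * ((K : ℝ) + 1) ^ Fintype.card V * pairCount nr A := by
  classical
  set d : V → ℝ := fun v => ((nbrs nr A v).card : ℝ) with hd
  have hdpos : ∀ v ∈ A, 0 < d v := fun v hv => by
    simp only [hd, Nat.cast_pos]
    exact Finset.card_pos.2 ⟨v, by simp [nbrs, hv]⟩
  -- The event that `v` beats the neighbourhoods of both `v` and `w`. If `v` is in the neighbourhood
  -- of `w`, then `v` wins and `w` is removed.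
  set Ev : V → V → Finset (V → Fin (K + 1)) := fun v w =>
    Finset.univ.filter fun X => ∀ u ∈ nbrs nr A v ∪ nbrs nr A w, u ≠ v → X u < X v with hEv
  -- the effect of one outcome
  have hone : ∀ X : V → Fin (K + 1), (pairCount nr (residual nr A A X) : ℝ) ≤
      pairCount nr A - ∑ w ∈ A, d w * ∑ v ∈ nbrs nr A w, if X ∈ Ev v w then 1 else 0 := by
    intro X
    have h1 : (pairCount nr (residual nr A A X) : ℝ) ≤
        ∑ w ∈ A, if w ∈ residual nr A A X then d w else 0 := by
      rw [pairCount, ← Finset.sum_filter]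
      push_cast
      have : A.filter (fun w => w ∈ residual nr A A X) = residual nr A A X := by
        ext w; simp only [Finset.mem_filter]
        exact ⟨fun h => h.2, fun h => ⟨(Finset.mem_filter.1 h).1, h⟩⟩
      rw [this]
      refine Finset.sum_le_sum fun w _ => Nat.cast_le.2 (Finset.card_le_card ?_)
      intro u hu
      simp only [nbrs, Finset.mem_filter] at hu ⊢
      exact ⟨(Finset.mem_filter.1 hu.1).1, hu.2⟩
    refine h1.trans ?_
    rw [pairCount]
    push_cast
    rw [← Finset.sum_sub_distrib]
    refine Finset.sum_le_sum fun w hw => ?_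
    -- For fixed `w` the events are disjoint, as two such vertices would beat each other. So their
    -- probabilities may be added.
    have hle : (∑ v ∈ nbrs nr A w, if X ∈ Ev v w then (1 : ℝ) else 0) ≤ 1 := by
      rw [Finset.sum_boole]
      rw [Nat.cast_le_one, Finset.card_le_one]
      intro v hv v' hv'
      by_contra hne
      simp only [Finset.mem_filter, hEv, Finset.mem_univ, true_and] at hv hv'
      have a1 := hv.2 v' (Finset.mem_union_right _ hv'.1) (Ne.symm hne)
      have a2 := hv'.2 v (Finset.mem_union_right _ hv.1) hne
      exact absurd a1 (not_lt.2 a2.le)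
    split_ifs with hres
    · rw [Finset.sum_eq_zero]
      · simp [hd]
      intro v hv
      rw [if_neg]
      intro hX
      simp only [hEv, Finset.mem_filter, Finset.mem_univ, true_and] at hX
      have hvA : v ∈ A ∧ (v = w ∨ nr w v) := Finset.mem_filter.1 hv
      have hwin : v ∈ winners nr A X := Finset.mem_filter.2 ⟨hvA.1, fun u hu hvu => by
        have huv : u ≠ v := fun h => hirr v (h ▸ hvu)
        exact hX u (Finset.mem_union_left _ (Finset.mem_filter.2 ⟨hu, Or.inr hvu⟩)) huv⟩
      exact (Finset.mem_filter.1 hres).2 v hwin (hvA.2.imp Eq.symm id)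
    · have := hdpos w hw
      have : (nbrs nr A w).card - d w * ∑ v ∈ nbrs nr A w, (if X ∈ Ev v w then (1 : ℝ) else 0) =
        d w * (1 - ∑ v ∈ nbrs nr A w, if X ∈ Ev v w then (1 : ℝ) else 0) := by
        simp only [hd]; ring
      rw [this]
      exact mul_nonneg (by positivity) (by linarith)
  have hprob : ∀ w ∈ A, ∀ v ∈ nbrs nr A w,
      ((K : ℝ) + 1) ^ Fintype.card V / (2 * (d v + d w)) ≤ (Ev v w).card := by
    intro w hw v hv
    have hvA : v ∈ A := (Finset.mem_filter.1 hv).1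
    have hvS : v ∈ nbrs nr A v ∪ nbrs nr A w := Finset.mem_union_right _ hv
    have h1 := card_strict_max hvS (K := K)
      ((Nat.mul_le_mul_left 2 (Finset.card_le_univ _)).trans hK)
    have h2 : ((nbrs nr A v ∪ nbrs nr A w).card : ℝ) ≤ d v + d w := by
      simp only [hd]
      exact_mod_cast Finset.card_union_le _ _
    rw [div_le_iff₀ (by have := hdpos v hvA; have := hdpos w hw; positivity)]
    refine h1.trans ?_
    rw [mul_comm ((Ev v w).card : ℝ)]
    exact mul_le_mul_of_nonneg_right (by linarith) (Nat.cast_nonneg _)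
  -- Adjacency is symmetric, so each ordered pair contributes 1/2 on average. With the factor 1/2 of
  -- `hprob`, a quarter of the pairs disappears in expectation.
  have hswap : ∑ w ∈ A, ∑ v ∈ nbrs nr A w, d w / (d v + d w) =
      ∑ w ∈ A, ∑ v ∈ nbrs nr A w, d v / (d v + d w) := by
    simp only [nbrs, Finset.sum_filter]
    rw [Finset.sum_comm]
    refine Finset.sum_congr rfl fun v _ => Finset.sum_congr rfl fun w _ => ?_
    have : (v = w ∨ nr w v) ↔ (w = v ∨ nr v w) :=
      or_congr eq_comm ⟨hs _ _, hs _ _⟩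
    simp only [this, add_comm (d v)]
  have hhalf : ∑ w ∈ A, ∑ v ∈ nbrs nr A w, d w / (d v + d w) = (pairCount nr A : ℝ) / 2 := by
    have : ∑ w ∈ A, ∑ v ∈ nbrs nr A w, d w / (d v + d w) +
        ∑ w ∈ A, ∑ v ∈ nbrs nr A w, d v / (d v + d w) = pairCount nr A := by
      rw [← Finset.sum_add_distrib, pairCount]
      push_cast
      refine Finset.sum_congr rfl fun w hw => ?_
      rw [← Finset.sum_add_distrib, Finset.card_eq_sum_ones]
      push_cast
      refine Finset.sum_congr rfl fun v hv => ?_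
      have := hdpos v (Finset.mem_filter.1 hv).1
      have := hdpos w hw
      rw [← add_div, add_comm (d w), div_self (by positivity)]
    linarith
  calc ∑ X : V → Fin (K + 1), (pairCount nr (residual nr A A X) : ℝ)
      ≤ ∑ X : V → Fin (K + 1), ((pairCount nr A : ℝ) -
          ∑ w ∈ A, d w * ∑ v ∈ nbrs nr A w, if X ∈ Ev v w then 1 else 0) :=
        Finset.sum_le_sum fun X _ => hone X
    _ = ((K : ℝ) + 1) ^ Fintype.card V * pairCount nr A -
          ∑ w ∈ A, d w * ∑ v ∈ nbrs nr A w, ((Ev v w).card : ℝ) := by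
        rw [Finset.sum_sub_distrib, Finset.sum_const, Finset.card_univ, Fintype.card_fun,
          Fintype.card_fin, nsmul_eq_mul]
        push_cast
        congr 1
        rw [Finset.sum_comm]
        refine Finset.sum_congr rfl fun w _ => ?_
        rw [← Finset.mul_sum, Finset.sum_comm]
        congr 1
        refine Finset.sum_congr rfl fun v _ => ?_
        rw [Finset.sum_boole]
        congr 2
        ext X
        simp
    _ ≤ ((K : ℝ) + 1) ^ Fintype.card V * pairCount nr A -
          ∑ w ∈ A, d w * ∑ v ∈ nbrs nr A w,
            ((K : ℝ) + 1) ^ Fintype.card V / (2 * (d v + d w)) :=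
        sub_le_sub_left (Finset.sum_le_sum fun w hw => mul_le_mul_of_nonneg_left
          (Finset.sum_le_sum fun v hv => hprob w hw v hv) (hdpos w hw).le) _
    _ = ((K : ℝ) + 1) ^ Fintype.card V * pairCount nr A -
          ((K : ℝ) + 1) ^ Fintype.card V / 2 *
            ∑ w ∈ A, ∑ v ∈ nbrs nr A w, d w / (d v + d w) := by
        congr 1
        rw [Finset.mul_sum]
        refine Finset.sum_congr rfl fun w _ => ?_
        rw [Finset.mul_sum, Finset.mul_sum]
        refine Finset.sum_congr rfl fun v _ => ?_
        rw [← div_div]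
        ring
    _ = 3 / 4 * ((K : ℝ) + 1) ^ Fintype.card V * pairCount nr A := by rw [hhalf]; ring

end Luby

end CorrClust

namespace CorrClust

/-! ### A potential for the whole choice of pivots -/

section Stepping

variable {V : Type*} [Fintype V] [DecidableEq V] {K : ℕ} {nr : V → V → Prop} {L : V → ℝ}
  {τ : ℕ → ℝ} {r : ℝ}

open scoped Classical in
/-- The elements of `U` of weight at least `θ`. -/
noncomputable def above (L : V → ℝ) (θ : ℝ) (U : Finset V) : Finset V := U.filter fun u => θ ≤ L u

open scoped Classical in
/-- One step of the choice of the pivots.  A state consists of the candidates and the phase; the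
threshold of phase `p` is `τ p`. -/
noncomputable def lubyStep (nr : V → V → Prop) (L : V → ℝ) (τ : ℕ → ℝ) (r : ℝ)
    (s : Option (Finset V × ℕ)) (X : V → Fin (K + 1)) : Option (Finset V × ℕ) :=
  s.bind fun q =>
    if above L (τ q.2) q.1 = ∅ then
      if τ q.2 ≤ r then none
      -- A step that finds no active vertex lowers the threshold and chooses pivots at the new
      -- threshold at once, with the same priorities.
      else some (residual nr q.1 (above L (τ (q.2 + 1)) q.1) X, q.2 + 1)
    else some (residual nr q.1 (above L (τ q.2) q.1) X, q.2)

/-- The potential of a state. -/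
noncomputable def potential (nr : V → V → Prop) (L : V → ℝ) (τ : ℕ → ℝ) (B : ℝ) (P : ℕ) :
    Option (Finset V × ℕ) → ℝ
  | none => 0
  -- The floor 1/8 keeps the potential positive when no active vertex is left; the power of `B` pays
  -- for the new active vertices of a new phase.
  | some q => B ^ (P - q.2) * max (pairCount nr (above L (τ q.2) q.1) : ℝ) (1 / 8)

theorem mem_winners {A : Finset V} {X : V → Fin (K + 1)} {u : V} :
    u ∈ winners nr A X ↔ u ∈ A ∧ ∀ v ∈ A, nr u v → X v < X u := by
  simp [winners]

theorem above_residual (θ : ℝ) (U : Finset V) (X : V → Fin (K + 1)) :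
    above L θ (residual nr U (above L θ U) X) =
      residual nr (above L θ U) (above L θ U) X := by
  ext u
  simp only [residual]
  generalize winners nr (above L θ U) X = w
  simp only [above, Finset.mem_filter]
  tauto

theorem lubyStep_phase_le {P : ℕ} (hP : τ P ≤ r) {s : Option (Finset V × ℕ)}
    (hs : ∀ q, s = some q → q.2 ≤ P) (X : V → Fin (K + 1)) :
    ∀ q, lubyStep nr L τ r s X = some q → q.2 ≤ P := by
  intro q hq
  match s, hs, hq with
  | some (U, p), hs, hq =>
    have hp : p ≤ P := hs _ rfl
    simp only [lubyStep, Option.bind_some] at hq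
    split_ifs at hq with h1 h2
    · cases hq
      rcases hp.lt_or_eq with h | h
      · exact h
      · exact absurd (h ▸ hP) h2
    · cases hq
      exact hp

theorem sum_potential_step {B : ℝ} {P : ℕ} (hirr : ∀ u, ¬ nr u u) (hsym : ∀ u v, nr u v → nr v u)
    (hK : 2 * Fintype.card V ≤ K + 1) (hV : 1 ≤ Fintype.card V)
    (hB : 10 * (Fintype.card V : ℝ) ^ 2 ≤ B) (hP : τ P ≤ r) {s : Option (Finset V × ℕ)}
    (hs : ∀ q, s = some q → q.2 ≤ P) :
    ∑ X : V → Fin (K + 1), potential nr L τ B P (lubyStep nr L τ r s X) ≤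
      7 / 8 * ((K : ℝ) + 1) ^ Fintype.card V * potential nr L τ B P s := by
  classical
  have hV2 : (1 : ℝ) ≤ (Fintype.card V : ℝ) ^ 2 := by
    have : (1 : ℝ) ≤ Fintype.card V := by exact_mod_cast hV
    nlinarith
  have hB0 : 0 < B := by linarith
  have hcard : (Fintype.card (V → Fin (K + 1)) : ℝ) = ((K : ℝ) + 1) ^ Fintype.card V := by
    rw [Fintype.card_fun, Fintype.card_fin]; push_cast; rfl
  match s, hs with
  | none, _ => simp [lubyStep, potential]
  | some (U, p), hs =>
    have hp : p ≤ P := hs _ rfl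
    by_cases h1 : above L (τ p) U = ∅
    · by_cases h2 : τ p ≤ r
      · simp only [lubyStep, Option.bind_some, if_pos h1, if_pos h2, potential,
          Finset.sum_const_zero]
        positivity
      -- New phase: the pair count rises from the floor 1/8 to at most |V|², but a factor B is
      -- gained, and |V|² ≤ (7/64)B.
      · have hlt : p < P := lt_of_le_of_ne hp fun h => h2 (h ▸ hP)
        simp only [lubyStep, Option.bind_some, if_pos h1, if_neg h2]
        simp only [potential, h1]
        have h3 : (pairCount nr (∅ : Finset V) : ℝ) = 0 := by simp [pairCount]
        rw [h3, max_eq_right (by norm_num)]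
        refine (Finset.sum_le_card_nsmul _ _ (B ^ (P - (p + 1)) * (Fintype.card V : ℝ) ^ 2)
          fun X _ => mul_le_mul_of_nonneg_left (max_le ?_ (by linarith)) (by positivity)).trans ?_
        · exact_mod_cast pairCount_le _ _
        · rw [nsmul_eq_mul, Finset.card_univ, hcard, show P - p = P - (p + 1) + 1 by omega,
            pow_succ B]
          have h4 : (0 : ℝ) ≤ ((K : ℝ) + 1) ^ Fintype.card V * B ^ (P - (p + 1)) := by positivity
          have h5 := mul_le_mul_of_nonneg_left
            (show (Fintype.card V : ℝ) ^ 2 ≤ 7 / 64 * B by linarith) h4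
          linarith
    · simp only [lubyStep, Option.bind_some, if_neg h1, potential, above_residual]
      set A := above L (τ p) U
      have hA : (1 : ℝ) ≤ pairCount nr A := by
        exact_mod_cast (Finset.card_pos.2 (Finset.nonempty_iff_ne_empty.2 h1)).trans_le
          (card_le_pairCount nr A)
      rw [← Finset.mul_sum, max_eq_left (by linarith)]
      have h5 : ∑ X : V → Fin (K + 1), max (pairCount nr (residual nr A A X) : ℝ) (1 / 8) ≤
          ∑ X : V → Fin (K + 1), ((pairCount nr (residual nr A A X) : ℝ) + 1 / 8) :=
        Finset.sum_le_sum fun X _ => max_le (by linarith)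
          (by have := Nat.cast_nonneg (α := ℝ) (pairCount nr (residual nr A A X)); linarith)
      rw [Finset.sum_add_distrib, Finset.sum_const, nsmul_eq_mul, Finset.card_univ, hcard] at h5
      have h6 := sum_pairCount_residual (A := A) hirr hsym hK
      have h7 : (0 : ℝ) ≤ ((K : ℝ) + 1) ^ Fintype.card V := by positivity
      -- Same phase: the pair count c is at least 1, so (3/4)c + 1/8 ≤ (7/8)c.
      have h8 : ∑ X : V → Fin (K + 1), max (pairCount nr (residual nr A A X) : ℝ) (1 / 8) ≤
          7 / 8 * ((K : ℝ) + 1) ^ Fintype.card V * pairCount nr A := by nlinarith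
      calc _ ≤ B ^ (P - p) * (7 / 8 * ((K : ℝ) + 1) ^ Fintype.card V * pairCount nr A) :=
            mul_le_mul_of_nonneg_left h8 (by positivity)
        _ = _ := by ring

/-- The average of the potential after `T` steps. -/
theorem sum_potential_run {B : ℝ} {P : ℕ} (hirr : ∀ u, ¬ nr u u) (hsym : ∀ u v, nr u v → nr v u)
    (hK : 2 * Fintype.card V ≤ K + 1) (hV : 1 ≤ Fintype.card V)
    (hB : 10 * (Fintype.card V : ℝ) ^ 2 ≤ B) (hP : τ P ≤ r) (T : ℕ) {s : Option (Finset V × ℕ)}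
    (hs : ∀ q, s = some q → q.2 ≤ P) :
    ∑ Xs : Fin T → V → Fin (K + 1),
        potential nr L τ B P ((List.ofFn Xs).foldl (lubyStep nr L τ r) s) ≤
      (7 / 8 * ((K : ℝ) + 1) ^ Fintype.card V) ^ T * potential nr L τ B P s := by
  induction T generalizing s with
  | zero => simp
  | succ T ih =>
    rw [← (Fin.consEquiv fun _ : Fin (T + 1) => V → Fin (K + 1)).sum_comp, Fintype.sum_prod_type]
    simp only [Fin.consEquiv, Equiv.coe_fn_mk, List.ofFn_succ, Fin.cons_zero, Fin.cons_succ,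
      List.foldl_cons]
    refine (Finset.sum_le_sum fun X _ => ih (lubyStep_phase_le hP hs X)).trans ?_
    rw [← Finset.mul_sum, pow_succ, mul_assoc]
    exact mul_le_mul_of_nonneg_left (sum_potential_step hirr hsym hK hV hB hP hs) (by positivity)

open scoped Classical in
-- Markov's inequality: an unfinished state has potential at least 1/8, and the initial potential is
-- at most B^(P+1)/8.
theorem card_unfinished_le {B : ℝ} {P : ℕ} (hirr : ∀ u, ¬ nr u u)
    (hsym : ∀ u v, nr u v → nr v u)
    (hK : 2 * Fintype.card V ≤ K + 1) (hV : 1 ≤ Fintype.card V)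
    (hB : 10 * (Fintype.card V : ℝ) ^ 2 ≤ B) (hP : τ P ≤ r) (T : ℕ) (U : Finset V) :
    ((Finset.univ.filter fun Xs : Fin T → V → Fin (K + 1) =>
        (List.ofFn Xs).foldl (lubyStep nr L τ r) (some (U, 0)) ≠ none).card : ℝ) ≤
      (7 / 8 * ((K : ℝ) + 1) ^ Fintype.card V) ^ T * (B ^ (P + 1)) := by
  have hV2 : (1 : ℝ) ≤ (Fintype.card V : ℝ) ^ 2 := by
    have : (1 : ℝ) ≤ Fintype.card V := by exact_mod_cast hV
    nlinarith
  have hB1 : 1 ≤ B := by linarith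
  have h1 := sum_potential_run (nr := nr) (L := L) (s := some (U, 0)) hirr hsym hK hV hB hP T
    (fun q hq => by cases hq; exact Nat.zero_le _)
  have h2 : ∀ s : Option (Finset V × ℕ), (if s ≠ none then (1 : ℝ) / 8 else 0) ≤
      potential nr L τ B P s := by
    intro s
    match s with
    | none => simp [potential]
    | some q =>
      simp only [potential, ne_eq, reduceCtorEq, not_false_eq_true, if_true]
      have h3 : 1 ≤ B ^ (P - q.2) := one_le_pow₀ hB1
      have h4 := le_max_right ((pairCount nr (above L (τ q.2) q.1) : ℝ)) (1 / 8)
      nlinarith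
  have h3 := (Finset.sum_le_sum fun Xs (_ : Xs ∈ (Finset.univ : Finset (Fin T → V → Fin (K + 1)))) =>
    h2 ((List.ofFn Xs).foldl (lubyStep nr L τ r) (some (U, 0)))).trans h1
  rw [← Finset.sum_filter, Finset.sum_const, nsmul_eq_mul] at h3
  have h4 : potential nr L τ B P (some (U, 0)) ≤ B ^ P * (B / 8) := by
    simp only [potential, Nat.sub_zero]
    refine mul_le_mul_of_nonneg_left (max_le ?_ (by linarith)) (by positivity)
    have : (pairCount nr (above L (τ 0) U) : ℝ) ≤ (Fintype.card V : ℝ) ^ 2 := by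
      exact_mod_cast pairCount_le _ _
    linarith
  have h5 : (0 : ℝ) ≤ (7 / 8 * ((K : ℝ) + 1) ^ Fintype.card V) ^ T := by positivity
  have h6 := mul_le_mul_of_nonneg_left h4 h5
  rw [pow_succ]
  nlinarith

end Stepping

/-! ### Three cycles form one step -/

section Link

variable {n M m : ℕ} {ε : ℝ} {x : Fin n → Fin n → ℝ} {D : Fin M → List (Fin n × Fin n)}
  {g : AlgState n} {ξ : ℕ → ℕ → ℕ} {G : SimpleGraph (Fin n)} {b : ℕ}

/-- Two vertices that cannot both be pivots. -/
def Near (ε : ℝ) (x : Fin n → Fin n → ℝ) (u v : Fin n) : Prop := v ≠ u ∧ x u v ≤ nearR ε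

/-- The threshold of a phase. -/
noncomputable def phaseThr (n : ℕ) (ε : ℝ) (p : ℕ) : ℝ := n * coreR ε / (1 + ε) ^ p

open scoped Classical in
/-- The undecided vertices without a pivot nearby. -/
noncomputable def AlgState.candidates (ε : ℝ) (x : Fin n → Fin n → ℝ) (g : AlgState n) :
    Finset (Fin n) :=
  Finset.univ.filter fun u => g.status u = 0 ∧ ∀ v, Near ε x u v → g.status v ≠ 1

/-- The variables at the start of a step agree with the abstract state. -/
structure IsState (ε : ℝ) (x : Fin n → Fin n → ℝ) (g : AlgState n) (q : Finset (Fin n) × ℕ) :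
    Prop where
  kind : g.kind = 2
  weight : g.weight = coreWeight ε x
  thr : g.thr = phaseThr n ε q.2
  candidates : g.candidates ε x = q.1

/-- The cycles of kinds 2, 3, 4 draw priorities and mark the neighbours of the old pivots, adjust
the threshold, and choose new pivots. Marking comes one cycle late, hence the abstract state
consists of the undecided vertices without a near pivot. The end is noticed after the second of the
three cycles. -/
theorem step_spec (hm : 0 < m) (hD : ∀ i, 2 * (D i).length ≤ m) (hx : IsApproxLP ε x)
    (hK : IsDistribution (relevantPairs G x) b D) (hε₀ : 0 < ε) (hε₁ : ε ≤ 1 / 20)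
    {q : Finset (Fin n) × ℕ} {ξ ξ₁ ξ₂ : ℕ → ℕ → ℕ} {X : Fin n → Fin (2 * n + 1)}
    (hX : ∀ (u : Fin n) (i : Fin M) (j : Fin (D i).length), (D i).get j = (u, u) → ξ i j = X u)
    (h : IsState ε x g q) {g₁ g₂ g₃ : AlgState n} (h₁ : g₁ = g.next M m ε (reqs ε x D m g ξ))
    (h₂ : g₂ = g₁.next M m ε (reqs ε x D m g₁ ξ₁)) (h₃ : g₃ = g₂.next M m ε (reqs ε x D m g₂ ξ₂)) :
    match lubyStep (Near ε x) (coreWeight ε x) (phaseThr n ε) (coreR ε) (some q) X with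
    | none => g₂.kind = 5
    | some q' => IsState ε x g₃ q' := by
  classical
  have hε : (0 : ℝ) < 1 + ε := by linarith
  obtain ⟨U, p⟩ := q
  have hc : g.candidates ε x = U := h.candidates
  have hthr : g.thr = phaseThr n ε p := h.thr
  obtain ⟨a1, a2, a3, a4, a5⟩ := next_of_kind_two (ξ := ξ) hm hD hx hK hε₁ h.kind
  rw [← h₁] at a1 a2 a3 a4 a5
  obtain ⟨b1, b2, b3, b4, b5⟩ := next_of_kind_three (ε := ε) (ξ := ξ₁) hm hD hK a1
  rw [← h₂] at b1 b2 b3 b4 b5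
  have hprio : ∀ u, g₂.prio u = X u := by
    intro u
    obtain ⟨i, j, hij, hu⟩ := exists_self_record hK u
    rw [b5, a5 u i j hij hu, hX u i j hij]
  have hU : ∀ u, g₁.status u = 0 ↔ u ∈ U := by
    intro u
    rw [← hc, AlgState.candidates, Finset.mem_filter, a4]
    simp only [Finset.mem_univ, true_and, Near]
    by_cases hu : g.status u = 0
    · by_cases hex : ∃ v, v ≠ u ∧ x u v ≤ nearR ε ∧ g.status v = 1
      · rw [if_pos ⟨hu, hex⟩]
        obtain ⟨v, h1, h2, h3⟩ := hex
        simp only [OfNat.ofNat_ne_zero, false_iff, not_and]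
        exact fun _ h4 => h4 v ⟨h1, h2⟩ h3
      · rw [if_neg (fun h' => hex h'.2)]
        simp only [hu, true_and, true_iff]
        exact fun v h1 h2 => hex ⟨v, h1.1, h1.2, h2⟩
    · rw [if_neg (fun h' => hu h'.1)]
      simp [hu]
  have hpiv : ∀ v, g₁.status v = 1 ↔ g.status v = 1 := by
    intro v
    rw [a4]
    split_ifs with h'
    · omega
    · rfl
  have hact₁ : ∀ u, g₁.Active u ↔ u ∈ above (coreWeight ε x) (phaseThr n ε p) U := by
    intro u
    rw [AlgState.Active, hU, a2, hthr, a3, h.weight, above, Finset.mem_filter]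
  have hempty : (∀ u, ¬ g₁.Active u) ↔ above (coreWeight ε x) (phaseThr n ε p) U = ∅ := by
    rw [Finset.eq_empty_iff_forall_notMem]
    exact forall_congr' fun u => not_congr (hact₁ u)
  simp only [hempty, a2, hthr] at b1 b2
  -- the end of a step
  have hend : ∀ p', g₂.kind = 4 → g₂.thr = phaseThr n ε p' → IsState ε x g₃
      (residual (Near ε x) U (above (coreWeight ε x) (phaseThr n ε p') U) X, p') := by
    intro p' hk ht
    obtain ⟨c1, c2, c3, c4⟩ := next_of_kind_four (ξ := ξ₂) hm hD hx hK hε₁ hk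
    rw [← h₃] at c1 c2 c3 c4
    have hact₂ : ∀ u, g₂.Active u ↔ u ∈ above (coreWeight ε x) (phaseThr n ε p') U := by
      intro u
      rw [AlgState.Active, b4, hU, ht, b3, a3, h.weight, above, Finset.mem_filter]
    have hwin : ∀ u, (g₂.Active u ∧ ∀ v, v ≠ u → x u v ≤ nearR ε → g₂.Active v →
        g₂.prio v < g₂.prio u) ↔
        u ∈ winners (Near ε x) (above (coreWeight ε x) (phaseThr n ε p') U) X := by
      intro u
      rw [mem_winners, hact₂]
      refine and_congr_right fun _ => forall_congr' fun v => ?_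
      rw [hact₂, hprio, hprio, Fin.val_fin_lt]
      simp only [Near]
      tauto
    refine ⟨c1, by rw [c3, b3, a3, h.weight], by rw [c2, ht], ?_⟩
    have hs1 : ∀ u, g₃.status u = 1 ↔
        u ∈ winners (Near ε x) (above (coreWeight ε x) (phaseThr n ε p') U) X ∨ g.status u = 1 := by
      intro u
      rw [c4, ← hwin, b4, ← hpiv]
      split_ifs with h'
      · exact iff_of_true rfl (Or.inl h')
      · exact ⟨Or.inr, fun h'' => h''.resolve_left h'⟩
    have hs0 : ∀ u, g₃.status u = 0 ↔
        u ∈ U ∧ u ∉ winners (Near ε x) (above (coreWeight ε x) (phaseThr n ε p') U) X := by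
      intro u
      rw [c4, ← hwin, b4, ← hU]
      split_ifs with h'
      · exact iff_of_false id fun h'' => h''.2 h'
      · exact ⟨fun h'' => ⟨h'', h'⟩, And.left⟩
    ext u
    simp only [AlgState.candidates, residual, Finset.mem_filter, Finset.mem_univ, true_and, hs0,
      ne_eq, hs1]
    constructor
    · rintro ⟨⟨h1, h2⟩, h3⟩
      refine ⟨h1, fun w hw => ?_⟩
      rintro (rfl | hn)
      · exact h2 hw
      · exact h3 w hn (Or.inl hw)
    · rintro ⟨h1, h2⟩
      refine ⟨⟨h1, fun hw => h2 u hw (Or.inl rfl)⟩, fun v hv => ?_⟩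
      rintro (h3 | h3)
      · exact h2 v h3 (Or.inr hv)
      · rw [← hc, AlgState.candidates, Finset.mem_filter] at h1
        exact h1.2.2 v hv h3
  simp only [lubyStep, Option.bind_some]
  by_cases h1 : above (coreWeight ε x) (phaseThr n ε p) U = ∅
  · by_cases h2 : phaseThr n ε p ≤ coreR ε
    · rw [if_pos h1, if_pos h2]
      show g₂.kind = 5
      rw [b1, if_pos ⟨h1, h2⟩]
    · rw [if_pos h1, if_neg h2]
      refine hend (p + 1) ?_ ?_
      · rw [b1, if_neg fun h' => h2 h'.2]
      · rw [b2, if_pos h1, phaseThr, phaseThr, pow_succ, div_div]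
  · rw [if_neg h1]
    refine hend p ?_ ?_
    · rw [b1, if_neg fun h' => h1 h'.1]
    · rw [b2, if_neg h1]

end Link

end CorrClust

namespace CorrClust

/-! ### Finitely many draws under the law of the tape -/

section Law

open MeasureTheory

theorem tapeLaw_eq_le {ι : Type*} [Fintype ι] {K : ℕ} {coord : ι → ℕ × ℕ × ℕ}
    (hinj : Function.Injective coord) (v : ι → Fin (K + 1)) :
    tapeLaw {ω | ∀ k, ω ((coord k).1, (coord k).2.1, (coord k).2.2, K) = v k} ≤
      (((K : ENNReal) + 1) ^ Fintype.card ι)⁻¹ := by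
  classical
  set c : ι → ℕ × ℕ × ℕ × ℕ := fun k => ((coord k).1, (coord k).2.1, (coord k).2.2, K) with hc
  have hcinj : Function.Injective c := by
    intro k k' h
    simp only [hc, Prod.mk.injEq] at h
    exact hinj (Prod.ext h.1 (Prod.ext h.2.1 h.2.2.1))
  -- The range of a draw depends on its coordinate, so the prescribed values are compared as natural
  -- numbers.
  let t : (q : ℕ × ℕ × ℕ × ℕ) → Set (Fin (q.2.2.2 + 1)) := fun q =>
    {y | ∀ k, c k = q → (y : ℕ) = v k}
  have hset : {ω : Tape | ∀ k, ω (c k) = v k} = Set.pi (Finset.univ.image c : Finset _) t := by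
    ext ω
    simp only [Set.mem_ofPred_eq, Set.mem_pi, Finset.coe_image, Finset.coe_univ, Set.image_univ,
      Set.mem_range, forall_exists_index, forall_apply_eq_imp_iff, t]
    constructor
    · intro h k k' hk
      obtain rfl := hcinj hk
      exact congrArg Fin.val (h k')
    · intro h k
      exact Fin.ext (h k k rfl)
  have ht : ∀ k, (PMF.uniformOfFintype (Fin ((c k).2.2.2 + 1))).toMeasure (t (c k)) =
      ((K : ENNReal) + 1)⁻¹ := by
    intro k
    have : t (c k) = {(v k : Fin (K + 1))} := by
      ext y
      simp only [t, Set.mem_ofPred_eq, Set.mem_singleton_iff]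
      constructor
      · intro h
        exact Fin.ext (h k rfl)
      · intro h k' hk'
        obtain rfl := hcinj hk'
        exact congrArg Fin.val h
    rw [this]
    refine (PMF.toMeasure_apply_singleton _ _ (measurableSet_singleton _)).trans ?_
    rw [PMF.uniformOfFintype_apply, Fintype.card_fin]
    simp [hc]
  show tapeLaw {ω : Tape | ∀ k, ω (c k) = v k} ≤ _
  rw [hset, tapeLaw, Measure.infinitePi_pi _ (fun q _ => MeasurableSet.of_discrete),
    Finset.prod_image (fun k _ k' _ h => hcinj h), Finset.prod_congr rfl (fun k _ => ht k),
    Finset.prod_const, Finset.card_univ, ENNReal.inv_pow]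

/-- A union bound over the finitely many outcomes in `F`; it turns counting into probability and
needs no measurability. -/
theorem tapeLaw_mem_le {ι : Type*} [Fintype ι] {K : ℕ} {coord : ι → ℕ × ℕ × ℕ}
    (hinj : Function.Injective coord) (F : Finset (ι → Fin (K + 1))) :
    tapeLaw {ω | (fun k => (ω ((coord k).1, (coord k).2.1, (coord k).2.2, K) : Fin (K + 1))) ∈ F} ≤
      F.card * (((K : ENNReal) + 1) ^ Fintype.card ι)⁻¹ := by
  have hsub : {ω : Tape | (fun k => (ω ((coord k).1, (coord k).2.1, (coord k).2.2, K) :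
      Fin (K + 1))) ∈ F} ⊆
      ⋃ v ∈ F, {ω | ∀ k, ω ((coord k).1, (coord k).2.1, (coord k).2.2, K) = v k} := by
    intro ω hω
    simp only [Set.mem_iUnion]
    exact ⟨_, hω, fun k => rfl⟩
  refine (measure_mono hsub).trans ((measure_biUnion_finset_le F _).trans ?_)
  refine (Finset.sum_le_card_nsmul _ _ _ fun v _ => tapeLaw_eq_le hinj v).trans ?_
  rw [nsmul_eq_mul]

end Law

/-! ### The number of cycles with high probability -/

section Start

variable {n M m p : ℕ} {ε : ℝ} {x : Fin n → Fin n → ℝ} {D : Fin M → List (Fin n × Fin n)}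
  {G : SimpleGraph (Fin n)} {b : ℕ} {ω : Tape}

theorem algRun_sorting (hn : 2 ≤ n) {k : ℕ} (hk : ∀ j < k, 2 ^ j < n) :
    (algRun ε x D m p ω (k + 1)).kind = (if n ≤ 2 ^ k then 1 else 0) ∧
    (algRun ε x D m p ω (k + 1)).bit = 2 ^ k ∧
    ∀ u, (algRun ε x D m p ω (k + 1)).status u = 0 := by
  induction k with
  | zero =>
    refine ⟨?_, ?_, fun u => ?_⟩
    · simp [algRun, AlgState.next, AlgState.start, nextKd, nextBit]
    · simp [algRun, AlgState.next, AlgState.start, nextBit]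
    · simp [algRun, AlgState.next, AlgState.start]
  | succ k ih =>
    obtain ⟨h1, h2, h3⟩ := ih fun j hj => hk j (by omega)
    rw [if_neg (not_le.2 (hk k (by omega)))] at h1
    have h4 : 2 ^ k ≠ 0 := by positivity
    rw [algRun]
    refine ⟨?_, ?_, fun u => ?_⟩
    · simp only [AlgState.next, h1, h2, nextKd, nextBit, if_true, if_neg h4, pow_succ']
    · simp only [AlgState.next, h1, h2, nextBit, if_true, if_neg h4, pow_succ']
    · rw [(next_of_kind_zero h1).2, h3]

/-- One cycle closes the gaps, `Nat.clog 2 n` cycles sort, and one computes the weights. -/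
theorem algRun_start (hn : 2 ≤ n) (hm : 0 < m) (hD : ∀ i, 2 * (D i).length ≤ m)
    (hx : IsApproxLP ε x) (hK : IsDistribution (relevantPairs G x) b D) (hε₀ : 0 < ε) :
    IsState ε x (algRun ε x D m p ω (Nat.clog 2 n + 2)) (Finset.univ, 0) := by
  obtain ⟨h1, -, h3⟩ := algRun_sorting (ε := ε) (x := x) (D := D) (m := m) (p := p) (ω := ω) hn
    (k := Nat.clog 2 n) (fun j hj => (Nat.lt_clog_iff_pow_lt one_lt_two).1 hj)
  rw [if_pos (Nat.le_pow_clog one_lt_two n)] at h1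
  obtain ⟨a1, a2, a3, a4⟩ := next_of_kind_one
    (ξ := drawsOf n ω ((Nat.clog 2 n + 1) * p)) hm hD hx hK hε₀ h1
  refine ⟨a1, a3, a2.trans (by simp [phaseThr]), ?_⟩
  have hst : ∀ u, (algRun ε x D m p ω (Nat.clog 2 n + 2)).status u = 0 := fun u =>
    (congrFun a4 u).trans (h3 u)
  ext u
  simp [AlgState.candidates, hst]

theorem algRun_luby (hn : 2 ≤ n) (hm : 0 < m) (hD : ∀ i, 2 * (D i).length ≤ m)
    (hx : IsApproxLP ε x) (hK : IsDistribution (relevantPairs G x) b D) (hε₀ : 0 < ε)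
    (hε₁ : ε ≤ 1 / 20) {X : ℕ → Fin n → Fin (2 * n + 1)}
    (hX : ∀ (s : ℕ) (u : Fin n) (i : Fin M) (j : Fin (D i).length), (D i).get j = (u, u) →
      drawsOf n ω ((Nat.clog 2 n + 2 + 3 * s) * p) i j = X s u) (s : ℕ) :
    match ((List.range s).map X).foldl
      (lubyStep (Near ε x) (coreWeight ε x) (phaseThr n ε) (coreR ε)) (some (Finset.univ, 0)) with
    | none => ∃ c ≤ Nat.clog 2 n + 2 + 3 * s, (algRun ε x D m p ω c).kind = 5
    | some q => IsState ε x (algRun ε x D m p ω (Nat.clog 2 n + 2 + 3 * s)) q := by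
  induction s with
  | zero => exact algRun_start hn hm hD hx hK hε₀
  | succ s ih =>
    rw [List.range_succ, List.map_append, List.foldl_append, List.map_singleton, List.foldl_cons,
      List.foldl_nil]
    cases hq : ((List.range s).map X).foldl
      (lubyStep (Near ε x) (coreWeight ε x) (phaseThr n ε) (coreR ε)) (some (Finset.univ, 0)) with
    | none =>
      rw [hq] at ih
      obtain ⟨c, hc, h5⟩ := ih
      exact ⟨c, by omega, h5⟩
    | some q =>
      rw [hq] at ih
      have := step_spec (ξ := drawsOf n ω ((Nat.clog 2 n + 2 + 3 * s) * p)) (X := X s) hm hD hx hK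
        hε₀ hε₁ (hX s) ih rfl
        (g₂ := algRun ε x D m p ω (Nat.clog 2 n + 2 + 3 * s + 2)) rfl
        (g₃ := algRun ε x D m p ω (Nat.clog 2 n + 2 + 3 * s + 3)) rfl
      revert this
      cases lubyStep (Near ε x) (coreWeight ε x) (phaseThr n ε) (coreR ε) (some q) (X s) with
      | none => exact fun h => ⟨_, by omega, h⟩
      | some q' => exact fun h => h

theorem tapeLaw_unfinished_le (hn : 2 ≤ n) (hm : 0 < m) (hp : 0 < p)
    (hD : ∀ i, 2 * (D i).length ≤ m)
    (hx : IsApproxLP ε x) (hK : IsDistribution (relevantPairs G x) b D) (hε₀ : 0 < ε)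
    (hε₁ : ε ≤ 1 / 20) {P : ℕ} (hP : phaseThr n ε P ≤ coreR ε) (T : ℕ) :
    tapeLaw {ω | ¬ ∃ c ≤ Nat.clog 2 n + 2 + 3 * T, (algRun ε x D m p ω c).kind = 5} ≤
      ENNReal.ofReal ((7 / 8) ^ T * (10 * (n : ℝ) ^ 2) ^ (P + 1)) := by
  classical
  choose I J hIJ hu using fun u => exists_self_record hK u
  -- The priority of a vertex in a step is the draw at its self-loop record in the round in which
  -- that cycle starts. Different vertices have different records, and different steps have
  -- different rounds, so these draws are independent.
  let coord : Fin T × Fin n → ℕ × ℕ × ℕ := fun k =>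
    (I k.2, (Nat.clog 2 n + 2 + 3 * k.1) * p, J k.2)
  have hinj : Function.Injective coord := by
    rintro ⟨s, u⟩ ⟨s', u'⟩ h
    simp only [coord, Prod.mk.injEq] at h
    obtain ⟨h1, h2, h3⟩ := h
    have e1 := Nat.eq_of_mul_eq_mul_right hp h2
    have e2 : s = s' := Fin.ext (by omega)
    have e3 : ((u, u) : Fin n × Fin n) = (u', u') := by
      rw [← hIJ u, ← hIJ u']
      have h4 : I u = I u' := Fin.ext h1
      simp only [List.get_eq_getElem, h3]
      congr 1
      rw [h4]
    rw [e2, (Prod.mk.inj e3).1]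
  let F : Finset (Fin T × Fin n → Fin (2 * n + 1)) := Finset.univ.filter fun Y =>
    (List.ofFn fun s u => Y (s, u)).foldl
      (lubyStep (Near ε x) (coreWeight ε x) (phaseThr n ε) (coreR ε)) (some (Finset.univ, 0)) ≠ none
  have hsub : {ω : Tape | ¬ ∃ c ≤ Nat.clog 2 n + 2 + 3 * T, (algRun ε x D m p ω c).kind = 5} ⊆
      {ω | (fun k => (ω ((coord k).1, (coord k).2.1, (coord k).2.2, 2 * n) :
        Fin (2 * n + 1))) ∈ F} := by
    intro ω hω
    simp only [F, Set.mem_ofPred_eq, Finset.mem_filter, Finset.mem_univ, true_and]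
    intro hnone
    apply hω
    let X : ℕ → Fin n → Fin (2 * n + 1) := fun s u =>
      ω (I u, (Nat.clog 2 n + 2 + 3 * s) * p, J u, 2 * n)
    have := algRun_luby (p := p) (ω := ω) hn hm hD hx hK hε₀ hε₁ (X := X)
      (fun s u i j hij => by
        obtain ⟨h1, h2⟩ := hu u i j hij
        show drawsOf n ω ((Nat.clog 2 n + 2 + 3 * s) * p) i j =
          drawsOf n ω ((Nat.clog 2 n + 2 + 3 * s) * p) (I u) (J u)
        rw [h1, h2]) T
    have hl : (List.range T).map X = List.ofFn fun s : Fin T => X s :=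
      List.ext_getElem (by simp) (by simp)
    rw [hl] at this
    change (List.ofFn fun s : Fin T => X s).foldl _ _ = none at hnone
    rw [hnone] at this
    exact this
  have hF : (F.card : ℝ) ≤ (7 / 8 * ((2 * n : ℕ) + 1) ^ n) ^ T * (10 * (n : ℝ) ^ 2) ^ (P + 1) := by
    have h1 := card_unfinished_le (V := Fin n) (K := 2 * n) (nr := Near ε x) (L := coreWeight ε x)
      (τ := phaseThr n ε) (r := coreR ε) (B := 10 * (n : ℝ) ^ 2) (P := P)
      (fun u h => h.1 rfl) (fun u v h => ⟨h.1.symm, by rw [hx.symm]; exact h.2⟩)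
      (by rw [Fintype.card_fin]; omega) (by rw [Fintype.card_fin]; omega)
      (by rw [Fintype.card_fin]) hP T Finset.univ
    rw [Fintype.card_fin] at h1
    refine le_trans (le_of_eq ?_) h1
    norm_cast
    refine Finset.card_bij' (fun Y _ s u => Y (s, u)) (fun Y _ k => Y k.1 k.2) ?_ ?_ ?_ ?_
    · intro Y hY
      simpa [F] using hY
    · intro Y hY
      simpa [F] using hY
    · intro Y hY; rfl
    · intro Y hY; rfl
  refine (MeasureTheory.measure_mono hsub).trans ((tapeLaw_mem_le hinj F).trans ?_)
  rw [Fintype.card_prod, Fintype.card_fin, Fintype.card_fin]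
  have hW : (0 : ℝ) < ((2 * n : ℕ) : ℝ) + 1 := by positivity
  have e1 : ((F.card : ENNReal)) = ENNReal.ofReal F.card := by rw [ENNReal.ofReal_natCast]
  have e2 : ((((2 * n : ℕ) : ENNReal) + 1) ^ (T * n))⁻¹ =
      ENNReal.ofReal (((((2 * n : ℕ) : ℝ) + 1) ^ (T * n))⁻¹) := by
    rw [ENNReal.ofReal_inv_of_pos (by positivity), ENNReal.ofReal_pow hW.le,
      ENNReal.ofReal_add (by positivity) zero_le_one, ENNReal.ofReal_natCast, ENNReal.ofReal_one]
  rw [e1, e2, ← ENNReal.ofReal_mul (by positivity)]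
  refine ENNReal.ofReal_le_ofReal ?_
  rw [← div_eq_mul_inv, div_le_iff₀ (by positivity)]
  refine hF.trans (le_of_eq ?_)
  rw [mul_pow, ← pow_mul, mul_comm n T]
  ring

end Start

end CorrClust

namespace CorrClust

/-! ### Sizes of the memory, the words and the number of machines -/

section Parameters

variable {δ ε : ℝ} {n k a : ℕ}

theorem memScale_pos (hn : 2 ≤ n) : 1 ≤ memScale δ n :=
  Nat.ceil_pos.2 (Real.rpow_pos_of_pos (by positivity) _)

theorem memScale_le (hδ₁ : δ < 1) (hn : 2 ≤ n) : memScale δ n ≤ n := by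
  refine Nat.ceil_le.2 ?_
  have h1 : (1 : ℝ) ≤ n := by exact_mod_cast (by omega : 1 ≤ n)
  calc (n : ℝ) ^ δ ≤ (n : ℝ) ^ (1 : ℝ) := Real.rpow_le_rpow_of_exponent_le h1 hδ₁.le
    _ = n := Real.rpow_one _

theorem memScale_le_two_mul (hδ₀ : 0 < δ) (hn : 2 ≤ n) :
    (memScale δ n : ℝ) ≤ 2 * (n : ℝ) ^ δ := by
  have h1 : (1 : ℝ) ≤ n := by exact_mod_cast (by omega : 1 ≤ n)
  have h2 : 1 ≤ (n : ℝ) ^ δ := Real.one_le_rpow h1 hδ₀.le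
  have h3 : (memScale δ n : ℝ) < (n : ℝ) ^ δ + 1 := Nat.ceil_lt_add_one (by positivity)
  linarith

theorem log_nat_ge (hn : 2 ≤ n) : (69 / 100 : ℝ) ≤ Real.log n := by
  have h1 : Real.log 2 ≤ Real.log n := Real.log_le_log (by norm_num) (by exact_mod_cast hn)
  have h2 := Real.log_two_gt_d9
  linarith

theorem clog_le_log (hn : 2 ≤ n) : (Nat.clog 2 n : ℝ) ≤ 3 * Real.log n := by
  have h1 := Nat.pow_pred_clog_lt_self one_lt_two (show 1 < n by omega)
  have h2 : 1 ≤ Nat.clog 2 n := Nat.clog_pos one_lt_two hn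
  obtain ⟨m, hm⟩ : ∃ m, Nat.clog 2 n = m + 1 := ⟨Nat.clog 2 n - 1, by omega⟩
  rw [hm, Nat.pred_succ] at h1
  have h3 : ((2 : ℝ) ^ m) ≤ n := by exact_mod_cast h1.le
  have h4 := Real.log_le_log (by positivity) h3
  rw [Real.log_pow] at h4
  have h5 := Real.log_two_gt_d9
  have h6 := log_nat_ge hn
  rw [hm]
  push_cast
  nlinarith [Nat.cast_nonneg (α := ℝ) m]

theorem clog_le_self (hn : 2 ≤ n) : Nat.clog 2 n ≤ n :=
  Nat.clog_le_of_le_pow Nat.lt_two_pow_self.le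

theorem le_card_relevantPairs (G : SimpleGraph (Fin n)) (x : Fin n → Fin n → ℝ) :
    n ≤ (relevantPairs G x).card := by
  classical
  have : (Finset.univ.image fun u : Fin n => (u, u)) ⊆ relevantPairs G x := by
    intro p hp
    obtain ⟨u, -, rfl⟩ := Finset.mem_image.1 hp
    simp [relevantPairs]
  have h := Finset.card_le_card this
  rwa [Finset.card_image_of_injective _ (fun u v h => (Prod.mk.inj h).1), Finset.card_univ,
    Fintype.card_fin] at h

theorem card_relevantPairs_le (G : SimpleGraph (Fin n)) (x : Fin n → Fin n → ℝ) :
    (relevantPairs G x).card ≤ n * n := by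
  refine (Finset.card_le_univ _).trans ?_
  rw [Fintype.card_prod, Fintype.card_fin]

theorem mpcSetup_slots : (mpcSetup (dim a) δ ε n k).slots a = 2 * a * memScale δ n := by
  show 2 * a * (dim a * memScale δ n / dim a) = _
  rw [Nat.mul_div_cancel_left _ (by unfold dim; omega)]

theorem numMachines_pos (hn : 2 ≤ n) (hk : n ≤ k) :
    0 < (mpcSetup (dim a) δ ε n k).numMachines := by
  have hs := memScale_pos (δ := δ) hn
  have hc : 1 ≤ Nat.clog 2 n := Nat.clog_pos one_lt_two hn
  show 0 < (k * Nat.clog 2 n) ⌈/⌉ memScale δ n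
  rw [Nat.ceilDiv_eq_add_pred_div]
  refine Nat.div_pos ?_ (by omega)
  have : 1 ≤ k * Nat.clog 2 n := Nat.mul_pos (by omega) (by omega)
  omega

/-- Rounding up the quotient costs at most one more block of memory, and a block has at most n ≤ k
words. -/
theorem numMachines_mul_le (hδ₁ : δ < 1) (hn : 2 ≤ n) (hk : n ≤ k) :
    (mpcSetup (dim a) δ ε n k).numMachines * memScale δ n ≤ 2 * (k * Nat.clog 2 n) := by
  have hs := memScale_le hδ₁ hn
  have hc : 1 ≤ Nat.clog 2 n := Nat.clog_pos one_lt_two hn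
  show (k * Nat.clog 2 n) ⌈/⌉ memScale δ n * memScale δ n ≤ _
  rw [Nat.ceilDiv_eq_add_pred_div]
  have h1 := Nat.div_mul_le_self (k * Nat.clog 2 n + memScale δ n - 1) (memScale δ n)
  have h2 : k ≤ k * Nat.clog 2 n := Nat.le_mul_of_pos_right _ (by omega)
  omega

theorem numMachines_le (hn : 2 ≤ n) (hk : k ≤ n * n) :
    (mpcSetup (dim a) δ ε n k).numMachines ≤ n ^ 3 := by
  have hs := memScale_pos (δ := δ) hn
  show (k * Nat.clog 2 n) ⌈/⌉ memScale δ n ≤ _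
  rw [ceilDiv_le_iff_le_smul (by omega)]
  calc k * Nat.clog 2 n ≤ n * n * n := Nat.mul_le_mul hk (clog_le_self hn)
    _ = n ^ 3 := by ring
    _ ≤ memScale δ n • n ^ 3 := by
      rw [smul_eq_mul]; exact Nat.le_mul_of_pos_left _ (by omega)

theorem clog_numMachines_le (hn : 2 ≤ n) (hk : k ≤ n * n) :
    Nat.clog 2 (mpcSetup (dim a) δ ε n k).numMachines ≤ 3 * Nat.clog 2 n := by
  refine Nat.clog_le_of_le_pow ((numMachines_le hn hk).trans ?_)
  rw [mul_comm, pow_mul]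
  exact Nat.pow_le_pow_left (Nat.le_pow_clog one_lt_two n) 3

/-- The exponent 2a+64 is generous: n^(2a) exceeds the constant 2a+1, n^4 covers the sizes that grow
with n, and the remaining powers cover absolute constants, since n ≥ 2. -/
theorem wordBound_ge (hn : 2 ≤ n) :
    (2 * a + 1) * n ^ 4 * 2 ^ 20 ≤ (mpcSetup (dim a) δ ε n k).wordBound := by
  show _ ≤ n ^ dim a
  have h1 : 2 * a + 1 ≤ n ^ (2 * a) :=
    (Nat.lt_two_pow_self (n := 2 * a)).trans_le (Nat.pow_le_pow_left hn _)
  have h2 : 2 ^ 20 ≤ n ^ 20 := Nat.pow_le_pow_left hn _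
  calc (2 * a + 1) * n ^ 4 * 2 ^ 20 ≤ n ^ (2 * a) * n ^ 4 * n ^ 20 :=
        Nat.mul_le_mul (Nat.mul_le_mul_right _ h1) h2
    _ = n ^ (2 * a + 4 + 20) := by rw [← pow_add, ← pow_add]
    _ ≤ n ^ dim a := Nat.pow_le_pow_right (by omega) (by unfold dim; omega)

theorem regular_mpcSetup (hδ₁ : δ < 1) (ha : 0 < a) (hn : 2 ≤ n) (hk : n ≤ k)
    (hk' : k ≤ n * n) {x : Fin n → Fin n → ℝ} (hx : ∀ u v, x u v = x v u)
    {D : Fin (mpcSetup (dim a) δ ε n k).numMachines → List (Fin n × Fin n)}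
    (hD : ∀ i, (D i).length ≤ a * memScale δ n) :
    Regular a (mpcSetup (dim a) δ ε n k) x D := by
  have hW := wordBound_ge (δ := δ) (ε := ε) (k := k) (a := a) hn
  have hs1 := memScale_pos (δ := δ) hn
  have hs2 := memScale_le hδ₁ hn
  have hM := numMachines_le (δ := δ) (ε := ε) (a := a) hn hk'
  have hMs := numMachines_mul_le (ε := ε) (a := a) hδ₁ hn hk
  have hn4 : n ≤ n ^ 4 := Nat.le_self_pow (by norm_num) n
  have hn34 : n ^ 3 ≤ n ^ 4 := Nat.pow_le_pow_right (by omega) (by norm_num)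
  have h16 : 16 ≤ n ^ 4 := Nat.pow_le_pow_left hn 4
  have han : n ^ 4 ≤ (2 * a + 1) * n ^ 4 := Nat.le_mul_of_pos_left _ (by omega)
  refine ⟨⟨?_, ?_, ?_, ?_⟩, hn, ?_, fun i => ?_, hx, rfl, ?_⟩
  · show dim a * memScale δ n < _
    refine lt_of_lt_of_le ?_ hW
    have h1 : dim a * memScale δ n ≤ 64 * ((2 * a + 1) * n ^ 4) := by
      calc dim a * memScale δ n ≤ (64 * (2 * a + 1)) * n ^ 4 :=
            Nat.mul_le_mul (by unfold dim; omega) (hs2.trans hn4)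
        _ = _ := by ring
    omega
  · omega
  · rw [mpcSetup_slots]
    positivity
  · omega
  · omega
  · rw [mpcSetup_slots, mul_assoc]
    exact Nat.mul_le_mul_left 2 (hD i)
  · rw [mpcSetup_slots]
    refine lt_of_lt_of_le ?_ hW
    have h1 : k * Nat.clog 2 n ≤ n ^ 3 := by
      calc k * Nat.clog 2 n ≤ n * n * n := Nat.mul_le_mul hk' (clog_le_self hn)
        _ = n ^ 3 := by ring
    have h2 : (2 * n + 1) * ((mpcSetup (dim a) δ ε n k).numMachines * (2 * a * memScale δ n)) ≤
        6 * ((2 * a + 1) * n ^ 4) := by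
      calc (2 * n + 1) * ((mpcSetup (dim a) δ ε n k).numMachines * (2 * a * memScale δ n))
          = ((2 * n + 1) * (2 * a)) * ((mpcSetup (dim a) δ ε n k).numMachines * memScale δ n) := by
            ring
        _ ≤ ((3 * n) * (2 * a + 1)) * (2 * n ^ 3) :=
            Nat.mul_le_mul (Nat.mul_le_mul (by omega) (by omega)) (by omega)
        _ = _ := by ring
    omega

end Parameters

/-! ### The tail estimate -/

section Tail

/-- The number of phases, and a bound for the probability to be unfinished. -/
theorem unfinished_bound {n γ : ℕ} {ε : ℝ} (hn : 2 ≤ n) (hε₀ : 0 < ε) (hε₁ : ε ≤ 1 / 20) {T : ℕ}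
    (hT : 8 * (24 + γ) * (Real.log n ^ 2 / ε) ≤ T) :
    ∃ P : ℕ, phaseThr n ε P ≤ coreR ε ∧
      (7 / 8 : ℝ) ^ T * (10 * (n : ℝ) ^ 2) ^ (P + 1) ≤ ((n : ℝ) ^ γ)⁻¹ := by
  have hl := log_nat_ge hn
  have hn0 : (0 : ℝ) < n := by positivity
  set l := Real.log n with hldef
  have hε' : 20 ≤ 1 / ε := by rw [le_div_iff₀ hε₀]; linarith
  have hlε : 13 ≤ l / ε := by
    rw [div_eq_mul_one_div]; nlinarith
  -- The threshold has to fall by the factor n, and log(1+ε) ≥ ε/2.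
  refine ⟨⌈2 * l / ε⌉₊, ?_, ?_⟩
  · have h1 : 2 * l / ε ≤ ⌈2 * l / ε⌉₊ := Nat.le_ceil _
    have h2 : ε / 2 ≤ Real.log (1 + ε) := by
      refine le_trans ?_ (Real.one_sub_inv_le_log_of_pos (by linarith))
      rw [inv_eq_one_div, le_sub_comm, div_le_iff₀ (by linarith)]
      nlinarith
    have h3 : l ≤ Real.log ((1 + ε) ^ ⌈2 * l / ε⌉₊) := by
      rw [Real.log_pow]
      have h4 : 2 * l / ε * (ε / 2) = l := by field_simp
      calc l = 2 * l / ε * (ε / 2) := h4.symm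
        _ ≤ ⌈2 * l / ε⌉₊ * Real.log (1 + ε) := mul_le_mul h1 h2 (by positivity) (by positivity)
    have h5 : (n : ℝ) ≤ (1 + ε) ^ ⌈2 * l / ε⌉₊ :=
      (Real.log_le_log_iff hn0 (by positivity)).1 h3
    rw [phaseThr, div_le_iff₀ (by positivity), mul_comm]
    exact mul_le_mul_of_nonneg_left h5 (coreR_pos hε₁).le
  · have h1 : (⌈2 * l / ε⌉₊ : ℝ) < 2 * l / ε + 1 := Nat.ceil_lt_add_one (by positivity)
    have h2 : (⌈2 * l / ε⌉₊ : ℝ) + 1 ≤ 4 * (l / ε) := by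
      have e : 2 * l / ε = 2 * (l / ε) := mul_div_assoc _ _ _
      linarith
    have h3 : 10 * (n : ℝ) ^ 2 ≤ Real.exp (6 * l) := by
      have : Real.exp (6 * l) = (n : ℝ) ^ 6 := by
        rw [show (6 : ℝ) * l = ((6 : ℕ) : ℝ) * l by norm_num, Real.exp_nat_mul, hldef,
          Real.exp_log hn0]
      rw [this]
      have h4 : (2 : ℝ) ≤ n := by exact_mod_cast hn
      have h5 : (2 : ℝ) ^ 4 ≤ (n : ℝ) ^ 4 := pow_le_pow_left₀ (by norm_num) h4 4
      nlinarith [sq_nonneg (n : ℝ)]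
    -- The base is at most exp(6l) and the exponent at most 4l/ε, whence 24. As (7/8)^T ≤ exp(-T/8),
    -- the choice T ≥ 8(24+γ)l²/ε leaves exp(-γl²/ε) ≤ n^(-γ).
    have h4 : (10 * (n : ℝ) ^ 2) ^ (⌈2 * l / ε⌉₊ + 1) ≤ Real.exp (24 * (l ^ 2 / ε)) := by
      calc (10 * (n : ℝ) ^ 2) ^ (⌈2 * l / ε⌉₊ + 1) ≤ Real.exp (6 * l) ^ (⌈2 * l / ε⌉₊ + 1) :=
            pow_le_pow_left₀ (by positivity) h3 _
        _ = Real.exp (((⌈2 * l / ε⌉₊ : ℝ) + 1) * (6 * l)) := by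
            rw [← Real.exp_nat_mul]; push_cast; rfl
        _ ≤ Real.exp (4 * (l / ε) * (6 * l)) :=
            Real.exp_le_exp.2 (mul_le_mul_of_nonneg_right h2 (by positivity))
        _ = _ := by congr 1; ring
    have h5 : (7 / 8 : ℝ) ^ T ≤ Real.exp (-(T / 8)) := by
      have h6 : (7 / 8 : ℝ) ≤ Real.exp (-(1 / 8)) := by
        have := Real.add_one_le_exp (-(1 / 8 : ℝ))
        linarith
      calc (7 / 8 : ℝ) ^ T ≤ Real.exp (-(1 / 8)) ^ T := pow_le_pow_left₀ (by norm_num) h6 _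
        _ = _ := by rw [← Real.exp_nat_mul]; congr 1; ring
    have h6 : ((n : ℝ) ^ γ)⁻¹ = Real.exp (-(γ * l)) := by
      rw [Real.exp_neg, Real.exp_nat_mul, hldef, Real.exp_log hn0]
    rw [h6]
    refine (mul_le_mul h5 h4 (by positivity) (by positivity)).trans ?_
    rw [← Real.exp_add]
    refine Real.exp_le_exp.2 ?_
    have h7 : (γ : ℝ) * l ≤ γ * (l ^ 2 / ε) := by
      refine mul_le_mul_of_nonneg_left ?_ (Nat.cast_nonneg γ)
      rw [sq, mul_div_assoc]
      nlinarith
    nlinarith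

end Tail

end CorrClust

namespace CorrClust

/-! ### Constants of the memory, round and work bounds -/

section Final

variable {δ ε : ℝ} {n k a γ : ℕ}

/-- The constant of the memory bounds. -/
def memConst (a : ℕ) : ℕ := 2 * dim a + 2 * dim a * dim a + 24 * a + 24

theorem memory_le {S : Setup} (hS : S = mpcSetup (dim a) δ ε n k) (hn : 2 ≤ n)
    {x : Fin n → Fin n → ℝ} {D : Fin S.numMachines → List (Fin n × Fin n)}
    (hR : Regular a S x D) (G : SimpleGraph (Fin n)) (ω : Tape) (t : ℕ) (i : Fin S.numMachines) :
    (roundingRun (clusterProg a) S G x D ω t i).memory S.capacity ≤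
      memConst a * memScale δ n := by
  obtain ⟨h1, h2⟩ := run_boxes_le hR G ω t i
  have hs := memScale_pos (δ := δ) hn
  have hsl : S.slots a = 2 * a * memScale δ n := by rw [hS, mpcSetup_slots]
  have hcap : S.capacity = dim a * memScale δ n := by rw [hS]; rfl
  rw [hsl] at h1 h2
  rw [MState.memory, hcap, memConst]
  nlinarith [Nat.zero_le (dim a), Nat.mul_le_mul_left (dim a) hs]

/-- In a cycle each machine spends time linear in its slots and in the number of scan rounds. The
latter is O(log n), and log n ≤ n^δ/δ absorbs it into the local memory; hence the term with 1/δ. -/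
theorem mul_cycleWork_le (hδ₀ : 0 < δ) (hδ₁ : δ < 1) (hn : 2 ≤ n) (hk : n ≤ k)
    (hk' : k ≤ n * n) {S : Setup} (hS : S = mpcSetup (dim a) δ ε n k) :
    ((S.numMachines * S.cycleWork a : ℕ) : ℝ) ≤
      (60000 * (2 * a + 1) + 16200 / δ) * (k * Real.log n) := by
  have hl := log_nat_ge hn
  have hs := memScale_pos (δ := δ) hn
  have hc := clog_le_log hn
  have hMs : (S.numMachines : ℝ) * memScale δ n ≤ 2 * (k * Nat.clog 2 n) := by
    rw [hS]
    exact_mod_cast numMachines_mul_le (ε := ε) (a := a) hδ₁ hn hk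
  have hMs' : (S.numMachines : ℝ) * memScale δ n ≤ 6 * (k * Real.log n) := by
    have := mul_le_mul_of_nonneg_left hc (Nat.cast_nonneg (α := ℝ) k)
    linarith
  have hcM : (Nat.clog 2 S.numMachines : ℝ) ≤ 3 * Nat.clog 2 n := by
    rw [hS]
    exact_mod_cast clog_numMachines_le (δ := δ) (ε := ε) (a := a) hn hk'
  have hlog : Real.log n ≤ memScale δ n / δ := by
    refine (Real.log_le_rpow_div (Nat.cast_nonneg n) hδ₀).trans ?_
    exact div_le_div_of_nonneg_right (Nat.le_ceil _) hδ₀.le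
  have h1 : (Nat.clog 2 S.numMachines : ℝ) ≤ 9 / δ * memScale δ n := by
    calc (Nat.clog 2 S.numMachines : ℝ) ≤ 9 * Real.log n := by linarith
      _ ≤ 9 * (memScale δ n / δ) := by linarith
      _ = _ := by ring
  have h2 : (S.cycleWork a : ℝ) ≤ (10000 * (2 * a + 1) + 2700 / δ) * memScale δ n := by
    have hsl : S.slots a = 2 * a * memScale δ n := by rw [hS, mpcSetup_slots]
    have hs' : (1 : ℝ) ≤ memScale δ n := by exact_mod_cast hs
    rw [Setup.cycleWork, hsl]
    push_cast
    have e : 300 * (9 / δ * memScale δ n) = 2700 / δ * memScale δ n := by ring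
    nlinarith
  push_cast
  calc (S.numMachines : ℝ) * S.cycleWork a
      ≤ S.numMachines * ((10000 * (2 * a + 1) + 2700 / δ) * memScale δ n) :=
        mul_le_mul_of_nonneg_left h2 (Nat.cast_nonneg _)
    _ = (10000 * (2 * a + 1) + 2700 / δ) * (S.numMachines * memScale δ n) := by ring
    _ ≤ (10000 * (2 * a + 1) + 2700 / δ) * (6 * (k * Real.log n)) :=
        mul_le_mul_of_nonneg_left hMs' (by positivity)
    _ = _ := by ring

/-- The constant in the number of cycles. -/
def cycleConst (γ : ℕ) : ℝ := 3 * (8 * (24 + γ)) + 10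

theorem cycles_le (hn : 2 ≤ n) (hε₀ : 0 < ε) (hε₁ : ε ≤ 1 / 20) :
    ((Nat.clog 2 n + 2 + 3 * ⌈8 * (24 + γ) * (Real.log n ^ 2 / ε)⌉₊ + 2 : ℕ) : ℝ) ≤
      cycleConst γ * (Real.log n ^ 2 / ε) := by
  have hl := log_nat_ge hn
  have hc := clog_le_log hn
  have hε' : 20 ≤ 1 / ε := by rw [le_div_iff₀ hε₀]; linarith
  have h1 : Real.log n ≤ Real.log n ^ 2 / ε := by
    rw [div_eq_mul_one_div]; nlinarith
  have h2 : 4 ≤ 4 * (Real.log n ^ 2 / ε) := by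
    rw [div_eq_mul_one_div]; nlinarith
  have h3 : (⌈8 * (24 + γ) * (Real.log n ^ 2 / ε)⌉₊ : ℝ) <
      8 * (24 + γ) * (Real.log n ^ 2 / ε) + 1 := Nat.ceil_lt_add_one (by positivity)
  push_cast
  unfold cycleConst
  linarith

theorem rounds_le (hn : 2 ≤ n) (hk' : k ≤ n * n) {S : Setup}
    (hS : S = mpcSetup (dim a) δ ε n k) {c : ℕ} {B : ℝ} (hc : ((c + 2 : ℕ) : ℝ) ≤ B) :
    (((c + 1) * (S.scanLen + 1) + 1 : ℕ) : ℝ) ≤ 14 * (B * Real.log n) := by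
  have hl := log_nat_ge hn
  have hcl := clog_le_log hn
  have hcM : (Nat.clog 2 S.numMachines : ℝ) ≤ 3 * Nat.clog 2 n := by
    rw [hS]
    exact_mod_cast clog_numMachines_le (δ := δ) (ε := ε) (a := a) hn hk'
  have h1 : ((S.scanLen + 1 : ℕ) : ℝ) ≤ 14 * Real.log n := by
    rw [Setup.scanLen]
    push_cast
    linarith
  have h2 : (c + 1) * (S.scanLen + 1) + 1 ≤ (c + 2) * (S.scanLen + 1) := by
    rw [show (c + 2) * (S.scanLen + 1) = (c + 1) * (S.scanLen + 1) + (S.scanLen + 1) by ring]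
    omega
  calc (((c + 1) * (S.scanLen + 1) + 1 : ℕ) : ℝ) ≤ (((c + 2) * (S.scanLen + 1) : ℕ) : ℝ) := by
        exact_mod_cast h2
    _ = ((c + 2 : ℕ) : ℝ) * ((S.scanLen + 1 : ℕ) : ℝ) := by push_cast; ring
    _ ≤ B * (14 * Real.log n) := mul_le_mul hc h1 (Nat.cast_nonneg _)
        ((Nat.cast_nonneg _).trans hc)
    _ = _ := by ring

end Final

end CorrClust

open CorrClust in
theorem mainTheorem4 (δ : ℝ) (hδ₀ : 0 < δ) (hδ₁ : δ < 1) (a : ℕ) :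
    ∃ (c : ℕ) (P : Prog c) (outL outR : Fin c) (C₀ : ℝ),
      ∀ γ : ℕ, ∃ C : ℝ,
        ∀ (n : ℕ), 2 ≤ n →
        ∀ (ε : ℝ), 0 < ε → ε ≤ 1 / 20 →
        ∀ (G : SimpleGraph (Fin n)) (x : Fin n → Fin n → ℝ), IsApproxLP ε x →
        ∀ (k : ℕ), k = (relevantPairs G x).card →
        ∀ (S : Setup), S = mpcSetup c δ ε n k →
        ∀ (D : Fin S.numMachines → List (Fin n × Fin n)),
          IsDistribution (relevantPairs G x) (a * memScale δ n) D →
          -- whenever the algorithm has terminated, its output is a good clustering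
          (∀ (ω : Tape) (t : ℕ), AllHalted (roundingRun P S G x D ω t) →
            ∃ f : Fin n → ℕ, Outputs outL outR D (roundingRun P S G x D ω t) f ∧
              ∀ u, (clusterCost G f u : ℝ) ≤ (5 + 55 * ε) * lpCost G x u) ∧
          -- memory per machine
          (∀ (ω : Tape) (t : ℕ) (i : Fin S.numMachines),
            ((roundingRun P S G x D ω t i).memory S.capacity : ℝ) ≤ C₀ * (n : ℝ) ^ δ) ∧
          -- total memory
          (∀ (ω : Tape) (t : ℕ),
            ((∑ i, (roundingRun P S G x D ω t i).memory S.capacity : ℕ) : ℝ)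
              ≤ C₀ * (k * Real.log n)) ∧
          -- rounds and total work, with high probability
          tapeLaw {ω : Tape | ¬ ∃ t : ℕ, (t : ℝ) ≤ C * (Real.log n ^ 3 / ε) ∧
              AllHalted (roundingRun P S G x D ω t) ∧
              ((∑ i, (roundingRun P S G x D ω t i).work : ℕ) : ℝ)
                ≤ C * (k * Real.log n ^ 3 / ε)}
            ≤ ENNReal.ofReal (((n : ℝ) ^ γ)⁻¹) := by
  refine ⟨dim a, clusterProg a, Arr.outL.ix, Arr.outR.ix, 6 * memConst a, fun γ =>
    ⟨cycleConst γ * (14 + (60000 * (2 * a + 1) + 16200 / δ)), ?_⟩⟩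
  intro n hn ε hε₀ hε₁ G x hx k hk S hS D hD
  have hk₁ : n ≤ k := hk ▸ le_card_relevantPairs G x
  have hk₂ : k ≤ n * n := hk ▸ card_relevantPairs_le G x
  have hl := log_nat_ge hn
  have hγ : 0 < cycleConst γ := by unfold cycleConst; positivity
  -- For `a = 0` there is no admissible distribution, because the self-loops make `K` nonempty.
  have ha : 0 < a := by
    rcases Nat.eq_zero_or_pos a with h0 | h0
    · obtain ⟨i, j, -⟩ := exists_self_record hD ⟨0, by omega⟩
      have h1 := hD.load i
      have h2 := j.2
      rw [h0, zero_mul] at h1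
      omega
    · exact h0
  have hM : 0 < S.numMachines := by rw [hS]; exact numMachines_pos hn hk₁
  have hSε : S.eps = ε := by rw [hS]; rfl
  have hR : Regular a S x D := by
    subst hS
    exact regular_mpcSetup hδ₁ ha hn hk₁ hk₂ hx.symm hD.load
  have hmem := memory_le hS hn hR G
  have hMs : (S.numMachines : ℝ) * memScale δ n ≤ 6 * (k * Real.log n) := by
    have h1 : (S.numMachines : ℝ) * memScale δ n ≤ 2 * (k * Nat.clog 2 n) := by
      rw [hS]
      exact_mod_cast numMachines_mul_le (ε := ε) (a := a) hδ₁ hn hk₁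
    have := mul_le_mul_of_nonneg_left (clog_le_log hn) (Nat.cast_nonneg (α := ℝ) k)
    linarith
  refine ⟨fun ω t ht => ?_, fun ω t i => ?_, fun ω t => ?_, ?_⟩
  · rw [← hSε] at hx hε₀ hε₁ ⊢
    exact run_correct hR hM hx hD hε₀ hε₁ ht
  · have h1 : ((roundingRun (clusterProg a) S G x D ω t i).memory S.capacity : ℝ) ≤
        memConst a * memScale δ n := by exact_mod_cast hmem ω t i
    have h2 := mul_le_mul_of_nonneg_left (memScale_le_two_mul hδ₀ hn)
      (Nat.cast_nonneg (α := ℝ) (memConst a))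
    have h3 : (0 : ℝ) ≤ memConst a * (n : ℝ) ^ δ := by positivity
    linarith
  · have h1 : (∑ i, (roundingRun (clusterProg a) S G x D ω t i).memory S.capacity) ≤
        S.numMachines * (memConst a * memScale δ n) := by
      refine (Finset.sum_le_card_nsmul _ _ _ fun i _ => hmem ω t i).trans ?_
      rw [Finset.card_univ, Fintype.card_fin, smul_eq_mul]
    calc ((∑ i, (roundingRun (clusterProg a) S G x D ω t i).memory S.capacity : ℕ) : ℝ)
        ≤ ((S.numMachines * (memConst a * memScale δ n) : ℕ) : ℝ) := by exact_mod_cast h1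
      _ = memConst a * (S.numMachines * memScale δ n) := by push_cast; ring
      _ ≤ memConst a * (6 * (k * Real.log n)) :=
          mul_le_mul_of_nonneg_left hMs (Nat.cast_nonneg _)
      _ = _ := by ring
  · obtain ⟨P, hP, hle⟩ := unfinished_bound (γ := γ) hn hε₀ hε₁ (Nat.le_ceil _)
    have htail := tapeLaw_unfinished_le (p := S.scanLen + 1) hn hR.fits.slots_pos
      (Nat.succ_pos _) hR.load hx hD hε₀ hε₁ hP ⌈8 * (24 + (γ : ℝ)) * (Real.log n ^ 2 / ε)⌉₊
    -- If the algorithm reaches its last cycle in time, the bounds on rounds and work hold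
    -- deterministically; so the bad event is contained in the event of being unfinished.
    refine le_trans (MeasureTheory.measure_mono fun ω hω => ?_)
      (htail.trans (ENNReal.ofReal_le_ofReal hle))
    rintro ⟨c, hc, h5⟩
    apply hω
    rw [← hSε] at h5
    obtain ⟨h6, h7⟩ := run_halts hR G h5
    have hcB : ((c + 2 : ℕ) : ℝ) ≤ cycleConst γ * (Real.log n ^ 2 / ε) :=
      le_trans (by exact_mod_cast Nat.add_le_add_right hc 2) (cycles_le (γ := γ) hn hε₀ hε₁)
    have hW := mul_cycleWork_le hδ₀ hδ₁ hn hk₁ hk₂ hS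
    have hq : (0 : ℝ) ≤ Real.log n ^ 3 / ε := by positivity
    have hC : (0 : ℝ) ≤ 60000 * (2 * a + 1) + 16200 / δ := by positivity
    refine ⟨_, (rounds_le hn hk₂ hS hcB).trans ?_, h6, ?_⟩
    · have e : 14 * (cycleConst γ * (Real.log n ^ 2 / ε) * Real.log n) =
          cycleConst γ * 14 * (Real.log n ^ 3 / ε) := by ring
      rw [e]
      refine mul_le_mul_of_nonneg_right (mul_le_mul_of_nonneg_left ?_ hγ.le) hq
      linarith
    · have h8 : (∑ i, (roundingRun (clusterProg a) S G x D ω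
          ((c + 1) * (S.scanLen + 1) + 1) i).work) ≤
          (c + 2) * (S.numMachines * S.cycleWork a) := by
        refine (Finset.sum_le_card_nsmul _ _ _ fun i _ => h7 i).trans ?_
        rw [Finset.card_univ, Fintype.card_fin, smul_eq_mul]
        exact le_of_eq (by ring)
      calc ((∑ i, (roundingRun (clusterProg a) S G x D ω
          ((c + 1) * (S.scanLen + 1) + 1) i).work : ℕ) : ℝ)
          ≤ (((c + 2) * (S.numMachines * S.cycleWork a) : ℕ) : ℝ) := by exact_mod_cast h8
        _ = ((c + 2 : ℕ) : ℝ) * ((S.numMachines * S.cycleWork a : ℕ) : ℝ) := by push_cast; ring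
        _ ≤ cycleConst γ * (Real.log n ^ 2 / ε) *
            ((60000 * (2 * a + 1) + 16200 / δ) * (k * Real.log n)) :=
            mul_le_mul hcB hW (Nat.cast_nonneg _) (by positivity)
        _ = cycleConst γ * (60000 * (2 * a + 1) + 16200 / δ) * (k * Real.log n ^ 3 / ε) := by ring
        _ ≤ _ := by
            refine mul_le_mul_of_nonneg_right (mul_le_mul_of_nonneg_left ?_ hγ.le) (by positivity)
            linarith
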